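/- Let $k$ be a field and let $A$ be a dg $k$-algebra that is homologically smooth (the diagonal bimodule $A$ is a perfect dg $A^{\mathrm{op}}\otimes_k A$-module) and compact ($\dim_k\bigoplus_i H^i(A)<\infty$). Let $\mathrm{Perf}(A)$ be the thick triangulated subcategory generated by $A$ in the derived category of right dg $A$-modules. For objects $X,Y$ write $\mathrm{Hom}^i(X,Y)=\mathrm{Hom}(X,Y[i])$, $e_-(X,Y)=\inf\{i\mid \mathrm{Hom}^i(X,Y)\neq 0\}$ and $e_+(X,Y)=\sup\{i\mid \mathrm{Hom}^i(X,Y)\neq 0\}$ (with $\inf\emptyset=+\infty$, $\sup\emptyset=-\infty$), and for a complex $C$ write $\inf C=\inf\{i\mid H^i(C)\ne 0\}$, $\sup C=\sup\{i\mid H^i(C)\neq0\}$. A generator of $\mathrm{Perf}(A)$ is an object $G$ with $\langle G\rangle=\mathrm{Perf}(A)$, i.e. every object is a direct summand of a finite iterated extension of finite direct sums of shifts of $G$. For an endofunctor $F$ of $\mathrm{Perf}(A)$ and generators $G,G'$ put $$F\text{-}\mathrm{Udim}=\limsup_{m\to\infty}\frac{-e_-(G,F^m(G'))}{m},\qquad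 F\text{-}\mathrm{Ldim}=\liminf_{m\to\infty}\frac{-e_+(G,F^m(G'))}{m}\qquad\text{in }[-\infty,+\infty].$$ (1) Let $F$ be a tensor endofunctor of $\mathrm{Perf}(A)$, i.e. an endofunctor isomorphic to $(-)\otimes^{\mathbf L}_A K$ for some dg $A$-bimodule $K$. Then $F\text{-}\mathrm{Udim}$ and $F\text{-}\mathrm{Ldim}$ do not depend on the generators $G,G'$, and for every $t\in\mathbb R$ the limit $$h_t(F)=\lim_{N\to\infty}\frac1N\ln\sum_{n\in\mathbb Z}\dim_k\mathrm{Hom}^n(G,F^N(G'))\,e^{-nt}\in[-\infty,+\infty)$$ (the entropy of $F$) exists and does not depend on the generators $G,G'$. For all generators $G,G'$ one has $$F\text{-}\mathrm{Udim}=\lim_{N\to\infty}\frac{-e_-(G,F^N(G'))}{N}=\lim_{t\to+\infty}\frac{h_t(F)}{t},\qquad F\text{-}\mathrm{Ldim}=\lim_{N\to\infty}\frac{-e_+(G,F^N(G'))}{N}=\lim_{t\to-\infty}\frac{h_t(F)}{t},$$ where all limits are taken in $[-\infty,+\infty]$. If $F$ is not nilpotent (no power of $F$ is zero), then $F\text{-}\mathrm{Udim}$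 and $F\text{-}\mathrm{Ldim}$ are finite. (2) $\mathrm{Perf}(A)$ has a Serre functor, i.e. an endofunctor $S$ with natural isomorphisms of vector spaces $\mathrm{Hom}(X,Y)\cong\mathrm{Hom}(Y,S(X))^*$. Let $S$ be any Serre functor and let $\mathrm{USdim}=S\text{-}\mathrm{Udim}$ and $\mathrm{LSdim}=S\text{-}\mathrm{Ldim}$ be the upper and lower Serre dimensions of $\mathrm{Perf}(A)$; they do not depend on the generators. For all generators $G,G'$, $$\mathrm{USdim}=\lim_{m\to\infty}\frac{-e_-(G,S^m(G'))}{m},\qquad \mathrm{LSdim}=\lim_{m\to\infty}\frac{-e_+(G,S^m(G'))}{m}.$$ In particular, with the dual bimodule $A^*=\mathrm{Hom}_k(A,k)$ and its $m$-fold derived tensor power $(A^*)^{\otimes^{\mathbf L}_A m}$ over $A$ (computed by any h-projective bimodule resolution $P\to A^*$, and such resolutions exist), $$\mathrm{USdim}=\lim_{m\to\infty}\frac{-\inf\,(A^*)^{\otimes^{\mathbf L}_A m}}{m},\qquad \mathrm{LSdim}=\lim_{m\to\infty}\frac{-\sup\,(A^*)^{\otimes^{\mathbf L}_A m}}{m}.$$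 If $\mathrm{Perf}(A)\neq 0$, these limits are finite. -/

import Mathlib

open CategoryTheory

universe u

/-- A dg algebra over a field `k`: a complex `(X, d)` with cohomological grading and an associative
unital multiplication of degree zero satisfying the graded Leibniz rule. All structure maps are
indexed by degrees together with a proof that the degrees match. -/
structure DGAlgebra (k : Type u) [Field k] where
  X : ℤ → Type u
  [addCommGroup : ∀ i, AddCommGroup (X i)]
  [module : ∀ i, Module k (X i)]
  d : ∀ i j : ℤ, i + 1 = j → X i →ₗ[k] X j
  mul : ∀ i j n : ℤ, i + j = n → X i →ₗ[k] X j →ₗ[k] X n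
  one : X 0
  d_d : ∀ (i j l : ℤ) (hij : i + 1 = j) (hjl : j + 1 = l) (a : X i), d j l hjl (d i j hij a) = 0
  mul_assoc : ∀ (i j l ij jl n : ℤ) (hij : i + j = ij) (hjl : j + l = jl) (h : ij + l = n)
    (h' : i + jl = n) (a : X i) (b : X j) (c : X l),
    mul ij l n h (mul i j ij hij a b) c = mul i jl n h' a (mul j l jl hjl b c)
  one_mul : ∀ (i : ℤ) (h : 0 + i = i) (a : X i), mul 0 i i h one a = a
  mul_one : ∀ (i : ℤ) (h : i + 0 = i) (a : X i), mul i 0 i h a one = a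
  d_mul : ∀ (i j n i' j' n' : ℤ) (h : i + j = n) (hi : i + 1 = i') (hj : j + 1 = j')
    (hn : n + 1 = n') (h₁ : i' + j = n') (h₂ : i + j' = n') (a : X i) (b : X j),
    d n n' hn (mul i j n h a b) =
      mul i' j n' h₁ (d i i' hi a) b + i.negOnePow • mul i j' n' h₂ a (d j j' hj b)

namespace DGAlgebra

attribute [instance] DGAlgebra.addCommGroup DGAlgebra.module

end DGAlgebra

/-- A dg `A`-`B`-bimodule (a left dg `A`-, right dg `B`-module, i.e. a right dg module over
`Aᵒᵖ ⊗ B`). -/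
structure DGBimod {k : Type u} [Field k] (A B : DGAlgebra k) where
  X : ℤ → Type u
  [addCommGroup : ∀ i, AddCommGroup (X i)]
  [module : ∀ i, Module k (X i)]
  d : ∀ i j : ℤ, i + 1 = j → X i →ₗ[k] X j
  lmul : ∀ i j n : ℤ, i + j = n → A.X i →ₗ[k] X j →ₗ[k] X n
  rmul : ∀ i j n : ℤ, i + j = n → X i →ₗ[k] B.X j →ₗ[k] X n
  d_d : ∀ (i j l : ℤ) (hij : i + 1 = j) (hjl : j + 1 = l) (x : X i), d j l hjl (d i j hij x) = 0
  lmul_lmul : ∀ (i j l ij jl n : ℤ) (hij : i + j = ij) (hjl : j + l = jl) (h : ij + l = n)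
    (h' : i + jl = n) (a : A.X i) (b : A.X j) (x : X l),
    lmul ij l n h (A.mul i j ij hij a b) x = lmul i jl n h' a (lmul j l jl hjl b x)
  rmul_rmul : ∀ (i j l ij jl n : ℤ) (hij : i + j = ij) (hjl : j + l = jl) (h : ij + l = n)
    (h' : i + jl = n) (x : X i) (b : B.X j) (c : B.X l),
    rmul ij l n h (rmul i j ij hij x b) c = rmul i jl n h' x (B.mul j l jl hjl b c)
  lmul_rmul : ∀ (i j l ij jl n : ℤ) (hij : i + j = ij) (hjl : j + l = jl) (h : ij + l = n)
    (h' : i + jl = n) (a : A.X i) (x : X j) (b : B.X l),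
    rmul ij l n h (lmul i j ij hij a x) b = lmul i jl n h' a (rmul j l jl hjl x b)
  one_lmul : ∀ (i : ℤ) (h : 0 + i = i) (x : X i), lmul 0 i i h A.one x = x
  rmul_one : ∀ (i : ℤ) (h : i + 0 = i) (x : X i), rmul i 0 i h x B.one = x
  d_lmul : ∀ (i j n i' j' n' : ℤ) (h : i + j = n) (hi : i + 1 = i') (hj : j + 1 = j')
    (hn : n + 1 = n') (h₁ : i' + j = n') (h₂ : i + j' = n') (a : A.X i) (x : X j),
    d n n' hn (lmul i j n h a x) =
      lmul i' j n' h₁ (A.d i i' hi a) x + i.negOnePow • lmul i j' n' h₂ a (d j j' hj x)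
  d_rmul : ∀ (i j n i' j' n' : ℤ) (h : i + j = n) (hi : i + 1 = i') (hj : j + 1 = j')
    (hn : n + 1 = n') (h₁ : i' + j = n') (h₂ : i + j' = n') (x : X i) (b : B.X j),
    d n n' hn (rmul i j n h x b) =
      rmul i' j n' h₁ (d i i' hi x) b + i.negOnePow • rmul i j' n' h₂ x (B.d j j' hj b)

namespace DGBimod

attribute [instance] DGBimod.addCommGroup DGBimod.module

variable {k : Type u} [Field k] {A B C : DGAlgebra k}

/-! ### Cohomology -/

/-- The `n`-th cohomology `k`-module of (the complex underlying) a dg bimodule. -/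
abbrev H (M : DGBimod A B) (n : ℤ) : Type u :=
  LinearMap.ker (M.d n (n + 1) rfl) ⧸
    (LinearMap.range (M.d (n - 1) n (sub_add_cancel n 1))).submoduleOf
      (LinearMap.ker (M.d n (n + 1) rfl))

/-- A dg bimodule is acyclic if its cohomology vanishes. -/
def Acyclic (M : DGBimod A B) : Prop := ∀ n, Subsingleton (M.H n)

/-! ### The category of dg bimodules and closed morphisms of degree zero -/

/-- Closed morphisms of degree zero. -/
@[ext]
structure Hom (M N : DGBimod A B) where
  f : ∀ i, M.X i →ₗ[k] N.X i
  comm : ∀ (i j : ℤ) (h : i + 1 = j) (x : M.X i), f j (M.d i j h x) = N.d i j h (f i x)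
  map_lmul : ∀ (i j n : ℤ) (h : i + j = n) (a : A.X i) (x : M.X j),
    f n (M.lmul i j n h a x) = N.lmul i j n h a (f j x)
  map_rmul : ∀ (i j n : ℤ) (h : i + j = n) (x : M.X i) (b : B.X j),
    f n (M.rmul i j n h x b) = N.rmul i j n h (f i x) b

instance : Category (DGBimod A B) where
  Hom M N := Hom M N
  id M := ⟨fun _ => LinearMap.id, by simp, by simp, by simp⟩
  comp f g := ⟨fun i => (g.f i).comp (f.f i), by simp [f.comm, g.comm],
    by simp [f.map_lmul, g.map_lmul], by simp [f.map_rmul, g.map_rmul]⟩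

@[ext]
lemma hom_ext {M N : DGBimod A B} {f g : M ⟶ N} (h : ∀ i x, f.f i x = g.f i x) : f = g :=
  Hom.ext (funext fun i => LinearMap.ext (h i))

@[simp]
lemma id_f (M : DGBimod A B) (i : ℤ) : Hom.f (𝟙 M) i = LinearMap.id := rfl

@[simp]
lemma comp_f {M N P : DGBimod A B} (f : M ⟶ N) (g : N ⟶ P) (i : ℤ) :
    (f ≫ g).f i = (g.f i).comp (f.f i) := rfl

namespace Hom

variable {M N : DGBimod A B}

instance : Zero (M ⟶ N) := ⟨⟨fun _ => 0, by simp, by simp, by simp⟩⟩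

instance : Add (M ⟶ N) := ⟨fun f g => ⟨fun i => f.f i + g.f i, by simp [f.comm, g.comm],
  by simp [f.map_lmul, g.map_lmul], by simp [f.map_rmul, g.map_rmul]⟩⟩

instance : Neg (M ⟶ N) := ⟨fun f => ⟨fun i => -f.f i, by simp [f.comm],
  by simp [f.map_lmul], by simp [f.map_rmul]⟩⟩

instance : SMul k (M ⟶ N) := ⟨fun c f => ⟨fun i => c • f.f i, by simp [f.comm],
  by simp [f.map_lmul], by simp [f.map_rmul]⟩⟩

@[simp] lemma zero_f (i : ℤ) : Hom.f (0 : M ⟶ N) i = 0 := rfl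

@[simp] lemma add_f (f g : M ⟶ N) (i : ℤ) : (f + g).f i = f.f i + g.f i := rfl

@[simp] lemma neg_f (f : M ⟶ N) (i : ℤ) : (-f).f i = -f.f i := rfl

@[simp] lemma smul_f (c : k) (f : M ⟶ N) (i : ℤ) : (c • f).f i = c • f.f i := rfl

instance : AddCommGroup (M ⟶ N) where
  add_assoc f g h := by ext; simp [add_assoc]
  zero_add f := by ext; simp
  add_zero f := by ext; simp
  add_comm f g := by ext; simp [add_comm]
  neg_add_cancel f := by ext; simp
  nsmul := nsmulRec
  zsmul := zsmulRec

instance : Module k (M ⟶ N) where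
  one_smul f := by ext; simp
  mul_smul a b f := by ext; simp [mul_smul]
  smul_zero a := by ext; simp
  smul_add a f g := by ext; simp
  add_smul a b f := by ext; simp [add_smul]
  zero_smul f := by ext; simp

end Hom

instance : Preadditive (DGBimod A B) where
  add_comp := by intros; ext; simp
  comp_add := by intros; ext; simp

instance : Linear k (DGBimod A B) where
  smul_comp := by intros; ext; simp
  comp_smul := by intros; ext; simp

/-- Quasi-isomorphisms: a closed morphism of degree zero that induces a bijection on cohomology,
spelled out on cocycles and coboundaries. -/
def QuasiIso {M N : DGBimod A B} (f : M ⟶ N) : Prop :=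
  ∀ (l n m : ℤ) (hl : l + 1 = n) (hm : n + 1 = m),
    (∀ x : M.X n, M.d n m hm x = 0 → (∃ y : N.X l, N.d l n hl y = f.f n x) →
      ∃ z : M.X l, M.d l n hl z = x) ∧
    (∀ y : N.X n, N.d n m hm y = 0 →
      ∃ x : M.X n, M.d n m hm x = 0 ∧ ∃ z : N.X l, N.d l n hl z = f.f n x - y)

/-! ### The homotopy category -/

/-- `f` and `g` are homotopic: `f - g = dh + hd` for a bimodule map `h` of degree `-1`. -/
def homotopic : HomRel (DGBimod A B) := fun M N f g =>
  ∃ h : ∀ i j : ℤ, j + 1 = i → M.X i →ₗ[k] N.X j,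
    (∀ (i j n j' n' : ℤ) (hn : i + j = n) (hj : j' + 1 = j) (hn' : n' + 1 = n)
      (hij : i + j' = n') (a : A.X i) (x : M.X j),
      h n n' hn' (M.lmul i j n hn a x) = i.negOnePow • N.lmul i j' n' hij a (h j j' hj x)) ∧
    (∀ (i j n i' n' : ℤ) (hn : i + j = n) (hi : i' + 1 = i) (hn' : n' + 1 = n)
      (hij : i' + j = n') (x : M.X i) (b : B.X j),
      h n n' hn' (M.rmul i j n hn x b) = N.rmul i' j n' hij (h i i' hi x) b) ∧
    ∀ (l n m : ℤ) (hl : l + 1 = n) (hm : n + 1 = m) (x : M.X n),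
      f.f n x - g.f n x = N.d l n hl (h n l hl x) + h m n hm (M.d n m hm x)

lemma homotopic_refl {M N : DGBimod A B} (f : M ⟶ N) : homotopic f f :=
  ⟨fun _ _ _ => 0, by simp, by simp, by simp⟩

lemma homotopic_add {M N : DGBimod A B} (f₁ f₂ g₁ g₂ : M ⟶ N) (hf : homotopic f₁ f₂)
    (hg : homotopic g₁ g₂) : homotopic (f₁ + g₁) (f₂ + g₂) := by
  obtain ⟨h, hl, hr, hd⟩ := hf
  obtain ⟨h', hl', hr', hd'⟩ := hg
  refine ⟨fun i j hij => h i j hij + h' i j hij, ?_, ?_, ?_⟩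
  · intro i j n j' n' hn hj hn' hij a x
    simp [hl i j n j' n' hn hj hn' hij, hl' i j n j' n' hn hj hn' hij]
  · intro i j n i' n' hn hi hn' hij x b
    simp [hr i j n i' n' hn hi hn' hij, hr' i j n i' n' hn hi hn' hij]
  · intro l n m hl hm x
    have h1 := hd l n m hl hm x
    have h2 := hd' l n m hl hm x
    simp only [Hom.add_f, LinearMap.add_apply, map_add]
    rw [add_sub_add_comm, h1, h2]
    abel

lemma homotopic_smul (c : k) {M N : DGBimod A B} (f g : M ⟶ N) (hf : homotopic f g) :
    homotopic (c • f) (c • g) := by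
  obtain ⟨h, hl, hr, hd⟩ := hf
  refine ⟨fun i j hij => c • h i j hij, ?_, ?_, ?_⟩
  · intro i j n j' n' hn hj hn' hij a x
    simp [hl i j n j' n' hn hj hn' hij, Units.smul_def, smul_comm c]
  · intro i j n i' n' hn hi hn' hij x b
    simp [hr i j n i' n' hn hi hn' hij]
  · intro l n m hl hm x
    have h1 := hd l n m hl hm x
    simp only [Hom.smul_f, LinearMap.smul_apply, map_smul]
    rw [← smul_sub, h1, smul_add]

lemma homotopic_comp_left {M N P : DGBimod A B} (f : M ⟶ N) {g g' : N ⟶ P} (hg : homotopic g g') :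
    homotopic (f ≫ g) (f ≫ g') := by
  obtain ⟨h, hl, hr, hd⟩ := hg
  refine ⟨fun i j hij => (h i j hij).comp (f.f i), ?_, ?_, ?_⟩
  · intro i j n j' n' hn hj hn' hij a x
    simp [f.map_lmul, hl i j n j' n' hn hj hn' hij]
  · intro i j n i' n' hn hi hn' hij x b
    simp [f.map_rmul, hr i j n i' n' hn hi hn' hij]
  · intro l n m hl hm x
    simpa [f.comm] using hd l n m hl hm (f.f n x)

lemma homotopic_comp_right {M N P : DGBimod A B} {f f' : M ⟶ N} (g : N ⟶ P)
    (hf : homotopic f f') : homotopic (f ≫ g) (f' ≫ g) := by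
  obtain ⟨h, hl, hr, hd⟩ := hf
  refine ⟨fun i j hij => (g.f j).comp (h i j hij), ?_, ?_, ?_⟩
  · intro i j n j' n' hn hj hn' hij a x
    simp [g.map_lmul, hl i j n j' n' hn hj hn' hij, Units.smul_def]
  · intro i j n i' n' hn hi hn' hij x b
    simp [g.map_rmul, hr i j n i' n' hn hi hn' hij]
  · intro l n m hl hm x
    simp only [comp_f, LinearMap.comp_apply]
    rw [← map_sub, hd l n m hl hm x, map_add, g.comm]

instance : Congruence (homotopic (A := A) (B := B)) where
  comp_left f _ _ h := homotopic_comp_left f h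
  comp_right g h := homotopic_comp_right g h
  equivalence :=
    { refl := homotopic_refl
      symm := fun {f g} h => by
        have h1 := homotopic_smul (-1 : k) f g h
        have h2 := homotopic_add _ _ _ _ h1 (homotopic_refl (f + g))
        have e1 : (-1 : k) • f + (f + g) = g := by rw [neg_one_smul]; abel
        have e2 : (-1 : k) • g + (f + g) = f := by rw [neg_one_smul]; abel
        rwa [e1, e2] at h2
      trans := fun {f g p} h h' => by
        have h2 := homotopic_add _ _ _ _ (homotopic_add _ _ _ _ h h') (homotopic_refl (-g))
        have e1 : f + g + -g = f := by abel
        have e2 : g + p + -g = p := by abel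
        rwa [e1, e2] at h2 }

end DGBimod

/-- The homotopy category of dg `A`-`B`-bimodules. -/
abbrev HoBimod {k : Type u} [Field k] (A B : DGAlgebra k) :=
  Quotient (DGBimod.homotopic (A := A) (B := B))

namespace HoBimod

variable {k : Type u} [Field k] {A B : DGAlgebra k}

instance : Preadditive (HoBimod A B) :=
  Quotient.preadditive _ fun _ _ f₁ f₂ g₁ g₂ => DGBimod.homotopic_add f₁ f₂ g₁ g₂

instance : (Quotient.functor (DGBimod.homotopic (A := A) (B := B))).Additive where

noncomputable instance : Linear k (HoBimod A B) :=
  Quotient.linear k _ fun c _ _ f g => DGBimod.homotopic_smul c f g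

end HoBimod

namespace DGBimod

variable {k : Type u} [Field k] {A B C : DGAlgebra k}

/-! ### Shifts and cones -/

/-- The shift `M[p]`: `M[p]ⁿ = Mⁿ⁺ᵖ`, with differential `(-1)ᵖ d`, left action twisted by
`(-1)^(p|a|)` and unchanged right action. -/
def shift (M : DGBimod A B) (p : ℤ) : DGBimod A B where
  X n := M.X (n + p)
  d i j h := p.negOnePow • M.d (i + p) (j + p) (by lia)
  lmul i j n h := (p * i).negOnePow • M.lmul i (j + p) (n + p) (by lia)
  rmul i j n h := M.rmul (i + p) j (n + p) (by lia)
  d_d i j l hij hjl x := by simp [Units.smul_def, M.d_d]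
  lmul_lmul i j l ij jl n hij hjl h h' a b x := by
    subst hij
    simp only [LinearMap.smul_apply, Units.smul_def, map_zsmul, smul_smul]
    rw [M.lmul_lmul i j (l + p) (i + j) (jl + p) (n + p) rfl (by lia) (by lia) (by lia)]
    rw [mul_add, Int.negOnePow_add, Units.val_mul, mul_comm]
  rmul_rmul i j l ij jl n hij hjl h h' x b c :=
    M.rmul_rmul (i + p) j l (ij + p) jl (n + p) (by lia) hjl (by lia) (by lia) x b c
  lmul_rmul i j l ij jl n hij hjl h h' a x b := by
    simp only [LinearMap.smul_apply, Units.smul_def, map_zsmul]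
    rw [M.lmul_rmul i (j + p) l (ij + p) (jl + p) (n + p) (by lia) (by lia) (by lia) (by lia)]
  one_lmul i h x := by simpa using M.one_lmul (i + p) (by lia) x
  rmul_one i h x := M.rmul_one (i + p) (by lia) x
  d_lmul i j n i' j' n' h hi hj hn h₁ h₂ a x := by
    subst hi
    simp only [LinearMap.smul_apply, Units.smul_def, map_zsmul, smul_smul]
    rw [M.d_lmul i (j + p) (n + p) (i + 1) (j' + p) (n' + p) (by lia) rfl (by lia) (by lia)
      (by lia) (by lia)]
    rw [mul_add, mul_one, Int.negOnePow_add, smul_add, Units.smul_def, smul_smul, Units.val_mul]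
    congr 2
    ring
  d_rmul i j n i' j' n' h hi hj hn h₁ h₂ x b := by
    simp only [LinearMap.smul_apply, Units.smul_def, map_zsmul]
    rw [M.d_rmul (i + p) j (n + p) (i' + p) j' (n' + p) (by lia) (by lia) hj (by lia)
      (by lia) (by lia)]
    rw [Int.negOnePow_add, smul_add, Units.smul_def, smul_smul, Units.val_mul]
    congr 2
    have : (p.negOnePow : ℤ) * p.negOnePow = 1 := Int.units_coe_mul_self p.negOnePow
    linear_combination (i.negOnePow : ℤ) * this

/-- The identity map between components of equal degrees. -/
def castX (M : DGBimod A B) (i j : ℤ) (h : i = j) : M.X i →ₗ[k] M.X j := h ▸ LinearMap.id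

@[simp]
lemma castX_self (M : DGBimod A B) (i : ℤ) : M.castX i i rfl = LinearMap.id := rfl

/-- `M ≅ M[0]`. -/
def isoShiftZero (M : DGBimod A B) : M ≅ M.shift 0 where
  hom :=
    { f i := M.castX i (i + 0) (by lia)
      comm i j h x := by
        have (i' j' : ℤ) (hi : i = i') (hj : j = j') (h' : i' + 1 = j') :
            M.castX j j' hj (M.d i j h x) = M.d i' j' h' (M.castX i i' hi x) := by
          subst hi hj; simp
        simp only [shift, Int.negOnePow_zero, one_smul]
        exact this (i + 0) (j + 0) (by lia) (by lia) (by lia)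
      map_lmul i j n h a x := by
        have (j' n' : ℤ) (hj : j = j') (hn : n = n') (h' : i + j' = n') :
            M.castX n n' hn (M.lmul i j n h a x) = M.lmul i j' n' h' a (M.castX j j' hj x) := by
          subst hj hn; simp
        simp only [shift, Int.negOnePow_zero, zero_mul, one_smul]
        exact this (j + 0) (n + 0) (by lia) (by lia) (by lia)
      map_rmul i j n h x b := by
        have (i' n' : ℤ) (hi : i = i') (hn : n = n') (h' : i' + j = n') :
            M.castX n n' hn (M.rmul i j n h x b) = M.rmul i' j n' h' (M.castX i i' hi x) b := by
          subst hi hn; simp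
        simp only [shift]
        exact this (i + 0) (n + 0) (by lia) (by lia) (by lia) }
  inv :=
    { f i := M.castX (i + 0) i (by lia)
      comm i j h x := by
        have (i' j' : ℤ) (hi : i' = i) (hj : j' = j) (h' : i' + 1 = j') (x : M.X i') :
            M.castX j' j hj (M.d i' j' h' x) = M.d i j h (M.castX i' i hi x) := by
          subst hi hj; simp
        simp only [shift, Int.negOnePow_zero, one_smul]
        exact this (i + 0) (j + 0) (by lia) (by lia) (by lia) x
      map_lmul i j n h a x := by
        have (j' n' : ℤ) (hj : j' = j) (hn : n' = n) (h' : i + j' = n') (x : M.X j') :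
            M.castX n' n hn (M.lmul i j' n' h' a x) = M.lmul i j n h a (M.castX j' j hj x) := by
          subst hj hn; simp
        simp only [shift, Int.negOnePow_zero, zero_mul, one_smul]
        exact this (j + 0) (n + 0) (by lia) (by lia) (by lia) x
      map_rmul i j n h x b := by
        have (i' n' : ℤ) (hi : i' = i) (hn : n' = n) (h' : i' + j = n') (x : M.X i') :
            M.castX n' n hn (M.rmul i' j n' h' x b) = M.rmul i j n h (M.castX i' i hi x) b := by
          subst hi hn; simp
        simp only [shift]
        exact this (i + 0) (n + 0) (by lia) (by lia) (by lia) x }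
  hom_inv_id := by
    ext i x
    have (i' : ℤ) (hi : i = i') : M.castX i' i hi.symm (M.castX i i' hi x) = x := by
      subst hi; simp
    exact this (i + 0) (by lia)
  inv_hom_id := by
    ext i x
    have (i' : ℤ) (hi : i' = i) (x : M.X i') :
        M.castX i i' hi.symm (M.castX i' i hi x) = x := by
      subst hi; simp
    exact this (i + 0) (by lia) x

/-- The cone of a closed morphism `f : M ⟶ N` of degree zero: `Mⁿ⁺¹ ⊕ Nⁿ` with differential
`(x, y) ↦ (-dx, f x + dy)`, left action `a (x, y) = ((-1)^|a| a x, a y)` and right action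
`(x, y) b = (x b, y b)`. -/
def cone {M N : DGBimod A B} (f : M ⟶ N) : DGBimod A B where
  X n := M.X (n + 1) × N.X n
  d i j h :=
    { toFun x := (-M.d (i + 1) (j + 1) (by lia) x.1,
        N.castX (i + 1) j h (f.f (i + 1) x.1) + N.d i j h x.2)
      map_add' x y := by ext <;> simp <;> abel
      map_smul' c x := by ext <;> simp }
  lmul i j n h := LinearMap.mk₂ k (fun a x =>
      (i.negOnePow • M.lmul i (j + 1) (n + 1) (by lia) a x.1, N.lmul i j n h a x.2))
    (by intros; simp) (by intros; ext <;> simp [Units.smul_def, smul_comm (_ : k) (_ : ℤ)])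
    (by intros; simp) (by intros; ext <;> simp [Units.smul_def, smul_comm (_ : k) (_ : ℤ)])
  rmul i j n h := LinearMap.mk₂ k (fun x b =>
      (M.rmul (i + 1) j (n + 1) (by lia) x.1 b, N.rmul i j n h x.2 b))
    (by intros; simp) (by intros; simp) (by intros; simp) (by intros; simp)
  d_d i j l hij hjl x := by
    subst hij hjl
    ext
    · simp [M.d_d]
    · simp [N.d_d, f.comm _ _ rfl]
  lmul_lmul i j l ij jl n hij hjl h h' a b x := by
    subst hij
    ext
    · simp only [LinearMap.mk₂_apply, Units.smul_def, map_zsmul, smul_smul]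
      rw [M.lmul_lmul i j (l + 1) (i + j) (jl + 1) (n + 1) rfl (by lia) (by lia) (by lia),
        Int.negOnePow_add, Units.val_mul]
    · exact N.lmul_lmul i j l _ jl n rfl hjl h h' a b x.2
  rmul_rmul i j l ij jl n hij hjl h h' x b c := by
    ext
    · exact M.rmul_rmul (i + 1) j l (ij + 1) jl (n + 1) (by lia) hjl (by lia) (by lia) x.1 b c
    · exact N.rmul_rmul i j l ij jl n hij hjl h h' x.2 b c
  lmul_rmul i j l ij jl n hij hjl h h' a x b := by
    ext
    · simp only [LinearMap.mk₂_apply, Units.smul_def, map_zsmul, LinearMap.smul_apply]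
      rw [M.lmul_rmul i (j + 1) l (ij + 1) (jl + 1) (n + 1) (by lia) (by lia) (by lia) (by lia)]
    · exact N.lmul_rmul i j l ij jl n hij hjl h h' a x.2 b
  one_lmul i h x := by
    ext
    · simpa using M.one_lmul (i + 1) (by lia) x.1
    · exact N.one_lmul i h x.2
  rmul_one i h x := by
    ext
    · exact M.rmul_one (i + 1) (by lia) x.1
    · exact N.rmul_one i h x.2
  d_lmul i j n i' j' n' h hi hj hn h₁ h₂ a x := by
    subst hi hj hn
    ext
    · simp only [LinearMap.mk₂_apply, LinearMap.coe_mk, AddHom.coe_mk, Units.smul_def, map_zsmul, Prod.fst_add,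
        Prod.smul_fst]
      rw [M.d_lmul i (j + 1) (n + 1) (i + 1) (j + 1 + 1) (n + 1 + 1) (by lia) rfl (by lia) (by lia)
        (by lia) (by lia)]
      simp [Int.negOnePow_succ, Units.smul_def, add_comm]
    · subst h
      have e1 : ∀ (n' : ℤ) (h : i + (j + 1) = n') (h' : i + j + 1 = n'),
          N.castX (i + j + 1) n' h' (f.f (i + j + 1) (M.lmul i (j + 1) (i + j + 1) (by lia) a x.1)) =
          N.lmul i (j + 1) n' h a (f.f (j + 1) x.1) := by
        rintro n' h h'
        subst h'
        simp [f.map_lmul i (j + 1) (i + j + 1) h]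
      simp only [LinearMap.mk₂_apply, LinearMap.coe_mk, AddHom.coe_mk,
        Units.smul_def, map_zsmul,
        Prod.snd_add, Prod.smul_snd, castX_self, LinearMap.id_apply, map_add, smul_add]
      have e2 := e1 (i + j + 1) (by lia) rfl
      simp only [castX_self, LinearMap.id_apply] at e2
      rw [e2, N.d_lmul i j (i + j) (i + 1) (j + 1) (i + j + 1) rfl rfl rfl rfl (by lia) (by lia),
        Units.smul_def]
      abel
  d_rmul i j n i' j' n' h hi hj hn h₁ h₂ x b := by
    subst hi hj hn
    ext
    · simp only [LinearMap.mk₂_apply, LinearMap.coe_mk, AddHom.coe_mk, Units.smul_def, Prod.fst_add,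
        Prod.smul_fst, map_neg]
      rw [M.d_rmul (i + 1) j (n + 1) (i + 1 + 1) (j + 1) (n + 1 + 1) (by lia) rfl rfl (by lia)
        (by lia) (by lia)]
      simp only [Int.negOnePow_succ, Units.smul_def, Units.val_neg, neg_smul, neg_add, neg_neg,
        LinearMap.neg_apply]
    · subst h
      simp only [LinearMap.mk₂_apply, LinearMap.coe_mk, AddHom.coe_mk,
        Units.smul_def,
        Prod.snd_add, Prod.smul_snd, castX_self, LinearMap.id_apply, map_add, LinearMap.add_apply]
      rw [f.map_rmul (i + 1) j (i + j + 1) (by lia), N.d_rmul i j (i + j) (i + 1) (j + 1) (i + j + 1)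
        rfl rfl rfl rfl (by lia) (by lia), Units.smul_def]
      abel

end DGBimod

namespace DGBimod

variable {k : Type u} [Field k] {A B C : DGAlgebra k}

/-! ### Tensor products -/

namespace Tensor

variable (M : DGBimod C A) (K : DGBimod A B)

/-- The degree `n` part of the tensor product of graded spaces `M ⊗ₖ K`. -/
abbrev Pre (n : ℤ) : Type u :=
  DirectSum {p : ℤ × ℤ // p.1 + p.2 = n} fun p => TensorProduct k (M.X p.1.1) (K.X p.1.2)

/-- The element `m ⊗ x` of `M ⊗ₖ K`. -/
noncomputable def pre (i j n : ℤ) (h : i + j = n) : M.X i →ₗ[k] K.X j →ₗ[k] Pre M K n :=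
  (TensorProduct.mk k (M.X i) (K.X j)).compr₂
    (DirectSum.lof k {p : ℤ × ℤ // p.1 + p.2 = n}
      (fun p => TensorProduct k (M.X p.1.1) (K.X p.1.2)) ⟨(i, j), h⟩)

/-- The relations `m a ⊗ x = m ⊗ a x`. -/
def rel (n : ℤ) : Submodule k (Pre M K n) :=
  Submodule.span k {z | ∃ (i l j il lj : ℤ) (hil : i + l = il) (hlj : l + j = lj)
    (h : il + j = n) (h' : i + lj = n) (m : M.X i) (a : A.X l) (x : K.X j),
    z = pre M K il j n h (M.rmul i l il hil m a) x - pre M K i lj n h' m (K.lmul l j lj hlj a x)}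

/-- The degree `n` part of `M ⊗_A K`. -/
def T (n : ℤ) : Type u := Pre M K n ⧸ rel M K n

noncomputable instance (n : ℤ) : AddCommGroup (T M K n) :=
  inferInstanceAs (AddCommGroup (Pre M K n ⧸ rel M K n))

noncomputable instance (n : ℤ) : Module k (T M K n) :=
  inferInstanceAs (Module k (Pre M K n ⧸ rel M K n))

/-- The projection from `M ⊗ₖ K` to `M ⊗_A K`. -/
noncomputable def proj (n : ℤ) : Pre M K n →ₗ[k] T M K n := (rel M K n).mkQ

/-- The element `m ⊗ x` of `M ⊗_A K`. -/
noncomputable def tmul (i j n : ℤ) (h : i + j = n) : M.X i →ₗ[k] K.X j →ₗ[k] T M K n :=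
  (pre M K i j n h).compr₂ (proj M K n)

lemma tmul_balanced (i l j il lj n : ℤ) (hil : i + l = il) (hlj : l + j = lj) (h : il + j = n)
    (h' : i + lj = n) (m : M.X i) (a : A.X l) (x : K.X j) :
    tmul M K il j n h (M.rmul i l il hil m a) x = tmul M K i lj n h' m (K.lmul l j lj hlj a x) :=
  (Submodule.Quotient.eq _).2
    (Submodule.subset_span ⟨i, l, j, il, lj, hil, hlj, h, h', m, a, x, rfl⟩)

variable {M K}

lemma T_ext {n : ℤ} {Z : Type*} [AddCommGroup Z] [Module k Z] {f g : T M K n →ₗ[k] Z}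
    (h : ∀ i j hij (m : M.X i) (x : K.X j), f (tmul M K i j n hij m x) = g (tmul M K i j n hij m x)) :
    f = g := by
  apply Submodule.linearMap_qext (rel M K n)
  apply DirectSum.linearMap_ext
  rintro ⟨⟨i, j⟩, hij⟩
  apply TensorProduct.ext'
  intro m x
  exact h i j hij m x

/-- The universal property of `M ⊗_A K` in degree `n`. -/
noncomputable def lift {n : ℤ} {Z : Type*} [AddCommGroup Z] [Module k Z]
    (φ : ∀ i j : ℤ, i + j = n → M.X i →ₗ[k] K.X j →ₗ[k] Z)
    (hφ : ∀ (i l j il lj : ℤ) (hil : i + l = il) (hlj : l + j = lj) (h : il + j = n)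
      (h' : i + lj = n) (m : M.X i) (a : A.X l) (x : K.X j),
      φ il j h (M.rmul i l il hil m a) x = φ i lj h' m (K.lmul l j lj hlj a x)) :
    T M K n →ₗ[k] Z :=
  Submodule.liftQ (rel M K n) (DirectSum.toModule k _ Z fun p => TensorProduct.lift (φ p.1.1 p.1.2 p.2)) (by
    refine Submodule.span_le.2 ?_
    rintro _ ⟨i, l, j, il, lj, hil, hlj, h, h', m, a, x, rfl⟩
    simp [pre, hφ i l j il lj hil hlj h h' m a x])

@[simp]
lemma lift_tmul {n : ℤ} {Z : Type*} [AddCommGroup Z] [Module k Z]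
    (φ : ∀ i j : ℤ, i + j = n → M.X i →ₗ[k] K.X j →ₗ[k] Z) (hφ)
    (i j : ℤ) (h : i + j = n) (m : M.X i) (x : K.X j) :
    lift φ hφ (tmul M K i j n h m x) = φ i j h m x := by
  change (DirectSum.toModule k _ Z fun p => TensorProduct.lift (φ p.1.1 p.1.2 p.2))
    (pre M K i j n h m x) = _
  simp [pre]

variable (M K)

/-- `d (m ⊗ x) = dm ⊗ x + (-1)^|m| m ⊗ dx`. -/
noncomputable def d (n n' : ℤ) (hn : n + 1 = n') : T M K n →ₗ[k] T M K n' :=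
  lift (fun i j h => (tmul M K (i + 1) j n' (by lia)).comp (M.d i (i + 1) rfl) +
      i.negOnePow • (tmul M K i (j + 1) n' (by lia)).compl₂ (K.d j (j + 1) rfl)) (by
    intro i l j il lj hil hlj h h' m a x
    subst hil hlj
    simp only [LinearMap.add_apply, LinearMap.comp_apply, LinearMap.smul_apply,
      LinearMap.compl₂_apply]
    rw [M.d_rmul i l (i + l) (i + 1) (l + 1) (i + l + 1) rfl rfl rfl rfl (by lia) (by lia),
      K.d_lmul l j (l + j) (l + 1) (j + 1) (l + j + 1) rfl rfl rfl rfl (by lia) (by lia)]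
    simp only [map_add, LinearMap.add_apply, Units.smul_def, map_zsmul, LinearMap.smul_apply,
      smul_add, smul_smul]
    rw [tmul_balanced M K (i + 1) l j (i + l + 1) (l + j) n' (by lia) rfl (by lia) (by lia),
      tmul_balanced M K i (l + 1) j (i + l + 1) (l + j + 1) n' (by lia) (by lia) (by lia) (by lia),
      tmul_balanced M K i l (j + 1) (i + l) (l + j + 1) n' (by lia) (by lia) (by lia) (by lia),
      Int.negOnePow_add, Units.val_mul]
    abel)

lemma d_tmul (i j n i' j' n' : ℤ) (h : i + j = n) (hi : i + 1 = i') (hj : j + 1 = j')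
    (hn : n + 1 = n') (h₁ : i' + j = n') (h₂ : i + j' = n') (m : M.X i) (x : K.X j) :
    d M K n n' hn (tmul M K i j n h m x) =
      tmul M K i' j n' h₁ (M.d i i' hi m) x + i.negOnePow • tmul M K i j' n' h₂ m (K.d j j' hj x) := by
  subst hi hj
  simp [d]

/-- `c (m ⊗ x) = cm ⊗ x`. -/
noncomputable def lmul (i j n : ℤ) (hn : i + j = n) : C.X i →ₗ[k] T M K j →ₗ[k] T M K n :=
  (lift (fun p q h => LinearMap.mk₂ k
      (fun m x => ((tmul M K (i + p) q n (by lia)).flip x).comp ((M.lmul i p (i + p) rfl).flip m))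
      (by intros; ext; simp) (by intros; ext; simp) (by intros; ext; simp) (by intros; ext; simp))
    (by
      intro p l q pl lq hpl hlq h h' m a x
      ext c
      simp only [LinearMap.mk₂_apply, LinearMap.comp_apply, LinearMap.flip_apply]
      rw [← tmul_balanced M K (i + p) l q (i + pl) lq n (by lia) hlq (by lia) (by lia),
        M.lmul_rmul i p l (i + p) pl (i + pl) rfl hpl (by lia) rfl])).flip

lemma lmul_tmul (i p q j ip n : ℤ) (hn : i + j = n) (h : p + q = j) (hip : i + p = ip)
    (h' : ip + q = n) (c : C.X i) (m : M.X p) (x : K.X q) :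
    lmul M K i j n hn c (tmul M K p q j h m x) = tmul M K ip q n h' (M.lmul i p ip hip c m) x := by
  subst hip
  simp [lmul]

/-- `(m ⊗ x) b = m ⊗ xb`. -/
noncomputable def rmul (i j n : ℤ) (hn : i + j = n) : T M K i →ₗ[k] B.X j →ₗ[k] T M K n :=
  lift (fun p q h => LinearMap.mk₂ k
      (fun m x => (tmul M K p (q + j) n (by lia) m).comp (K.rmul q j (q + j) rfl x))
      (by intros; ext; simp) (by intros; ext; simp) (by intros; ext; simp) (by intros; ext; simp))
    (by
      intro p l q pl lq hpl hlq h h' m a x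
      ext b
      simp only [LinearMap.mk₂_apply, LinearMap.comp_apply]
      rw [tmul_balanced M K p l (q + j) pl (lq + j) n hpl (by lia) (by lia) (by lia),
        K.lmul_rmul l q j lq (q + j) (lq + j) hlq rfl rfl (by lia)])

lemma rmul_tmul (p q i j qj n : ℤ) (hn : i + j = n) (h : p + q = i) (hqj : q + j = qj)
    (h' : p + qj = n) (m : M.X p) (x : K.X q) (b : B.X j) :
    rmul M K i j n hn (tmul M K p q i h m x) b = tmul M K p qj n h' m (K.rmul q j qj hqj x b) := by
  subst hqj
  simp [rmul]

lemma induction {n : ℤ} {P : T M K n → Prop}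
    (h : ∀ i j hij (m : M.X i) (x : K.X j), P (tmul M K i j n hij m x))
    (h0 : P 0) (hadd : ∀ z w, P z → P w → P (z + w)) (z : T M K n) : P z := by
  obtain ⟨z, rfl⟩ := Submodule.Quotient.mk_surjective _ z
  induction z using DirectSum.induction_on with
  | zero => exact h0
  | add z w hz hw => exact hadd _ _ hz hw
  | of p z =>
    obtain ⟨⟨i, j⟩, hij⟩ := p
    induction z using TensorProduct.induction_on with
    | zero => rw [map_zero]; exact h0
    | add z w hz hw => rw [map_add]; exact hadd _ _ hz hw
    | tmul m x => exact h i j hij m x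

end Tensor

open Tensor in
/-- The tensor product `M ⊗_A K` of a dg `C`-`A`-bimodule and a dg `A`-`B`-bimodule. -/
noncomputable def tensor (M : DGBimod C A) (K : DGBimod A B) : DGBimod C B where
  X n := T M K n
  d n n' h := Tensor.d M K n n' h
  lmul i j n h := Tensor.lmul M K i j n h
  rmul i j n h := Tensor.rmul M K i j n h
  d_d n n' n'' h h' z := by
    subst h h'
    induction z using Tensor.induction with
    | h0 => simp
    | hadd z w hz hw => simp [hz, hw]
    | h i j hij m x =>
      rw [d_tmul M K i j n (i + 1) (j + 1) (n + 1) hij rfl rfl rfl (by lia) (by lia), map_add,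
        Units.smul_def, map_zsmul,
        d_tmul M K (i + 1) j (n + 1) (i + 1 + 1) (j + 1) (n + 1 + 1) (by lia) rfl rfl rfl (by lia)
          (by lia),
        d_tmul M K i (j + 1) (n + 1) (i + 1) (j + 1 + 1) (n + 1 + 1) (by lia) rfl rfl rfl (by lia)
          (by lia), M.d_d, K.d_d]
      simp [Int.negOnePow_succ, Units.smul_def]
  lmul_lmul i j l ij jl n hij hjl h h' a b z := by
    subst hij hjl
    induction z using Tensor.induction with
    | h0 => simp
    | hadd z w hz hw => simp [hz, hw]
    | h p q hpq m x =>
      rw [lmul_tmul M K (i + j) p q l (i + j + p) n h hpq rfl (by lia),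
        lmul_tmul M K j p q l (j + p) (j + l) rfl hpq rfl (by lia),
        lmul_tmul M K i (j + p) q (j + l) (i + j + p) n h' (by lia) (by lia) (by lia),
        M.lmul_lmul i j p (i + j) (j + p) (i + j + p) rfl rfl rfl (by lia)]
  rmul_rmul i j l ij jl n hij hjl h h' z b c := by
    subst hij hjl
    induction z using Tensor.induction with
    | h0 => simp
    | hadd z w hz hw => simp [hz, hw]
    | h p q hpq m x =>
      rw [rmul_tmul M K p q i (j + l) (q + j + l) n h' hpq (by lia) (by lia),
        rmul_tmul M K p q i j (q + j) (i + j) rfl hpq rfl (by lia),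
        rmul_tmul M K p (q + j) (i + j) l (q + j + l) n h (by lia) rfl (by lia),
        K.rmul_rmul q j l (q + j) (j + l) (q + j + l) rfl rfl rfl (by lia)]
  lmul_rmul i j l ij jl n hij hjl h h' a z b := by
    subst hij hjl
    induction z using Tensor.induction with
    | h0 => simp
    | hadd z w hz hw => simp [hz, hw]
    | h p q hpq m x =>
      rw [lmul_tmul M K i p q j (i + p) (i + j) rfl hpq rfl (by lia),
        rmul_tmul M K (i + p) q (i + j) l (q + l) n h (by lia) rfl (by lia),
        rmul_tmul M K p q j l (q + l) (j + l) rfl hpq rfl (by lia),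
        lmul_tmul M K i p (q + l) (j + l) (i + p) n h' (by lia) rfl (by lia)]
  one_lmul i h z := by
    induction z using Tensor.induction with
    | h0 => simp
    | hadd z w hz hw => simp [hz, hw]
    | h p q hpq m x => rw [lmul_tmul M K 0 p q i p i h hpq (zero_add p) hpq, M.one_lmul]
  rmul_one i h z := by
    induction z using Tensor.induction with
    | h0 => simp
    | hadd z w hz hw => simp [hz, hw]
    | h p q hpq m x => rw [rmul_tmul M K p q i 0 q i h hpq (add_zero q) hpq, K.rmul_one]
  d_lmul i j n i' j' n' h hi hj hn h₁ h₂ a z := by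
    subst hi hj hn
    induction z using Tensor.induction with
    | h0 => simp
    | hadd z w hz hw => simp only [map_add, hz, hw, smul_add]; abel
    | h p q hpq m x =>
      rw [lmul_tmul M K i p q j (i + p) n h hpq rfl (by lia),
        d_tmul M K (i + p) q n (i + p + 1) (q + 1) (n + 1) (by lia) rfl rfl rfl (by lia) (by lia),
        M.d_lmul i p (i + p) (i + 1) (p + 1) (i + p + 1) rfl rfl rfl rfl (by lia) (by lia),
        lmul_tmul M K (i + 1) p q j (i + p + 1) (n + 1) (by lia) hpq (by lia) (by lia),
        d_tmul M K p q j (p + 1) (q + 1) (j + 1) hpq rfl rfl rfl (by lia) (by lia)]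
      simp only [map_add, LinearMap.add_apply, Units.smul_def, map_zsmul, LinearMap.smul_apply,
        smul_add, smul_smul]
      rw [lmul_tmul M K i (p + 1) q (j + 1) (i + p + 1) (n + 1) (by lia) (by lia) (by lia) (by lia),
        lmul_tmul M K i p (q + 1) (j + 1) (i + p) (n + 1) (by lia) (by lia) (by lia) (by lia),
        Int.negOnePow_add, Units.val_mul, add_assoc]
  d_rmul i j n i' j' n' h hi hj hn h₁ h₂ z b := by
    subst hi hj hn
    induction z using Tensor.induction with
    | h0 => simp
    | hadd z w hz hw => simp only [map_add, LinearMap.add_apply, hz, hw, smul_add]; abel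
    | h p q hpq m x =>
      rw [rmul_tmul M K p q i j (q + j) n h hpq rfl (by lia),
        d_tmul M K p (q + j) n (p + 1) (q + j + 1) (n + 1) (by lia) rfl rfl rfl (by lia) (by lia),
        K.d_rmul q j (q + j) (q + 1) (j + 1) (q + j + 1) rfl rfl rfl rfl (by lia) (by lia),
        rmul_tmul M K p q i (j + 1) (q + j + 1) (n + 1) (by lia) hpq (by lia) (by lia),
        d_tmul M K p q i (p + 1) (q + 1) (i + 1) hpq rfl rfl rfl (by lia) (by lia)]
      simp only [map_add, LinearMap.add_apply, Units.smul_def, map_zsmul, LinearMap.smul_apply,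
        smul_add, smul_smul]
      rw [rmul_tmul M K (p + 1) q (i + 1) j (q + j) (n + 1) (by lia) (by lia) (by lia) (by lia),
        rmul_tmul M K p (q + 1) (i + 1) j (q + j + 1) (n + 1) (by lia) (by lia) (by lia)
          (by lia), show i.negOnePow = p.negOnePow * q.negOnePow by rw [← hpq, Int.negOnePow_add],
        Units.val_mul]
      abel

namespace Tensor

/-- The map `f ⊗ 1` for `f : M → N` a graded map of degree `p` compatible with the right actions. -/
noncomputable def mapT {M N : DGBimod C A} (K : DGBimod A B) (p : ℤ)
    (f : ∀ i j : ℤ, j = i + p → M.X i →ₗ[k] N.X j)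
    (hf : ∀ (i l il i' il' : ℤ) (h : i + l = il) (hi : i' = i + p) (hil : il' = il + p)
      (h' : i' + l = il') (m : M.X i) (a : A.X l),
      f il il' hil (M.rmul i l il h m a) = N.rmul i' l il' h' (f i i' hi m) a)
    (n n' : ℤ) (hn : n' = n + p) : T M K n →ₗ[k] T N K n' :=
  lift (fun i j h => (tmul N K (i + p) j n' (by lia)).comp (f i (i + p) rfl)) (by
    intro i l j il lj hil hlj h h' m a x
    simp only [LinearMap.comp_apply]
    rw [hf i l il (i + p) (il + p) hil rfl rfl (by lia),
      tmul_balanced N K (i + p) l j (il + p) lj n' (by lia) hlj])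

lemma mapT_tmul {M N : DGBimod C A} (K : DGBimod A B) (p : ℤ)
    (f : ∀ i j : ℤ, j = i + p → M.X i →ₗ[k] N.X j) (hf)
    (n n' : ℤ) (hn : n' = n + p) (i j i' : ℤ) (h : i + j = n) (hi : i' = i + p) (h' : i' + j = n')
    (m : M.X i) (x : K.X j) :
    mapT K p f hf n n' hn (tmul M K i j n h m x) = tmul N K i' j n' h' (f i i' hi m) x := by
  subst hi
  simp [mapT]

/-- The map `f ⊗ 1` for a closed morphism `f : M ⟶ N` of degree zero. -/
noncomputable def map {M N : DGBimod C A} (f : M ⟶ N) (K : DGBimod A B) (n : ℤ) :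
    T M K n →ₗ[k] T N K n :=
  lift (fun i j h => (tmul N K i j n h).comp (f.f i)) (by
    intro i l j il lj hil hlj h h' m a x
    simp only [LinearMap.comp_apply]
    rw [f.map_rmul, tmul_balanced])

@[simp]
lemma map_tmul {M N : DGBimod C A} (f : M ⟶ N) (K : DGBimod A B) (n i j : ℤ) (h : i + j = n)
    (m : M.X i) (x : K.X j) :
    map f K n (tmul M K i j n h m x) = tmul N K i j n h (f.f i m) x := by
  simp [map]

end Tensor

open Tensor in
/-- The functor `- ⊗_A K` on dg bimodules. -/
noncomputable def tensorFunctor (C : DGAlgebra k) (K : DGBimod A B) :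
    DGBimod C A ⥤ DGBimod C B where
  obj M := M.tensor K
  map {M N} f :=
    { f n := Tensor.map f K n
      comm n n' h z := by
        change Tensor.map f K n' (Tensor.d M K n n' h z) = Tensor.d N K n n' h (Tensor.map f K n z)
        subst h
        induction z using Tensor.induction with
        | h0 => simp
        | hadd z w hz hw => simp [hz, hw]
        | h i j hij m x =>
          rw [map_tmul,
            d_tmul M K i j n (i + 1) (j + 1) (n + 1) hij rfl rfl rfl (by lia) (by lia),
            d_tmul N K i j n (i + 1) (j + 1) (n + 1) hij rfl rfl rfl (by lia) (by lia)]
          simp [Units.smul_def, f.comm]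
      map_lmul i j n h c z := by
        change Tensor.map f K n (Tensor.lmul M K i j n h c z) =
          Tensor.lmul N K i j n h c (Tensor.map f K j z)
        subst h
        induction z using Tensor.induction with
        | h0 => simp
        | hadd z w hz hw => simp [hz, hw]
        | h p q hpq m x =>
          rw [map_tmul, lmul_tmul M K i p q j (i + p) (i + j) rfl hpq rfl (by lia),
            lmul_tmul N K i p q j (i + p) (i + j) rfl hpq rfl (by lia)]
          simp [f.map_lmul]
      map_rmul i j n h z b := by
        change Tensor.map f K n (Tensor.rmul M K i j n h z b) =
          Tensor.rmul N K i j n h (Tensor.map f K i z) b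
        subst h
        induction z using Tensor.induction with
        | h0 => simp
        | hadd z w hz hw => simp [hz, hw]
        | h p q hpq m x =>
          rw [map_tmul, rmul_tmul M K p q i j (q + j) (i + j) rfl hpq rfl (by lia),
            rmul_tmul N K p q i j (q + j) (i + j) rfl hpq rfl (by lia)]
          simp }
  map_id M := by
    refine Hom.ext (funext fun n => ?_)
    change Tensor.map (𝟙 M) K n = LinearMap.id
    exact T_ext fun i j hij m x => by simp
  map_comp f g := by
    refine Hom.ext (funext fun n => ?_)
    change Tensor.map (f ≫ g) K n = (Tensor.map g K n).comp (Tensor.map f K n)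
    exact T_ext fun i j hij m x => by simp

set_option maxHeartbeats 1600000 in
open Tensor in
lemma homotopic_tensor {M N : DGBimod C A} {f g : M ⟶ N} (K : DGBimod A B) (hfg : homotopic f g) :
    homotopic ((tensorFunctor C K).map f) ((tensorFunctor C K).map g) := by
  obtain ⟨h, hl, hr, hd⟩ := hfg
  have hr' : ∀ (i l il i' il' : ℤ) (e : i + l = il) (hi : i' = i + -1) (hil : il' = il + -1)
      (h' : i' + l = il') (m : M.X i) (a : A.X l),
      h il il' (by lia) (M.rmul i l il e m a) = N.rmul i' l il' h' (h i i' (by lia) m) a :=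
    fun i l il i' il' e hi hil h' m a => hr i l il i' il' e (by lia) (by lia) h' m a
  refine ⟨fun i j hij => mapT K (-1) (fun i j hij => h i j (by lia)) hr' i j (by lia), ?_, ?_, ?_⟩
  · intro i j n j' n' hn hj hn' hij c z
    change mapT K (-1) _ hr' n n' _ (Tensor.lmul M K i j n hn c z) =
      i.negOnePow • Tensor.lmul N K i j' n' hij c (mapT K (-1) _ hr' j j' _ z)
    induction z using Tensor.induction with
    | h0 => simp
    | hadd z w hz hw => simp [hz, hw]
    | h p q hpq m x =>
      rw [lmul_tmul M K i p q j (i + p) n hn hpq rfl (by lia),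
        mapT_tmul K (-1) _ hr' n n' (by lia) (i + p) q (i + p + -1) (by lia) (by lia) (by lia),
        mapT_tmul K (-1) _ hr' j j' (by lia) p q (p + -1) (by lia) (by lia) (by lia),
        lmul_tmul N K i (p + -1) q j' (i + p + -1) n' hij (by lia) (by lia) (by lia),
        hl i p (i + p) (p + -1) (i + p + -1) rfl (by lia) (by lia) (by lia)]
      simp [Units.smul_def]
  · intro i j n i' n' hn hi hn' hij z b
    change mapT K (-1) _ hr' n n' _ (Tensor.rmul M K i j n hn z b) =
      Tensor.rmul N K i' j n' hij (mapT K (-1) _ hr' i i' _ z) b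
    induction z using Tensor.induction with
    | h0 => simp
    | hadd z w hz hw => simp [hz, hw]
    | h p q hpq m x =>
      rw [rmul_tmul M K p q i j (q + j) n hn hpq rfl (by lia),
        mapT_tmul K (-1) _ hr' n n' (by lia) p (q + j) (p + -1) (by lia) (by lia) (by lia),
        mapT_tmul K (-1) _ hr' i i' (by lia) p q (p + -1) (by lia) (by lia) (by lia),
        rmul_tmul N K (p + -1) q i' j (q + j) n' hij (by lia) rfl (by lia)]
  · intro l n m hl' hm z
    have key : Tensor.map f K n - Tensor.map g K n =
        (Tensor.d N K l n hl').comp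
          (mapT K (-1) (fun i j hij => h i j (by lia)) hr' n l (by lia)) +
        (mapT K (-1) (fun i j hij => h i j (by lia)) hr' m n (by lia)).comp
          (Tensor.d M K n m hm) := by
      refine T_ext fun p q hpq y x => ?_
      have e := hd (p + -1) p (p + 1) (by lia) rfl y
      simp only [LinearMap.sub_apply, LinearMap.add_apply, LinearMap.comp_apply]
      rw [map_tmul, map_tmul,
        mapT_tmul K (-1) _ hr' n l (by lia) p q (p + -1) hpq rfl (by lia),
        d_tmul M K p q n (p + 1) (q + 1) m hpq rfl rfl hm (by lia) (by lia),
        d_tmul N K (p + -1) q l p (q + 1) n (by lia) (by lia) rfl hl' (by lia) (by lia),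
        map_add, Units.smul_def, Units.smul_def, map_zsmul,
        mapT_tmul K (-1) _ hr' m n (by lia) (p + 1) q p (by lia) (by lia) (by lia),
        mapT_tmul K (-1) _ hr' m n (by lia) p (q + 1) (p + -1) (by lia) (by lia) (by lia),
        ← LinearMap.sub_apply, ← map_sub, e, map_add, LinearMap.add_apply,
        Int.negOnePow_add, Int.negOnePow_neg, Int.negOnePow_one]
      simp only [mul_neg, mul_one, Units.val_neg, neg_smul]
      abel
    exact LinearMap.congr_fun key z

end DGBimod

namespace DGAlgebra

variable (k : Type u) [Field k]

/-- The component of degree `i` of `k` viewed as a graded algebra concentrated in degree zero. -/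
def basePart (i : ℤ) : Submodule k k where
  carrier := {x | i ≠ 0 → x = 0}
  add_mem' hx hy h := by rw [hx h, hy h, add_zero]
  zero_mem' _ := rfl
  smul_mem' c x hx h := by rw [hx h, smul_zero]

/-- The ground field `k` as a dg algebra concentrated in degree zero. -/
def base : DGAlgebra k where
  X i := basePart k i
  d _ _ _ := 0
  mul i j n h := LinearMap.mk₂ k (fun x y => (⟨x.1 * y.1, fun hn => by
      by_cases hi : i = 0
      · rw [y.2 (by lia), mul_zero]
      · rw [x.2 hi, zero_mul]⟩ : basePart k n))
    (fun _ _ _ => Subtype.ext (add_mul _ _ _)) (fun _ _ _ => Subtype.ext (_root_.mul_assoc _ _ _))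
    (fun _ _ _ => Subtype.ext (mul_add _ _ _)) (fun _ _ _ => Subtype.ext (mul_left_comm _ _ _))
  one := (⟨1, fun h => absurd rfl h⟩ : basePart k 0)
  d_d _ _ _ _ _ _ := rfl
  mul_assoc _ _ _ _ _ _ _ _ _ _ _ _ _ := Subtype.ext (_root_.mul_assoc _ _ _)
  one_mul _ _ _ := Subtype.ext (_root_.one_mul _)
  mul_one _ _ _ := Subtype.ext (_root_.mul_one _)
  d_mul _ _ _ _ _ _ _ _ _ _ _ _ _ _ := Subtype.ext (by simp)

variable {k}

/-- The identity map between components of equal degrees. -/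
def castX (A : DGAlgebra k) (i j : ℤ) (h : i = j) : A.X i →ₗ[k] A.X j := h ▸ LinearMap.id

@[simp]
lemma castX_self (A : DGAlgebra k) (i : ℤ) : A.castX i i rfl = LinearMap.id := rfl

lemma d_one (A : DGAlgebra k) (j : ℤ) (h : 0 + 1 = j) : A.d 0 j h A.one = 0 := by
  have e := A.d_mul 0 0 0 j j j rfl h h h (add_zero j) (zero_add j) A.one A.one
  rw [A.one_mul, A.mul_one, A.one_mul] at e
  simpa using e

/-- The unit homomorphism `k → A`, `c ↦ c • 1`. -/
def unit (A : DGAlgebra k) (i : ℤ) : (base k).X i →ₗ[k] A.X i :=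
  if h : 0 = i then (LinearMap.toSpanSingleton k (A.X i) (A.castX 0 i h A.one)) ∘ₗ
    (basePart k i).subtype else 0

lemma unit_zero (A : DGAlgebra k) (c : (base k).X 0) :
    A.unit 0 c = (basePart k 0).subtype c • A.one := by
  rw [unit, dif_pos rfl]
  rfl

lemma unit_of_ne (A : DGAlgebra k) (i : ℤ) (h : 0 ≠ i) (c : (base k).X i) : A.unit i c = 0 := by
  simp [unit, h]

lemma unit_one (A : DGAlgebra k) : A.unit 0 (base k).one = A.one := by
  rw [unit_zero]
  exact one_smul k _

lemma unit_mul (A : DGAlgebra k) (i j n : ℤ) (h : i + j = n) (a : (base k).X i)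
    (b : (base k).X j) :
    A.unit n ((base k).mul i j n h a b) = A.mul i j n h (A.unit i a) (A.unit j b) := by
  by_cases hi : 0 = i
  · subst hi
    by_cases hj : 0 = j
    · subst hj
      obtain rfl : n = 0 := by lia
      rw [unit_zero, unit_zero, unit_zero]
      simp only [map_smul, LinearMap.smul_apply, smul_smul, A.one_mul]
      congr 1
      exact mul_comm _ _
    · rw [A.unit_of_ne j hj, A.unit_of_ne n (by lia), map_zero]
  · rw [A.unit_of_ne i hi, map_zero, LinearMap.zero_apply]
    by_cases hn : 0 = n
    · subst hn
      rw [unit_zero]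
      have : (basePart k 0).subtype ((base k).mul i j 0 h a b) = 0 := by
        change a.1 * b.1 = 0
        rw [a.2 (by lia), zero_mul]
      rw [this, zero_smul]
    · rw [A.unit_of_ne n hn]

lemma d_unit (A : DGAlgebra k) (i j : ℤ) (h : i + 1 = j) (a : (base k).X i) :
    A.d i j h (A.unit i a) = 0 := by
  by_cases hi : 0 = i
  · subst hi
    rw [unit_zero, map_smul, d_one, smul_zero]
  · rw [A.unit_of_ne i hi, map_zero]

end DGAlgebra

namespace DGBimod

variable {k : Type u} [Field k] {A B C : DGAlgebra k}

/-! ### Some dg bimodules -/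

/-- The diagonal bimodule `A`. -/
def diag (A : DGAlgebra k) : DGBimod A A where
  X := A.X
  d := A.d
  lmul := A.mul
  rmul := A.mul
  d_d := A.d_d
  lmul_lmul := A.mul_assoc
  rmul_rmul := A.mul_assoc
  lmul_rmul := A.mul_assoc
  one_lmul := A.one_mul
  rmul_one := A.mul_one
  d_lmul := A.d_mul
  d_rmul := A.d_mul

/-- Forget the left action, i.e. restrict it along the unit homomorphism `k → A`. -/
def forgetLeft (M : DGBimod A B) : DGBimod (DGAlgebra.base k) B where
  X := M.X
  d := M.d
  lmul i j n h := M.lmul i j n h ∘ₗ A.unit i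
  rmul := M.rmul
  d_d := M.d_d
  lmul_lmul i j l ij jl n hij hjl h h' a b x := by
    simp only [LinearMap.comp_apply]
    rw [A.unit_mul, M.lmul_lmul]
  rmul_rmul := M.rmul_rmul
  lmul_rmul i j l ij jl n hij hjl h h' a x b :=
    M.lmul_rmul i j l ij jl n hij hjl h h' (A.unit i a) x b
  one_lmul i h x := by
    rw [LinearMap.comp_apply, A.unit_one, M.one_lmul]
  rmul_one := M.rmul_one
  d_lmul i j n i' j' n' h hi hj hn h₁ h₂ a x := by
    simp only [LinearMap.comp_apply]
    rw [M.d_lmul i j n i' j' n' h hi hj hn h₁ h₂, A.d_unit]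
    change _ = M.lmul i' j n' h₁ (A.unit i' 0) x + _
    simp
  d_rmul := M.d_rmul

/-- Forget the right action, i.e. restrict it along the unit homomorphism `k → B`. -/
def forgetRight (M : DGBimod A B) : DGBimod A (DGAlgebra.base k) where
  X := M.X
  d := M.d
  lmul := M.lmul
  rmul i j n h := (M.rmul i j n h).compl₂ (B.unit j)
  d_d := M.d_d
  lmul_lmul := M.lmul_lmul
  rmul_rmul i j l ij jl n hij hjl h h' x b c := by
    simp only [LinearMap.compl₂_apply]
    rw [B.unit_mul, M.rmul_rmul]
  lmul_rmul i j l ij jl n hij hjl h h' a x b :=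
    M.lmul_rmul i j l ij jl n hij hjl h h' a x (B.unit l b)
  one_lmul := M.one_lmul
  rmul_one i h x := by
    rw [LinearMap.compl₂_apply, B.unit_one, M.rmul_one]
  d_lmul := M.d_lmul
  d_rmul i j n i' j' n' h hi hj hn h₁ h₂ x b := by
    simp only [LinearMap.compl₂_apply]
    rw [M.d_rmul i j n i' j' n' h hi hj hn h₁ h₂, B.d_unit]
    change _ = _ + i.negOnePow • M.rmul i j' n' h₂ x (B.unit j' 0)
    simp

/-- The `k`-dual `M^* = Hom_k(M, k)`: `(M^*)ⁿ` is the dual of `M⁻ⁿ`, with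
`(df)(m) = -(-1)^|f| f(dm)`, `(b f)(m) = (-1)^|b| f(m b)` and `(f a)(m) = f(a m)`. -/
def dual (M : DGBimod A B) : DGBimod B A where
  X n := Module.Dual k (M.X (-n))
  d i j h := -(i.negOnePow • (M.d (-j) (-i) (by lia)).dualMap)
  lmul i j n h := LinearMap.mk₂ k
    (fun b f => i.negOnePow • f ∘ₗ (M.rmul (-n) i (-j) (by lia)).flip b)
    (by intros; ext; simp) (by intros; ext; simp [Units.smul_def, mul_left_comm])
    (by intros; ext; simp) (by intros; ext; simp [Units.smul_def, mul_left_comm])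
  rmul i j n h := LinearMap.mk₂ k (fun f a => f ∘ₗ M.lmul j (-n) (-i) (by lia) a)
    (by intros; ext; simp) (by intros; ext; simp)
    (by intros; ext; simp) (by intros; ext; simp)
  d_d i j l hij hjl f := by
    ext m
    simp [Units.smul_def, M.d_d]
  lmul_lmul i j l ij jl n hij hjl h h' a b f := by
    subst hij
    ext m
    simp only [LinearMap.mk₂_apply, LinearMap.smul_apply, LinearMap.comp_apply,
      LinearMap.flip_apply, Units.smul_def, smul_smul]
    rw [M.rmul_rmul (-n) i j (-jl) (i + j) (-l) (by lia) rfl (by lia) (by lia),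
      Int.negOnePow_add, Units.val_mul]
  rmul_rmul i j l ij jl n hij hjl h h' f b c := by
    ext m
    simp only [LinearMap.mk₂_apply, LinearMap.comp_apply]
    rw [M.lmul_lmul j l (-n) jl (-ij) (-i) hjl (by lia) (by lia) (by lia)]
  lmul_rmul i j l ij jl n hij hjl h h' a f b := by
    ext m
    simp only [LinearMap.mk₂_apply, LinearMap.smul_apply, LinearMap.comp_apply,
      LinearMap.flip_apply, Units.smul_def]
    rw [M.lmul_rmul l (-n) i (-ij) (-jl) (-j) (by lia) (by lia) (by lia) (by lia)]
  one_lmul i h f := by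
    ext m
    simp only [LinearMap.mk₂_apply, LinearMap.smul_apply, LinearMap.comp_apply,
      LinearMap.flip_apply, Int.negOnePow_zero, one_smul]
    rw [M.rmul_one]
  rmul_one i h f := by
    ext m
    simp only [LinearMap.mk₂_apply, LinearMap.comp_apply]
    rw [M.one_lmul]
  d_lmul i j n i' j' n' h hi hj hn h₁ h₂ a f := by
    subst hi hj hn
    ext m
    have e := M.d_rmul (-(n + 1)) i (-(j + 1)) (-n) (i + 1) (-j) (by lia) (by lia) rfl
      (by lia) (by lia) (by lia) m a
    have hs : (-(n + 1)).negOnePow = -(i.negOnePow * j.negOnePow) := by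
      rw [Int.negOnePow_neg, Int.negOnePow_succ, ← h, Int.negOnePow_add]
    have hi : (i.negOnePow : ℤ) * i.negOnePow = 1 := Int.units_coe_mul_self _
    have hj : (j.negOnePow : ℤ) * j.negOnePow = 1 := Int.units_coe_mul_self _
    simp only [LinearMap.mk₂_apply, LinearMap.smul_apply, LinearMap.comp_apply,
      LinearMap.flip_apply, LinearMap.neg_apply, LinearMap.add_apply, LinearMap.dualMap_apply]
    have hn : n.negOnePow = i.negOnePow * j.negOnePow := by rw [← h, Int.negOnePow_add]
    rw [e, hs, hn, Int.negOnePow_succ]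
    simp only [map_add, Units.smul_def, map_zsmul, Units.val_neg, Units.val_mul, zsmul_eq_mul]
    push_cast
    have hi' : ((i.negOnePow : ℤ) : k) * (i.negOnePow : ℤ) = 1 := by
      rw [← Int.cast_mul, hi, Int.cast_one]
    have hj' : ((j.negOnePow : ℤ) : k) * (j.negOnePow : ℤ) = 1 := by
      rw [← Int.cast_mul, hj, Int.cast_one]
    generalize ((i.negOnePow : ℤ) : k) = I at *
    generalize ((j.negOnePow : ℤ) : k) = J at *
    generalize f (M.rmul (-(n + 1)) (i + 1) (-j) _ m (B.d i (i + 1) _ a)) = Y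
    generalize f (M.rmul (-n) i (-j) _ (M.d (-(n + 1)) (-n) _ m) a) = X
    linear_combination (-(I * J * J * Y)) * hi' - I * Y * hj'
  d_rmul i j n i' j' n' h hi hj hn h₁ h₂ f b := by
    subst hi hj hn
    ext m
    have e := M.d_lmul j (-(n + 1)) (-(i + 1)) (j + 1) (-n) (-i) (by lia) rfl (by lia)
      (by lia) (by lia) (by lia) b m
    simp only [LinearMap.mk₂_apply, LinearMap.smul_apply, LinearMap.comp_apply,
      LinearMap.flip_apply, LinearMap.neg_apply, LinearMap.add_apply, LinearMap.dualMap_apply]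
    have hn : n.negOnePow = i.negOnePow * j.negOnePow := by rw [← h, Int.negOnePow_add]
    rw [e, hn]
    simp only [map_add, Units.smul_def, map_zsmul, Units.val_mul, zsmul_eq_mul]
    push_cast
    ring

end DGBimod

/-! ### The homotopy category and generation -/

namespace HoBimod

variable {k : Type u} [Field k] {A B : DGAlgebra k}

/-- A dg bimodule as an object of the homotopy category. -/
abbrev of (M : DGBimod A B) : HoBimod A B := (Quotient.functor DGBimod.homotopic).obj M

/-- The shift `X[n]` of an object of the homotopy category. -/
abbrev shift (X : HoBimod A B) (n : ℤ) : HoBimod A B := of (X.as.shift n)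

/-- A morphism of the homotopy category that is represented by a quasi-isomorphism. -/
def QuasiIso {X Y : HoBimod A B} (φ : X ⟶ Y) : Prop :=
  ∃ f : X.as ⟶ Y.as, (Quotient.functor DGBimod.homotopic).map f = φ ∧ DGBimod.QuasiIso f

/-- `Z ∈ P ⋆ Q`: there is a distinguished triangle `X → Z → Y → X[1]` with `X ∈ P` and `Y ∈ Q`,
i.e. `Z` is isomorphic to the cone of a morphism `Y[-1] → X`. -/
def star (P Q : ObjectProperty (HoBimod A B)) : ObjectProperty (HoBimod A B) := fun Z =>
  ∃ X Y : HoBimod A B, P X ∧ Q Y ∧ ∃ f : Y.as.shift (-1) ⟶ X.as, Nonempty (Z ≅ of (DGBimod.cone f))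

/-- `[E]₀`: the objects isomorphic to a finite direct sum of shifts of `E`. -/
def sums (E : HoBimod A B) : ObjectProperty (HoBimod A B) := fun X =>
  ∃ (r : ℕ) (n : Fin r → ℤ) (b : Limits.Bicone fun i => shift E (n i)),
    Nonempty b.IsBilimit ∧ Nonempty (X ≅ b.pt)

/-- `[E]ₙ = [E]₀ ⋆ ⋯ ⋆ [E]₀` with `n + 1` factors. -/
def layer (E : HoBimod A B) : ℕ → ObjectProperty (HoBimod A B)
  | 0 => sums E
  | n + 1 => star (sums E) (layer E n)

/-- `⟨E⟩ₙ`: the direct summands of the objects of `[E]ₙ`. -/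
def thickLayer (E : HoBimod A B) (n : ℕ) : ObjectProperty (HoBimod A B) := fun X =>
  ∃ Y, layer E n Y ∧ Nonempty (Retract X Y)

/-- `⟨E⟩`, the union of all `⟨E⟩ₙ`. -/
def thick (E : HoBimod A B) : ObjectProperty (HoBimod A B) := fun X => ∃ n, thickLayer E n X

lemma sums_self (E X : HoBimod A B) (h : Nonempty (X ≅ shift E 0)) : sums E X := by
  refine ⟨1, fun _ => 0, Limits.Bicone.mk (shift E 0) (fun _ => 𝟙 _) (fun _ => 𝟙 _) ?_, ?_, h⟩
  · intro i j
    obtain rfl := Subsingleton.elim i j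
    simp
  · exact ⟨Limits.isBilimitOfTotal _ (by simp)⟩

lemma thick_self (E : HoBimod A B) : thick E E :=
  ⟨0, E, sums_self E E ⟨(Quotient.functor _).mapIso E.as.isoShiftZero⟩, ⟨Retract.refl E⟩⟩

end HoBimod

namespace DGBimod

variable {k : Type u} [Field k] {A B : DGAlgebra k}

/-- h-projective dg bimodules: every morphism to an acyclic dg bimodule is null-homotopic. -/
def HProjective (P : DGBimod A B) : Prop :=
  ∀ N : DGBimod A B, N.Acyclic → ∀ φ : HoBimod.of P ⟶ HoBimod.of N, φ = 0

/-- The free dg bimodule `A ⊗ₖ B` of rank one. -/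
noncomputable def free (A B : DGAlgebra k) : DGBimod A B :=
  (diag A).forgetRight.tensor (diag B).forgetLeft

/-- A dg `A`-`B`-bimodule is perfect if it is quasi-isomorphic to an object of the thick
triangulated subcategory generated by `A ⊗ₖ B`. The objects of `⟨A ⊗ₖ B⟩` are h-projective, so that
this is membership in `Perf(Aᵒᵖ ⊗ B) ⊆ D(Aᵒᵖ ⊗ B)`. -/
def IsPerfect (M : DGBimod A B) : Prop :=
  ∃ P : DGBimod A B, HoBimod.thick (HoBimod.of (free A B)) (HoBimod.of P) ∧
    ∃ f : P ⟶ M, QuasiIso f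

/-- `inf {i | Hⁱ(M) ≠ 0}`. -/
noncomputable def infH (M : DGBimod A B) : EReal :=
  ⨅ (i : ℤ) (_ : Nontrivial (M.H i)), ((i : ℝ) : EReal)

/-- `sup {i | Hⁱ(M) ≠ 0}`. -/
noncomputable def supH (M : DGBimod A B) : EReal :=
  ⨆ (i : ℤ) (_ : Nontrivial (M.H i)), ((i : ℝ) : EReal)

/-- The tensor power `P ⊗_A ⋯ ⊗_A P` with `m` factors, `A` for `m = 0`. If `P → M` is a
quasi-isomorphism from an h-projective dg bimodule, it is the derived tensor power of `M`. -/
noncomputable def tensorPow (P : DGBimod A A) : ℕ → DGBimod A A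
  | 0 => diag A
  | m + 1 => (tensorPow P m).tensor P

/-- `P` is an h-projective resolution of the dual bimodule `A^*`: it is h-projective and there is a
quasi-isomorphism `P → A^*`. -/
def IsDualResolution {A : DGAlgebra k} (P : DGBimod A A) : Prop :=
  P.HProjective ∧ ∃ f : P ⟶ (diag A).dual, QuasiIso f

end DGBimod

namespace HoBimod

variable {k : Type u} [Field k] {A B : DGAlgebra k}

/-- The functor `- ⊗_A K` on homotopy categories. -/
noncomputable def tensorFunctor (C : DGAlgebra k) (K : DGBimod A B) : HoBimod C A ⥤ HoBimod C B :=
  CategoryTheory.Quotient.lift _ (DGBimod.tensorFunctor C K ⋙ Quotient.functor DGBimod.homotopic)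
    fun _ _ _ _ h => CategoryTheory.Quotient.sound _ (DGBimod.homotopic_tensor K h)

/-- `e₋(X, Y) = inf {i | Homⁱ(X, Y) ≠ 0}`. -/
noncomputable def eMinus (X Y : HoBimod A B) : EReal :=
  ⨅ (i : ℤ) (_ : Nontrivial (X ⟶ shift Y i)), ((i : ℝ) : EReal)

/-- `e₊(X, Y) = sup {i | Homⁱ(X, Y) ≠ 0}`. -/
noncomputable def ePlus (X Y : HoBimod A B) : EReal :=
  ⨆ (i : ℤ) (_ : Nontrivial (X ⟶ shift Y i)), ((i : ℝ) : EReal)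

/-- `∑ₙ dim Homⁿ(X, Y) e^(-nt)`. -/
noncomputable def weightedDim (X Y : HoBimod A B) (t : ℝ) : ENNReal :=
  ∑' n : ℤ, ((Cardinal.toENat (Module.rank k (X ⟶ shift Y n)) : ℕ∞) : ENNReal) *
    ENNReal.ofReal (Real.exp (-(n * t)))

end HoBimod

namespace DGAlgebra

variable {k : Type u} [Field k]

/-- `A` is (homologically) smooth: the diagonal bimodule is perfect. -/
def Smooth (A : DGAlgebra k) : Prop := (DGBimod.diag A).IsPerfect

/-- `A` is compact: its total cohomology is finite dimensional. -/
def Compact (A : DGAlgebra k) : Prop :=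
  Module.Finite k (DirectSum ℤ fun i => (DGBimod.diag A).H i)

/-- `A` as a right dg module over itself. -/
def regular (A : DGAlgebra k) : DGBimod (base k) A := (DGBimod.diag A).forgetLeft

end DGAlgebra

/-- The triangulated category `Perf(A)`, realised as the full subcategory `⟨A⟩` of the homotopy
category of right dg `A`-modules. Since `A` is h-projective, so are all its objects, and it is
equivalent to the thick subcategory of `D(A)` generated by `A`. -/
abbrev Perf {k : Type u} [Field k] (A : DGAlgebra k) :=
  (HoBimod.thick (HoBimod.of A.regular)).FullSubcategory

namespace Perf

variable {k : Type u} [Field k] {A : DGAlgebra k}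

/-- `G` is a (classical) generator: `Perf(A) = ⟨G⟩`. -/
def IsGenerator (G : Perf A) : Prop := ∀ X : Perf A, HoBimod.thick G.obj X.obj

/-- A Serre functor: there are natural isomorphisms `Hom(X, Y) ≃ Hom(Y, S X)^*`. -/
def IsSerreFunctor (S : Perf A ⥤ Perf A) : Prop :=
  ∃ e : ∀ X Y : Perf A, (X ⟶ Y) ≃ₗ[k] Module.Dual k (Y ⟶ S.obj X),
    (∀ (X' X Y : Perf A) (f : X' ⟶ X) (φ : X ⟶ Y) (ψ : Y ⟶ S.obj X'),
      e X' Y (f ≫ φ) ψ = e X Y φ (ψ ≫ S.map f)) ∧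
    ∀ (X Y Y' : Perf A) (g : Y ⟶ Y') (φ : X ⟶ Y) (ψ : Y' ⟶ S.obj X),
      e X Y' (φ ≫ g) ψ = e X Y φ (g ≫ ψ)

/-- A tensor endofunctor: `F` is isomorphic to `- ⊗ᴸ_A K` for a dg bimodule `K`. As the objects of
`Perf(A)` are h-projective, this means that there are natural quasi-isomorphisms
`F(X) → X ⊗_A K`. -/
def IsTensorEndofunctor (F : Perf A ⥤ Perf A) : Prop :=
  ∃ (K : DGBimod A A)
    (η : F ⋙ ObjectProperty.ι _ ⟶ ObjectProperty.ι _ ⋙ HoBimod.tensorFunctor (DGAlgebra.base k) K),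
    ∀ X, HoBimod.QuasiIso (η.app X)

/-- `F` is nilpotent: some power of `F` is zero. -/
def IsNilpotentFunctor (F : Perf A ⥤ Perf A) : Prop :=
  ∃ N : ℕ, ∀ X : Perf A, Limits.IsZero (F.obj^[N] X)

/-- The sequence `-e₋(G, Fᵐ(G')) / m`. -/
noncomputable def upperSeq (F : Perf A ⥤ Perf A) (G G' : Perf A) (m : ℕ) : EReal :=
  -HoBimod.eMinus G.obj (F.obj^[m] G').obj / m

/-- The sequence `-e₊(G, Fᵐ(G')) / m`. -/
noncomputable def lowerSeq (F : Perf A ⥤ Perf A) (G G' : Perf A) (m : ℕ) : EReal :=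
  -HoBimod.ePlus G.obj (F.obj^[m] G').obj / m

/-- The sequence `(1 / N) ln ∑ₙ dim Homⁿ(G, Fᴺ(G')) e^(-nt)`. -/
noncomputable def entropySeq (F : Perf A ⥤ Perf A) (G G' : Perf A) (t : ℝ) (N : ℕ) : EReal :=
  ENNReal.log (HoBimod.weightedDim G.obj (F.obj^[N] G').obj t) / N

/-- `F-Udim(Perf(A), G, G')`. -/
noncomputable def upperDimWrt (F : Perf A ⥤ Perf A) (G G' : Perf A) : EReal :=
  Filter.limsup (upperSeq F G G') Filter.atTop

/-- `F-Ldim(Perf(A), G, G')`. -/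
noncomputable def lowerDimWrt (F : Perf A ⥤ Perf A) (G G' : Perf A) : EReal :=
  Filter.liminf (lowerSeq F G G') Filter.atTop

/-- The free module `A` as an object of `Perf(A)`. -/
def free (A : DGAlgebra k) : Perf A :=
  ⟨HoBimod.of A.regular, HoBimod.thick_self _⟩

/-- The upper `F`-dimension of `Perf(A)`, computed with the generator `A`. For a Serre functor `F`
this is the upper Serre dimension. -/
noncomputable def upperDim (F : Perf A ⥤ Perf A) : EReal := upperDimWrt F (free A) (free A)

/-- The lower `F`-dimension of `Perf(A)`, computed with the generator `A`. For a Serre functor `F`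
this is the lower Serre dimension. -/
noncomputable def lowerDim (F : Perf A ⥤ Perf A) : EReal := lowerDimWrt F (free A) (free A)

/-- The entropy `h_t(F)`, computed with the generator `A`. -/
noncomputable def entropy (F : Perf A ⥤ Perf A) (t : ℝ) : EReal :=
  Filter.limsup (entropySeq F (free A) (free A) t) Filter.atTop

end Perf

/-!
Both parts of the theorem reduce to the growth of one sequence of graded dimensions.

**Growth.** Let `P → A` be a resolution of the diagonal bimodule that is built from `A ⊗ₖ A`, which
exists by smoothness, and let `F` be computed by a flat bimodule `L`. Write `b N n` for the dimension
of the `n`-th cohomology of `A ⊗_A L ⊗_A ⋯ ⊗_A L` with `N` factors `L` (`growth`). Inserting `P` in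
the middle of `L ⊗ ⋯ ⊗ L` and replacing it by `A ⊗ₖ A` splits the tensor product over the ground
field, so that `b (M + N)` is bounded by finitely many shifts of the convolution of `b M` and `b N`,
where the shifts depend on `P` only (`growth_mul_le`). By compactness all these dimensions are finite.
For generators `G` and `G'` the dimensions of `Homⁿ(G, Fᴺ(G'))` and `b N n` bound each other up to
finitely many shifts that do not depend on `N` (`comparable_homCx`). Both facts are instances of
`thick_bound`: if `X` is built from `Y`, the cohomology of `Φ X` is bounded by finitely many shifts of
that of `Φ Y`, uniformly in the dg functor `Φ`.

The rest of the first part is a statement about sequences (`Submult.exists_growthRates`): the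
smallest and largest degrees and the logarithms of the weighted dimensions are subadditive up to a
constant, so that their growth rates exist by Fekete's lemma, and a comparable sequence has the same
rates. A tensor endofunctor `- ⊗_A K` is computed by the flat bimodule `P ⊗_A K`.

**Serre functors.** Put `S X = (X ⊗_A A^*) ⊗_A P`, which is perfect by compactness and is
quasi-isomorphic to `X ⊗_A A^*`. There are natural maps from `X ⊗_A Y^*` to `Hom(X, Y)^*` (`evalHom`)
and to `Hom(Y, X ⊗_A A^*)` (`contractHom`). They are bijective for `X = A`, hence quasi-isomorphisms
for all perfect `X`, and together they give `Hom(Y, S X) ≅ Hom(X, Y)^*` (`serreEquiv`). By the Yoneda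
lemma the values of any Serre functor are isomorphic to those of `S`, so that every Serre functor is
computed by every h-projective resolution `R → A^*`, and the growth sequence of `R` is that of the
cohomology of its tensor powers. Such a resolution is `(P ⊗_A A^*) ⊗_A P`. A Serre functor is not
nilpotent if `Perf(A) ≠ 0`, because `Hom(X, X) ≅ Hom(X, S X)^*`.
-/

namespace DGBimod

variable {k : Type u} [Field k] {A B : DGAlgebra k}

/-! ### Graded maps of arbitrary degree -/

lemma map_sign {V W : Type*} [AddCommGroup V] [Module k V] [AddCommGroup W] [Module k W]
    (f : V →ₗ[k] W) (s : ℤˣ) (x : V) : f (s • x) = s • f x := by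
  rw [Units.smul_def, map_zsmul, ← Units.smul_def]

lemma sign_apply {V W : Type*} [AddCommGroup V] [Module k V] [AddCommGroup W] [Module k W]
    (f : V →ₗ[k] W) (s : ℤˣ) (x : V) : (s • f) x = s • f x := by
  rw [Units.smul_def, LinearMap.smul_apply, ← Units.smul_def]

lemma sign_comm {V : Type*} [AddCommGroup V] [Module k V] (s : ℤˣ) (c : k) (x : V) :
    s • c • x = c • s • x := by
  rw [Units.smul_def, Units.smul_def, smul_comm]

/-- The space of bimodule maps `M → N` of degree `p` (not necessarily compatible with the
differentials), as a submodule of the space of all families of linear maps of degree `p`. -/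
def gradedMaps (M N : DGBimod A B) (p : ℤ) :
    Submodule k (∀ t : {t : ℤ × ℤ // t.1 + p = t.2}, (M.X t.1.1 →ₗ[k] N.X t.1.2)) where
  carrier := {f |
    (∀ (i j n j' n' : ℤ) (h : i + j = n) (hj : j + p = j') (hn : n + p = n') (h' : i + j' = n')
      (a : A.X i) (x : M.X j), f ⟨(n, n'), hn⟩ (M.lmul i j n h a x) =
        (p * i).negOnePow • N.lmul i j' n' h' a (f ⟨(j, j'), hj⟩ x)) ∧
    ∀ (i j n i' n' : ℤ) (h : i + j = n) (hi : i + p = i') (hn : n + p = n') (h' : i' + j = n')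
      (x : M.X i) (b : B.X j),
        f ⟨(n, n'), hn⟩ (M.rmul i j n h x b) = N.rmul i' j n' h' (f ⟨(i, i'), hi⟩ x) b}
  add_mem' {f g} hf hg := by
    refine ⟨fun i j n j' n' h hj hn h' a x => ?_, fun i j n i' n' h hi hn h' x b => ?_⟩
    · simp only [Pi.add_apply, LinearMap.add_apply, map_add, smul_add,
        hf.1 i j n j' n' h hj hn h' a x, hg.1 i j n j' n' h hj hn h' a x]
    · simp only [Pi.add_apply, LinearMap.add_apply, map_add,
        hf.2 i j n i' n' h hi hn h' x b, hg.2 i j n i' n' h hi hn h' x b]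
  zero_mem' := ⟨by simp, by simp⟩
  smul_mem' c f hf := by
    refine ⟨fun i j n j' n' h hj hn h' a x => ?_, fun i j n i' n' h hi hn h' x b => ?_⟩
    · simp only [Pi.smul_apply, LinearMap.smul_apply, map_smul, sign_comm,
        hf.1 i j n j' n' h hj hn h' a x]
    · simp only [Pi.smul_apply, LinearMap.smul_apply, map_smul,
        hf.2 i j n i' n' h hi hn h' x b]

/-- The type of bimodule maps `M → N` of degree `p`: the degree `p` part of the morphism complex of
the dg category of dg bimodules. -/
def GHom (M N : DGBimod A B) (p : ℤ) : Type u := gradedMaps M N p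

instance (M N : DGBimod A B) (p : ℤ) : AddCommGroup (GHom M N p) :=
  inferInstanceAs (AddCommGroup (gradedMaps M N p))

instance (M N : DGBimod A B) (p : ℤ) : Module k (GHom M N p) :=
  inferInstanceAs (Module k (gradedMaps M N p))

namespace GHom

variable {M N L K : DGBimod A B} {p q r : ℤ}

/-- The component `Mⁱ → Nʲ` with `j = i + p` of a graded map of degree `p`. -/
def f (f : GHom M N p) (i j : ℤ) (h : i + p = j) : M.X i →ₗ[k] N.X j := f.1 ⟨(i, j), h⟩

/-- A graded map given by its components. -/
def mk' (f : ∀ i j : ℤ, i + p = j → (M.X i →ₗ[k] N.X j))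
    (hl : ∀ (i j n j' n' : ℤ) (h : i + j = n) (hj : j + p = j') (hn : n + p = n') (h' : i + j' = n')
      (a : A.X i) (x : M.X j), f n n' hn (M.lmul i j n h a x) =
        (p * i).negOnePow • N.lmul i j' n' h' a (f j j' hj x))
    (hr : ∀ (i j n i' n' : ℤ) (h : i + j = n) (hi : i + p = i') (hn : n + p = n') (h' : i' + j = n')
      (x : M.X i) (b : B.X j), f n n' hn (M.rmul i j n h x b) = N.rmul i' j n' h' (f i i' hi x) b) :
    GHom M N p := ⟨fun t => f t.1.1 t.1.2 t.2, hl, hr⟩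

@[simp] lemma mk'_f (f : ∀ i j : ℤ, i + p = j → (M.X i →ₗ[k] N.X j)) (hl) (hr) (i j : ℤ)
    (h : i + p = j) : (mk' (M := M) (N := N) f hl hr).f i j h = f i j h := rfl

lemma map_lmul (f : GHom M N p) (i j n j' n' : ℤ) (h : i + j = n) (hj : j + p = j')
    (hn : n + p = n') (h' : i + j' = n') (a : A.X i) (x : M.X j) :
    f.f n n' hn (M.lmul i j n h a x) = (p * i).negOnePow • N.lmul i j' n' h' a (f.f j j' hj x) :=
  Subtype.prop f |>.1 i j n j' n' h hj hn h' a x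

lemma map_rmul (f : GHom M N p) (i j n i' n' : ℤ) (h : i + j = n) (hi : i + p = i')
    (hn : n + p = n') (h' : i' + j = n') (x : M.X i) (b : B.X j) :
    f.f n n' hn (M.rmul i j n h x b) = N.rmul i' j n' h' (f.f i i' hi x) b :=
  Subtype.prop f |>.2 i j n i' n' h hi hn h' x b

@[ext]
lemma ext {f g : GHom M N p} (h : ∀ i j hij x, f.f i j hij x = g.f i j hij x) : f = g :=
  Subtype.ext (funext fun t => LinearMap.ext (h t.1.1 t.1.2 t.2))

lemma congr_f {f g : GHom M N p} (h : f = g) (i j : ℤ) (hij : i + p = j) (x : M.X i) :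
    f.f i j hij x = g.f i j hij x := by rw [h]

@[simp] lemma zero_f (i j : ℤ) (h : i + p = j) (x : M.X i) : (0 : GHom M N p).f i j h x = 0 := rfl

@[simp] lemma add_f (f g : GHom M N p) (i j : ℤ) (h : i + p = j) (x : M.X i) :
    (f + g).f i j h x = f.f i j h x + g.f i j h x := rfl

@[simp] lemma sub_f (f g : GHom M N p) (i j : ℤ) (h : i + p = j) (x : M.X i) :
    (f - g).f i j h x = f.f i j h x - g.f i j h x := rfl

@[simp] lemma neg_f (f : GHom M N p) (i j : ℤ) (h : i + p = j) (x : M.X i) :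
    (-f).f i j h x = -f.f i j h x := rfl

@[simp] lemma smul_f (c : k) (f : GHom M N p) (i j : ℤ) (h : i + p = j) (x : M.X i) :
    (c • f).f i j h x = c • f.f i j h x := rfl

@[simp] lemma sign_f (s : ℤˣ) (f : GHom M N p) (i j : ℤ) (h : i + p = j) (x : M.X i) :
    (s • f).f i j h x = s • f.f i j h x := by
  rcases Int.units_eq_one_or s with rfl | rfl <;> simp [Units.smul_def]

lemma castX_d (M : DGBimod A B) (i j i' j' : ℤ) (hi : i = i') (hj : j = j') (h : i + 1 = j)
    (h' : i' + 1 = j') (x : M.X i) :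
    M.castX j j' hj (M.d i j h x) = M.d i' j' h' (M.castX i i' hi x) := by
  subst hi hj; rfl

lemma castX_lmul (M : DGBimod A B) (i j n j' n' : ℤ) (hj : j = j') (hn : n = n') (h : i + j = n)
    (h' : i + j' = n') (a : A.X i) (x : M.X j) :
    M.castX n n' hn (M.lmul i j n h a x) = M.lmul i j' n' h' a (M.castX j j' hj x) := by
  subst hj hn; rfl

lemma castX_rmul (M : DGBimod A B) (i j n i' n' : ℤ) (hi : i = i') (hn : n = n') (h : i + j = n)
    (h' : i' + j = n') (x : M.X i) (b : B.X j) :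
    M.castX n n' hn (M.rmul i j n h x b) = M.rmul i' j n' h' (M.castX i i' hi x) b := by
  subst hi hn; rfl

@[simp] lemma castX_castX (M : DGBimod A B) (i j l : ℤ) (h : i = j) (h' : j = l) (x : M.X i) :
    M.castX j l h' (M.castX i j h x) = M.castX i l (h.trans h') x := by
  subst h h'; rfl

lemma castX_rfl (M : DGBimod A B) (i : ℤ) (h : i = i) (x : M.X i) : M.castX i i h x = x := rfl

/-- The identity as a graded map of degree zero. -/
def id (M : DGBimod A B) : GHom M M 0 :=
  mk' (fun i j h => M.castX i j (by lia))
    (fun i j n j' n' h hj hn h' a x => by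
      rw [zero_mul, Int.negOnePow_zero, one_smul]
      exact castX_lmul M _ _ _ _ _ (by lia) _ _ _ _ _)
    (fun i j n i' n' h hi hn h' x b => castX_rmul M _ _ _ _ _ (by lia) _ _ _ _ _)

@[simp] lemma id_f (M : DGBimod A B) (i : ℤ) (h : i + 0 = i) (x : M.X i) :
    (id M).f i i h x = x := rfl

/-- The composition `g ∘ f`, written in diagrammatic order. -/
def comp (f : GHom M N p) (g : GHom N L q) (h : p + q = r) : GHom M L r :=
  mk' (fun i j hij => (g.f (i + p) j (by lia)) ∘ₗ f.f i (i + p) rfl)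
    (fun i j n j' n' hn hj hn' h' a x => by
      subst h hn
      simp only [LinearMap.comp_apply]
      rw [f.map_lmul i j (i + j) (j + p) (i + j + p) rfl rfl rfl (by lia), map_sign,
        g.map_lmul i (j + p) (i + j + p) j' n' (by lia) (by lia) (by lia) h', smul_smul,
        ← Int.negOnePow_add, add_mul])
    (fun i j n i' n' hn hi hn' h' x b => by
      subst h hn
      simp only [LinearMap.comp_apply]
      rw [f.map_rmul i j (i + j) (i + p) (i + j + p) rfl rfl rfl (by lia),
        g.map_rmul (i + p) j (i + j + p) i' n' (by lia) (by lia) (by lia) h'])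

lemma comp_f (f : GHom M N p) (g : GHom N L q) (h : p + q = r) (i l j : ℤ) (hij : i + r = j)
    (hil : i + p = l) (hlj : l + q = j) (x : M.X i) :
    (f.comp g h).f i j hij x = g.f l j hlj (f.f i l hil x) := by
  subst hil; rfl

@[simp] lemma comp_f' (f : GHom M N p) (g : GHom N L q) (h : p + q = r) (i j : ℤ)
    (hij : i + r = j) (x : M.X i) :
    (f.comp g h).f i j hij x = g.f (i + p) j (by lia) (f.f i (i + p) rfl x) := rfl

/-- The differential of the morphism complex: `Df = d ∘ f - (-1)^p f ∘ d`. -/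
def D (f : GHom M N p) (h : p + 1 = q) : GHom M N q :=
  mk' (fun i j hij => (N.d (i + p) j (by lia)) ∘ₗ f.f i (i + p) rfl -
      p.negOnePow • (f.f (i + 1) j (by lia)) ∘ₗ M.d i (i + 1) rfl)
    (fun i j n j' n' hn hj hn' h' a x => by
      subst h hn
      obtain rfl : j' = j + p + 1 := by lia
      obtain rfl : n' = i + j + p + 1 := by lia
      simp only [LinearMap.comp_apply, LinearMap.sub_apply, sign_apply]
      rw [f.map_lmul i j (i + j) (j + p) (i + j + p) rfl rfl rfl (by lia), map_sign,
        N.d_lmul i (j + p) (i + j + p) (i + 1) (j + p + 1) (i + j + p + 1) (by lia) rfl rfl rfl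
          (by lia) (by lia),
        M.d_lmul i j (i + j) (i + 1) (j + 1) (i + j + 1) rfl rfl rfl rfl (by lia) (by lia),
        map_add, map_sign,
        f.map_lmul (i + 1) j (i + j + 1) (j + p) (i + j + p + 1) (by lia) rfl (by lia) (by lia),
        f.map_lmul i (j + 1) (i + j + 1) (j + p + 1) (i + j + p + 1) (by lia) (by lia) (by lia)
          (by lia)]
      simp only [map_sub, map_sign, smul_sub, smul_add, smul_smul, mul_add, add_mul, mul_one,
        one_mul, Int.negOnePow_add]
      have h1 : p.negOnePow * ((p * i).negOnePow * p.negOnePow) = (p * i).negOnePow := by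
        rw [mul_comm (p * i).negOnePow, ← mul_assoc, Int.units_mul_self, one_mul]
      have h2 : p.negOnePow * (i.negOnePow * (p * i).negOnePow) =
        (p * i).negOnePow * i.negOnePow * p.negOnePow := by
        rw [mul_comm i.negOnePow, mul_comm]
      rw [h1, h2]
      abel)
    (fun i j n i' n' hn hi hn' h' x b => by
      subst h hn
      obtain rfl : i' = i + p + 1 := by lia
      obtain rfl : n' = i + j + p + 1 := by lia
      simp only [LinearMap.comp_apply, LinearMap.sub_apply, sign_apply]
      rw [f.map_rmul i j (i + j) (i + p) (i + j + p) rfl rfl rfl (by lia),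
        N.d_rmul (i + p) j (i + j + p) (i + p + 1) (j + 1) (i + j + p + 1) (by lia) rfl rfl rfl
          (by lia) (by lia),
        M.d_rmul i j (i + j) (i + 1) (j + 1) (i + j + 1) rfl rfl rfl rfl (by lia) (by lia),
        map_add, map_sign,
        f.map_rmul (i + 1) j (i + j + 1) (i + p + 1) (i + j + p + 1) (by lia) (by lia) (by lia)
          (by lia),
        f.map_rmul i (j + 1) (i + j + 1) (i + p) (i + j + p + 1) (by lia) rfl (by lia) (by lia)]
      simp only [map_sub, map_sign, sign_apply, LinearMap.sub_apply, smul_add, smul_smul,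
        Int.negOnePow_add]
      rw [mul_comm i.negOnePow]
      abel)

lemma D_f (f : GHom M N p) (h : p + 1 = q) (i l m j : ℤ) (hij : i + q = j) (hil : i + p = l)
    (hlj : l + 1 = j) (him : i + 1 = m) (hmj : m + p = j) (x : M.X i) :
    (f.D h).f i j hij x =
      N.d l j hlj (f.f i l hil x) - p.negOnePow • f.f m j hmj (M.d i m him x) := by
  subst hil him
  simp [D]

lemma D_zero (h : p + 1 = q) : (0 : GHom M N p).D h = 0 := by
  ext; simp [D]

lemma D_add (f g : GHom M N p) (h : p + 1 = q) : (f + g).D h = f.D h + g.D h := by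
  ext i j hij x
  simp only [add_f, D_f _ h i (i + p) (i + 1) j hij rfl (by lia) rfl (by lia), map_add, smul_add]
  abel

lemma D_smul (c : k) (f : GHom M N p) (h : p + 1 = q) : (c • f).D h = c • f.D h := by
  ext i j hij x
  simp only [smul_f, D_f _ h i (i + p) (i + 1) j hij rfl (by lia) rfl (by lia), map_smul, smul_sub,
    sign_comm]

lemma D_neg (f : GHom M N p) (h : p + 1 = q) : (-f).D h = -f.D h := by
  rw [← neg_one_smul k f, D_smul, neg_one_smul]

lemma D_sub (f g : GHom M N p) (h : p + 1 = q) : (f - g).D h = f.D h - g.D h := by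
  rw [sub_eq_add_neg, D_add, D_neg, sub_eq_add_neg]

lemma D_sign (s : ℤˣ) (f : GHom M N p) (h : p + 1 = q) : (s • f).D h = s • f.D h := by
  rcases Int.units_eq_one_or s with rfl | rfl
  · simp
  · simp only [Units.neg_smul, one_smul, D_neg]

lemma D_D (f : GHom M N p) (h : p + 1 = q) (h' : q + 1 = r) : (f.D h).D h' = 0 := by
  subst h h'
  ext i j hij x
  rw [D_f _ rfl i (i + (p + 1)) (i + 1) j hij rfl (by lia) rfl (by lia),
    D_f f rfl i (i + p) (i + 1) (i + (p + 1)) rfl rfl (by lia) rfl (by lia),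
    D_f f rfl (i + 1) (i + (p + 1)) (i + 1 + 1) j _ (by lia) (by lia) rfl (by lia), map_sub,
    map_sign, N.d_d, M.d_d]
  simp only [map_zero, smul_zero, sub_zero, zero_sub, zero_f, Int.negOnePow_succ, Units.neg_smul]
  rw [sub_neg_eq_add, neg_add_cancel]

/-- The graded Leibniz rule `D(g ∘ f) = Dg ∘ f + (-1)^|g| g ∘ Df`. -/
lemma D_comp (f : GHom M N p) (g : GHom N L q) {s p' q' : ℤ} (h : p + q = r) (h' : r + 1 = s)
    (hp : p + 1 = p') (hq : q + 1 = q') (h₁ : p + q' = s) (h₂ : p' + q = s) :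
    (f.comp g h).D h' = f.comp (g.D hq) h₁ + q.negOnePow • (f.D hp).comp g h₂ := by
  subst hp hq h h'
  ext i j hij x
  rw [D_f _ rfl i (i + (p + q)) (i + 1) j hij rfl (by lia) rfl (by lia), add_f, sign_f,
    comp_f f g rfl i (i + p) _ rfl rfl (by lia), comp_f f g rfl (i + 1)
      (i + 1 + p) _ _ rfl (by lia),
    comp_f f _ _ i (i + p) j _ rfl (by lia),
    comp_f _ g _ i (i + 1 + p) j _ (by lia) (by lia),
    D_f g rfl (i + p) (i + (p + q)) (i + 1 + p) j _ (by lia) (by lia) (by lia) (by lia),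
    D_f f rfl i (i + p) (i + 1) (i + 1 + p) _ rfl (by lia) rfl rfl, map_sub, map_sign,
    smul_sub, smul_smul, Int.negOnePow_add, mul_comm q.negOnePow]
  abel

lemma comp_assoc {p q r s t u : ℤ} (f : GHom M N p) (g : GHom N L q) (e : GHom L K r)
    (h1 : p + q = s) (h2 : s + r = t) (h3 : q + r = u) (h4 : p + u = t) :
    (f.comp g h1).comp e h2 = f.comp (g.comp e h3) h4 := by
  subst h1 h2
  ext i j hij x
  rw [comp_f _ e _ i (i + p + q) j _ (by lia) (by lia), comp_f f g _ i (i + p) _ _ rfl rfl,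
    comp_f f _ _ i (i + p) _ _ rfl (by lia), comp_f g e _ (i + p) (i + p + q) _ _ rfl (by lia)]


lemma comp_comp_comp_comp {K' : DGBimod A B} {p q r s t u v w x : ℤ} (a : GHom M N p)
    (b : GHom N L q) (c : GHom L K r) (d : GHom K K' s) (h1 : p + q = t) (h2 : r + s = u)
    (h3 : t + u = v) (h4 : q + r = w) (h5 : p + w = x) (h6 : x + s = v) :
    (a.comp b h1).comp (c.comp d h2) h3 = (a.comp (b.comp c h4) h5).comp d h6 := by
  rw [comp_assoc a b _ h1 h3 (u := q + u) rfl (by lia), ← comp_assoc b c d h4 (by lia),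
    comp_assoc a _ d h5 h6 (u := q + u) (by lia) (by lia)]

lemma comp_id (f : GHom M N p) (h : p + 0 = p) : f.comp (id N) h = f := by
  ext i j hij x
  rw [comp_f f _ _ i j j _ hij (by lia), id_f]

lemma id_comp (f : GHom M N p) (h : 0 + p = p) : (id M).comp f h = f := by
  ext i j hij x
  rw [comp_f _ f _ i i j _ (by lia) hij, id_f]

lemma add_comp (f f' : GHom M N p) (g : GHom N L q) (h : p + q = r) :
    (f + f').comp g h = f.comp g h + f'.comp g h := by ext; simp

lemma comp_add (f : GHom M N p) (g g' : GHom N L q) (h : p + q = r) :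
    f.comp (g + g') h = f.comp g h + f.comp g' h := by ext; simp

lemma smul_comp (c : k) (f : GHom M N p) (g : GHom N L q) (h : p + q = r) :
    (c • f).comp g h = c • f.comp g h := by ext; simp

lemma comp_smul (c : k) (f : GHom M N p) (g : GHom N L q) (h : p + q = r) :
    f.comp (c • g) h = c • f.comp g h := by ext; simp

lemma neg_comp (f : GHom M N p) (g : GHom N L q) (h : p + q = r) :
    (-f).comp g h = -f.comp g h := by ext; simp

lemma sub_comp (f f' : GHom M N p) (g : GHom N L q) (h : p + q = r) :
    (f - f').comp g h = f.comp g h - f'.comp g h := by ext; simp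

lemma comp_sub (f : GHom M N p) (g g' : GHom N L q) (h : p + q = r) :
    f.comp (g - g') h = f.comp g h - f.comp g' h := by ext; simp

@[simp] lemma zero_comp (g : GHom N L q) (h : p + q = r) :
    (0 : GHom M N p).comp g h = 0 := by ext; simp

@[simp] lemma comp_zero (f : GHom M N p) (h : p + q = r) :
    f.comp (0 : GHom N L q) h = 0 := by ext; simp

lemma D_id (M : DGBimod A B) (h : (0 : ℤ) + 1 = q) : (id M).D h = 0 := by
  subst h
  ext i j hij x
  rw [D_f _ _ i i j j hij (by lia) (by lia) (by lia) (by lia)]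
  simp

end GHom

end DGBimod

namespace DGBimod

variable {k : Type u} [Field k] {A B : DGAlgebra k}

namespace GHom

variable {M N L : DGBimod A B} {p q r : ℤ}

/-- A graded map `f` of degree `p` is closed if `d f = (-1)^p f d`. -/
def Closed (f : GHom M N p) : Prop := f.D rfl = 0

lemma closed_iff (f : GHom M N p) : f.Closed ↔ ∀ (q : ℤ) (h : p + 1 = q), f.D h = 0 :=
  ⟨fun h q hq => by subst hq; exact h, fun h => h _ rfl⟩

lemma Closed.D {f : GHom M N p} (hf : f.Closed) (h : p + 1 = q) : f.D h = 0 :=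
  (closed_iff f).1 hf q h

lemma Closed.d_f {f : GHom M N p} (hf : f.Closed) (i m l j : ℤ) (hil : i + p = l) (hlj : l + 1 = j)
    (him : i + 1 = m) (hmj : m + p = j) (x : M.X i) :
    N.d l j hlj (f.f i l hil x) = p.negOnePow • f.f m j hmj (M.d i m him x) := by
  have := congr_f (hf.D rfl) i j (by lia) x
  rw [D_f f rfl i l m j (by lia) hil hlj him hmj] at this
  exact sub_eq_zero.1 this

lemma closed_of_d_f {f : GHom M N p} (h : ∀ (i m l j : ℤ) (hil : i + p = l) (hlj : l + 1 = j)
    (him : i + 1 = m) (hmj : m + p = j) (x : M.X i),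
    N.d l j hlj (f.f i l hil x) = p.negOnePow • f.f m j hmj (M.d i m him x)) : f.Closed := by
  ext i j hij x
  rw [D_f f rfl i (i + p) (i + 1) j hij rfl (by lia) rfl (by lia),
    h i (i + 1) (i + p) j rfl (by lia) rfl (by lia), sub_self, zero_f]

lemma closed_id (M : DGBimod A B) : (GHom.id M).Closed := D_id M _

lemma Closed.comp {f : GHom M N p} {g : GHom N L q} (hf : f.Closed) (hg : g.Closed)
    (h : p + q = r) : (f.comp g h).Closed := by
  refine (closed_iff _).2 fun s hs => ?_
  rw [D_comp f g h hs rfl rfl (by lia) (by lia), hf, hg, comp_zero, zero_comp, smul_zero, add_zero]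

/-- A closed morphism of degree zero as a graded map. -/
def ofHom (f : M ⟶ N) : GHom M N 0 :=
  mk' (fun i j h => (N.castX i j (by lia)) ∘ₗ Hom.f f i)
    (fun i j n j' n' h hj hn h' a x => by
      simp only [LinearMap.comp_apply, f.map_lmul, zero_mul, Int.negOnePow_zero, one_smul]
      exact castX_lmul N _ _ _ _ _ (by lia) _ _ _ _ _)
    (fun i j n i' n' h hi hn h' x b => by
      simp only [LinearMap.comp_apply, f.map_rmul]
      exact castX_rmul N _ _ _ _ _ (by lia) _ _ _ _ _)

@[simp] lemma ofHom_f (f : M ⟶ N) (i : ℤ) (h : i + 0 = i) (x : M.X i) :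
    (ofHom f).f i i h x = Hom.f f i x := rfl

lemma closed_ofHom (f : M ⟶ N) : (ofHom f).Closed := by
  refine closed_of_d_f fun i m l j hil hlj him hmj x => ?_
  obtain rfl : i = l := by lia
  obtain rfl : m = j := by lia
  rw [ofHom_f, ofHom_f, f.comm, Int.negOnePow_zero, one_smul]

/-- A closed graded map of degree zero as a morphism. -/
def toHom (f : GHom M N 0) (hf : f.Closed) : M ⟶ N where
  f i := f.f i i (add_zero i)
  comm i j h x := by
    rw [hf.d_f i j i j (add_zero i) h h (add_zero j), Int.negOnePow_zero, one_smul]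
  map_lmul i j n h a x := by
    rw [f.map_lmul i j n j n h (add_zero j) (add_zero n) h, zero_mul, Int.negOnePow_zero, one_smul]
  map_rmul i j n h x b := f.map_rmul i j n i n h (add_zero i) (add_zero n) h x b

@[simp] lemma toHom_f (f : GHom M N 0) (hf : f.Closed) (i : ℤ) (x : M.X i) :
    Hom.f (f.toHom hf) i x = f.f i i (add_zero i) x := rfl

lemma ext_zero {f g : GHom M N 0} (h : ∀ i x, f.f i i (add_zero i) x = g.f i i (add_zero i) x) :
    f = g := by
  ext i j hij x
  obtain rfl : i = j := by lia
  exact h i x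

@[simp] lemma ofHom_toHom (f : GHom M N 0) (hf : f.Closed) : ofHom (f.toHom hf) = f :=
  ext_zero fun i x => by simp

@[simp] lemma toHom_ofHom (f : M ⟶ N) : (ofHom f).toHom (closed_ofHom f) = f := by
  ext i x; simp

lemma ofHom_id (M : DGBimod A B) : ofHom (𝟙 M) = GHom.id M := ext_zero fun i x => by simp

lemma ofHom_comp (f : M ⟶ N) (g : N ⟶ L) :
    ofHom (f ≫ g) = (ofHom f).comp (ofHom g) (add_zero 0) :=
  ext_zero fun i x => by
    rw [comp_f _ _ _ i i i _ (add_zero i) (add_zero i)]; simp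

end GHom

open GHom

lemma homotopic_iff {M N : DGBimod A B} (f g : M ⟶ N) :
    homotopic f g ↔ ∃ h : GHom M N (-1), h.D (by lia) = ofHom f - ofHom g := by
  constructor
  · rintro ⟨h, hl, hr, hd⟩
    refine ⟨GHom.mk' (fun i j hij => h i j (by lia)) ?_ ?_, ?_⟩
    · intro i j n j' n' e hj hn h' a x
      rw [hl i j n j' n' e (by lia) (by lia) h', neg_mul, one_mul, Int.negOnePow_neg]
    · intro i j n i' n' e hi hn h' x b
      exact hr i j n i' n' e (by lia) (by lia) h' x b
    · refine ext_zero fun i x => ?_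
      rw [D_f _ _ i (i - 1) (i + 1) i (add_zero i) (by lia) (by lia) rfl (by lia), sub_f]
      simp [hd (i - 1) i (i + 1) (by lia) rfl x]
  · rintro ⟨h, hh⟩
    refine ⟨fun i j hij => h.f i j (by lia), ?_, ?_, ?_⟩
    · intro i j n j' n' e hj hn h' a x
      rw [h.map_lmul i j n j' n' e (by lia) (by lia) h', neg_mul, one_mul, Int.negOnePow_neg]
    · intro i j n i' n' e hi hn h' x b
      exact h.map_rmul i j n i' n' e (by lia) (by lia) h' x b
    · intro l n m hl hm x
      have := congr_f hh n n (add_zero n) x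
      rw [D_f _ _ n l m n (add_zero n) (by lia) (by lia) hm (by lia), sub_f] at this
      simp at this
      exact this.symm

/-! ### Shifts and isomorphisms of arbitrary degree -/

/-- A closed isomorphism of degree `p`. -/
structure GIso (M N : DGBimod A B) (p : ℤ) where
  hom : GHom M N p
  inv : GHom N M (-p)
  hom_inv : hom.comp inv (add_neg_cancel p) = GHom.id M
  inv_hom : inv.comp hom (neg_add_cancel p) = GHom.id N
  closed_hom : hom.Closed
  closed_inv : inv.Closed

namespace GIso

variable {M N L : DGBimod A B} {p q r : ℤ}

lemma hom_inv_f (e : GIso M N p) (i j : ℤ) (h : i + p = j) (h' : j + -p = i) (x : M.X i) :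
    e.inv.f j i h' (e.hom.f i j h x) = x := by
  rw [← GHom.comp_f e.hom e.inv (add_neg_cancel p) i j i (add_zero i) h h', e.hom_inv, GHom.id_f]

lemma inv_hom_f (e : GIso M N p) (i j : ℤ) (h : i + p = j) (h' : j + -p = i) (x : N.X j) :
    e.hom.f i j h (e.inv.f j i h' x) = x := by
  rw [← GHom.comp_f e.inv e.hom (neg_add_cancel p) j i j (add_zero j) h' h, e.inv_hom, GHom.id_f]

lemma bijective (e : GIso M N p) (i j : ℤ) (h : i + p = j) :
    Function.Bijective (e.hom.f i j h) :=
  Function.bijective_iff_has_inverse.2 ⟨e.inv.f j i (by lia), fun x => e.hom_inv_f i j h _ x,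
    fun x => e.inv_hom_f i j h _ x⟩

/-- A closed graded map that is bijective in each degree is an isomorphism. -/
noncomputable def ofBijective (f : GHom M N p) (hf : f.Closed)
    (hb : ∀ i j h, Function.Bijective (f.f i j h)) : GIso M N p :=
  let g (i j : ℤ) (h : i + -p = j) : N.X i →ₗ[k] M.X j :=
    (LinearEquiv.ofBijective (f.f j i (by lia)) (hb j i (by lia))).symm
  have hg (i j : ℤ) (h : i + -p = j) (x : N.X i) : f.f j i (by lia) (g i j h x) = x :=
    LinearEquiv.apply_ofBijective_symm_apply _ _
  have hg' (i j : ℤ) (h : i + -p = j) (x : M.X j) : g i j h (f.f j i (by lia) x) = x :=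
    LinearEquiv.ofBijective_symm_apply_apply _ _
  { hom := f
    inv := GHom.mk' g
      (fun i j n j' n' e hj hn h' a x => by
        apply (hb n' n (by lia)).1
        rw [hg n n' hn, map_sign, f.map_lmul i j' n' j n h' (by lia) (by lia) e, hg j j' hj,
          smul_smul, neg_mul,
          Int.negOnePow_neg, Int.units_mul_self, one_smul])
      (fun i j n i' n' e hi hn h' x b => by
        apply (hb n' n (by lia)).1
        rw [hg n n' hn, f.map_rmul i' j n' i n h' (by lia) (by lia) e, hg i i' hi])
    hom_inv := ext_zero fun i x => by
      rw [GHom.comp_f _ _ _ i (i + p) i _ rfl (by lia)]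
      exact hg' (i + p) i (by lia) x
    inv_hom := ext_zero fun i x => by
      rw [GHom.comp_f _ _ _ i (i + -p) i _ rfl (by lia)]
      exact hg i (i + -p) rfl x
    closed_hom := hf
    closed_inv := closed_of_d_f fun i m l j hil hlj him hmj x => by
      apply (hb j m (by lia)).1
      obtain ⟨y, rfl⟩ := (hb l i (by lia)).2 x
      rw [map_sign, mk'_f, mk'_f, hg m j hmj, hg' i l hil,
        hf.d_f l j i m (by lia) him hlj (by lia), smul_smul,
        Int.negOnePow_neg, Int.units_mul_self, one_smul] }

/-- The inverse isomorphism. -/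
noncomputable def symm (e : GIso M N p) : GIso N M (-p) :=
  ofBijective e.inv e.closed_inv fun i j h =>
    Function.bijective_iff_has_inverse.2 ⟨e.hom.f j i (by lia), fun x => e.inv_hom_f j i _ h x,
      fun x => e.hom_inv_f j i _ h x⟩

/-- The composition of isomorphisms. -/
noncomputable def trans (e : GIso M N p) (e' : GIso N L q) (h : p + q = r) : GIso M L r :=
  ofBijective (e.hom.comp e'.hom h) (e.closed_hom.comp e'.closed_hom h) fun i j hij =>
    (e'.bijective (i + p) j (by lia)).comp (e.bijective i (i + p) rfl)

/-- An isomorphism of degree zero is an isomorphism in the category of dg bimodules. -/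
def toIso (e : GIso M N 0) : M ≅ N where
  hom := e.hom.toHom e.closed_hom
  inv := e.inv.toHom e.closed_inv
  hom_inv_id := by
    ext i x
    exact e.hom_inv_f i i _ _ x
  inv_hom_id := by
    ext i x
    exact e.inv_hom_f i i _ _ x

/-- An isomorphism in the category of dg bimodules as an isomorphism of degree zero. -/
def ofIso (e : M ≅ N) : GIso M N 0 where
  hom := ofHom e.hom
  inv := ofHom e.inv
  hom_inv := by rw [← ofHom_id, ← e.hom_inv_id, ofHom_comp]
  inv_hom := by rw [← ofHom_id, ← e.inv_hom_id, ofHom_comp]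
  closed_hom := closed_ofHom _
  closed_inv := closed_ofHom _

/-- The canonical isomorphism `M → M[p]` of degree `-p`. -/
noncomputable def toShift (M : DGBimod A B) (p : ℤ) : GIso M (M.shift p) (-p) :=
  ofBijective
    (GHom.mk' (N := M.shift p) (fun i j h => M.castX i (j + p) (by lia))
      (fun i j n j' n' h hj hn h' a x => by
        change M.castX n (n' + p) _ _ =
          (-p * i).negOnePow • (((p * i).negOnePow • M.lmul i (j' + p) (n' + p) _) a
            (M.castX j (j' + p) _ x))
        rw [neg_mul, Int.negOnePow_neg, sign_apply, sign_apply, smul_smul,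
          Int.units_mul_self, one_smul, castX_lmul M i j n (j' + p) (n' + p)])
      (fun i j n i' n' h hi hn h' x b => castX_rmul M i j n (i' + p) (n' + p) _ _ _ _ x b))
    (closed_of_d_f fun i m l j hil hlj him hmj x => by
      change (p.negOnePow • M.d (l + p) (j + p) _) (M.castX i (l + p) _ x) =
        (-p).negOnePow • M.castX m (j + p) _ _
      rw [sign_apply, Int.negOnePow_neg, castX_d M i m (l + p) (j + p)])
    (fun i j h => by
      have (a b : ℤ) (e : a = b) : Function.Bijective (M.castX a b e) := by
        subst e; exact Function.bijective_id
      exact this _ _ _)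

end GIso

/-- The identity on the underlying graded spaces gives an isomorphism. -/
noncomputable def GIso.ofId {M N : DGBimod A B} (e : ∀ i, M.X i →ₗ[k] N.X i)
    (hb : ∀ i, Function.Bijective (e i))
    (hd : ∀ i j h x, e j (M.d i j h x) = N.d i j h (e i x))
    (hl : ∀ i j n h a x, e n (M.lmul i j n h a x) = N.lmul i j n h a (e j x))
    (hr : ∀ i j n h x b, e n (M.rmul i j n h x b) = N.rmul i j n h (e i x) b) : GIso M N 0 :=
  .ofBijective (ofHom ⟨e, hd, hl, hr⟩) (closed_ofHom _) fun i j h => by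
    obtain rfl : i = j := by lia
    exact hb i

/-! ### Cohomology -/

section Cohomology

variable (M : DGBimod A B)

/-- The class of a cocycle. -/
abbrev Hmk (n : ℤ) : LinearMap.ker (M.d n (n + 1) rfl) →ₗ[k] M.H n := Submodule.mkQ _

lemma Hmk_surjective (n : ℤ) : Function.Surjective (M.Hmk n) := Submodule.mkQ_surjective _

variable {M}

lemma Hmk_eq_zero_iff {l n : ℤ} (h : l + 1 = n) (x : LinearMap.ker (M.d n (n + 1) rfl)) :
    M.Hmk n x = 0 ↔ ∃ y, M.d l n h y = x.1 := by
  obtain rfl : l = n - 1 := by lia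
  rw [Submodule.mkQ_apply, Submodule.Quotient.mk_eq_zero]
  rfl

lemma acyclic_iff : M.Acyclic ↔ ∀ (l n m : ℤ) (hl : l + 1 = n) (hm : n + 1 = m) (x : M.X n),
    M.d n m hm x = 0 → ∃ y, M.d l n hl y = x := by
  constructor
  · intro h l n m hl hm x hx
    subst hm
    have := h n
    exact (Hmk_eq_zero_iff hl ⟨x, hx⟩).1 (Subsingleton.elim _ _)
  · intro h n
    refine subsingleton_of_forall_eq 0 fun z => ?_
    obtain ⟨x, rfl⟩ := M.Hmk_surjective n z
    exact (Hmk_eq_zero_iff (sub_add_cancel n 1) x).2 (h _ _ _ _ _ x.1 x.2)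

/-- The dimension of the `n`-th cohomology, with value `⊤` if it is infinite. -/
noncomputable def hdim (M : DGBimod A B) (n : ℤ) : ℕ∞ := Cardinal.toENat (Module.rank k (M.H n))

lemma hdim_eq_zero_iff {n : ℤ} : M.hdim n = 0 ↔ Subsingleton (M.H n) := by
  rw [hdim, Cardinal.toENat_eq_zero, rank_zero_iff]

lemma hdim_ne_zero_iff {n : ℤ} : M.hdim n ≠ 0 ↔ Nontrivial (M.H n) := by
  rw [Ne, hdim_eq_zero_iff, not_subsingleton_iff_nontrivial]

lemma acyclic_iff_hdim : M.Acyclic ↔ ∀ n, M.hdim n = 0 := by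
  simp only [Acyclic, hdim_eq_zero_iff]

variable {N L : DGBimod A B} {p q r : ℤ}

/-- The map induced on cohomology by a closed graded map. -/
noncomputable def Hmap (f : GHom M N p) (hf : f.Closed) (n m : ℤ) (h : n + p = m) :
    M.H n →ₗ[k] N.H m :=
  Submodule.mapQ _ _ ((f.f n m h).restrict (p := LinearMap.ker (M.d n (n + 1) rfl))
      (q := LinearMap.ker (N.d m (m + 1) rfl)) (fun x hx => by
        rw [LinearMap.mem_ker] at hx ⊢
        rw [hf.d_f n (n + 1) m (m + 1) h rfl rfl (by lia), hx, map_zero, smul_zero])) (by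
    rintro ⟨x, hx⟩ hx'
    obtain ⟨y, rfl⟩ := hx'
    refine ⟨p.negOnePow • f.f (n - 1) (m - 1) (by lia) y, ?_⟩
    rw [map_sign, hf.d_f (n - 1) n (m - 1) m (by lia) _ (by lia) h, smul_smul, Int.units_mul_self,
      one_smul]
    rfl)

lemma Hmap_mk (f : GHom M N p) (hf : f.Closed) (n m : ℤ) (h : n + p = m)
    (x : LinearMap.ker (M.d n (n + 1) rfl)) : ∃ hx, Hmap f hf n m h (M.Hmk n x) =
      N.Hmk m ⟨f.f n m h x.1, hx⟩ := ⟨_, Submodule.mapQ_apply _ _ _ _⟩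

/-- Two closed maps that differ by a boundary in the morphism complex agree on cohomology. -/
lemma Hmap_eq_of_homotopy (f g : GHom M N p) (hf : f.Closed) (hg : g.Closed) (e : GHom M N q)
    (hq : q + 1 = p) (he : e.D hq = f - g) (n m : ℤ) (h : n + p = m) :
    Hmap f hf n m h = Hmap g hg n m h := by
  refine LinearMap.ext fun z => ?_
  obtain ⟨x, rfl⟩ := M.Hmk_surjective n z
  obtain ⟨_, h1⟩ := Hmap_mk f hf n m h x
  obtain ⟨_, h2⟩ := Hmap_mk g hg n m h x
  rw [h1, h2, ← sub_eq_zero, ← map_sub, Hmk_eq_zero_iff (l := n + q) (by lia)]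
  refine ⟨e.f n (n + q) rfl x.1, ?_⟩
  have h3 := congr_f he n m h x.1
  rw [D_f e hq n (n + q) (n + 1) m h rfl (by lia) rfl (by lia), x.2, map_zero, smul_zero,
    sub_zero] at h3
  rw [h3]
  rfl

lemma Hmap_comp (f : GHom M N p) (g : GHom N L q) (hf : f.Closed) (hg : g.Closed) (h : p + q = r)
    (n m l : ℤ) (h₁ : n + p = m) (h₂ : m + q = l) (h₃ : n + r = l) :
    Hmap (f.comp g h) (hf.comp hg h) n l h₃ = Hmap g hg m l h₂ ∘ₗ Hmap f hf n m h₁ := by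
  refine LinearMap.ext fun z => ?_
  obtain ⟨x, rfl⟩ := M.Hmk_surjective n z
  obtain ⟨_, h1⟩ := Hmap_mk f hf n m h₁ x
  obtain ⟨_, h2⟩ := Hmap_mk _ (hf.comp hg h) n l h₃ x
  rw [LinearMap.comp_apply, h1, h2]
  obtain ⟨_, h3⟩ := Hmap_mk g hg m l h₂ ⟨f.f n m h₁ x.1, ‹_›⟩
  rw [h3]
  congr 2
  exact GHom.comp_f f g h n m l h₃ h₁ h₂ x.1

lemma Hmap_id (n : ℤ) (hn : n + 0 = n) :
    Hmap (GHom.id M) (closed_id M) n n hn = LinearMap.id := by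
  refine LinearMap.ext fun z => ?_
  obtain ⟨x, rfl⟩ := M.Hmk_surjective n z
  obtain ⟨_, h1⟩ := Hmap_mk _ (closed_id M) n n hn x
  rw [h1]
  rfl

lemma hdim_le_of_injective {n m : ℤ} {M : DGBimod A B} {A' B' : DGAlgebra k} {N : DGBimod A' B'}
    (f : M.H n →ₗ[k] N.H m) (hf : Function.Injective f) : M.hdim n ≤ N.hdim m :=
  OrderHomClass.mono Cardinal.toENat (LinearMap.rank_le_of_injective f hf)

lemma hdim_eq_of_equiv {n m : ℤ} {M : DGBimod A B} {A' B' : DGAlgebra k} {N : DGBimod A' B'}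
    (f : M.H n ≃ₗ[k] N.H m) : M.hdim n = N.hdim m := by
  rw [hdim, hdim, f.rank_eq]

lemma Hmap_left_inverse (f : GHom M N p) (g : GHom N M q) (hf : f.Closed) (hg : g.Closed)
    (h : p + q = 0) (e : GHom M M (-1)) (he : e.D (by lia) = f.comp g h - GHom.id M)
    (n m : ℤ) (h₁ : n + p = m) (h₂ : m + q = n) (z : M.H n) :
    Hmap g hg m n h₂ (Hmap f hf n m h₁ z) = z := by
  rw [← LinearMap.comp_apply, ← Hmap_comp f g hf hg h n m n h₁ h₂ (add_zero n),
    Hmap_eq_of_homotopy _ _ _ (closed_id M) e (by lia) he, Hmap_id, LinearMap.id_apply]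

lemma hdim_le_of_retract (f : GHom M N p) (g : GHom N M q) (hf : f.Closed) (hg : g.Closed)
    (h : p + q = 0) (e : GHom M M (-1)) (he : e.D (by lia) = f.comp g h - GHom.id M) (n m : ℤ)
    (hm : n + p = m) : M.hdim n ≤ N.hdim m :=
  hdim_le_of_injective (Hmap f hf n m hm) (Function.LeftInverse.injective
    fun z => Hmap_left_inverse f g hf hg h e he n m hm (by lia) z)

/-- The isomorphism on cohomology induced by an isomorphism of degree `p`. -/
noncomputable def GIso.mapH (e : GIso M N p) (n m : ℤ) (h : n + p = m) : M.H n ≃ₗ[k] N.H m :=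
  LinearEquiv.ofBijective (Hmap e.hom e.closed_hom n m h)
    (Function.bijective_iff_has_inverse.2 ⟨Hmap e.inv e.closed_inv m n (by lia),
      fun z => Hmap_left_inverse _ _ _ _ (add_neg_cancel p) 0
        (by rw [D_zero, e.hom_inv, sub_self]) _ _ _ _ z,
      fun z => Hmap_left_inverse _ _ _ _ (neg_add_cancel p) 0
        (by rw [D_zero, e.inv_hom, sub_self]) _ _ _ _ z⟩)

lemma GIso.hdim_eq (e : GIso M N p) (n m : ℤ) (h : n + p = m) : M.hdim n = N.hdim m :=
  hdim_eq_of_equiv (e.mapH n m h)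

lemma hdim_shift (M : DGBimod A B) (p n : ℤ) : (M.shift p).hdim n = M.hdim (n + p) :=
  ((GIso.toShift M p).hdim_eq _ _ (by lia)).symm

/-! ### Cones and quasi-isomorphisms -/

lemma quasiIso_iff_bijective (f : M ⟶ N) : QuasiIso f ↔
    ∀ n, Function.Bijective (Hmap (ofHom f) (closed_ofHom f) n n (add_zero n)) := by
  constructor
  · intro hf n
    obtain ⟨h1, h2⟩ := hf (n - 1) n (n + 1) (by lia) rfl
    constructor
    · rw [injective_iff_map_eq_zero]
      intro z hz
      obtain ⟨x, rfl⟩ := M.Hmk_surjective n z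
      obtain ⟨_, h3⟩ := Hmap_mk (ofHom f) (closed_ofHom f) n n (add_zero n) x
      rw [h3, Hmk_eq_zero_iff (l := n - 1) (by lia)] at hz
      rw [Hmk_eq_zero_iff (l := n - 1) (by lia)]
      exact h1 x.1 x.2 hz
    · intro z
      obtain ⟨y, rfl⟩ := N.Hmk_surjective n z
      obtain ⟨x, hx, w, hw⟩ := h2 y.1 y.2
      refine ⟨M.Hmk n ⟨x, hx⟩, ?_⟩
      obtain ⟨_, h3⟩ := Hmap_mk (ofHom f) (closed_ofHom f) n n (add_zero n) ⟨x, hx⟩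
      rw [h3, ← sub_eq_zero, ← map_sub, Hmk_eq_zero_iff (l := n - 1) (by lia)]
      exact ⟨w, hw⟩
  · intro hf l n m hl hm
    subst hm
    refine ⟨fun x hx hy => ?_, fun y hy => ?_⟩
    · rw [← Hmk_eq_zero_iff hl ⟨x, hx⟩]
      apply (hf n).1
      obtain ⟨_, h3⟩ := Hmap_mk (ofHom f) (closed_ofHom f) n n (add_zero n) ⟨x, hx⟩
      rw [h3, map_zero, Hmk_eq_zero_iff hl]
      exact hy
    · obtain ⟨z, hz⟩ := (hf n).2 (N.Hmk n ⟨y, hy⟩)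
      obtain ⟨x, rfl⟩ := M.Hmk_surjective n z
      obtain ⟨_, h3⟩ := Hmap_mk (ofHom f) (closed_ofHom f) n n (add_zero n) x
      rw [h3, ← sub_eq_zero, ← map_sub, Hmk_eq_zero_iff hl] at hz
      exact ⟨x.1, x.2, hz⟩

lemma QuasiIso.hdim_eq {f : M ⟶ N} (hf : QuasiIso f) (n : ℤ) : M.hdim n = N.hdim n :=
  hdim_eq_of_equiv (LinearEquiv.ofBijective _ ((quasiIso_iff_bijective f).1 hf n))

lemma QuasiIso.comp {f : M ⟶ N} {g : N ⟶ L} (hf : QuasiIso f) (hg : QuasiIso g) :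
    QuasiIso (f ≫ g) := by
  rw [quasiIso_iff_bijective] at *
  intro n
  have := (hg n).comp (hf n)
  rw [← LinearMap.coe_comp, ← Hmap_comp _ _ _ _ (add_zero 0) n n n _ _ (add_zero n)] at this
  convert this using 3
  exact ofHom_comp f g

/-- Homotopy equivalences are quasi-isomorphisms. -/
lemma quasiIso_of_isIso {M N : DGBimod A B} (f : M ⟶ N)
    [hf : IsIso ((Quotient.functor (homotopic (A := A) (B := B))).map f)] : QuasiIso f := by
  obtain ⟨g', h1, h2⟩ := hf
  obtain ⟨g, rfl⟩ := (Quotient.functor homotopic).map_surjective g'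
  rw [← Functor.map_comp, ← CategoryTheory.Functor.map_id, Quotient.functor_map_eq_iff,
    homotopic_iff] at h1 h2
  obtain ⟨e1, he1⟩ := h1
  obtain ⟨e2, he2⟩ := h2
  rw [ofHom_comp, ofHom_id] at he1 he2
  rw [quasiIso_iff_bijective]
  intro n
  exact Function.bijective_iff_has_inverse.2 ⟨Hmap (ofHom g) (closed_ofHom g) n n (add_zero n),
    fun z => Hmap_left_inverse _ _ _ _ (add_zero 0) e1 he1 _ _ _ _ z,
    fun z => Hmap_left_inverse _ _ _ _ (add_zero 0) e2 he2 _ _ _ _ z⟩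

lemma cone_d_fst (f : M ⟶ N) (i j : ℤ) (h : i + 1 = j) (x : M.X (i + 1)) (y : N.X i) :
    ((cone f).d i j h (x, y)).1 = -M.d (i + 1) (j + 1) (by lia) x := rfl

lemma cone_d_snd (f : M ⟶ N) (i j : ℤ) (h : i + 1 = j) (x : M.X (i + 1)) (y : N.X i) :
    ((cone f).d i j h (x, y)).2 = N.castX (i + 1) j h (Hom.f f (i + 1) x) + N.d i j h y := rfl

/-- A closed morphism is a quasi-isomorphism if and only if its cone is acyclic. -/
lemma quasiIso_iff_acyclic_cone (f : M ⟶ N) : QuasiIso f ↔ (cone f).Acyclic := by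
  rw [acyclic_iff]
  constructor
  · rintro hf l n m rfl rfl ⟨x, y⟩ hxy
    have h1 := congrArg Prod.fst hxy
    have h2 := congrArg Prod.snd hxy
    rw [cone_d_fst] at h1
    rw [cone_d_snd, castX_rfl] at h2
    change -_ = 0 at h1
    change _ = (0 : N.X _) at h2
    rw [neg_eq_zero] at h1
    obtain ⟨z, hz⟩ := (hf (l + 1) (l + 1 + 1) (l + 1 + 1 + 1) rfl rfl).1 x h1
      ⟨-y, by rw [map_neg]; exact neg_eq_of_add_eq_zero_left h2⟩
    obtain ⟨x', hx', w, hw⟩ := (hf l (l + 1) (l + 1 + 1) rfl rfl).2 (y + Hom.f f _ z) (by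
      rw [map_add, ← f.comm, hz, add_comm (N.d _ _ _ y)]; exact h2)
    refine ⟨(x' - z, -w), ?_⟩
    refine Prod.ext ?_ ?_
    · rw [cone_d_fst, map_sub, hx', hz, zero_sub, neg_neg]
    · rw [cone_d_snd, castX_rfl, map_neg, hw, map_sub]
      abel
  · rintro hf l n m rfl rfl
    constructor
    · rintro x hx ⟨y, hy⟩
      obtain ⟨⟨z, w⟩, hz⟩ := hf (l - 1) l (l + 1) (by lia) rfl (x, -y) (by
        refine Prod.ext ?_ ?_
        · rw [cone_d_fst, hx, neg_zero]; rfl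
        · rw [cone_d_snd, castX_rfl, map_neg, hy, add_neg_cancel]; rfl)
      have := congrArg Prod.fst hz
      rw [cone_d_fst] at this
      refine ⟨M.castX _ _ (by lia) (-z), ?_⟩
      rw [show x = -M.d (l - 1 + 1) (l + 1) _ z from this.symm, ← map_neg]
      have aux (a b c : ℤ) (e : a = b) (h : a + 1 = c) (h' : b + 1 = c) (z : M.X a) :
          M.d b c h' (M.castX a b e z) = M.d a c h z := by subst e; rfl
      exact aux _ _ _ _ _ _ _
    · intro y hy
      obtain ⟨⟨z, w⟩, hz⟩ := hf l (l + 1) (l + 1 + 1) rfl rfl (0, y) (by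
        refine Prod.ext ?_ ?_
        · rw [cone_d_fst, map_zero, neg_zero]; rfl
        · rw [cone_d_snd, castX_rfl, map_zero, zero_add, hy]; rfl)
      have h1 := congrArg Prod.fst hz
      have h2 := congrArg Prod.snd hz
      rw [cone_d_fst] at h1
      rw [cone_d_snd, castX_rfl] at h2
      refine ⟨z, neg_eq_zero.1 h1, -w, ?_⟩
      simp only at h2
      rw [map_neg, ← h2]
      abel

/-- The inclusion `N → cone f`. -/
def coneInr (f : M ⟶ N) : GHom N (cone f) 0 := GHom.mk' (N := cone f)
  (fun i j h => LinearMap.prod 0 (N.castX i j (by lia)))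
  (fun i j n j' n' h hj hn h' a x => by
    obtain rfl : j = j' := by lia
    obtain rfl : n = n' := by lia
    rw [zero_mul, Int.negOnePow_zero, one_smul]
    refine Prod.ext ?_ ?_
    · change 0 = i.negOnePow • M.lmul i (j + 1) (n + 1) _ a 0
      rw [map_zero, smul_zero]
    · rfl)
  (fun i j n i' n' h hi hn h' x b => by
    obtain rfl : i = i' := by lia
    obtain rfl : n = n' := by lia
    refine Prod.ext ?_ ?_
    · change 0 = M.rmul (i + 1) j (n + 1) _ 0 b
      rw [map_zero, LinearMap.zero_apply]
    · rfl)

lemma closed_coneInr (f : M ⟶ N) : (coneInr f).Closed :=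
  closed_of_d_f fun i m l j hil hlj him hmj x => by
    obtain rfl : i = l := by lia
    obtain rfl : m = j := by lia
    rw [Int.negOnePow_zero, one_smul]
    change (cone f).d i m _ (0, x) = (0, N.d i m _ x)
    refine Prod.ext ?_ ?_
    · rw [cone_d_fst, map_zero, neg_zero]
    · rw [cone_d_snd, map_zero, map_zero, zero_add]

/-- The projection `cone f → M` of degree one. -/
def coneFst (f : M ⟶ N) : GHom (cone f) M 1 := GHom.mk' (M := cone f)
  (fun i j h => (M.castX (i + 1) j (by lia)) ∘ₗ LinearMap.fst k _ _)
  (fun i j n j' n' h hj hn h' a x => by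
    subst hj hn
    change i.negOnePow • M.lmul i (j + 1) (n + 1) _ a x.1 = _
    rw [one_mul]
    rfl)
  (fun i j n i' n' h hi hn h' x b => by
    subst hi hn
    rfl)

lemma closed_coneFst (f : M ⟶ N) : (coneFst f).Closed :=
  closed_of_d_f fun i m l j hil hlj him hmj x => by
    subst hil hmj
    change M.d (i + 1) (m + 1) _ x.1 = (1 : ℤ).negOnePow • -M.d (i + 1) (m + 1) _ x.1
    simp

/-- The graded inclusion `M → cone f` of degree `-1`. -/
def coneInl (f : M ⟶ N) : GHom M (cone f) (-1) := GHom.mk' (N := cone f)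
  (fun i j h => LinearMap.prod (M.castX i (j + 1) (by lia)) 0)
  (fun i j n j' n' h hj hn h' a x => by
    refine Prod.ext ?_ ?_
    · change M.castX n (n' + 1) _ _ = (-1 * i).negOnePow • i.negOnePow •
        M.lmul i (j' + 1) (n' + 1) _ a (M.castX j (j' + 1) _ x)
      rw [smul_smul, neg_mul, one_mul, Int.negOnePow_neg, Int.units_mul_self, one_smul,
        castX_lmul M i j n (j' + 1) (n' + 1)]
    · change 0 = (-1 * i).negOnePow • N.lmul i j' n' _ a 0
      rw [map_zero, smul_zero])
  (fun i j n i' n' h hi hn h' x b => by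
    refine Prod.ext ?_ ?_
    · exact castX_rmul M i j n (i' + 1) (n' + 1) _ _ _ _ x b
    · change 0 = N.rmul i' j n' _ 0 b
      rw [map_zero, LinearMap.zero_apply])

/-- The graded projection `cone f → N` of degree zero. -/
def coneSnd (f : M ⟶ N) : GHom (cone f) N 0 := GHom.mk' (M := cone f)
  (fun i j h => (N.castX i j (by lia)) ∘ₗ LinearMap.snd k _ _)
  (fun i j n j' n' h hj hn h' a x => by
    obtain rfl : j = j' := by lia
    obtain rfl : n = n' := by lia
    rw [zero_mul, Int.negOnePow_zero, one_smul]
    rfl)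
  (fun i j n i' n' h hi hn h' x b => by
    obtain rfl : i = i' := by lia
    obtain rfl : n = n' := by lia
    rfl)

lemma D_coneInl (f : M ⟶ N) : (coneInl f).D (by lia) = (ofHom f).comp (coneInr f) (add_zero 0) := by
  refine ext_zero fun i x => ?_
  rw [D_f _ _ i (i - 1) (i + 1) i _ (by lia) (by lia) rfl (by lia),
    GHom.comp_f _ _ _ i i i _ (add_zero i) (add_zero i), Int.negOnePow_neg, Int.negOnePow_one,
    Units.neg_smul, one_smul, sub_neg_eq_add]
  refine Prod.ext ?_ ?_
  · change -M.d (i - 1 + 1) (i + 1) _ (M.castX i (i - 1 + 1) _ x) + M.castX (i + 1) (i + 1) _ _ = 0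
    rw [← castX_d M i (i + 1) (i - 1 + 1) (i + 1) (by lia) rfl rfl, neg_add_cancel]
  · change N.castX (i - 1 + 1) i _ (Hom.f f (i - 1 + 1) (M.castX i (i - 1 + 1) _ x)) +
        N.d (i - 1) i _ 0 + 0 = N.castX i i rfl (N.castX i i rfl (Hom.f f i x))
    rw [map_zero, add_zero, add_zero]
    have aux (a b : ℤ) (e : a = b) (e' : b = a) (w : M.X a) :
      N.castX b a e' (Hom.f f b (M.castX a b e w)) = Hom.f f a w := by subst e; rfl
    exact aux _ _ _ _ _

lemma D_coneSnd (f : M ⟶ N) : (coneSnd f).D (zero_add 1) =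
    -(coneFst f).comp (ofHom f) (add_zero 1) := by
  ext i j hij x
  subst hij
  rw [D_f _ _ i i (i + 1) (i + 1) _ (by lia) rfl rfl (by lia), neg_f,
    GHom.comp_f _ _ _ i (i + 1) (i + 1) _ rfl (add_zero _), Int.negOnePow_zero, one_smul]
  change N.d i (i + 1) _ x.2 - (N.castX (i + 1) (i + 1) rfl (Hom.f f (i + 1) x.1) +
    N.d i (i + 1) _ x.2) = -Hom.f f (i + 1) x.1
  rw [castX_rfl]
  abel

lemma coneInr_snd (f : M ⟶ N) : (coneInr f).comp (coneSnd f) (add_zero 0) = GHom.id N :=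
  ext_zero fun i x => by
    rw [GHom.comp_f _ _ _ i i i _ (add_zero i) (add_zero i)]; rfl

lemma coneInl_fst (f : M ⟶ N) : (coneInl f).comp (coneFst f) (by lia) = GHom.id M :=
  ext_zero fun i x => by
    rw [GHom.comp_f _ _ _ i (i - 1) i _ (by lia) (by lia)]
    exact castX_castX _ _ _ _ _ _ _

lemma coneInr_fst (f : M ⟶ N) : (coneInr f).comp (coneFst f) (zero_add 1) = 0 := by
  ext i j h x
  rw [GHom.comp_f _ _ _ i i j _ (add_zero i) h]
  change M.castX (i + 1) j _ 0 = 0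
  rw [map_zero]

lemma coneInl_snd (f : M ⟶ N) : (coneInl f).comp (coneSnd f) (add_zero _) = 0 := by
  ext i j h x
  rw [GHom.comp_f _ _ _ i j j _ h (add_zero j)]
  change N.castX j j rfl 0 = 0
  rw [map_zero]

lemma cone_total (f : M ⟶ N) : (coneFst f).comp (coneInl f) (by lia) +
    (coneSnd f).comp (coneInr f) (add_zero 0) = GHom.id (cone f) :=
  ext_zero fun i x => by
    rw [add_f, GHom.comp_f _ _ _ i (i + 1) i _ rfl (by lia),
      GHom.comp_f _ _ _ i i i _ (add_zero i) (add_zero i)]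
    exact Prod.ext (add_zero _) (zero_add _)

lemma hdim_cone_le (f : M ⟶ N) (n : ℤ) : (cone f).hdim n ≤ N.hdim n + M.hdim (n + 1) := by
  let i := coneInr f
  have hi : i.Closed := closed_coneInr f
  let π := coneFst f
  have hπ : π.Closed := closed_coneFst f
  have h := LinearMap.rank_range_add_rank_ker (Hmap π hπ n (n + 1) rfl)
  rw [hdim, ← h, map_add, add_comm]
  refine add_le_add (OrderHomClass.mono Cardinal.toENat ?_)
    (OrderHomClass.mono Cardinal.toENat (Submodule.rank_le _))
  refine le_trans (Submodule.rank_mono (t := LinearMap.range (Hmap i hi n n (add_zero n))) ?_)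
    (rank_range_le _)
  intro z hz
  obtain ⟨⟨⟨x, y⟩, hxy⟩, rfl⟩ := Hmk_surjective _ n z
  have h1 : ((cone f).d n (n + 1) rfl (x, y)).2 = 0 :=
    congrArg Prod.snd (show (cone f).d n (n + 1) rfl (x, y) = 0 from hxy)
  rw [LinearMap.mem_ker] at hz
  obtain ⟨_, h3⟩ := Hmap_mk π hπ n (n + 1) rfl ⟨(x, y), hxy⟩
  rw [h3, Hmk_eq_zero_iff (l := n) rfl] at hz
  obtain ⟨w, hw⟩ := hz
  change M.d n (n + 1) _ w = x at hw
  subst hw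
  rw [cone_d_snd, castX_rfl] at h1
  refine ⟨N.Hmk n ⟨y + Hom.f f n w, ?_⟩, ?_⟩
  · rw [LinearMap.mem_ker, map_add, ← f.comm, add_comm (N.d _ _ _ y)]
    exact h1
  · obtain ⟨_, h4⟩ := Hmap_mk i hi n n (add_zero n) ⟨y + Hom.f f n w, by
      rw [LinearMap.mem_ker, map_add, ← f.comm, add_comm (N.d _ _ _ y)]
      exact h1⟩
    rw [h4, ← sub_eq_zero, ← map_sub, Hmk_eq_zero_iff (l := n - 1) (by lia)]
    refine ⟨(M.castX n (n - 1 + 1) (by lia) w, 0), ?_⟩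
    refine Prod.ext ?_ ?_
    · rw [cone_d_fst, ← castX_d M n (n + 1) _ _ _ (by lia) rfl, castX_rfl]
      exact (zero_sub _).symm
    · rw [cone_d_snd, map_zero, add_zero]
      change _ = (y + Hom.f f n w) - y
      rw [add_sub_cancel_left]
      have aux (a b : ℤ) (e : a = b) (e' : b = a) (w : M.X a) :
          N.castX b a e' (Hom.f f b (M.castX a b e w)) = Hom.f f a w := by subst e; rfl
      exact aux _ _ _ _ _

end Cohomology

end DGBimod

namespace DGBimod

variable {k : Type u} [Field k] {A B C E C' E' : DGAlgebra k}

open GHom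

/-! ### Dg functors -/

/-- A dg functor from dg `A`-`B`-bimodules to dg `C`-`E`-bimodules: it acts on graded maps of
arbitrary degree and commutes with compositions and differentials. -/
structure DGFunctor (A B C E : DGAlgebra k) where
  obj : DGBimod A B → DGBimod C E
  map : ∀ {M N : DGBimod A B} {p : ℤ}, GHom M N p → GHom (obj M) (obj N) p
  map_add : ∀ {M N : DGBimod A B} {p : ℤ} (f g : GHom M N p), map (f + g) = map f + map g
  map_smul : ∀ {M N : DGBimod A B} {p : ℤ} (c : k) (f : GHom M N p), map (c • f) = c • map f
  map_id : ∀ M : DGBimod A B, map (GHom.id M) = GHom.id (obj M)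
  map_comp : ∀ {M N L : DGBimod A B} {p q r : ℤ} (f : GHom M N p) (g : GHom N L q)
    (h : p + q = r), map (f.comp g h) = (map f).comp (map g) h
  map_D : ∀ {M N : DGBimod A B} {p q : ℤ} (f : GHom M N p) (h : p + 1 = q),
    map (f.D h) = (map f).D h

namespace DGFunctor

variable (Φ : DGFunctor A B C E) {M N L : DGBimod A B} {p q r : ℤ}

lemma map_zero : Φ.map (0 : GHom M N p) = 0 := by
  rw [← zero_smul k (0 : GHom M N p), Φ.map_smul, zero_smul]

lemma map_neg (f : GHom M N p) : Φ.map (-f) = -Φ.map f := by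
  rw [← neg_one_smul k f, Φ.map_smul, neg_one_smul]

lemma map_sub (f g : GHom M N p) : Φ.map (f - g) = Φ.map f - Φ.map g := by
  rw [sub_eq_add_neg, Φ.map_add, map_neg, sub_eq_add_neg]

variable {Φ} in
lemma map_closed {f : GHom M N p} (hf : f.Closed) : (Φ.map f).Closed := by
  rw [GHom.Closed, ← Φ.map_D, hf, map_zero]

/-- The identity functor. -/
def id (A B : DGAlgebra k) : DGFunctor A B A B where
  obj M := M
  map f := f
  map_add _ _ := rfl
  map_smul _ _ := rfl
  map_id _ := rfl
  map_comp _ _ _ := rfl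
  map_D _ _ := rfl

/-- The composition of dg functors. -/
def comp (Φ : DGFunctor A B C E) (Ψ : DGFunctor C E C' E') : DGFunctor A B C' E' where
  obj M := Ψ.obj (Φ.obj M)
  map f := Ψ.map (Φ.map f)
  map_add f g := by rw [Φ.map_add, Ψ.map_add]
  map_smul c f := by rw [Φ.map_smul, Ψ.map_smul]
  map_id M := by rw [Φ.map_id, Ψ.map_id]
  map_comp f g h := by rw [Φ.map_comp, Ψ.map_comp]
  map_D f h := by rw [Φ.map_D, Ψ.map_D]

/-- Iterates of a dg endofunctor. -/
def iter (Φ : DGFunctor A B A B) : ℕ → DGFunctor A B A B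
  | 0 => id A B
  | n + 1 => (iter Φ n).comp Φ

lemma iter_add_obj (Φ : DGFunctor A B A B) (m n : ℕ) (M : DGBimod A B) :
    (Φ.iter (m + n)).obj M = (Φ.iter n).obj ((Φ.iter m).obj M) := by
  induction n with
  | zero => rfl
  | succ n ih => exact congrArg Φ.obj ih

/-- The image of an isomorphism of degree `p`. -/
def mapGIso (e : GIso M N p) : GIso (Φ.obj M) (Φ.obj N) p where
  hom := Φ.map e.hom
  inv := Φ.map e.inv
  hom_inv := by rw [← Φ.map_comp, e.hom_inv, Φ.map_id]
  inv_hom := by rw [← Φ.map_comp, e.inv_hom, Φ.map_id]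
  closed_hom := map_closed e.closed_hom
  closed_inv := map_closed e.closed_inv

/-- The image of a closed morphism of degree zero. -/
def mapHom (f : M ⟶ N) : Φ.obj M ⟶ Φ.obj N := (Φ.map (ofHom f)).toHom (map_closed (closed_ofHom f))

@[simp] lemma ofHom_mapHom (f : M ⟶ N) : ofHom (Φ.mapHom f) = Φ.map (ofHom f) := ofHom_toHom _ _

lemma ofHom_injective {f g : M ⟶ N} (h : ofHom f = ofHom g) : f = g := by
  ext i x
  exact congr_f h i i (add_zero i) x

lemma mapHom_id (M : DGBimod A B) : Φ.mapHom (𝟙 M) = 𝟙 (Φ.obj M) := by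
  apply ofHom_injective
  rw [ofHom_mapHom, ofHom_id, ofHom_id, Φ.map_id]

lemma mapHom_comp (f : M ⟶ N) (g : N ⟶ L) : Φ.mapHom (f ≫ g) = Φ.mapHom f ≫ Φ.mapHom g := by
  apply ofHom_injective
  rw [ofHom_comp, ofHom_mapHom, ofHom_mapHom, ofHom_mapHom, ofHom_comp, Φ.map_comp]

lemma mapHom_homotopic {f g : M ⟶ N} (h : homotopic f g) :
    homotopic (Φ.mapHom f) (Φ.mapHom g) := by
  rw [homotopic_iff] at *
  obtain ⟨e, he⟩ := h
  exact ⟨Φ.map e, by rw [← Φ.map_D, he, map_sub, ofHom_mapHom, ofHom_mapHom]⟩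

/-- The induced functor on homotopy categories. -/
def ho : HoBimod A B ⥤ HoBimod C E :=
  CategoryTheory.Quotient.lift _
    { obj := fun M => HoBimod.of (Φ.obj M)
      map := fun f => (Quotient.functor homotopic).map (Φ.mapHom f)
      map_id := fun M => by rw [mapHom_id, CategoryTheory.Functor.map_id]
      map_comp := fun f g => by rw [mapHom_comp, Functor.map_comp] }
    fun _ _ _ _ h => CategoryTheory.Quotient.sound _ (Φ.mapHom_homotopic h)

lemma ho_map (f : M ⟶ N) : Φ.ho.map ((Quotient.functor homotopic).map f) =
    (Quotient.functor homotopic).map (Φ.mapHom f) := rfl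

/-- Dg functors preserve cones. -/
noncomputable def coneIso (f : M ⟶ N) : GIso (Φ.obj (cone f)) (cone (Φ.mapHom f)) 0 where
  hom := (Φ.map (coneFst f)).comp (coneInl (Φ.mapHom f)) (by lia) +
    (Φ.map (coneSnd f)).comp (coneInr (Φ.mapHom f)) (add_zero 0)
  inv := (coneFst (Φ.mapHom f)).comp (Φ.map (coneInl f)) (by lia) +
    (coneSnd (Φ.mapHom f)).comp (Φ.map (coneInr f)) (add_zero 0)
  hom_inv := by
    rw [← Φ.map_id, ← cone_total, Φ.map_add, Φ.map_comp, Φ.map_comp]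
    simp only [comp_add, add_comp]
    rw [comp_comp_comp_comp (Φ.map (coneFst f)) (coneInl _) (coneFst _) (Φ.map (coneInl f)) (w := 0)
        (x := 1) _ _ _ (by lia) (by lia) (by lia),
      comp_comp_comp_comp (Φ.map (coneFst f)) (coneInl _) (coneSnd _) (Φ.map (coneInr f))
        (w := -1) (x := 0) _ _ _ (by lia) (by lia) (by lia),
      comp_comp_comp_comp (Φ.map (coneSnd f)) (coneInr _) (coneFst _) (Φ.map (coneInl f))
        (w := 1) (x := 1) _ _ _ (by lia) (by lia) (by lia),
      comp_comp_comp_comp (Φ.map (coneSnd f)) (coneInr _) (coneSnd _) (Φ.map (coneInr f))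
        (w := 0) (x := 0) _ _ _ (by lia) (by lia) (by lia),
      coneInl_fst, coneInr_fst, coneInl_snd, coneInr_snd, comp_id, comp_id]
    simp
  inv_hom := by
    have h1 : (Φ.map (coneInl f)).comp (Φ.map (coneFst f)) (by lia) = GHom.id _ := by
      rw [← Φ.map_comp, coneInl_fst, Φ.map_id]
    have h2 : (Φ.map (coneInr f)).comp (Φ.map (coneFst f)) (by lia) = (0 : GHom _ _ 1) := by
      rw [← Φ.map_comp, coneInr_fst, map_zero]
    have h3 : (Φ.map (coneInl f)).comp (Φ.map (coneSnd f)) (by lia) = (0 : GHom _ _ (-1)) := by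
      rw [← Φ.map_comp, coneInl_snd, map_zero]
    have h4 : (Φ.map (coneInr f)).comp (Φ.map (coneSnd f)) (by lia) = GHom.id _ := by
      rw [← Φ.map_comp, coneInr_snd, Φ.map_id]
    rw [← cone_total (Φ.mapHom f)]
    simp only [comp_add, add_comp]
    rw [comp_comp_comp_comp (coneFst _) (Φ.map (coneInl f)) (Φ.map (coneFst f)) (coneInl _) (w := 0)
        (x := 1) _ _ _ (by lia) (by lia) (by lia),
      comp_comp_comp_comp (coneFst _) (Φ.map (coneInl f)) (Φ.map (coneSnd f)) (coneInr _)
        (w := -1) (x := 0) _ _ _ (by lia) (by lia) (by lia),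
      comp_comp_comp_comp (coneSnd _) (Φ.map (coneInr f)) (Φ.map (coneFst f)) (coneInl _)
        (w := 1) (x := 1) _ _ _ (by lia) (by lia) (by lia),
      comp_comp_comp_comp (coneSnd _) (Φ.map (coneInr f)) (Φ.map (coneSnd f)) (coneInr _)
        (w := 0) (x := 0) _ _ _ (by lia) (by lia) (by lia),
      h1, h2, h3, h4, comp_id, comp_id]
    simp
  closed_hom := by
    refine (closed_iff _).2 fun q hq => ?_
    obtain rfl : q = 1 := by lia
    rw [D_add,
      D_comp _ _ _ _ (p' := 2) (q' := 0) (by lia) (by lia) (by lia) (by lia),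
      D_comp _ _ _ _ (p' := 1) (q' := 1) (by lia) (by lia) (by lia) (by lia),
      D_coneInl, (closed_coneInr _).D, (map_closed (closed_coneFst f)).D, ← Φ.map_D, D_coneSnd,
      zero_comp, comp_zero, smul_zero, add_zero, zero_add, Int.negOnePow_zero, one_smul, map_neg,
      neg_comp, Φ.map_comp, ofHom_mapHom, comp_assoc _ _ _ _ _ (u := 0) (by lia) (by lia),
      add_neg_cancel]
  closed_inv := by
    refine (closed_iff _).2 fun q hq => ?_
    obtain rfl : q = 1 := by lia
    rw [D_add,
      D_comp _ _ _ _ (p' := 2) (q' := 0) (by lia) (by lia) (by lia) (by lia),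
      D_comp _ _ _ _ (p' := 1) (q' := 1) (by lia) (by lia) (by lia) (by lia),
      D_coneSnd, (closed_coneFst _).D, (map_closed (closed_coneInr f)).D, ← Φ.map_D, D_coneInl,
      zero_comp, comp_zero, smul_zero, add_zero, zero_add, Int.negOnePow_zero, one_smul,
      neg_comp, Φ.map_comp, ofHom_mapHom, comp_assoc _ _ _ _ _ (u := 0) (by lia) (by lia),
      add_neg_cancel]

/-- Dg functors preserve shifts. -/
noncomputable def shiftIso (M : DGBimod A B) (s : ℤ) :
    GIso (Φ.obj (M.shift s)) ((Φ.obj M).shift s) 0 :=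
  (Φ.mapGIso (GIso.toShift M s)).symm.trans (GIso.toShift (Φ.obj M) s) (by lia)

lemma hdim_obj_shift (M : DGBimod A B) (s n : ℤ) :
    (Φ.obj (M.shift s)).hdim n = (Φ.obj M).hdim (n + s) := by
  rw [(Φ.shiftIso M s).hdim_eq n n (add_zero n), hdim_shift]

lemma hdim_obj_cone_le (f : M ⟶ N) (n : ℤ) :
    (Φ.obj (cone f)).hdim n ≤ (Φ.obj N).hdim n + (Φ.obj M).hdim (n + 1) := by
  rw [(Φ.coneIso f).hdim_eq n n (add_zero n)]
  exact hdim_cone_le _ _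

/-- A dg functor that sends the cone of `f` to an acyclic dg bimodule sends `f` to a
quasi-isomorphism. -/
lemma quasiIso_mapHom_iff (f : M ⟶ N) :
    QuasiIso (Φ.mapHom f) ↔ (Φ.obj (cone f)).Acyclic := by
  rw [quasiIso_iff_acyclic_cone, acyclic_iff_hdim, acyclic_iff_hdim]
  exact forall_congr' fun n => by rw [(Φ.coneIso f).hdim_eq n n (add_zero n)]

lemma quasiIso_mapHom (hΦ : ∀ M : DGBimod A B, M.Acyclic → (Φ.obj M).Acyclic) {f : M ⟶ N}
    (hf : QuasiIso f) : QuasiIso (Φ.mapHom f) :=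
  (Φ.quasiIso_mapHom_iff f).2 (hΦ _ ((quasiIso_iff_acyclic_cone f).1 hf))

end DGFunctor

end DGBimod

namespace DGBimod

variable {k : Type u} [Field k] {A B C E : DGAlgebra k}

namespace GHom

variable {M N L : DGBimod A B} {p q r : ℤ}

/-! ### Homotopies between graded maps -/

lemma comp_sum {ι : Type*} (s : Finset ι) (f : GHom M N p) (g : ι → GHom N L q)
    (h : p + q = r) : f.comp (∑ i ∈ s, g i) h = ∑ i ∈ s, f.comp (g i) h := by
  classical
  induction s using Finset.induction_on with
  | empty => simp
  | insert a s ha ih => rw [Finset.sum_insert ha, Finset.sum_insert ha, comp_add, ih]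

lemma sum_comp {ι : Type*} (s : Finset ι) (f : ι → GHom M N p) (g : GHom N L q)
    (h : p + q = r) : (∑ i ∈ s, f i).comp g h = ∑ i ∈ s, (f i).comp g h := by
  classical
  induction s using Finset.induction_on with
  | empty => simp
  | insert a s ha ih => rw [Finset.sum_insert ha, Finset.sum_insert ha, add_comp, ih]

/-- `f` and `g` differ by a boundary in the morphism complex. -/
def Htpy (f g : GHom M N p) : Prop := ∃ e : GHom M N (p - 1), e.D (sub_add_cancel p 1) = f - g

namespace Htpy

variable {f f' f'' : GHom M N p} {g g' : GHom N L q}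

lemma of_D {e : GHom M N q} (h : q + 1 = p) (he : e.D h = f - f') : Htpy f f' := by
  obtain rfl : q = p - 1 := by lia
  exact ⟨e, he⟩

lemma exists_D (h : Htpy f f') (hq : q + 1 = p) : ∃ e : GHom M N q, e.D hq = f - f' := by
  obtain rfl : q = p - 1 := by lia
  exact h

lemma refl (f : GHom M N p) : Htpy f f := ⟨0, by rw [D_zero, sub_self]⟩

lemma of_eq (h : f = f') : Htpy f f' := h ▸ refl f

lemma symm (h : Htpy f f') : Htpy f' f := by
  obtain ⟨e, he⟩ := h
  exact ⟨-e, by rw [D_neg, he, neg_sub]⟩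

lemma trans (h : Htpy f f') (h' : Htpy f' f'') : Htpy f f'' := by
  obtain ⟨e, he⟩ := h
  obtain ⟨e', he'⟩ := h'
  exact ⟨e + e', by rw [D_add, he, he', sub_add_sub_cancel]⟩

lemma add {f₁ f₁' : GHom M N p} (h : Htpy f f') (h' : Htpy f₁ f₁') :
    Htpy (f + f₁) (f' + f₁') := by
  obtain ⟨e, he⟩ := h
  obtain ⟨e', he'⟩ := h'
  exact ⟨e + e', by rw [D_add, he, he', add_sub_add_comm]⟩

lemma sum {ι : Type*} {s : Finset ι} {f g : ι → GHom M N p} (h : ∀ i, Htpy (f i) (g i)) :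
    Htpy (∑ i ∈ s, f i) (∑ i ∈ s, g i) := by
  classical
  induction s using Finset.induction_on with
  | empty => simpa using refl _
  | insert a s ha ih => rw [Finset.sum_insert ha, Finset.sum_insert ha]; exact (h a).add ih

lemma comp_right (h : Htpy f f') (hg : g.Closed) (hr : p + q = r) :
    Htpy (f.comp g hr) (f'.comp g hr) := by
  obtain ⟨e, he⟩ := h
  refine of_D (e := q.negOnePow • e.comp g (r := r - 1) (by lia)) (by lia) ?_
  rw [D_sign, D_comp e g _ _ (sub_add_cancel p 1) rfl (by lia) hr, hg.D, comp_zero, zero_add, he,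
    smul_smul, Int.units_mul_self, one_smul, sub_comp]

lemma comp_left (hf : f.Closed) (h : Htpy g g') (hr : p + q = r) :
    Htpy (f.comp g hr) (f.comp g' hr) := by
  obtain ⟨e, he⟩ := h
  refine of_D (e := f.comp e (r := r - 1) (by lia)) (by lia) ?_
  rw [D_comp f e _ _ rfl (sub_add_cancel q 1) hr (by lia), hf.D, zero_comp, smul_zero, add_zero,
    he, comp_sub]

lemma map (Φ : DGFunctor A B C E) (h : Htpy f f') : Htpy (Φ.map f) (Φ.map f') := by
  obtain ⟨e, he⟩ := h
  exact ⟨Φ.map e, by rw [← Φ.map_D, he, Φ.map_sub]⟩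

end Htpy

lemma closed_zero : (0 : GHom M N p).Closed := D_zero _

lemma Closed.add {f g : GHom M N p} (hf : f.Closed) (hg : g.Closed) : (f + g).Closed := by
  rw [Closed, D_add, hf, hg, add_zero]

lemma Closed.smul {f : GHom M N p} (hf : f.Closed) (c : k) : (c • f).Closed := by
  rw [Closed, D_smul, hf, smul_zero]

lemma Closed.neg {f : GHom M N p} (hf : f.Closed) : (-f).Closed := by
  rw [Closed, D_neg, hf, neg_zero]

lemma Closed.sum {ι : Type*} {s : Finset ι} {f : ι → GHom M N p} (h : ∀ i, (f i).Closed) :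
    (∑ i ∈ s, f i).Closed := by
  classical
  induction s using Finset.induction_on with
  | empty => exact closed_zero
  | insert a s ha ih => rw [Finset.sum_insert ha]; exact (h a).add ih

/-- The morphism of the homotopy category given by a closed map of degree zero. -/
def cls (f : GHom M N 0) (hf : f.Closed) : HoBimod.of M ⟶ HoBimod.of N :=
  (Quotient.functor homotopic).map (f.toHom hf)

lemma cls_eq_iff {f g : GHom M N 0} {hf : f.Closed} {hg : g.Closed} :
    cls f hf = cls g hg ↔ Htpy f g := by
  rw [cls, cls, Quotient.functor_map_eq_iff, homotopic_iff, ofHom_toHom, ofHom_toHom]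
  rfl

lemma exists_cls {X Y : HoBimod A B} (φ : X ⟶ Y) : ∃ (f : GHom X.as Y.as 0) (hf : f.Closed),
    cls f hf = φ := by
  obtain ⟨f, rfl⟩ := (Quotient.functor (homotopic (A := A) (B := B))).map_surjective
    (X := X.as) (Y := Y.as) φ
  exact ⟨ofHom f, closed_ofHom f, by rw [cls, toHom_ofHom]⟩

lemma cls_comp (f : GHom M N 0) (g : GHom N L 0) (hf : f.Closed) (hg : g.Closed) :
    cls f hf ≫ cls g hg = cls (f.comp g (add_zero 0)) (hf.comp hg _) := by
  rw [cls, cls, ← Functor.map_comp, cls]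
  congr 1
  ext i x
  exact (GHom.comp_f f g (add_zero 0) i i i (add_zero i) (add_zero i) (add_zero i) x).symm

lemma cls_id (M : DGBimod A B) : cls (GHom.id M) (closed_id M) = 𝟙 (HoBimod.of M) := by
  rw [cls, ← CategoryTheory.Functor.map_id]
  congr 1

lemma cls_zero : cls (0 : GHom M N 0) closed_zero = 0 := by
  rw [cls, ← Functor.map_zero (Quotient.functor (homotopic (A := A) (B := B)))]
  congr 1

lemma cls_add (f g : GHom M N 0) (hf : f.Closed) (hg : g.Closed) :
    cls f hf + cls g hg = cls (f + g) (hf.add hg) := by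
  rw [cls, cls, ← Functor.map_add, cls]
  congr 1

lemma cls_sum {ι : Type*} (s : Finset ι) (f : ι → GHom M N 0) (hf : ∀ i, (f i).Closed) :
    ∑ i ∈ s, cls (f i) (hf i) = cls (∑ i ∈ s, f i) (.sum hf) := by
  classical
  induction s using Finset.induction_on with
  | empty => rw [Finset.sum_empty, ← cls_zero]; congr 1
  | insert a s ha ih => 
    rw [Finset.sum_insert ha, ih, cls_add]
    congr 1
    rw [Finset.sum_insert ha]

lemma cls_eq_zero_iff {f : GHom M N 0} {hf : f.Closed} : cls f hf = 0 ↔ Htpy f 0 := by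
  rw [← cls_zero, cls_eq_iff]

lemma _root_.DGBimod.DGFunctor.ho_cls (Φ : DGFunctor A B C E) (f : GHom M N 0) (hf : f.Closed) :
    Φ.ho.map (cls f hf) = cls (Φ.map f) (Φ.map_closed hf) := by
  rw [cls, DGFunctor.ho_map, DGFunctor.mapHom, cls]
  congr 2
  rw [ofHom_toHom]

end GHom

open GHom

/-! ### Finite direct sums of shifts -/

/-- A presentation of `X` in the homotopy category as a finite direct sum of shifts of `E`: closed
maps `pⱼ : X → E` of degree `deg j` and `qⱼ : E → X` of degree `-deg j` that satisfy the equations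
of a biproduct up to homotopy. -/
structure SumDecomp (E X : DGBimod A B) where
  ι : Type
  [fin : Fintype ι]
  deg : ι → ℤ
  p : ∀ j, GHom X E (deg j)
  q : ∀ j, GHom E X (-deg j)
  closed_p : ∀ j, (p j).Closed
  closed_q : ∀ j, (q j).Closed
  q_p : ∀ j, Htpy ((q j).comp (p j) (neg_add_cancel _)) (GHom.id E)
  q_p_of_ne : ∀ i j, i ≠ j → Htpy ((q i).comp (p j) rfl) 0
  total : Htpy (∑ j, (p j).comp (q j) (add_neg_cancel _)) (GHom.id X)

namespace SumDecomp

attribute [instance] SumDecomp.fin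

variable {E' E X Y : DGBimod A B}

/-- The image under a dg functor. -/
def map {A' B' : DGAlgebra k} (Φ : DGFunctor A B A' B') (S : SumDecomp E X) :
    SumDecomp (Φ.obj E) (Φ.obj X) where
  ι := S.ι
  deg := S.deg
  p j := Φ.map (S.p j)
  q j := Φ.map (S.q j)
  closed_p j := Φ.map_closed (S.closed_p j)
  closed_q j := Φ.map_closed (S.closed_q j)
  q_p j := by rw [← Φ.map_comp, ← Φ.map_id]; exact (S.q_p j).map Φ
  q_p_of_ne i j h := by rw [← Φ.map_comp, ← Φ.map_zero]; exact (S.q_p_of_ne i j h).map Φ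
  total := by
    have := S.total.map Φ
    rw [Φ.map_id] at this
    refine .trans (.of_eq ?_) this
    rw [show Φ.map (∑ j, (S.p j).comp (S.q j) (add_neg_cancel _)) =
      ∑ j, Φ.map ((S.p j).comp (S.q j) (add_neg_cancel _)) from
      map_sum (AddMonoidHom.mk' (fun f => Φ.map f) Φ.map_add) _ _]
    exact Finset.sum_congr rfl fun j _ => (Φ.map_comp _ _ _).symm

/-- Transitivity: a sum of shifts of sums of shifts. -/
def trans (S : SumDecomp E' E) (T : SumDecomp E X) : SumDecomp E' X where
  ι := T.ι × S.ι
  deg j := T.deg j.1 + S.deg j.2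
  p j := (T.p j.1).comp (S.p j.2) rfl
  q j := (S.q j.2).comp (T.q j.1) (by lia)
  closed_p j := (T.closed_p _).comp (S.closed_p _) _
  closed_q j := (S.closed_q _).comp (T.closed_q _) _
  q_p j := by
    rw [comp_comp_comp_comp _ _ _ _ _ _ _ (neg_add_cancel _) (add_zero _) (by lia)]
    refine .trans (.comp_right (.comp_left (S.closed_q _) (T.q_p _) _) (S.closed_p _) _) ?_
    rw [comp_id]
    exact S.q_p _
  q_p_of_ne i j h := by
    rw [comp_comp_comp_comp (S.q i.2) (T.q i.1) (T.p j.1) (S.p j.2) _ _ _ rfl rfl (by lia)]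
    by_cases hij : i.1 = j.1
    · obtain ⟨i, a⟩ := i
      obtain ⟨j, b⟩ := j
      obtain rfl : i = j := hij
      have hab : a ≠ b := fun e => h (by rw [e])
      have key : ∀ (t w : ℤ) (ht : -T.deg i + T.deg i = t) (hx : -S.deg a + t = w)
          (v : ℤ) (hv : w + S.deg b = v),
          Htpy (((S.q a).comp ((T.q i).comp (T.p i) ht) hx).comp (S.p b) hv) 0 := by
        intro t w ht hx v hv
        obtain rfl : t = 0 := by lia
        obtain rfl : w = -S.deg a := by lia
        obtain rfl := hv
        refine .trans (.comp_right (.comp_left (S.closed_q _) (T.q_p _) _) (S.closed_p _) _) ?_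
        rw [comp_id]
        exact S.q_p_of_ne a b hab
      exact key _ _ _ _ _ _
    · refine .trans (.comp_right (.comp_left (S.closed_q _) (T.q_p_of_ne _ _ hij) _)
        (S.closed_p _) _) ?_
      rw [comp_zero, zero_comp]
      exact .refl _
  total := by
    rw [Fintype.sum_prod_type]
    refine .trans (.sum fun i => ?_) T.total
    have h1 : ∀ j : S.ι, ((T.p i).comp (S.p j) rfl).comp ((S.q j).comp (T.q i)
        (r := -(T.deg i + S.deg j)) (by lia)) (add_neg_cancel _) =
        ((T.p i).comp ((S.p j).comp (S.q j) (add_neg_cancel _)) (add_zero _)).comp (T.q i)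
          (add_neg_cancel _) := fun j => comp_comp_comp_comp _ _ _ _ _ _ _ _ _ _
    rw [Finset.sum_congr rfl fun j _ => h1 j, ← sum_comp, ← comp_sum]
    refine .trans (.comp_right (.comp_left (T.closed_p i) S.total _) (T.closed_q i) _) ?_
    rw [comp_id]
    exact .refl _

/-- An isomorphism of degree `s` is a decomposition with one summand. -/
noncomputable def ofGIso {s : ℤ} (e : GIso X E s) : SumDecomp E X where
  ι := Unit
  deg _ := s
  p _ := e.hom
  q _ := e.inv
  closed_p _ := e.closed_hom
  closed_q _ := e.closed_inv
  q_p _ := .of_eq e.inv_hom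
  q_p_of_ne i j h := absurd (Subsingleton.elim i j) h
  total := .of_eq (by simpa using e.hom_inv)

lemma hdim_le (S : SumDecomp E X) (n : ℤ) : X.hdim n ≤ ∑ j, E.hdim (n + S.deg j) := by
  have key : Function.Injective (LinearMap.pi fun j =>
      Hmap (S.p j) (S.closed_p j) n (n + S.deg j) rfl) := by
    rw [← LinearMap.ker_eq_bot, LinearMap.ker_eq_bot']
    intro z hz
    obtain ⟨⟨x, hx⟩, rfl⟩ := X.Hmk_surjective n z
    rw [LinearMap.mem_ker] at hx
    have h1 : ∀ j, ∃ y, E.d (n + S.deg j - 1) _ (by lia) y = (S.p j).f n (n + S.deg j) rfl x := by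
      intro j
      have := congrFun hz j
      rw [LinearMap.pi_apply] at this
      obtain ⟨h, e⟩ := Hmap_mk (S.p j) (S.closed_p j) n (n + S.deg j) rfl ⟨x, hx⟩
      rw [e, Pi.zero_apply, Hmk_eq_zero_iff (sub_add_cancel _ 1)] at this
      exact this
    choose y hy using h1
    obtain ⟨e, he⟩ := S.total
    rw [Hmk_eq_zero_iff (sub_add_cancel _ 1)]
    refine ⟨∑ j, (-S.deg j).negOnePow • (S.q j).f _ (n - 1) (by lia) (y j) -
      e.f n (n - 1) (by lia) x, ?_⟩
    have h2 : X.d (n - 1) n (by lia) (e.f n (n - 1) (by lia) x) =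
        (∑ j, (S.p j).comp (S.q j) (add_neg_cancel _) - GHom.id X).f n n (by lia) x := by
      rw [← he, D_f _ _ n (n - 1) (n + 1) n _ (by lia) (by lia) rfl (by lia), hx, map_zero,
        smul_zero, sub_zero]
    have h3 : (∑ j, (S.p j).comp (S.q j) (add_neg_cancel _)).f n n (add_zero n) x =
        ∑ j, (S.q j).f (n + S.deg j) n (by lia) ((S.p j).f n _ rfl x) := by
      have : ∀ s : Finset S.ι, (∑ j ∈ s, (S.p j).comp (S.q j) (add_neg_cancel _)).f n n
          (add_zero n) x = ∑ j ∈ s, (S.q j).f (n + S.deg j) n (by lia) ((S.p j).f n _ rfl x) := by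
        intro s
        classical
        induction s using Finset.induction_on with
        | empty => simp
        | insert a s ha ih => rw [Finset.sum_insert ha, Finset.sum_insert ha, add_f, ih, comp_f']
      exact this _
    rw [map_sub, h2, sub_f, h3, GHom.id_f, map_sum]
    have h4 : ∀ j, X.d (n - 1) n (by lia) ((-S.deg j).negOnePow • (S.q j).f (n + S.deg j - 1)
        (n - 1) (by lia) (y j)) = (S.q j).f (n + S.deg j) n (by lia) ((S.p j).f n _ rfl x) := by
      intro j
      rw [map_sign, (S.closed_q j).d_f (n + S.deg j - 1) (n + S.deg j) (n - 1) n (by lia) (by lia)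
        (by lia) (by lia), hy, smul_smul, Int.units_mul_self, one_smul]
    rw [Finset.sum_congr rfl fun j _ => h4 j, sub_sub_cancel]
  have h := OrderHomClass.mono Cardinal.toENat (LinearMap.rank_le_of_injective _ key)
  refine h.trans ?_
  by_cases hfin : ∀ j, Module.Finite k (E.H (n + S.deg j))
  · rw [← Module.finrank_eq_rank, Module.finrank_pi_fintype, map_natCast, Nat.cast_sum]
    refine Finset.sum_le_sum fun j _ => le_of_eq ?_
    rw [hdim, ← Module.finrank_eq_rank, map_natCast]
  · push Not at hfin
    obtain ⟨j, hj⟩ := hfin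
    have : E.hdim (n + S.deg j) = ⊤ := by
      rw [hdim, Cardinal.toENat_eq_top, ← not_lt, Module.rank_lt_aleph0_iff]
      exact hj
    exact le_top.trans (this.ge.trans
      (Finset.single_le_sum (f := fun j => E.hdim (n + S.deg j)) (fun _ _ => by simp)
        (Finset.mem_univ j)))

end SumDecomp

end DGBimod

namespace DGBimod

variable {k : Type u} [Field k] {A B C E : DGAlgebra k}

open GHom

/-! ### Thick subcategories and dg functors -/

lemma sumDecomp_of_sums {Y X : HoBimod A B} (h : HoBimod.sums Y X) :
    Nonempty (SumDecomp Y.as X.as) := by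
  obtain ⟨r, n, b, ⟨hb⟩, ⟨e⟩⟩ := h
  have hP₀ (j) : ∃ (f : GHom X.as (Y.as.shift (n j)) 0) (hf : f.Closed), cls f hf =
    e.hom ≫ b.π j := exists_cls (e.hom ≫ b.π j)
  have hQ₀ (j) : ∃ (f : GHom (Y.as.shift (n j)) X.as 0) (hf : f.Closed), cls f hf =
    b.ι j ≫ e.inv := exists_cls (b.ι j ≫ e.inv)
  choose P hP hP' using hP₀
  choose Q hQ hQ' using hQ₀
  let t (j : Fin r) := GIso.toShift Y.as (n j)
  exact ⟨{
    ι := Fin r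
    deg := n
    p := fun j => (P j).comp (t j).inv (by lia)
    q := fun j => (t j).hom.comp (Q j) (add_zero _)
    closed_p := fun j => (hP j).comp (t j).closed_inv _
    closed_q := fun j => (t j).closed_hom.comp (hQ j) _
    q_p := fun j => by
      have h1 : Htpy ((Q j).comp (P j) (add_zero 0)) (GHom.id _) := by
        rw [← cls_eq_iff (hf := (hQ j).comp (hP j) _) (hg := closed_id _), ← cls_comp _ _ (hQ j)
          (hP j), hQ', hP',
          cls_id]
        have := b.ι_π j j
        rw [dif_pos rfl] at this
        rw [Category.assoc, e.inv_hom_id_assoc, this]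
        rfl
      rw [comp_comp_comp_comp _ _ _ _ _ _ _ (add_zero 0) (add_zero _) (by lia)]
      refine .trans (.comp_right (.comp_left (t j).closed_hom h1 _) (t j).closed_inv _) ?_
      rw [comp_id]
      refine .of_eq ?_
      rw [← (t j).hom_inv]
    q_p_of_ne := fun i j hij => by
      have h1 : Htpy ((Q i).comp (P j) (add_zero 0)) 0 := by
        rw [← cls_eq_zero_iff (hf := (hQ i).comp (hP j) _), ← cls_comp _ _ (hQ i) (hP j), hQ', hP']
        have := b.ι_π i j
        rw [dif_neg hij] at this
        rw [Category.assoc, e.inv_hom_id_assoc, this]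
      rw [comp_comp_comp_comp (t i).hom (Q i) (P j) (t j).inv _ _ _ (add_zero 0) (add_zero _)
        (by lia)]
      refine .trans (.comp_right (.comp_left (t i).closed_hom h1 _) (t j).closed_inv _) ?_
      rw [comp_zero, zero_comp]
      exact .refl _
    total := by
      have h1 : ∀ j, ((P j).comp (t j).inv (r := n j) (by lia)).comp
          ((t j).hom.comp (Q j) (add_zero _)) (add_neg_cancel _) =
            (P j).comp (Q j) (add_zero 0) := fun j => by
        rw [comp_comp_comp_comp _ _ _ _ _ _ _ (by lia : - -n j + -n j = 0) (add_zero _) (by lia),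
          show (t j).inv.comp (t j).hom _ = GHom.id _ from (t j).inv_hom, comp_id]
      rw [Finset.sum_congr rfl fun j _ => h1 j]
      rw [← cls_eq_iff (hf := .sum fun j => (hQ j |> (hP j).comp) _) (hg := closed_id _),
        ← cls_sum _ _ (fun j => (hP j).comp (hQ j) _),
        Finset.sum_congr rfl fun j _ => (cls_comp _ _ (hP j) (hQ j)).symm, cls_id]
      simp only [hP', hQ']
      have := Limits.IsBilimit.total hb
      calc _ = e.hom ≫ (∑ j, b.π j ≫ b.ι j) ≫ e.inv := by
            simp only [Preadditive.comp_sum, Preadditive.sum_comp, Category.assoc]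
        _ = 𝟙 X := by rw [this, Category.id_comp, e.hom_inv_id] }⟩

lemma sums_of_sumDecomp {Y X : DGBimod A B} (S : SumDecomp Y X) :
    HoBimod.sums (HoBimod.of Y) (HoBimod.of X) := by
  let σ : S.ι ≃ Fin (Fintype.card S.ι) := Fintype.equivFin S.ι
  let n (j : Fin (Fintype.card S.ι)) : ℤ := S.deg (σ.symm j)
  let t (j : Fin (Fintype.card S.ι)) := GIso.toShift Y (n j)
  let P (j) := (S.p (σ.symm j)).comp (t j).hom (add_neg_cancel _)
  let Q (j) := (t j).inv.comp (S.q (σ.symm j)) (neg_add_cancel (-n j))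
  have hP (j) : (P j).Closed := (S.closed_p _).comp (t j).closed_hom _
  have hQ (j) : (Q j).Closed := (t j).closed_inv.comp (S.closed_q _) _
  have h1 (j) : cls (Q j) (hQ j) ≫ cls (P j) (hP j) = 𝟙 _ := by
    rw [cls_comp, ← cls_id, cls_eq_iff]
    simp only [P, Q]
    rw [comp_comp_comp_comp _ _ _ _ _ _ _ (neg_add_cancel _) (add_zero _) (by lia)]
    refine .trans (.comp_right (.comp_left (t j).closed_inv (S.q_p _) _) (t j).closed_hom _) ?_
    rw [comp_id]
    exact .of_eq (t j).inv_hom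
  have h2 (i j) (hij : i ≠ j) : cls (Q i) (hQ i) ≫ cls (P j) (hP j) = 0 := by
    rw [cls_comp, cls_eq_zero_iff]
    simp only [P, Q]
    rw [comp_comp_comp_comp _ _ _ _ _ _ _ rfl rfl (by lia)]
    refine .trans (.comp_right (.comp_left (t i).closed_inv
      (S.q_p_of_ne _ _ (σ.symm.injective.ne hij)) _) (t j).closed_hom _) ?_
    rw [comp_zero, zero_comp]
    exact .refl _
  let b : Limits.Bicone fun j => HoBimod.shift (HoBimod.of Y) (n j) :=
    { pt := HoBimod.of X
      π := fun j => cls (P j) (hP j)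
      ι := fun j => cls (Q j) (hQ j)
      ι_π := fun i j => by
        split_ifs with h
        · subst h
          exact h1 i
        · exact h2 i j h }
  refine ⟨_, n, b, ⟨Limits.isBilimitOfTotal b ?_⟩, ⟨Iso.refl _⟩⟩
  change ∑ j, cls (P j) (hP j) ≫ cls (Q j) (hQ j) = 𝟙 _
  simp only [cls_comp]
  rw [cls_sum _ _ fun j => (hP j).comp (hQ j) _, ← cls_id, cls_eq_iff]
  have h3 (j) : (P j).comp (Q j) (add_zero 0) =
      (S.p (σ.symm j)).comp (S.q (σ.symm j)) (add_neg_cancel _) := by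
    simp only [P, Q]
    rw [comp_comp_comp_comp _ _ _ _ _ _ _ (add_neg_cancel _) (add_zero _) (by lia),
      (t j).hom_inv, comp_id]
  rw [Finset.sum_congr rfl fun j _ => h3 j]
  refine .trans (.of_eq ?_) S.total
  exact σ.symm.sum_comp fun j => (S.p j).comp (S.q j) (add_neg_cancel _)

lemma retract_exists {X Y : HoBimod A B} (h : Retract X Y) :
    ∃ (i : GHom X.as Y.as 0) (r : GHom Y.as X.as 0) (_ : i.Closed) (_ : r.Closed),
      Htpy (i.comp r (add_zero 0)) (GHom.id X.as) := by
  obtain ⟨i, hi, hi'⟩ := exists_cls h.i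
  obtain ⟨r, hr, hr'⟩ := exists_cls h.r
  refine ⟨i, r, hi, hr, ?_⟩
  rw [← cls_eq_iff (hf := hi.comp hr _) (hg := closed_id _), ← cls_comp _ _ hi hr, hi', hr', cls_id]
  exact h.retract

lemma hdim_le_of_retract' {X Y : HoBimod A B} (h : Retract X Y) (Φ : DGFunctor A B C E) (n : ℤ) :
    (Φ.obj X.as).hdim n ≤ (Φ.obj Y.as).hdim n := by
  obtain ⟨i, r, hi, hr, hir⟩ := retract_exists h
  have h1 := hir.map Φ
  rw [Φ.map_comp, Φ.map_id] at h1
  obtain ⟨e, he⟩ := h1.exists_D (by lia : (-1 : ℤ) + 1 = 0)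
  exact hdim_le_of_retract _ _ (Φ.map_closed hi) (Φ.map_closed hr) _ e he n n (add_zero n)

/-- The cohomology of `Φ X` for `X ∈ ⟨Y⟩` is bounded by finitely many shifts of that of `Φ Y`,
where the shifts do not depend on the dg functor `Φ`: retracts do not increase the dimension of
cohomology, and that of a cone is at most the sum of those of its ends. -/
theorem thick_bound {Y X : HoBimod A B} (h : HoBimod.thick Y X) :
    ∃ (ι : Type) (_ : Fintype ι) (s : ι → ℤ), ∀ {C E : DGAlgebra k} (Φ : DGFunctor A B C E) (n : ℤ),
      (Φ.obj X.as).hdim n ≤ ∑ j, (Φ.obj Y.as).hdim (n + s j) := by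
  have hsums : ∀ X, HoBimod.sums Y X → ∃ (ι : Type) (_ : Fintype ι) (s : ι → ℤ),
      ∀ {C E : DGAlgebra k} (Φ : DGFunctor A B C E) (n : ℤ),
      (Φ.obj X.as).hdim n ≤ ∑ j, (Φ.obj Y.as).hdim (n + s j) := by
    intro X hX
    obtain ⟨S⟩ := sumDecomp_of_sums hX
    exact ⟨S.ι, S.fin, S.deg, fun Φ n => (S.map Φ).hdim_le n⟩
  have hlayer : ∀ (m : ℕ) (X), HoBimod.layer Y m X → ∃ (ι : Type) (_ : Fintype ι) (s : ι → ℤ),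
      ∀ {C E : DGAlgebra k} (Φ : DGFunctor A B C E) (n : ℤ),
      (Φ.obj X.as).hdim n ≤ ∑ j, (Φ.obj Y.as).hdim (n + s j) := by
    intro m
    induction m with
    | zero => exact hsums
    | succ m ih =>
      rintro Z ⟨X', Y', hX', hY', f, ⟨e⟩⟩
      obtain ⟨ι, _, s, hs⟩ := hsums X' hX'
      obtain ⟨ι', _, s', hs'⟩ := ih Y' hY'
      refine ⟨ι ⊕ ι', inferInstance, Sum.elim s s', fun Φ n => ?_⟩
      rw [Fintype.sum_sum_type]
      refine (hdim_le_of_retract' e.retract Φ n).trans ((Φ.hdim_obj_cone_le f n).trans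
        (add_le_add (hs Φ n) ?_))
      rw [Φ.hdim_obj_shift, show n + 1 + -1 = n by lia]
      exact hs' Φ n
  obtain ⟨m, X', hX', ⟨r⟩⟩ := h
  obtain ⟨ι, _, s, hs⟩ := hlayer m X' hX'
  exact ⟨ι, _, s, fun Φ n => (hdim_le_of_retract' r Φ n).trans (hs Φ n)⟩

/-- A dg functor that kills `Y` up to quasi-isomorphism kills `⟨Y⟩`: all shifts in `thick_bound`
contribute zero. -/
lemma acyclic_obj_of_thick {Y X : HoBimod A B} (h : HoBimod.thick Y X) (Φ : DGFunctor A B C E)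
    (hY : (Φ.obj Y.as).Acyclic) : (Φ.obj X.as).Acyclic := by
  obtain ⟨ι, _, s, hs⟩ := thick_bound h
  rw [acyclic_iff_hdim] at *
  intro n
  refine le_antisymm ((hs Φ n).trans (le_of_eq ?_)) (by simp)
  simp [hY]

lemma layer_congr {Y Y' : HoBimod A B} (h : ∀ X, HoBimod.sums Y' X → HoBimod.sums Y X) (m : ℕ)
    (X : HoBimod A B) (hX : HoBimod.layer Y' m X) : HoBimod.layer Y m X := by
  induction m generalizing X with
  | zero => exact h X hX
  | succ m ih =>
    obtain ⟨X', Y'', hX', hY', f, e⟩ := hX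
    exact ⟨X', Y'', h _ hX', ih _ hY', f, e⟩

/-- If `Y'` is a finite direct sum of shifts of `Y`, then `⟨Y'⟩ ⊆ ⟨Y⟩`. -/
lemma thick_of_sumDecomp {Y Y' : DGBimod A B} (S : SumDecomp Y Y') {X : HoBimod A B}
    (hX : HoBimod.thick (HoBimod.of Y') X) : HoBimod.thick (HoBimod.of Y) X := by
  obtain ⟨m, X', hX', r⟩ := hX
  refine ⟨m, X', layer_congr (fun Z hZ => ?_) m X' hX', r⟩
  obtain ⟨T⟩ := sumDecomp_of_sums hZ
  exact sums_of_sumDecomp (X := Z.as) (S.trans T)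

/-- Precomposition with an isomorphism does not change the cone. -/
noncomputable def conePrecomp {M M' N : DGBimod A B} (e : M ≅ M') (f : M' ⟶ N) :
    GIso (cone (e.hom ≫ f)) (cone f) 0 :=
  GIso.ofId (fun i => (Hom.f e.hom (i + 1)).prodMap LinearMap.id)
    (fun i => ((GIso.ofIso e).bijective (i + 1) (i + 1) (add_zero _)).prodMap Function.bijective_id)
    (fun i j h x => by
      refine Prod.ext ?_ rfl
      change Hom.f e.hom (j + 1) (-M.d _ _ _ x.1) = -M'.d _ _ _ (Hom.f e.hom (i + 1) x.1)
      rw [map_neg, e.hom.comm])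
    (fun i j n h a x => by
      refine Prod.ext ?_ rfl
      change Hom.f e.hom (n + 1) (i.negOnePow • M.lmul _ _ _ _ a x.1) =
        i.negOnePow • M'.lmul _ _ _ _ a (Hom.f e.hom (j + 1) x.1)
      rw [map_sign, e.hom.map_lmul])
    (fun i j n h x b => by
      refine Prod.ext ?_ rfl
      change Hom.f e.hom (n + 1) (M.rmul _ _ _ _ x.1 b) =
        M'.rmul _ _ _ _ (Hom.f e.hom (i + 1) x.1) b
      rw [e.hom.map_rmul])

/-- Dg functors map `⟨Y⟩` to `⟨Φ Y⟩`. -/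
theorem thick_map {Y X : HoBimod A B} (h : HoBimod.thick Y X) (Φ : DGFunctor A B C E) :
    HoBimod.thick (Φ.ho.obj Y) (Φ.ho.obj X) := by
  have hsums : ∀ X, HoBimod.sums Y X → HoBimod.sums (Φ.ho.obj Y) (Φ.ho.obj X) := by
    intro X hX
    obtain ⟨S⟩ := sumDecomp_of_sums hX
    exact sums_of_sumDecomp (S.map Φ)
  have hlayer : ∀ (m : ℕ) (X), HoBimod.layer Y m X → HoBimod.layer (Φ.ho.obj Y) m (Φ.ho.obj X) := by
    intro m
    induction m with
    | zero => exact hsums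
    | succ m ih =>
      rintro Z ⟨X', Y', hX', hY', f, ⟨e⟩⟩
      refine ⟨_, _, hsums X' hX', ih Y' hY', (Φ.shiftIso Y'.as (-1)).toIso.inv ≫ Φ.mapHom f, ⟨?_⟩⟩
      exact Φ.ho.mapIso e ≪≫ (Quotient.functor homotopic).mapIso
        ((Φ.coneIso f).toIso ≪≫ (conePrecomp (Φ.shiftIso Y'.as (-1)).toIso.symm _).toIso.symm)
  obtain ⟨m, X', hX', ⟨r⟩⟩ := h
  exact ⟨m, _, hlayer m X' hX', ⟨r.map Φ.ho⟩⟩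

end DGBimod

namespace DGBimod

variable {k : Type u} [Field k] {A B C E : DGAlgebra k}

open GHom

/-! ### Tensor products of graded maps -/

section Tensor

variable {M M' : DGBimod C A} {K K' : DGBimod A B} {N : DGBimod C B} {p q : ℤ}

/-- The element `m ⊗ x` of `M ⊗_A K`. -/
noncomputable def tm (M : DGBimod C A) (K : DGBimod A B) (i j n : ℤ) (h : i + j = n) :
    M.X i →ₗ[k] K.X j →ₗ[k] (M.tensor K).X n := Tensor.tmul M K i j n h

lemma tm_balanced {i l j il lj n : ℤ} (hil : i + l = il) (hlj : l + j = lj) (h : il + j = n)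
    (h' : i + lj = n) (m : M.X i) (a : A.X l) (x : K.X j) :
    tm M K il j n h (M.rmul i l il hil m a) x = tm M K i lj n h' m (K.lmul l j lj hlj a x) :=
  Tensor.tmul_balanced M K i l j il lj n hil hlj h h' m a x

lemma d_tm {i j n i' j' n' : ℤ} (h : i + j = n) (hi : i + 1 = i') (hj : j + 1 = j')
    (hn : n + 1 = n') (h₁ : i' + j = n') (h₂ : i + j' = n') (m : M.X i) (x : K.X j) :
    (M.tensor K).d n n' hn (tm M K i j n h m x) =
      tm M K i' j n' h₁ (M.d i i' hi m) x + i.negOnePow • tm M K i j' n' h₂ m (K.d j j' hj x) :=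
  Tensor.d_tmul M K i j n i' j' n' h hi hj hn h₁ h₂ m x

lemma lmul_tm {i p q j ip n : ℤ} (hn : i + j = n) (h : p + q = j) (hip : i + p = ip)
    (h' : ip + q = n) (c : C.X i) (m : M.X p) (x : K.X q) :
    (M.tensor K).lmul i j n hn c (tm M K p q j h m x) = tm M K ip q n h'
      (M.lmul i p ip hip c m) x :=
  Tensor.lmul_tmul M K i p q j ip n hn h hip h' c m x

lemma rmul_tm {p q i j qj n : ℤ} (hn : i + j = n) (h : p + q = i) (hqj : q + j = qj)
    (h' : p + qj = n) (m : M.X p) (x : K.X q) (b : B.X j) :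
    (M.tensor K).rmul i j n hn (tm M K p q i h m x) b = tm M K p qj n h' m
      (K.rmul q j qj hqj x b) :=
  Tensor.rmul_tmul M K p q i j qj n hn h hqj h' m x b

lemma tensor_lin_ext {n : ℤ} {Z : Type*} [AddCommGroup Z] [Module k Z]
    {f g : (M.tensor K).X n →ₗ[k] Z}
    (h : ∀ i j hij (m : M.X i) (x : K.X j), f (tm M K i j n hij m x) = g (tm M K i j n hij m x)) :
    f = g :=
  Tensor.T_ext h

lemma tensor_ext {A' B' : DGAlgebra k} {M : DGBimod C A'} {K : DGBimod A' B'} {N : DGBimod C B'}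
    {f g : GHom (M.tensor K) N p}
    (h : ∀ i j n l (hij : i + j = n) (hn : n + p = l) (m : M.X i) (x : K.X j),
      f.f n l hn (tm M K i j n hij m x) = g.f n l hn (tm M K i j n hij m x)) : f = g := by
  ext n l hn z
  exact LinearMap.congr_fun (tensor_lin_ext fun i j hij m x => h i j n l hij hn m x) z

/-- The universal property of `M ⊗_A K` in one degree. -/
noncomputable def tlift {n : ℤ} {Z : Type*} [AddCommGroup Z] [Module k Z]
    (φ : ∀ i j : ℤ, i + j = n → M.X i →ₗ[k] K.X j →ₗ[k] Z)
    (hφ : ∀ (i l j il lj : ℤ) (hil : i + l = il) (hlj : l + j = lj) (h : il + j = n)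
      (h' : i + lj = n) (m : M.X i) (a : A.X l) (x : K.X j),
      φ il j h (M.rmul i l il hil m a) x = φ i lj h' m (K.lmul l j lj hlj a x)) :
    (M.tensor K).X n →ₗ[k] Z := Tensor.lift φ hφ

@[simp] lemma tlift_tm {n : ℤ} {Z : Type*} [AddCommGroup Z] [Module k Z]
    (φ : ∀ i j : ℤ, i + j = n → M.X i →ₗ[k] K.X j →ₗ[k] Z) (hφ)
    (i j : ℤ) (h : i + j = n) (m : M.X i) (x : K.X j) :
    tlift φ hφ (tm M K i j n h m x) = φ i j h m x := Tensor.lift_tmul φ hφ i j h m x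

/-- The graded map `M ⊗_A K → N` given by a balanced family of bilinear maps. -/
noncomputable def tdesc (φ : ∀ i j n : ℤ, i + j + p = n → M.X i →ₗ[k] K.X j →ₗ[k] N.X n)
    (hb : ∀ (i l j il lj n : ℤ) (hil : i + l = il) (hlj : l + j = lj) (h : il + j + p = n)
      (h' : i + lj + p = n) (m : M.X i) (a : A.X l) (x : K.X j),
      φ il j n h (M.rmul i l il hil m a) x = φ i lj n h' m (K.lmul l j lj hlj a x))
    (hl : ∀ (c i j ci l n : ℤ) (hci : c + i = ci) (h : ci + j + p = n) (h' : i + j + p = l)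
      (h'' : c + l = n) (a : C.X c) (m : M.X i) (x : K.X j),
      φ ci j n h (M.lmul c i ci hci a m) x = (p * c).negOnePow •
        N.lmul c l n h'' a (φ i j l h' m x))
    (hr : ∀ (i j b jb l n : ℤ) (hjb : j + b = jb) (h : i + jb + p = n) (h' : i + j + p = l)
      (h'' : l + b = n) (m : M.X i) (x : K.X j) (y : B.X b),
      φ i jb n h m (K.rmul j b jb hjb x y) = N.rmul l b n h'' (φ i j l h' m x) y) :
    GHom (M.tensor K) N p :=
  have hb' (n l : ℤ) (h : n + p = l) := fun (i l' j il lj : ℤ) (hil : i + l' = il)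
      (hlj : l' + j = lj) (h₁ : il + j = n) (h₂ : i + lj = n) (m : M.X i) (a : A.X l')
      (x : K.X j) => hb i l' j il lj l hil hlj (by lia) (by lia) m a x
  let F (n l : ℤ) (h : n + p = l) : (M.tensor K).X n →ₗ[k] N.X l :=
    tlift (fun i j hij => φ i j l (by lia)) (hb' n l h)
  have hF (n l : ℤ) (h : n + p = l) (i j : ℤ) (hij : i + j = n) (m : M.X i) (x : K.X j) :
      F n l h (tm M K i j n hij m x) = φ i j l (by lia) m x := tlift_tm _ _ _ _ _ _ _
  have hFl (c n cn l cl : ℤ) (hcn : c + n = cn) (hl' : n + p = l) (hn' : cn + p = cl)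
      (h : c + l = cl) (a : C.X c) (z : (M.tensor K).X n) :
      F cn cl hn' ((M.tensor K).lmul c n cn hcn a z) =
        (p * c).negOnePow • N.lmul c l cl h a (F n l hl' z) := by
    have := LinearMap.congr_fun (f := (F cn cl hn') ∘ₗ (M.tensor K).lmul c n cn hcn a)
      (g := (p * c).negOnePow • (N.lmul c l cl h a) ∘ₗ (F n l hl'))
      (tensor_lin_ext fun i j hij m x => by
        rw [LinearMap.comp_apply, lmul_tm _ hij rfl (by lia), hF _ _ hn', sign_apply,
          LinearMap.comp_apply, hF _ _ hl']
        exact hl c i j _ l cl rfl (by lia) (by lia) h a m x) z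
    simpa only [LinearMap.comp_apply, sign_apply] using this
  have hFr (n b nb l lb : ℤ) (hnb : n + b = nb) (hl' : n + p = l) (hn' : nb + p = lb)
      (h : l + b = lb) (z : (M.tensor K).X n) (y : B.X b) :
      F nb lb hn' ((M.tensor K).rmul n b nb hnb z y) = N.rmul l b lb h (F n l hl' z) y := by
    have := LinearMap.congr_fun (f := (F nb lb hn') ∘ₗ ((M.tensor K).rmul n b nb hnb).flip y)
      (g := ((N.rmul l b lb h).flip y) ∘ₗ (F n l hl'))
      (tensor_lin_ext fun i j hij m x => by
        rw [LinearMap.comp_apply, LinearMap.flip_apply, rmul_tm _ hij rfl (by lia), hF _ _ hn',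
          LinearMap.comp_apply, hF _ _ hl']
        exact hr i j b _ l lb rfl (by lia) (by lia) h m x y) z
    simpa only [LinearMap.comp_apply, LinearMap.flip_apply] using this
  mk' F hFl hFr

@[simp] lemma tdesc_tm (φ : ∀ i j n : ℤ, i + j + p = n → M.X i →ₗ[k] K.X j →ₗ[k] N.X n) (hb hl hr)
    (i j n l : ℤ) (hij : i + j = n) (h : n + p = l) (m : M.X i) (x : K.X j) :
    (tdesc φ hb hl hr).f n l h (tm M K i j n hij m x) = φ i j l (by lia) m x :=
  tlift_tm (fun i j hij => φ i j l (by lia))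
    (fun i l' j il lj hil hlj h₁ h₂ m a x => hb i l' j il lj l hil hlj (by lia) (by lia) m a x)
    i j hij m x

lemma closed_of_tm {f : GHom (M.tensor K) N p}
    (h : ∀ (i j n i' j' n' l l' : ℤ) (hij : i + j = n) (hi : i + 1 = i') (hj : j + 1 = j')
      (_ : n + 1 = n') (h₁ : i' + j = n') (h₂ : i + j' = n') (hl : n + p = l) (hl' : n' + p = l')
      (hll : l + 1 = l') (m : M.X i) (x : K.X j),
      N.d l l' hll (f.f n l hl (tm M K i j n hij m x)) =
        p.negOnePow • (f.f n' l' hl' (tm M K i' j n' h₁ (M.d i i' hi m) x) +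
          i.negOnePow • f.f n' l' hl' (tm M K i j' n' h₂ m (K.d j j' hj x)))) : f.Closed := by
  refine closed_of_d_f fun n n' l l' hl hll hn hl' z => ?_
  refine LinearMap.congr_fun (f := (N.d l l' hll) ∘ₗ f.f n l hl) (g := p.negOnePow •
    (f.f n' l' hl') ∘ₗ (M.tensor K).d n n' hn) (tensor_lin_ext fun i j hij m x => ?_) z
  rw [LinearMap.comp_apply, sign_apply, LinearMap.comp_apply, d_tm hij rfl rfl hn (by lia) (by lia),
    map_add, map_sign]
  exact h i j n _ _ n' l l' hij rfl rfl hn (by lia) (by lia) hl hl' hll m x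

/-- The graded map `f ⊗ 1`. -/
noncomputable def tensorRMap {M N : DGBimod C A} (K : DGBimod A B) (f : GHom M N p) :
    GHom (M.tensor K) (N.tensor K) p :=
  tdesc (fun i j n h => (tm N K (i + p) j n (by lia)) ∘ₗ f.f i (i + p) rfl)
  (fun i l j il lj n hil hlj h h' m a x => by
    rw [LinearMap.comp_apply, LinearMap.comp_apply,
      f.map_rmul i l il (i + p) (il + p) hil rfl rfl (by lia), tm_balanced _ hlj _ (by lia)])
  (fun c i j ci l n hci h h' h'' a m x => by
    rw [LinearMap.comp_apply, LinearMap.comp_apply,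
      f.map_lmul c i ci (i + p) (ci + p) hci rfl rfl (by lia), map_sign, sign_apply,
      lmul_tm _ _ (by lia : c + (i + p) = ci + p)])
  (fun i j b jb l n hjb h h' h'' m x y => by
    rw [LinearMap.comp_apply, LinearMap.comp_apply, rmul_tm])

@[simp] lemma tensorRMap_tm (K : DGBimod A B) (f : GHom M M' p) (i j n l i' : ℤ) (hij : i + j = n)
    (h : n + p = l) (hi : i + p = i') (h' : i' + j = l) (m : M.X i) (x : K.X j) :
    (tensorRMap K f).f n l h (tm M K i j n hij m x) = tm M' K i' j l h' (f.f i i' hi m) x := by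
  subst hi
  rw [tensorRMap, tdesc_tm, LinearMap.comp_apply]

variable (C) in
/-- The dg functor `- ⊗_A K`. -/
noncomputable def tensorR (K : DGBimod A B) : DGFunctor C A C B where
  obj M := M.tensor K
  map f := tensorRMap K f
  map_add {M N p} f g := tensor_ext fun i j n l hij hn m x => by
    rw [add_f, tensorRMap_tm K _ i j n l (i + p) hij hn rfl (by lia),
      tensorRMap_tm K _ i j n l (i + p) hij hn rfl (by lia),
      tensorRMap_tm K _ i j n l (i + p) hij hn rfl (by lia), add_f, map_add, LinearMap.add_apply]
  map_smul {M N p} c f := tensor_ext fun i j n l hij hn m x => by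
    rw [smul_f, tensorRMap_tm K _ i j n l (i + p) hij hn rfl (by lia),
      tensorRMap_tm K _ i j n l (i + p) hij hn rfl (by lia), smul_f, map_smul,
      LinearMap.smul_apply]
  map_id M := tensor_ext fun i j n l hij hn m x => by
    obtain rfl : l = n := by lia
    rw [tensorRMap_tm K _ i j l l i hij hn (by lia) hij, GHom.id_f, GHom.id_f]
  map_comp {M N L p q r} f g h := tensor_ext fun i j n l hij hn m x => by
    rw [GHom.comp_f _ _ _ n (n + p) l hn rfl (by lia),
      tensorRMap_tm K _ i j n l (i + r) hij hn rfl (by lia),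
      tensorRMap_tm K _ i j n (n + p) (i + p) hij rfl rfl (by lia),
      tensorRMap_tm K _ (i + p) j (n + p) l (i + r) (by lia) (by lia) (by lia) (by lia),
      GHom.comp_f _ _ _ i (i + p) (i + r) rfl rfl (by lia)]
  map_D {M N p q} f h := tensor_ext fun i j n l hij hn m x => by
    rw [tensorRMap_tm K _ i j n l (i + q) hij hn rfl (by lia),
      D_f f h i (i + p) (i + 1) (i + q) rfl rfl (by lia) rfl (by lia),
      D_f _ h n (n + p) (n + 1) l hn rfl (by lia) rfl (by lia),
      tensorRMap_tm K _ i j n (n + p) (i + p) hij rfl rfl (by lia),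
      d_tm hij rfl rfl rfl (by lia) (by lia),
      d_tm (i' := i + q) (j' := j + 1) (by lia) (by lia) rfl (by lia) (by lia) (by lia), map_add,
      map_sign,
      tensorRMap_tm K _ (i + 1) j (n + 1) l (i + q) (by lia) (by lia) (by lia) (by lia),
      tensorRMap_tm K _ i (j + 1) (n + 1) l (i + p) (by lia) (by lia) (by lia) (by lia), map_sub,
      LinearMap.sub_apply, map_sign, sign_apply, smul_add, smul_smul, Int.negOnePow_add,
      mul_comm i.negOnePow]
    abel

/-- The graded map `1 ⊗ f`. -/
noncomputable def tensorLMap (X : DGBimod C A) {M N : DGBimod A B} (f : GHom M N p) :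
    GHom (X.tensor M) (X.tensor N) p :=
  tdesc (fun i j n h => (p * i).negOnePow • (tm X N i (j + p) n (by lia)).compl₂
    (f.f j (j + p) rfl))
  (fun i l j il lj n hil hlj h h' m a x => by
    subst hil
    simp only [LinearMap.smul_apply, LinearMap.compl₂_apply]
    rw [f.map_lmul l j lj (j + p) (lj + p) hlj rfl rfl (by lia),
      tm_balanced rfl (by lia : l + (j + p) = lj + p) _ (by lia), map_sign, smul_smul,
      mul_add, Int.negOnePow_add])
  (fun c i j ci l n hci h h' h'' a m x => by
    subst hci
    simp only [LinearMap.smul_apply, LinearMap.compl₂_apply]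
    rw [map_sign, lmul_tm _ _ rfl (by lia), smul_smul,
      mul_add, Int.negOnePow_add])
  (fun i j b jb l n hjb h h' h'' m x y => by
    simp only [LinearMap.smul_apply, LinearMap.compl₂_apply]
    rw [f.map_rmul j b jb (j + p) (jb + p) hjb rfl rfl (by lia), map_sign,
      sign_apply, rmul_tm _ _ (by lia : j + p + b = jb + p)])

@[simp] lemma tensorLMap_tm (X : DGBimod C A) (f : GHom K K' p) (i j n l j' : ℤ) (hij : i + j = n)
    (h : n + p = l) (hj : j + p = j') (h' : i + j' = l) (m : X.X i) (x : K.X j) :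
    (tensorLMap X f).f n l h (tm X K i j n hij m x) =
      (p * i).negOnePow • tm X K' i j' l h' m (f.f j j' hj x) := by
  subst hj
  rw [tensorLMap, tdesc_tm, sign_apply, sign_apply, LinearMap.compl₂_apply]

/-- The dg functor `X ⊗_A -`, with `(1 ⊗ g)(x ⊗ m) = (-1)^(|g||x|) x ⊗ g m`. -/
noncomputable def tensorL (B : DGAlgebra k) (X : DGBimod C A) : DGFunctor A B C B where
  obj M := X.tensor M
  map {M N p} f := tensorLMap X f
  map_add {M N p} f g := tensor_ext fun i j n l hij hn m x => by
    rw [add_f, tensorLMap_tm X _ i j n l (j + p) hij hn rfl (by lia),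
      tensorLMap_tm X _ i j n l (j + p) hij hn rfl (by lia),
      tensorLMap_tm X _ i j n l (j + p) hij hn rfl (by lia), add_f, map_add, smul_add]
  map_smul {M N p} c f := tensor_ext fun i j n l hij hn m x => by
    rw [smul_f, tensorLMap_tm X _ i j n l (j + p) hij hn rfl (by lia),
      tensorLMap_tm X _ i j n l (j + p) hij hn rfl (by lia), smul_f, map_smul, sign_comm]
  map_id M := tensor_ext fun i j n l hij hn m x => by
    obtain rfl : l = n := by lia
    rw [tensorLMap_tm X _ i j l l j hij hn (by lia) hij, GHom.id_f, GHom.id_f, zero_mul,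
      Int.negOnePow_zero, one_smul]
  map_comp {M N L p q r} f g h := tensor_ext fun i j n l hij hn m x => by
    rw [GHom.comp_f _ _ _ n (n + p) l hn rfl (by lia),
      tensorLMap_tm X _ i j n l (j + r) hij hn rfl (by lia),
      tensorLMap_tm X _ i j n (n + p) (j + p) hij rfl rfl (by lia), map_sign,
      tensorLMap_tm X _ i (j + p) (n + p) l (j + r) (by lia) (by lia) (by lia) (by lia),
      GHom.comp_f _ _ _ j (j + p) (j + r) rfl rfl (by lia), smul_smul,
      show (r * i).negOnePow = (p * i).negOnePow * (q * i).negOnePow by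
        rw [← h, add_mul, Int.negOnePow_add]]
  map_D {M N p q} f h := tensor_ext fun i j n l hij hn m x => by
    rw [tensorLMap_tm X _ i j n l (j + q) hij hn rfl (by lia),
      D_f f h j (j + p) (j + 1) (j + q) rfl rfl (by lia) rfl (by lia),
      D_f _ h n (n + p) (n + 1) l hn rfl (by lia) rfl (by lia),
      tensorLMap_tm X _ i j n (n + p) (j + p) hij rfl rfl (by lia),
      d_tm hij rfl rfl rfl (by lia) (by lia), map_sign,
      d_tm (i' := i + 1) (j' := j + q) (by lia) rfl (by lia) (by lia) (by lia) (by lia), map_add,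
      map_sign,
      tensorLMap_tm X _ (i + 1) j (n + 1) l (j + p) (by lia) (by lia) (by lia) (by lia),
      tensorLMap_tm X _ i (j + 1) (n + 1) l (j + q) (by lia) (by lia) (by lia) (by lia), map_sub,
      map_sign, show (q * i).negOnePow = (p * i).negOnePow * i.negOnePow by
        rw [← h, add_mul, one_mul, Int.negOnePow_add]]
    have e2 : p.negOnePow * (p * (i + 1)).negOnePow = (p * i).negOnePow := by
      rw [mul_add, mul_one, Int.negOnePow_add, mul_comm (p * i).negOnePow, ← mul_assoc,
        Int.units_mul_self, one_mul]
    simp only [smul_add, smul_sub, smul_smul]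
    rw [e2, mul_comm i.negOnePow (p * i).negOnePow,
      mul_comm ((p * i).negOnePow * i.negOnePow) p.negOnePow]
    abel

end Tensor

end DGBimod

namespace DGBimod

variable {k : Type u} [Field k] {A B C E : DGAlgebra k}

open GHom

/-! ### Bimodules over the ground field -/

/-- The scalar underlying an element of the ground field viewed as a dg algebra. -/
def coeff (k : Type u) [Field k] (i : ℤ) : (DGAlgebra.base k).X i →ₗ[k] k :=
  (DGAlgebra.basePart k i).subtype

lemma coeff_eq_zero {i : ℤ} (hi : i ≠ 0) (c : (DGAlgebra.base k).X i) : coeff k i c = 0 := c.2 hi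

lemma coeff_injective (i : ℤ) : Function.Injective (coeff k i) := Subtype.val_injective

lemma coeff_one : coeff k 0 (DGAlgebra.base k).one = 1 := rfl

lemma coeff_mul (i j n : ℤ) (h : i + j = n) (c : (DGAlgebra.base k).X i)
    (c' : (DGAlgebra.base k).X j) :
    coeff k n ((DGAlgebra.base k).mul i j n h c c') = coeff k i c * coeff k j c' := rfl

lemma base_eq_zero {i : ℤ} (hi : i ≠ 0) (c : (DGAlgebra.base k).X i) : c = 0 :=
  coeff_injective i (by rw [coeff_eq_zero hi, map_zero])

lemma base_eq_smul_one (c : (DGAlgebra.base k).X 0) :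
    c = coeff k 0 c • (DGAlgebra.base k).one :=
  coeff_injective 0 (by rw [map_smul, coeff_one, smul_eq_mul, mul_one])

lemma base_d (i j : ℤ) (h : i + 1 = j) (c : (DGAlgebra.base k).X i) :
    (DGAlgebra.base k).d i j h c = 0 := rfl

lemma base_lmul (M : DGBimod (DGAlgebra.base k) B) (n : ℤ) (h : 0 + n = n)
    (c : (DGAlgebra.base k).X 0) (x : M.X n) : M.lmul 0 n n h c x = coeff k 0 c • x := by
  conv_lhs => rw [base_eq_smul_one c]
  rw [map_smul, LinearMap.smul_apply, M.one_lmul]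

lemma base_rmul (M : DGBimod A (DGAlgebra.base k)) (n : ℤ) (h : n + 0 = n)
    (c : (DGAlgebra.base k).X 0) (x : M.X n) : M.rmul n 0 n h x c = coeff k 0 c • x := by
  conv_lhs => rw [base_eq_smul_one c]
  rw [map_smul, M.rmul_one]

/-- Over the ground field, compatibility with the left action is automatic. -/
lemma base_map_lmul {M N : DGBimod (DGAlgebra.base k) B} {p : ℤ}
    (f : ∀ i j : ℤ, i + p = j → (M.X i →ₗ[k] N.X j)) (i j n j' n' : ℤ) (h : i + j = n)
    (hj : j + p = j') (hn : n + p = n') (h' : i + j' = n') (a : (DGAlgebra.base k).X i)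
    (x : M.X j) : f n n' hn (M.lmul i j n h a x) =
      (p * i).negOnePow • N.lmul i j' n' h' a (f j j' hj x) := by
  by_cases hi : i = 0
  · subst hi
    obtain rfl : j = n := by lia
    obtain rfl : j' = n' := by lia
    rw [base_lmul, base_lmul, map_smul, mul_zero, Int.negOnePow_zero, one_smul]
  · rw [base_eq_zero hi a]
    simp

/-- Over the ground field, compatibility with the right action is automatic. -/
lemma base_map_rmul {M N : DGBimod A (DGAlgebra.base k)} {p : ℤ}
    (f : ∀ i j : ℤ, i + p = j → (M.X i →ₗ[k] N.X j)) (i j n i' n' : ℤ) (h : i + j = n)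
    (hi : i + p = i') (hn : n + p = n') (h' : i' + j = n') (x : M.X i)
    (b : (DGAlgebra.base k).X j) : f n n' hn (M.rmul i j n h x b) =
      N.rmul i' j n' h' (f i i' hi x) b := by
  by_cases hj : j = 0
  · subst hj
    obtain rfl : i = n := by lia
    obtain rfl : i' = n' := by lia
    rw [base_rmul, base_rmul, map_smul]
  · rw [base_eq_zero hj b]
    simp

/-- A graded map of complexes of vector spaces. -/
def GHom.mkBase {M N : DGBimod (DGAlgebra.base k) (DGAlgebra.base k)} {p : ℤ}
    (f : ∀ i j : ℤ, i + p = j → (M.X i →ₗ[k] N.X j)) : GHom M N p :=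
  mk' f (base_map_lmul f) (base_map_rmul f)

section OfCx

variable (X : ℤ → Type u) [∀ i, AddCommGroup (X i)] [∀ i, Module k (X i)]

/-- The identity `X j → X n` if `j = n` and zero otherwise. -/
def castOr (j n : ℤ) : X j →ₗ[k] X n := if h : j = n then h ▸ LinearMap.id else 0

@[simp] lemma castOr_self (n : ℤ) : castOr (k := k) X n n = LinearMap.id := by simp [castOr]

/-- A complex of vector spaces as a dg bimodule over the ground field. -/
def ofCx (d : ∀ i j : ℤ, i + 1 = j → X i →ₗ[k] X j)
    (d_d : ∀ (i j l : ℤ) (hij : i + 1 = j) (hjl : j + 1 = l) (x : X i),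
      d j l hjl (d i j hij x) = 0) :
    DGBimod (DGAlgebra.base k) (DGAlgebra.base k) where
  X := X
  d := d
  lmul i j n _ := (LinearMap.lsmul k (X n)).compl₁₂ (coeff k i) (castOr X j n)
  rmul i j n _ := ((LinearMap.lsmul k (X n)).compl₁₂ (coeff k j) (castOr X i n)).flip
  d_d := d_d
  lmul_lmul i j l ij jl n hij hjl h h' a b x := by
    by_cases hi : i = 0
    · by_cases hj : j = 0
      · subst hi hj
        obtain rfl : ij = 0 := by lia
        obtain rfl : l = n := by lia
        obtain rfl : jl = l := by lia
        simp [coeff_mul, mul_smul, smul_comm (coeff k 0 b)]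
      · simp [coeff_mul, coeff_eq_zero hj]
    · simp [coeff_mul, coeff_eq_zero hi]
  rmul_rmul i j l ij jl n hij hjl h h' x b c := by
    by_cases hl : l = 0
    · by_cases hj : j = 0
      · subst hl hj
        obtain rfl : jl = 0 := by lia
        obtain rfl : ij = n := by lia
        obtain rfl : i = ij := by lia
        simp [coeff_mul, mul_smul, smul_comm (coeff k 0 b)]
      · simp [coeff_mul, coeff_eq_zero hj]
    · simp [coeff_mul, coeff_eq_zero hl]
  lmul_rmul i j l ij jl n hij hjl h h' a x b := by
    by_cases hi : i = 0
    · by_cases hl : l = 0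
      · subst hi hl
        obtain rfl : ij = n := by lia
        obtain rfl : j = ij := by lia
        obtain rfl : jl = j := by lia
        simp [smul_comm (coeff k 0 b)]
      · simp [coeff_eq_zero hl]
    · simp [coeff_eq_zero hi]
  one_lmul i h x := by simp [coeff_one]
  rmul_one i h x := by simp [coeff_one]
  d_lmul i j n i' j' n' h hi hj hn h₁ h₂ a x := by
    by_cases hi : i = 0
    · subst hi
      obtain rfl : j = n := by lia
      obtain rfl : j' = n' := by lia
      simp [base_d]
    · simp [base_d, coeff_eq_zero hi]
  d_rmul i j n i' j' n' h hi hj hn h₁ h₂ x b := by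
    by_cases hj : j = 0
    · subst hj
      obtain rfl : i = n := by lia
      obtain rfl : i' = n' := by lia
      simp [base_d]
    · simp [base_d, coeff_eq_zero hj]

end OfCx

/-! ### Forgetful functors -/

/-- Forgetting the left action, as a dg functor. -/
def forgetLeftF (A B : DGAlgebra k) : DGFunctor A B (DGAlgebra.base k) B where
  obj M := M.forgetLeft
  map {M N _} f := mk' (M := M.forgetLeft) (N := N.forgetLeft) (fun i j h => f.f i j h)
    (base_map_lmul (M := M.forgetLeft) (N := N.forgetLeft) fun i j h => f.f i j h)
    (fun i j n i' n' h hi hn h' x b => f.map_rmul i j n i' n' h hi hn h' x b)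
  map_add _ _ := rfl
  map_smul _ _ := rfl
  map_id _ := rfl
  map_comp _ _ _ := rfl
  map_D _ _ := rfl

/-- Forgetting the right action, as a dg functor. -/
def forgetRightF (A B : DGAlgebra k) : DGFunctor A B A (DGAlgebra.base k) where
  obj M := M.forgetRight
  map {M N _} f := mk' (M := M.forgetRight) (N := N.forgetRight) (fun i j h => f.f i j h)
    (fun i j n j' n' h hj hn h' a x => f.map_lmul i j n j' n' h hj hn h' a x)
    (base_map_rmul (M := M.forgetRight) (N := N.forgetRight) fun i j h => f.f i j h)
  map_add _ _ := rfl
  map_smul _ _ := rfl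
  map_id _ := rfl
  map_comp _ _ _ := rfl
  map_D _ _ := rfl

/-! ### Morphism complexes -/

/-- `D` as a linear map. -/
def GHom.Dl (M N : DGBimod A B) (p q : ℤ) (h : p + 1 = q) : GHom M N p →ₗ[k] GHom M N q where
  toFun f := f.D h
  map_add' f g := D_add f g h
  map_smul' c f := D_smul c f h

/-- The morphism complex `Hom(M, N)`. -/
def homCx (M N : DGBimod A B) : DGBimod (DGAlgebra.base k) (DGAlgebra.base k) :=
  ofCx (fun n => GHom M N n) (fun i j h => GHom.Dl M N i j h) (fun _ _ _ h h' f => D_D f h h')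

/-- The dg functor `Hom(T, -)`. -/
def homF (T : DGBimod A B) : DGFunctor A B (DGAlgebra.base k) (DGAlgebra.base k) where
  obj N := homCx T N
  map {M N p} f := mkBase (M := homCx T M) (N := homCx T N) fun i j h =>
    { toFun := fun g : GHom T M i => (g.comp f h : GHom T N j)
      map_add' := fun g g' => add_comp g g' f h
      map_smul' := fun c g => smul_comp c g f h }
  map_add {M N p} f g := by
    ext i j h e
    exact comp_add (M := T) e f g h
  map_smul {M N p} c f := by
    ext i j h e
    exact comp_smul (M := T) c e f h
  map_id M := by
    ext i j h e
    obtain rfl : j = i := by lia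
    exact comp_id (M := T) e h
  map_comp {M N L p q r} f g h := by
    ext i j hij e
    exact (comp_assoc (M := T) e f g rfl (by lia) h hij).symm
  map_D {M N p q} f h := by
    ext i j hij e
    rw [D_f _ h i (i + p) (i + 1) j hij rfl (by lia) rfl (by lia)]
    have := D_comp (M := T) e f (r := i + p) (s := j) rfl (by lia) rfl h hij (by lia)
    change GHom.comp (M := T) e (f.D h) hij = (GHom.comp (M := T) e f rfl).D (by lia) -
      p.negOnePow • (GHom.D (M := T) e rfl).comp f (by lia)
    exact eq_sub_of_add_eq this.symm

lemma dual_d_apply (M : DGBimod A B) (i j : ℤ) (h : i + 1 = j) (φ : M.dual.X i) (x : M.X (-j)) :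
    (show Module.Dual k (M.X (-j)) from M.dual.d i j h φ) x =
      -(i.negOnePow • (show Module.Dual k (M.X (-i)) from φ) (M.d (-j) (-i) (by lia) x)) := rfl

/-- The map `φ ↦ (g ↦ (-1)^|f| φ (g ∘ f))`. -/
def dhomMap (Y : DGBimod A B) {M N : DGBimod A B} {p : ℤ} (f : GHom M N p) :
    GHom (homCx M Y).dual (homCx N Y).dual p :=
  p.negOnePow • mkBase (M := (homCx M Y).dual) (N := (homCx N Y).dual) fun i j h =>
    (Module.Dual.transpose (R := k) (M := GHom N Y (-j)) (M' := GHom M Y (-i))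
      { toFun := fun g => f.comp g (by lia)
        map_add' := fun g g' => comp_add f g g' _
        map_smul' := fun c g => comp_smul c f g _ })

/-- Evaluation of a functional on the morphism complex. -/
def homEval {M Y : DGBimod A B} {i j : ℤ} (φ : (homCx M Y).dual.X i) (_ : i + j = 0) :
    Module.Dual k (GHom M Y j) :=
  (show Module.Dual k (GHom M Y (-i)) from φ) ∘ₗ
    (castOr (k := k) (fun n => GHom M Y n) j (-i))

lemma homEval_self {M Y : DGBimod A B} {i : ℤ} (φ : (homCx M Y).dual.X i) (h : i + -i = 0) :
    homEval φ h = φ := by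
  rw [homEval, castOr_self]
  rfl

lemma homEval_ext {M Y : DGBimod A B} {i j : ℤ} (h : i + j = 0) {φ ψ : (homCx M Y).dual.X i}
    (e : ∀ g : GHom M Y j, homEval φ h g = homEval ψ h g) : φ = ψ := by
  obtain rfl : j = -i := by lia
  rw [← homEval_self φ h, ← homEval_self ψ h]
  exact LinearMap.ext e

@[simp] lemma homEval_add {M Y : DGBimod A B} {i j : ℤ} (φ ψ : (homCx M Y).dual.X i)
    (h : i + j = 0) (g : GHom M Y j) : homEval (φ + ψ) h g = homEval φ h g + homEval ψ h g := rfl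

@[simp] lemma homEval_sub {M Y : DGBimod A B} {i j : ℤ} (φ ψ : (homCx M Y).dual.X i)
    (h : i + j = 0) (g : GHom M Y j) : homEval (φ - ψ) h g = homEval φ h g - homEval ψ h g := rfl

@[simp] lemma homEval_smul {M Y : DGBimod A B} {i j : ℤ} (c : k) (φ : (homCx M Y).dual.X i)
    (h : i + j = 0) (g : GHom M Y j) : homEval (c • φ) h g = c • homEval φ h g := rfl

@[simp] lemma homEval_sign {M Y : DGBimod A B} {i j : ℤ} (c : ℤˣ) (φ : (homCx M Y).dual.X i)
    (h : i + j = 0) (g : GHom M Y j) : homEval (c • φ) h g = c • homEval φ h g := by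
  rcases Int.units_eq_one_or c with rfl | rfl
  · simp
  · rw [Units.neg_smul, one_smul, Units.neg_smul, one_smul]
    rfl

lemma homEval_d {M Y : DGBimod A B} {i i' j j' : ℤ} (φ : (homCx M Y).dual.X i) (hi : i + 1 = i')
    (h' : i' + j' = 0) (h : i + j = 0) (hj : j' + 1 = j) (g : GHom M Y j') :
    homEval ((homCx M Y).dual.d i i' hi φ) h' g = -(i.negOnePow • homEval φ h (g.D hj)) := by
  obtain rfl : j = -i := by lia
  obtain rfl : j' = -i' := by lia
  rw [homEval_self, homEval_self]
  rfl

lemma homEval_dhomMap {M N Y : DGBimod A B} {p i l j j' : ℤ} (f : GHom M N p)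
    (φ : (homCx M Y).dual.X i) (hl : i + p = l) (h' : l + j' = 0) (h : i + j = 0) (hj : p + j' = j)
    (g : GHom N Y j') :
    homEval ((dhomMap Y f).f i l hl φ) h' g = p.negOnePow • homEval φ h (f.comp g hj) := by
  obtain rfl : j = -i := by lia
  obtain rfl : j' = -l := by lia
  rw [dhomMap, sign_f, homEval_sign, homEval_self, homEval_self]
  rfl

/-- The dg functor `Hom(-, Y)^*`, with `f_* φ (g) = (-1)^|f| φ (g ∘ f)`. -/
def dhomF (Y : DGBimod A B) : DGFunctor A B (DGAlgebra.base k) (DGAlgebra.base k) where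
  obj M := (homCx M Y).dual
  map f := dhomMap Y f
  map_add {M N p} f g := by
    ext i l h φ
    refine homEval_ext (add_neg_cancel l) fun e => ?_
    rw [add_f, homEval_add, homEval_dhomMap _ _ h _ (add_neg_cancel i) (by lia),
      homEval_dhomMap _ _ h _ (add_neg_cancel i) (by lia),
      homEval_dhomMap _ _ h _ (add_neg_cancel i) (by lia), add_comp, map_add, smul_add]
  map_smul {M N p} c f := by
    ext i l h φ
    refine homEval_ext (add_neg_cancel l) fun e => ?_
    rw [smul_f, homEval_smul, homEval_dhomMap _ _ h _ (add_neg_cancel i) (by lia),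
      homEval_dhomMap _ _ h _ (add_neg_cancel i) (by lia), smul_comp, map_smul, sign_comm]
  map_id M := by
    ext i l h φ
    obtain rfl : l = i := by lia
    refine homEval_ext (add_neg_cancel l) fun e => ?_
    rw [homEval_dhomMap _ _ h _ (add_neg_cancel l) (by lia), GHom.id_comp, GHom.id_f,
      Int.negOnePow_zero, one_smul]
  map_comp {M N L p q r} f g h := by
    ext i l hil φ
    refine homEval_ext (add_neg_cancel l) fun e => ?_
    rw [GHom.comp_f _ _ _ i (i + p) l hil rfl (by lia),
      homEval_dhomMap _ _ hil _ (add_neg_cancel i) (by lia),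
      homEval_dhomMap _ _ _ _ (add_neg_cancel (i + p)) (by lia),
      homEval_dhomMap _ _ rfl _ (add_neg_cancel i) (by lia), smul_smul,
      comp_assoc f g e h (by lia) (by lia : q + -l = -(i + p)) (by lia),
      show r.negOnePow = q.negOnePow * p.negOnePow by rw [← h, add_comm, Int.negOnePow_add]]
  map_D {M N p q} f h := by
    ext i l hil φ
    refine homEval_ext (add_neg_cancel l) fun e => ?_
    rw [D_f _ h i (i + p) (i + 1) l hil rfl (by lia) rfl (by lia), homEval_sub, homEval_sign,
      homEval_dhomMap _ _ hil _ (add_neg_cancel i) (by lia),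
      homEval_d _ _ _ (add_neg_cancel (i + p)) (by lia),
      homEval_dhomMap _ _ rfl _ (add_neg_cancel i) (by lia),
      homEval_dhomMap _ _ (by lia : i + 1 + p = l) _ (by lia : i + 1 + (-i - 1) = 0) (by lia),
      homEval_d _ _ _ (add_neg_cancel i) (by lia),
      D_comp f e (r := -i - 1) (s := -i) _ _ h (rfl : -l + 1 = -l + 1) (by lia) (by lia), map_add,
        map_sign,
      show (i + p).negOnePow = i.negOnePow * p.negOnePow from Int.negOnePow_add _ _,
      show (-l).negOnePow = i.negOnePow * q.negOnePow by
        rw [← hil, Int.negOnePow_neg, Int.negOnePow_add]]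
    simp only [smul_neg, smul_add, smul_smul]
    have e1 : i.negOnePow * p.negOnePow * p.negOnePow = i.negOnePow := by
      rw [mul_assoc, Int.units_mul_self, mul_one]
    have e2 : p.negOnePow * (p.negOnePow * i.negOnePow) = i.negOnePow := by
      rw [← mul_assoc, Int.units_mul_self, one_mul]
    have e3 : p.negOnePow * (p.negOnePow * (i.negOnePow * (i.negOnePow * q.negOnePow))) =
        q.negOnePow := by
      rw [← mul_assoc i.negOnePow, Int.units_mul_self, one_mul, ← mul_assoc, Int.units_mul_self,
        one_mul]
    rw [e1, e2, e3]
    have e5 : ∀ a b : k, b = -a - -(a + b) := by intros; ring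
    exact e5 _ _

/-! ### Cones of natural transformations -/

/-- The map induced on cones by a commutative square. -/
def coneMap {M N M' N' : DGBimod C E} {p : ℤ} (α : M ⟶ N) (β : M' ⟶ N')
    (f : GHom M M' p) (g : GHom N N' p) : GHom (cone α) (cone β) p :=
  mk' (M := cone α) (N := cone β)
    (fun i j h => (p.negOnePow • f.f (i + 1) (j + 1) (by lia)).prodMap (g.f i j h))
    (fun i j n j' n' h hj hn h' a x => by
      refine Prod.ext ?_ (g.map_lmul i j n j' n' h hj hn h' a x.2)
      change p.negOnePow • f.f (n + 1) (n' + 1) _ (i.negOnePow • M.lmul i (j + 1) (n + 1) _ a x.1) =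
        (p * i).negOnePow • i.negOnePow • M'.lmul i (j' + 1) (n' + 1) _ a
          (p.negOnePow • f.f (j + 1) (j' + 1) _ x.1)
      rw [map_sign, f.map_lmul i (j + 1) (n + 1) (j' + 1) (n' + 1) (by lia) (by lia) (by lia)
        (by lia), map_sign, smul_smul, smul_smul, smul_smul, smul_smul]
      congr 1
      ac_rfl)
    (fun i j n i' n' h hi hn h' x b => by
      refine Prod.ext ?_ (g.map_rmul i j n i' n' h hi hn h' x.2 b)
      change p.negOnePow • f.f (n + 1) (n' + 1) _ (M.rmul (i + 1) j (n + 1) _ x.1 b) =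
        M'.rmul (i' + 1) j (n' + 1) _ (p.negOnePow • f.f (i + 1) (i' + 1) _ x.1) b
      rw [f.map_rmul (i + 1) j (n + 1) (i' + 1) (n' + 1) (by lia) (by lia) (by lia) (by lia),
        map_sign, sign_apply])

lemma coneMap_f {M N M' N' : DGBimod C E} {p : ℤ} (α : M ⟶ N) (β : M' ⟶ N')
    (f : GHom M M' p) (g : GHom N N' p) (i j : ℤ) (h : i + p = j) (z : (cone α).X i) :
    (coneMap α β f g).f i j h z = (p.negOnePow • f.f (i + 1) (j + 1) (by lia) z.1, g.f i j h z.2) :=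
  rfl

lemma coneMap_comp {M N M' N' M'' N'' : DGBimod C E} {p q r : ℤ} (α : M ⟶ N) (β : M' ⟶ N')
    (γ : M'' ⟶ N'') (f : GHom M M' p) (g : GHom N N' p) (f' : GHom M' M'' q) (g' : GHom N' N'' q)
    (h : p + q = r) :
    (coneMap α β f g).comp (coneMap β γ f' g') h = coneMap α γ (f.comp f' h) (g.comp g' h) := by
  ext i j hij z
  rw [GHom.comp_f _ _ h i (i + p) j hij rfl (by lia)]
  refine Prod.ext ?_ (GHom.comp_f g g' h i (i + p) j hij rfl (by lia) z.2).symm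
  change q.negOnePow • f'.f (i + p + 1) (j + 1) _ (p.negOnePow • f.f (i + 1) (i + p + 1) _ z.1) =
    r.negOnePow • (f.comp f' h).f (i + 1) (j + 1) _ z.1
  rw [GHom.comp_f f f' h (i + 1) (i + p + 1) (j + 1) (by lia) (by lia) (by lia), map_sign,
    smul_smul,
    show r.negOnePow = q.negOnePow * p.negOnePow by rw [← h, add_comm, Int.negOnePow_add]]

lemma coneMap_D {M N M' N' : DGBimod C E} {p q : ℤ} (α : M ⟶ N) (β : M' ⟶ N')
    (f : GHom M M' p) (g : GHom N N' p) (h : p + 1 = q)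
    (sq : ∀ i j (hij : i + p = j) x, Hom.f β j (f.f i j hij x) = g.f i j hij (Hom.f α i x)) :
    (coneMap α β f g).D h = coneMap α β (f.D h) (g.D h) := by
  ext i j hij z
  obtain rfl : j = i + p + 1 := by lia
  rw [D_f _ h i (i + p) (i + 1) _ hij rfl rfl rfl (by lia)]
  refine Prod.ext ?_ ?_
  · change -M'.d (i + p + 1) (i + p + 1 + 1) _ (p.negOnePow • f.f (i + 1) (i + p + 1) _ z.1) -
      p.negOnePow • p.negOnePow • f.f (i + 1 + 1) (i + p + 1 + 1) _ (-M.d (i + 1)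
        (i + 1 + 1) _ z.1) =
      q.negOnePow • (f.D h).f (i + 1) (i + p + 1 + 1) _ z.1
    rw [D_f f h (i + 1) (i + p + 1) (i + 1 + 1) _ (by lia) (by lia) rfl rfl (by lia), map_sign,
      ← h, Int.negOnePow_succ, map_neg, smul_neg, smul_neg, Units.neg_smul, smul_sub]
    abel
  · change Hom.f β (i + p + 1) (p.negOnePow • f.f (i + 1) (i + p + 1) _ z.1) +
      N'.d (i + p) (i + p + 1) _ (g.f i (i + p) _ z.2) -
      p.negOnePow • g.f (i + 1) (i + p + 1) _ (Hom.f α (i + 1) z.1 + N.d i (i + 1) _ z.2) =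
      (g.D h).f i (i + p + 1) _ z.2
    rw [D_f g h i (i + p) (i + 1) _ hij rfl rfl rfl (by lia), map_sign,
      sq _ _ (by lia) z.1, map_add, smul_add]
    abel

/-- The cone of a closed natural transformation of degree zero between dg functors. -/
def coneF (Φ Ψ : DGFunctor A B C E) (η : ∀ M, GHom (Φ.obj M) (Ψ.obj M) 0)
    (hη : ∀ M, (η M).Closed)
    (nat : ∀ {M N : DGBimod A B} {p : ℤ} (f : GHom M N p),
      (Φ.map f).comp (η N) (add_zero p) = (η M).comp (Ψ.map f) (zero_add p)) :
    DGFunctor A B C E where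
  obj M := cone ((η M).toHom (hη M))
  map {M N p} f := coneMap _ _ (Φ.map f) (Ψ.map f)
  map_add {M N p} f g := by
    ext i j h z
    rw [add_f, coneMap_f, coneMap_f, coneMap_f, Φ.map_add, Ψ.map_add, add_f, add_f, smul_add]
    rfl
  map_smul {M N p} c f := by
    ext i j h z
    rw [smul_f, coneMap_f, coneMap_f, Φ.map_smul, Ψ.map_smul, smul_f, smul_f, sign_comm]
    rfl
  map_id M := by
    rw [Φ.map_id, Ψ.map_id]
    refine ext_zero fun i x => ?_
    rw [coneMap_f, Int.negOnePow_zero, one_smul, GHom.id_f, GHom.id_f, GHom.id_f]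
    rfl
  map_comp {M N L p q r} f g h := by
    rw [coneMap_comp, Φ.map_comp, Ψ.map_comp]
  map_D {M N p q} f h := by
    rw [coneMap_D, Φ.map_D, Ψ.map_D]
    intro i j hij x
    have := congr_f (nat f) i j hij x
    rwa [GHom.comp_f _ _ _ i j j hij hij (add_zero j),
      GHom.comp_f _ _ _ i i j hij (add_zero i) hij] at this

/-- A closed natural transformation that is a quasi-isomorphism on `Y` is one on `⟨Y⟩`, because
its cones are the values of a dg functor. -/
lemma quasiIso_of_thick {Y X : HoBimod A B} (hX : HoBimod.thick Y X) (Φ Ψ : DGFunctor A B C E)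
    (η : ∀ M, GHom (Φ.obj M) (Ψ.obj M) 0) (hη : ∀ M, (η M).Closed)
    (nat : ∀ {M N : DGBimod A B} {p : ℤ} (f : GHom M N p),
      (Φ.map f).comp (η N) (add_zero p) = (η M).comp (Ψ.map f) (zero_add p))
    (hY : QuasiIso ((η Y.as).toHom (hη Y.as))) : QuasiIso ((η X.as).toHom (hη X.as)) := by
  rw [quasiIso_iff_acyclic_cone] at *
  exact acyclic_obj_of_thick hX (coneF Φ Ψ η hη nat) hY

end DGBimod

namespace DGBimod

variable {k : Type u} [Field k] {A B C E : DGAlgebra k}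

open GHom

/-! ### Associativity and units of the tensor product -/

lemma tm_induction {M : DGBimod C A} {K : DGBimod A B} {n : ℤ} {P : (M.tensor K).X n → Prop}
    (h : ∀ i j hij (m : M.X i) (x : K.X j), P (tm M K i j n hij m x))
    (h0 : P 0) (hadd : ∀ z w, P z → P w → P (z + w)) (z : (M.tensor K).X n) : P z :=
  Tensor.induction M K h h0 hadd z

/-- An isomorphism of degree zero from a closed map with an inverse on each component. -/
noncomputable def GIso.ofInv {M N : DGBimod A B} (f : GHom M N 0) (hf : f.Closed)
    (g : ∀ i, N.X i →ₗ[k] M.X i) (h₁ : ∀ i x, g i (f.f i i (add_zero i) x) = x)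
    (h₂ : ∀ i x, f.f i i (add_zero i) (g i x) = x) : GIso M N 0 :=
  GIso.ofBijective f hf fun i j h => by
    obtain rfl : i = j := by lia
    exact Function.bijective_iff_has_inverse.2 ⟨g i, h₁ i, h₂ i⟩

section Assoc

variable (M : DGBimod E C) (K : DGBimod C A) (L : DGBimod A B)

/-- The associativity map `(m ⊗ x) ⊗ y ↦ m ⊗ (x ⊗ y)`. -/
noncomputable def assocHom : GHom ((M.tensor K).tensor L) (M.tensor (K.tensor L)) 0 :=
  tdesc (fun i j n h => tlift (fun p q hpq => LinearMap.mk₂ k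
      (fun m x => (tm M (K.tensor L) p (q + j) n (by lia) m) ∘ₗ (tm K L q j (q + j) rfl x))
      (by intros; ext; simp) (by intros; ext; simp) (by intros; ext; simp) (by intros; ext; simp))
    (fun p l q pl lq hpl hlq h h' m a x => by
      ext y
      simp only [LinearMap.mk₂_apply, LinearMap.comp_apply]
      rw [tm_balanced hpl (by lia : l + (q + j) = lq + j) _ (by lia), lmul_tm _ rfl hlq]))
    (fun i l j il lj n hil hlj h h' z a y => by
      induction z using tm_induction with
      | h0 => simp
      | hadd z w hz hw => simp only [map_add, LinearMap.add_apply, hz, hw]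
      | h p q hpq m x =>
        subst hlj
        rw [rmul_tm _ hpq rfl (by lia), tlift_tm, tlift_tm]
        simp only [LinearMap.mk₂_apply, LinearMap.comp_apply]
        have (a b : ℤ) (h : a = b) (h1 : p + a = n) (h2 : p + b = n) (z : (K.tensor L).X a) :
            tm M (K.tensor L) p a n h1 m z = tm M (K.tensor L) p b n h2 m
              ((K.tensor L).castX a b h z) := by subst h; rfl
        rw [this _ (q + (l + j)) (by lia) _ (by lia), ← tm_balanced rfl rfl (by lia) (by lia)]
        have (a b : ℤ) (h : a = b) (h1 : q + l + j = a) (h2 : q + l + j = b) (x' : K.X (q + l))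
          (y : L.X j) :
            (K.tensor L).castX a b h (tm K L (q + l) j a h1 x' y) = tm K L (q + l) j b h2 x' y := by
          subst h; rfl
        rw [this])
    (fun c i j ci l n hci h h' h'' a z y => by
      induction z using tm_induction with
      | h0 => simp
      | hadd z w hz hw => simp only [map_add, LinearMap.add_apply, hz, hw, smul_add]
      | h p q hpq m x =>
        rw [lmul_tm hci hpq rfl (by lia), tlift_tm, tlift_tm]
        simp only [LinearMap.mk₂_apply, LinearMap.comp_apply]
        rw [lmul_tm _ _ rfl, zero_mul, Int.negOnePow_zero, one_smul])
    (fun i j b jb l n hjb h h' h'' z y c => by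
      induction z using tm_induction with
      | h0 => simp
      | hadd z w hz hw => simp only [map_add, LinearMap.add_apply, hz, hw]
      | h p q hpq m x =>
        rw [tlift_tm, tlift_tm]
        simp only [LinearMap.mk₂_apply, LinearMap.comp_apply]
        rw [rmul_tm _ _ (by lia : q + j + b = q + jb) (by lia), rmul_tm _ rfl hjb])

lemma assocHom_tm (p q j i s n n' : ℤ) (hpq : p + q = i) (hij : i + j = n) (hs : q + j = s)
    (hn : n + 0 = n') (h : p + s = n') (m : M.X p) (x : K.X q) (y : L.X j) :
    (assocHom M K L).f n n' hn (tm (M.tensor K) L i j n hij (tm M K p q i hpq m x) y) =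
      tm M (K.tensor L) p s n' h m (tm K L q j s hs x y) := by
  subst hs
  rw [assocHom, tdesc_tm, tlift_tm]
  rfl

lemma closed_assocHom : (assocHom M K L).Closed :=
  closed_of_tm fun i j n i' j' n' l l' hij hi hj hn h₁ h₂ hl hl' hll z y => by
    obtain rfl : l = n := by lia
    obtain rfl : l' = n' := by lia
    induction z using tm_induction with
    | h0 => simp
    | hadd z w hz hw => 
      simp only [map_add, LinearMap.add_apply, hz, hw, smul_add]
      abel
    | h p q hpq m x =>
      rw [assocHom_tm M K L p q j i (q + j) l l hpq hij rfl hl (by lia),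
        d_tm hpq rfl rfl hi (by lia) (by lia), map_add, LinearMap.add_apply, map_add, map_sign,
        sign_apply, map_sign,
        assocHom_tm M K L (p + 1) q j i' (q + j) l' l' (by lia) h₁ rfl hl' (by lia),
        assocHom_tm M K L p (q + 1) j i' (q + j + 1) l' l' (by lia) h₁ (by lia) hl' (by lia),
        assocHom_tm M K L p q j' i (q + j + 1) l' l' hpq h₂ (by lia) hl' (by lia),
        d_tm (i' := p + 1) (j' := q + j + 1) _ rfl rfl _ (by lia) (by lia),
        d_tm (i' := q + 1) (j' := j') rfl rfl hj rfl (by lia) (by lia), map_add, map_sign,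
        Int.negOnePow_zero, one_smul, smul_add, smul_smul,
        show i.negOnePow = p.negOnePow * q.negOnePow by rw [← hpq, Int.negOnePow_add]]
      exact (add_assoc _ _ _).symm

/-- The inverse of the associativity map. -/
noncomputable def assocInv (n : ℤ) :
    (M.tensor (K.tensor L)).X n →ₗ[k] ((M.tensor K).tensor L).X n :=
  tlift (fun p s h => (tlift (fun q j hqj => LinearMap.mk₂ k
      (fun x y => ((tm (M.tensor K) L (p + q) j n (by lia)).flip y) ∘ₗ
        ((tm M K p q (p + q) rfl).flip x))
      (by intros; ext; simp) (by intros; ext; simp) (by intros; ext; simp) (by intros; ext; simp))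
    (fun q l j ql lj hql hlj h h' x a y => by
      ext m
      simp only [LinearMap.mk₂_apply, LinearMap.comp_apply, LinearMap.flip_apply]
      rw [← tm_balanced (by lia : p + q + l = p + ql) hlj (by lia) _, rmul_tm _ rfl hql])).flip)
    (fun p l s pl ls hpl hls h h' m a z => by
      simp only [LinearMap.flip_apply]
      induction z using tm_induction with
      | h0 => simp
      | hadd z w hz hw => simp only [map_add, LinearMap.add_apply, hz, hw]
      | h q j hqj x y =>
        subst hls hpl
        rw [lmul_tm _ hqj rfl (by lia), tlift_tm, tlift_tm]
        simp only [LinearMap.mk₂_apply, LinearMap.comp_apply, LinearMap.flip_apply]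
        rw [tm_balanced rfl rfl _ (by lia)]
        have (a b : ℤ) (h : a = b) (h1 : a + j = n) (h2 : b + j = n) (h3 : p + (l + q) = a)
            (h4 : p + (l + q) = b) (w : K.X (l + q)) :
            tm (M.tensor K) L a j n h1 (tm M K p (l + q) a h3 m w) y =
              tm (M.tensor K) L b j n h2 (tm M K p (l + q) b h4 m w) y := by subst h; rfl
        exact this _ _ (by lia) _ _ _ _ _)

lemma assocInv_tm (p q j i s n : ℤ) (hpq : p + q = i) (hij : i + j = n) (hs : q + j = s)
    (h : p + s = n) (m : M.X p) (x : K.X q) (y : L.X j) :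
    assocInv M K L n (tm M (K.tensor L) p s n h m (tm K L q j s hs x y)) =
      tm (M.tensor K) L i j n hij (tm M K p q i hpq m x) y := by
  subst hpq
  rw [assocInv, tlift_tm, LinearMap.flip_apply, tlift_tm]
  rfl

/-- `(M ⊗ K) ⊗ L ≅ M ⊗ (K ⊗ L)`. -/
noncomputable def assocIso : GIso ((M.tensor K).tensor L) (M.tensor (K.tensor L)) 0 :=
  GIso.ofInv (assocHom M K L) (closed_assocHom M K L) (assocInv M K L)
    (fun n w => by
      induction w using tm_induction with
      | h0 => simp
      | hadd z w hz hw => simp only [map_add, hz, hw]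
      | h i j hij z y =>
        induction z using tm_induction with
        | h0 => simp
        | hadd z w hz hw => simp only [map_add, LinearMap.add_apply, hz, hw]
        | h p q hpq m x =>
          rw [assocHom_tm M K L p q j i (q + j) n n hpq hij rfl _ (by lia),
            assocInv_tm M K L p q j i (q + j) n hpq hij rfl (by lia)])
    (fun n w => by
      induction w using tm_induction with
      | h0 => simp
      | hadd z w hz hw => simp only [map_add, hz, hw]
      | h p s hps m z =>
        induction z using tm_induction with
        | h0 => simp
        | hadd z w hz hw => simp only [map_add, hz, hw]
        | h q j hqj x y =>
          rw [assocInv_tm M K L p q j (p + q) s n rfl (by lia) hqj hps,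
            assocHom_tm M K L p q j (p + q) s n n rfl (by lia) hqj _ hps])

end Assoc

/-- The unit of `A` as an element of the diagonal bimodule. -/
def diagOne (A : DGAlgebra k) : (diag A).X 0 := A.one

lemma lmul_diagOne (i n : ℤ) (h : i + 0 = n) (a : (diag A).X i) :
    (diag A).lmul i 0 n h a (diagOne A) = (diag A).castX i n (by lia) a := by
  obtain rfl : i = n := by lia
  exact A.mul_one i _ a

lemma rmul_diagOne (i n : ℤ) (h : 0 + i = n) (a : (diag A).X i) :
    (diag A).rmul 0 i n h (diagOne A) a = (diag A).castX i n (by lia) a := by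
  obtain rfl : i = n := by lia
  exact A.one_mul i _ a

section Unit

variable (M : DGBimod C A)

/-- The map `M ⊗_A A → M`, `m ⊗ a ↦ m a`. -/
noncomputable def rightUnitHom : GHom (M.tensor (diag A)) M 0 :=
  tdesc (fun i j n h => M.rmul i j n (by lia))
    (fun i l j il lj n hil hlj h h' m a x => M.rmul_rmul _ _ _ _ _ _ _ _ _ _ _ _ _)
    (fun c i j ci l n hci h h' h'' a m x => by
      rw [zero_mul, Int.negOnePow_zero, one_smul]
      exact M.lmul_rmul _ _ _ _ _ _ _ _ _ _ _ _ _)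
    (fun i j b jb l n hjb h h' h'' m x y => (M.rmul_rmul _ _ _ _ _ _ _ _ _ _ _ _ _).symm)

lemma rightUnitHom_tm (i j n l : ℤ) (hij : i + j = n) (hl : n + 0 = l) (h : i + j = l) (m : M.X i)
    (a : (diag A).X j) :
    (rightUnitHom M).f n l hl (tm M (diag A) i j n hij m a) = M.rmul i j l h m a :=
  tdesc_tm ..

lemma closed_rightUnitHom : (rightUnitHom M).Closed :=
  closed_of_tm fun i j n i' j' n' l l' hij hi hj hn h₁ h₂ hl hl' hll m a => by
    rw [rightUnitHom_tm M i j n l hij hl (by lia), rightUnitHom_tm M i' j n' l' h₁ hl' (by lia),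
      rightUnitHom_tm M i j' n' l' h₂ hl' (by lia), Int.negOnePow_zero, one_smul]
    exact M.d_rmul _ _ _ _ _ _ _ _ _ _ _ _ _ _

/-- `M ⊗_A A ≅ M`. -/
noncomputable def rightUnit : GIso (M.tensor (diag A)) M 0 :=
  GIso.ofInv (rightUnitHom M) (closed_rightUnitHom M)
    (fun n => (tm M (diag A) n 0 n (add_zero n)).flip (diagOne A))
    (fun n w => by
      induction w using tm_induction with
      | h0 => simp
      | hadd z w hz hw => simp only [map_add, hz, hw]
      | h i j hij m a =>
        rw [rightUnitHom_tm M i j n n hij _ hij, LinearMap.flip_apply]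
        refine (tm_balanced hij (add_zero j) _ hij m a (diagOne A)).trans ?_
        rw [lmul_diagOne]
        rfl)
    (fun n m => by
      rw [LinearMap.flip_apply, rightUnitHom_tm M n 0 n n _ _ (add_zero n)]
      exact M.rmul_one _ _ _)

/-- The map `C ⊗_C M → M`, `c ⊗ m ↦ c m`. -/
noncomputable def leftUnitHom : GHom ((diag C).tensor M) M 0 :=
  tdesc (fun i j n h => M.lmul i j n (by lia))
    (fun i l j il lj n hil hlj h h' m a x => M.lmul_lmul _ _ _ _ _ _ _ _ _ _ _ _ _)
    (fun c i j ci l n hci h h' h'' a m x => by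
      rw [zero_mul, Int.negOnePow_zero, one_smul]
      exact M.lmul_lmul _ _ _ _ _ _ _ _ _ _ _ _ _)
    (fun i j b jb l n hjb h h' h'' m x y => (M.lmul_rmul _ _ _ _ _ _ _ _ _ _ _ _ _).symm)

lemma leftUnitHom_tm (i j n l : ℤ) (hij : i + j = n) (hl : n + 0 = l) (h : i + j = l)
    (a : (diag C).X i) (m : M.X j) :
    (leftUnitHom M).f n l hl (tm (diag C) M i j n hij a m) = M.lmul i j l h a m :=
  tdesc_tm ..

lemma closed_leftUnitHom : (leftUnitHom M).Closed :=
  closed_of_tm fun i j n i' j' n' l l' hij hi hj hn h₁ h₂ hl hl' hll m a => by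
    rw [leftUnitHom_tm M i j n l hij hl (by lia), leftUnitHom_tm M i' j n' l' h₁ hl' (by lia),
      leftUnitHom_tm M i j' n' l' h₂ hl' (by lia), Int.negOnePow_zero, one_smul]
    exact M.d_lmul _ _ _ _ _ _ _ _ _ _ _ _ _ _

/-- `C ⊗_C M ≅ M`. -/
noncomputable def leftUnit : GIso ((diag C).tensor M) M 0 :=
  GIso.ofInv (leftUnitHom M) (closed_leftUnitHom M)
    (fun n => tm (diag C) M 0 n n (zero_add n) (diagOne C))
    (fun n w => by
      induction w using tm_induction with
      | h0 => simp
      | hadd z w hz hw => simp only [map_add, hz, hw]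
      | h i j hij c m =>
        rw [leftUnitHom_tm M i j n n hij _ hij]
        refine (tm_balanced (zero_add i) hij hij _ (diagOne C) c m).symm.trans ?_
        rw [rmul_diagOne]
        rfl)
    (fun n m => by
      rw [leftUnitHom_tm M 0 n n n _ _ (zero_add n)]
      exact M.one_lmul _ _ _)

end Unit

/-- `(M ⊗ K).forgetLeft ≅ M.forgetLeft ⊗ K`. -/
noncomputable def forgetLeftTensor (M : DGBimod C A) (K : DGBimod A B) :
    GIso (M.forgetLeft.tensor K) (M.tensor K).forgetLeft 0 :=
  GIso.ofId (fun i => LinearMap.id) (fun i => Function.bijective_id) (fun _ _ _ _ => rfl)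
    (fun i j n h a z => by
      change (M.forgetLeft.tensor K).lmul i j n h a z = (M.tensor K).lmul i j n h (C.unit i a) z
      induction z using tm_induction with
      | h0 => exact (map_zero _).trans (map_zero _).symm
      | hadd z w hz hw => exact (map_add _ z w).trans ((congrArg₂ _ hz hw).trans
          (map_add ((M.tensor K).lmul i j n h (C.unit i a)) z w).symm)
      | h p q hpq m x =>
        rw [lmul_tm h hpq rfl (by lia)]
        exact (lmul_tm (M := M) (K := K) h hpq rfl (by lia) (C.unit i a) m x).symm)
    (fun _ _ _ _ _ _ => rfl)

/-- `(M ⊗ K).forgetRight ≅ M ⊗ K.forgetRight`. -/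
noncomputable def forgetRightTensor (M : DGBimod C A) (K : DGBimod A B) :
    GIso (M.tensor K.forgetRight) (M.tensor K).forgetRight 0 :=
  GIso.ofId (fun i => LinearMap.id) (fun i => Function.bijective_id) (fun _ _ _ _ => rfl)
    (fun _ _ _ _ _ _ => rfl)
    (fun i j n h z b => by
      change (M.tensor K.forgetRight).rmul i j n h z b = (M.tensor K).rmul i j n h z (B.unit j b)
      induction z using tm_induction with
      | h0 =>
        exact (congrArg (fun f => f b) (map_zero ((M.tensor K.forgetRight).rmul i j n h))).trans
          (congrArg (fun f => f (B.unit j b)) (map_zero ((M.tensor K).rmul i j n h))).symm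
      | hadd z w hz hw =>
        exact
          (congrArg (fun f => f b) (map_add ((M.tensor K.forgetRight).rmul i j n h) z w)).trans
            ((congrArg₂ (fun a b : (M.tensor K).X n => a + b) hz hw).trans
              (congrArg (fun f => f (B.unit j b)) (map_add ((M.tensor K).rmul i j n h) z w)).symm)
      | h p q hpq m x =>
        rw [rmul_tm h hpq rfl (by lia)]
        exact (rmul_tm (M := M) (K := K) h hpq rfl (by lia) m x (B.unit j b)).symm)

/-- `X ⊗_A (A ⊗ₖ B) ≅ X ⊗ₖ B`. -/
noncomputable def tensorFree (X : DGBimod C A) (B : DGAlgebra k) :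
    GIso (X.tensor (free A B)) (X.forgetRight.tensor B.regular) 0 :=
  have e₁ : GIso (X.tensor (diag A).forgetRight) X.forgetRight 0 :=
    (forgetRightTensor X (diag A)).trans ((forgetRightF C A).mapGIso (rightUnit X)) (zero_add 0)
  (assocIso X (diag A).forgetRight (diag B).forgetLeft).symm.trans
    ((tensorR C (diag B).forgetLeft).mapGIso e₁) (neg_add_cancel 0)

/-- `(A ⊗ₖ B) ⊗_B M ≅ A ⊗ₖ M`. -/
noncomputable def freeTensor (A : DGAlgebra k) (M : DGBimod B C) :
    GIso ((free A B).tensor M) ((diag A).forgetRight.tensor M.forgetLeft) 0 :=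
  have e₁ : GIso ((diag B).forgetLeft.tensor M) M.forgetLeft 0 :=
    (forgetLeftTensor (diag B) M).trans ((forgetLeftF B C).mapGIso (leftUnit M)) (zero_add 0)
  (assocIso (diag A).forgetRight (diag B).forgetLeft M).trans
    ((tensorL C (diag A).forgetRight).mapGIso e₁) (zero_add 0)

end DGBimod

namespace DGBimod

variable {k : Type u} [Field k] {A B C E : DGAlgebra k}

open GHom

/-! ### Contractible dg bimodules and h-projectivity -/

/-- A dg bimodule is contractible if its identity is null-homotopic. -/
def Contractible (M : DGBimod A B) : Prop := Htpy (GHom.id M) 0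

lemma Contractible.map {M : DGBimod A B} (h : M.Contractible) (Φ : DGFunctor A B C E) :
    (Φ.obj M).Contractible := by
  have := Htpy.map Φ h
  rwa [Φ.map_id, Φ.map_zero] at this

lemma Contractible.acyclic {M : DGBimod A B} (h : M.Contractible) : M.Acyclic := by
  obtain ⟨e, he⟩ := h.exists_D (by lia : (-1 : ℤ) + 1 = 0)
  rw [acyclic_iff]
  intro l n m hl hm x hx
  refine ⟨e.f n l (by lia) x, ?_⟩
  have := congr_f he n n (add_zero n) x
  rw [D_f e _ n l m n _ (by lia) hl hm (by lia), hx, map_zero, smul_zero, sub_zero, sub_f, zero_f,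
    sub_zero, GHom.id_f] at this
  exact this

lemma Contractible.acyclic_obj {M : DGBimod A B} (h : M.Contractible) (Φ : DGFunctor A B C E) :
    (Φ.obj M).Acyclic := (h.map Φ).acyclic

lemma Contractible.htpy_zero {M N : DGBimod A B} (h : N.Contractible) {p : ℤ} (f : GHom M N p)
    (hf : f.Closed) : Htpy f 0 := by
  have := Htpy.comp_left hf h (add_zero p)
  rwa [comp_id, comp_zero] at this

lemma htpy_zero_iff {M N : DGBimod A B} {p q : ℤ} (h : q + 1 = p) (f : GHom M N p) :
    Htpy f 0 ↔ ∃ e : GHom M N q, e.D h = f := by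
  refine ⟨fun hf => ?_, fun ⟨e, he⟩ => Htpy.of_D (e := e) h (by rw [he, sub_zero])⟩
  obtain ⟨e, he⟩ := hf.exists_D h
  exact ⟨e, by rw [he, sub_zero]⟩

lemma acyclic_homCx_iff (M N : DGBimod A B) :
    (homCx M N).Acyclic ↔ ∀ (p : ℤ) (f : GHom M N p), f.Closed → Htpy f 0 := by
  rw [acyclic_iff]
  constructor
  · intro h p f hf
    rw [htpy_zero_iff (sub_add_cancel p 1)]
    exact h (p - 1) p (p + 1) (sub_add_cancel p 1) rfl f (hf.D rfl)
  · intro h l n m hl hm f hf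
    exact (htpy_zero_iff hl f).1 (h n f ((closed_iff f).2 fun q hq => by
      obtain rfl : q = m := by lia
      exact hf))

lemma GIso.acyclic_iff {M N : DGBimod A B} {p : ℤ} (e : GIso M N p) : M.Acyclic ↔ N.Acyclic := by
  rw [acyclic_iff_hdim, acyclic_iff_hdim]
  refine ⟨fun h n => ?_, fun h n => ?_⟩
  · rw [← e.hdim_eq (n - p) n (by lia), h]
  · rw [e.hdim_eq n (n + p) rfl, h]

lemma hProjective_iff (P : DGBimod A B) :
    P.HProjective ↔ ∀ N : DGBimod A B, N.Acyclic → (homCx P N).Acyclic := by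
  constructor
  · intro h N hN
    rw [acyclic_homCx_iff]
    intro p f hf
    let t := GIso.toShift N p
    have h1 : Htpy (f.comp t.hom (add_neg_cancel p)) 0 := by
      rw [← cls_eq_zero_iff (hf := hf.comp t.closed_hom _)]
      exact h _ (t.acyclic_iff.1 hN) _
    have h2 := Htpy.comp_right h1 t.closed_inv (r := p) (by lia)
    rwa [comp_assoc _ _ _ _ _ (by lia : -p + - -p = 0) (add_zero p),
      t.hom_inv, comp_id, zero_comp] at h2
  · intro h N hN φ
    obtain ⟨f, hf, rfl⟩ := exists_cls φ
    exact cls_eq_zero_iff.2 ((acyclic_homCx_iff P N).1 (h N hN) 0 f hf)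

lemma HProjective.htpy_zero {P N : DGBimod A B} (hP : P.HProjective) (hN : N.Acyclic) {p : ℤ}
    (f : GHom P N p) (hf : f.Closed) : Htpy f 0 :=
  (acyclic_homCx_iff P N).1 ((hProjective_iff P).1 hP N hN) p f hf

lemma hProjective_of_htpy {P : DGBimod A B}
    (h : ∀ (N : DGBimod A B), N.Acyclic → ∀ (p : ℤ) (f : GHom P N p), f.Closed → Htpy f 0) :
    P.HProjective :=
  (hProjective_iff P).2 fun N hN => (acyclic_homCx_iff P N).2 (h N hN)

lemma HProjective.contractible {P : DGBimod A B} (hP : P.HProjective) (h : P.Acyclic) :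
    P.Contractible := hP.htpy_zero h _ (closed_id P)

/-! ### Complexes of vector spaces -/

section Base

variable (M : DGBimod (DGAlgebra.base k) (DGAlgebra.base k))

lemma exists_generalized_inverse {V W : Type*} [AddCommGroup V] [Module k V] [AddCommGroup W]
    [Module k W] (f : V →ₗ[k] W) : ∃ g : W →ₗ[k] V, ∀ x, f (g (f x)) = f x := by
  obtain ⟨s, hs⟩ := f.rangeRestrict.exists_rightInverse_of_surjective f.range_rangeRestrict
  obtain ⟨g, hg⟩ := s.exists_extend
  refine ⟨g, fun x => ?_⟩
  have h1 := LinearMap.congr_fun hs (f.rangeRestrict x)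
  have h2 := LinearMap.congr_fun hg (f.rangeRestrict x)
  have h3 : g (f x) = s (f.rangeRestrict x) := h2
  rw [h3]
  exact congrArg Subtype.val h1

/-- Over a field the identity of a complex is homotopic to a map `e` with `d e = 0 = e d`. -/
lemma exists_htpy_id : ∃ e : GHom M M 0, e.Closed ∧ Htpy e (GHom.id M) ∧
    (∀ (n m : ℤ) (h : n + 1 = m) (x : M.X n), M.d n m h (e.f n n (add_zero n) x) = 0) ∧
    (∀ (n m : ℤ) (h : n + 1 = m) (x : M.X n), e.f m m (add_zero m) (M.d n m h x) = 0) := by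
  choose r hr using fun n : ℤ => exists_generalized_inverse (M.d n (n + 1) rfl)
  let h : GHom M M (-1) := mkBase fun i j hij => by
    obtain rfl : i = j + 1 := by lia
    exact r j
  have hh (n m : ℤ) (hnm : n + 1 = m) (x : M.X n) :
      M.d n m hnm (h.f m n (by lia) (M.d n m hnm x)) = M.d n m hnm x := by
    subst hnm
    exact hr n x
  have hD (l n m : ℤ) (hl : l + 1 = n) (hm : n + 1 = m) (x : M.X n) :
      (h.D (by lia : (-1 : ℤ) + 1 = 0)).f n n (add_zero n) x =
        M.d l n hl (h.f n l (by lia) x) + h.f m n (by lia) (M.d n m hm x) := by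
    rw [D_f h _ n l m n _ (by lia) hl hm (by lia), Int.negOnePow_neg, Int.negOnePow_one,
      Units.neg_smul, one_smul, sub_neg_eq_add]
  refine ⟨GHom.id M - h.D (by lia), ?_, ?_, ?_, ?_⟩
  · rw [closed_iff]
    intro q hq
    rw [D_sub, D_id, D_D, sub_zero]
  · refine Htpy.of_D (e := -h) (by lia : (-1 : ℤ) + 1 = 0) ?_
    rw [D_neg]
    abel
  · intro n m hnm x
    rw [sub_f, GHom.id_f, hD (n - 1) n m (by lia) hnm, map_sub, map_add, M.d_d, hh, zero_add,
      sub_self]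
  · intro n m hnm x
    rw [sub_f, GHom.id_f, hD n m (m + 1) hnm rfl, M.d_d, map_zero, add_zero, hh, sub_self]

/-- The map `e` of `exists_htpy_id` squares to zero if the complex is acyclic. -/
lemma contractible_of_acyclic (h : M.Acyclic) : M.Contractible := by
  obtain ⟨e, he, hid, h1, h2⟩ := exists_htpy_id M
  have h3 : e.comp e (add_zero 0) = 0 := ext_zero fun i x => by
    rw [GHom.comp_f e e _ i i i (add_zero i) (add_zero i) (add_zero i), zero_f]
    obtain ⟨y, hy⟩ := acyclic_iff.1 h (i - 1) i (i + 1) (by lia) rfl _ (h1 i (i + 1) rfl x)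
    rw [← hy, h2]
  have h4 := Htpy.comp_left he hid.symm (add_zero 0)
  rw [h3, comp_id] at h4
  exact hid.symm.trans h4

lemma hProjective_base : M.HProjective :=
  hProjective_of_htpy fun N hN _ f hf => (contractible_of_acyclic N hN).htpy_zero f hf

end Base

/-! ### Duals -/

lemma toENat_rank_dual (V : Type u) [AddCommGroup V] [Module k V] :
    Cardinal.toENat (Module.rank k (Module.Dual k V)) = Cardinal.toENat (Module.rank k V) := by
  by_cases h : Module.Finite k V
  · rw [← Module.finrank_eq_rank, ← Module.finrank_eq_rank, Subspace.dual_finrank_eq]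
  · have h1 : Cardinal.aleph0 ≤ Module.rank k V := by
      rwa [← not_lt, Module.rank_lt_aleph0_iff]
    rw [Cardinal.toENat_eq_top.2 h1, Cardinal.toENat_eq_top]
    have := lift_rank_lt_rank_dual h1
    rw [Cardinal.lift_id] at this
    exact h1.trans this.le

/-- The pairing between cocycles of `M^*` and cohomology classes of `M`. -/
noncomputable def dualPairing (M : DGBimod A B) (n : ℤ) :
    LinearMap.ker (M.dual.d n (n + 1) rfl) →ₗ[k] Module.Dual k (M.H (-n)) where
  toFun φ := Submodule.liftQ _
    ((show Module.Dual k (M.X (-n)) from φ.1) ∘ₗ (LinearMap.ker (M.d (-n) (-n + 1) rfl)).subtype)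
      (by
      rintro ⟨x, hx⟩ ⟨y, hy⟩
      have h1 : M.dual.d n (n + 1) rfl φ.1 = 0 := φ.2
      have h2 := dual_d_apply M n (n + 1) rfl φ.1 (M.castX (-n - 1) (-(n + 1)) (by lia) y)
      have h3 : (show Module.Dual k (M.X (-(n + 1))) from M.dual.d n (n + 1) rfl φ.1) = 0 := h1
      rw [h3, LinearMap.zero_apply, eq_comm, neg_eq_zero, smul_eq_zero_iff_eq] at h2
      change (show Module.Dual k (M.X (-n)) from φ.1) x = 0
      rw [← h2]
      congr 1
      have (a : ℤ) (h : -n - 1 = a) (h' : a + 1 = -n) :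
          M.d a (-n) h' (M.castX (-n - 1) a h y) = x := by
        subst h
        exact hy
      exact (this _ _ _).symm)
  map_add' φ ψ := by
    refine LinearMap.ext fun z => ?_
    obtain ⟨z, rfl⟩ := M.Hmk_surjective _ z
    rfl
  map_smul' c φ := by
    refine LinearMap.ext fun z => ?_
    obtain ⟨z, rfl⟩ := M.Hmk_surjective _ z
    rfl

lemma dualPairing_mk (M : DGBimod A B) (n : ℤ) (φ : LinearMap.ker (M.dual.d n (n + 1) rfl))
    (z : LinearMap.ker (M.d (-n) (-n + 1) rfl)) :
    dualPairing M n φ (M.Hmk (-n) z) = (show Module.Dual k (M.X (-n)) from φ.1) z.1 := rfl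

lemma dualPairing_surjective (M : DGBimod A B) (n : ℤ) :
    Function.Surjective (dualPairing M n) := by
  intro f
  obtain ⟨φ, hφ⟩ := (f ∘ₗ M.Hmk (-n)).exists_extend
  have hz (z : LinearMap.ker (M.d (-n) (-n + 1) rfl)) : φ z.1 = f (M.Hmk (-n) z) :=
    LinearMap.congr_fun hφ z
  refine ⟨⟨φ, ?_⟩, LinearMap.ext fun z => ?_⟩
  · refine LinearMap.mem_ker.2 (LinearMap.ext fun x => ?_)
    refine (dual_d_apply M n (n + 1) rfl φ x).trans ?_
    change -(n.negOnePow • φ (M.d (-(n + 1)) (-n) _ x)) = 0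
    have h1 := hz ⟨M.d (-(n + 1)) (-n) (by lia) x, M.d_d _ _ _ _ _ _⟩
    rw [(M.Hmk_eq_zero_iff (by lia) _).2 ⟨x, rfl⟩, map_zero] at h1
    rw [h1, smul_zero, neg_zero]
  · obtain ⟨z, rfl⟩ := M.Hmk_surjective _ z
    exact (dualPairing_mk M n _ z).trans (hz z)

lemma ker_dualPairing (M : DGBimod A B) (n : ℤ) : LinearMap.ker (dualPairing M n) =
    (LinearMap.range (M.dual.d (n - 1) n (sub_add_cancel n 1))).submoduleOf
      (LinearMap.ker (M.dual.d n (n + 1) rfl)) := by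
  ext φ
  rw [LinearMap.mem_ker, ← Submodule.Quotient.mk_eq_zero]
  refine Iff.trans ?_ (M.dual.Hmk_eq_zero_iff (sub_add_cancel n 1) φ).symm
  constructor
  · intro h
    have hz (z : M.X (-n)) (hz : M.d (-n) (-n + 1) rfl z = 0) :
        (show Module.Dual k (M.X (-n)) from φ.1) z = 0 :=
      (dualPairing_mk M n φ ⟨z, hz⟩).symm.trans (by rw [h, LinearMap.zero_apply])
    obtain ⟨g, hg⟩ := exists_generalized_inverse (M.d (-n) (-(n - 1)) (by lia))
    refine ⟨-((n - 1).negOnePow • (show Module.Dual k (M.X (-n)) from φ.1) ∘ₗ g), ?_⟩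
    refine LinearMap.ext fun x => (dual_d_apply M _ _ _ _ _).trans ?_
    change -((n - 1).negOnePow • (-((n - 1).negOnePow •
      (show Module.Dual k (M.X (-n)) from φ.1) (g _)))) = (show Module.Dual k (M.X (-n)) from φ.1) x
    rw [smul_neg, neg_neg, smul_smul, Int.units_mul_self, one_smul, ← sub_eq_zero, ← map_sub]
    refine hz _ ?_
    have (a b : ℤ) (h : -n + 1 = a) (h' : -n + 1 = b) (y : M.X (-n)) (hy : M.d (-n) a h y = 0) :
        M.d (-n) b h' y = 0 := by
      subst h h'
      exact hy
    refine this (-(n - 1)) (-n + 1) (by lia) rfl _ ?_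
    rw [map_sub, hg, sub_self]
  · rintro ⟨ψ, hψ⟩
    refine LinearMap.ext fun z => ?_
    obtain ⟨z, rfl⟩ := M.Hmk_surjective _ z
    rw [dualPairing_mk, ← hψ]
    refine (dual_d_apply M (n - 1) n _ ψ z.1).trans ?_
    have (a : ℤ) (h : -n + 1 = a) : M.d (-n) a h z.1 = 0 := by
      subst h
      exact z.2
    rw [this, map_zero, smul_zero, neg_zero]
    rfl

/-- `Hⁿ(M^*) ≅ H⁻ⁿ(M)^*`, hence both have the same dimension. -/
lemma hdim_dual (M : DGBimod A B) (n : ℤ) : M.dual.hdim n = M.hdim (-n) := by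
  have e : M.dual.H n ≃ₗ[k] Module.Dual k (M.H (-n)) :=
    (Submodule.quotEquivOfEq _ _ (ker_dualPairing M n).symm).trans
      ((dualPairing M n).quotKerEquivOfSurjective (dualPairing_surjective M n))
  rw [hdim, e.rank_eq, toENat_rank_dual]
  rfl

lemma acyclic_dual (M : DGBimod A B) : M.dual.Acyclic ↔ M.Acyclic := by
  rw [acyclic_iff_hdim, acyclic_iff_hdim]
  refine ⟨fun h n => ?_, fun h n => ?_⟩
  · rw [← neg_neg n, ← hdim_dual, h]
  · rw [hdim_dual, h]

/-! ### Permanence of h-projectivity -/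

/-- H-projectivity as a vanishing condition on dg functors, to which `thick_bound` applies. -/
lemma hProjective_iff_dhomF (P : DGBimod A B) :
    P.HProjective ↔ ∀ N : DGBimod A B, N.Acyclic → ((dhomF N).obj P).Acyclic := by
  rw [hProjective_iff]
  exact forall₂_congr fun N _ => (acyclic_dual (homCx P N)).symm

lemma GIso.hProjective {P Q : DGBimod A B} {p : ℤ} (e : GIso P Q p) (h : P.HProjective) :
    Q.HProjective := by
  rw [hProjective_iff_dhomF] at *
  exact fun N hN => ((dhomF N).mapGIso e).acyclic_iff.1 (h N hN)

/-- If a dg functor sends `Y` to an h-projective, then it does so on `⟨Y⟩`. The dual of the morphism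
complex is used because it is a covariant dg functor of its first argument. -/
lemma hProjective_of_thick {Y X : HoBimod A B} (h : HoBimod.thick Y X) (Φ : DGFunctor A B C E)
    (hY : (Φ.obj Y.as).HProjective) : (Φ.obj X.as).HProjective := by
  rw [hProjective_iff_dhomF] at *
  exact fun N hN => acyclic_obj_of_thick h (Φ.comp (dhomF N)) (hY N hN)

lemma hProjective_cone {M N : DGBimod A B} (f : M ⟶ N) (Φ : DGFunctor A B C E)
    (hM : (Φ.obj M).HProjective) (hN : (Φ.obj N).HProjective) :
    (Φ.obj (cone f)).HProjective := by
  rw [hProjective_iff_dhomF] at *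
  intro L hL
  rw [acyclic_iff_hdim]
  intro n
  refine le_antisymm (((Φ.comp (dhomF L)).hdim_obj_cone_le f n).trans (le_of_eq ?_)) (by simp)
  change ((dhomF L).obj (Φ.obj N)).hdim n + ((dhomF L).obj (Φ.obj M)).hdim (n + 1) = 0
  rw [acyclic_iff_hdim.1 (hN L hL), acyclic_iff_hdim.1 (hM L hL), add_zero]

/-- The unit `V → V ⊗ₖ B`, `v ↦ v ⊗ 1`. -/
noncomputable def inducedRight (V : DGBimod C (DGAlgebra.base k)) (B : DGAlgebra k) :
    GHom V (V.tensor B.regular).forgetRight 0 :=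
  mk' (M := V) (N := (V.tensor B.regular).forgetRight)
    (fun i j h => (show V.X i →ₗ[k] (V.tensor B.regular).X j from
      (tm V B.regular i 0 j h).flip (diagOne B)))
    (fun i j n j' n' h hj hn h' a x => by
      rw [zero_mul, Int.negOnePow_zero, one_smul]
      exact (lmul_tm (M := V) (K := B.regular) h' hj h hn a x (diagOne B)).symm)
    (base_map_rmul (M := V) (N := (V.tensor B.regular).forgetRight) _)

lemma closed_inducedRight (V : DGBimod C (DGAlgebra.base k)) (B : DGAlgebra k) :
    (inducedRight V B).Closed :=
  closed_of_d_f fun i m l j hil hlj him hmj x => by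
    rw [Int.negOnePow_zero, one_smul]
    refine (d_tm (M := V) (K := B.regular) hil him (zero_add 1) hlj hmj (by lia) x
      (diagOne B)).trans ?_
    have : B.regular.d 0 1 (zero_add 1) (diagOne B) = 0 := B.d_one _ _
    rw [this, map_zero, smul_zero, add_zero]
    rfl

/-- The counit `N ⊗ₖ B → N`, `x ⊗ b ↦ x b`. -/
noncomputable def actRight (N : DGBimod C B) : GHom (N.forgetRight.tensor B.regular) N 0 :=
  tdesc (M := N.forgetRight) (K := B.regular) (fun i j n h => N.rmul i j n (by lia))
    (fun i l j il lj n hil hlj h h' m a x => N.rmul_rmul _ _ _ _ _ _ _ _ _ _ _ _ _)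
    (fun c i j ci l n hci h h' h'' a m x => by
      rw [zero_mul, Int.negOnePow_zero, one_smul]
      exact N.lmul_rmul _ _ _ _ _ _ _ _ _ _ _ _ _)
    (fun i j b jb l n hjb h h' h'' m x y => (N.rmul_rmul _ _ _ _ _ _ _ _ _ _ _ _ _).symm)

lemma actRight_tm (N : DGBimod C B) (i j n l : ℤ) (hij : i + j = n) (hl : n + 0 = l)
    (h : i + j = l) (x : N.X i) (b : B.X j) :
    (actRight N).f n l hl (tm N.forgetRight B.regular i j n hij x b) = N.rmul i j l h x b :=
  tdesc_tm ..

lemma closed_actRight (N : DGBimod C B) : (actRight N).Closed :=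
  closed_of_tm fun i j n i' j' n' l l' hij hi hj hn h₁ h₂ hl hl' hll m a => by
    refine (congrArg _ (actRight_tm N i j n l hij hl (by lia) m a)).trans ?_
    rw [Int.negOnePow_zero, one_smul]
    refine (N.d_rmul _ _ _ i' j' _ _ hi hj _ (by lia) (by lia) _ _).trans ?_
    exact congrArg₂ _ (actRight_tm N i' j n' l' h₁ hl' (by lia) _ a).symm
      (congrArg _ (actRight_tm N i j' n' l' h₂ hl' (by lia) m _).symm)

/-- Extension of scalars preserves h-projectivity. -/
lemma hProjective_tensor_regular {V : DGBimod C (DGAlgebra.base k)} (hV : V.HProjective)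
    (B : DGAlgebra k) : (V.tensor B.regular).HProjective :=
  hProjective_of_htpy fun N hN p f hf => by
    obtain ⟨g, hg, hgf⟩ : ∃ g : GHom (V.tensor B.regular).forgetRight N.forgetRight p, g.Closed ∧
        ∀ i j h x, g.f i j h x = f.f i j h x :=
      ⟨(forgetRightF C B).map f, (forgetRightF C B).map_closed hf, fun _ _ _ _ => rfl⟩
    have h1 := hV.htpy_zero (N := N.forgetRight) hN
      ((inducedRight V B).comp g (zero_add p)) ((closed_inducedRight V B).comp hg _)
    have h3 : Htpy (tensorRMap B.regular ((inducedRight V B).comp g (zero_add p))) 0 :=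
      (Htpy.map (tensorR C B.regular) h1).trans (.of_eq (tensorR C B.regular).map_zero)
    have h2 := Htpy.comp_right h3 (closed_actRight N) (add_zero p)
    rw [zero_comp] at h2
    refine .trans (.of_eq ?_) h2
    refine tensor_ext fun i j n l hij hn v b => ?_
    rw [GHom.comp_f _ _ _ n l l hn hn (add_zero l)]
    rw [tensorRMap_tm _ _ i j n l (i + p) hij hn rfl (by lia)]
    refine Eq.trans ?_ (actRight_tm N (i + p) j l l (by lia) _ (by lia) _ b).symm
    rw [GHom.comp_f _ _ _ i i (i + p) rfl (add_zero i) rfl, hgf]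
    have h3 := f.map_rmul i j n (i + p) l hij rfl hn (by lia)
      (tm V B.regular i 0 i (add_zero i) v (diagOne B)) b
    refine Eq.trans ?_ h3
    rw [rmul_tm (M := V) (K := B.regular) hij (add_zero i) (zero_add j) hij v (diagOne B) b]
    exact congrArg (fun b' => f.f n l hn (tm V B.regular i j n hij v b'))
      (B.one_mul j (zero_add j) b).symm

/-- The unit `V → A ⊗ₖ V`, `v ↦ 1 ⊗ v`. -/
noncomputable def inducedLeft (A : DGAlgebra k) (V : DGBimod (DGAlgebra.base k) B) :
    GHom V ((diag A).forgetRight.tensor V).forgetLeft 0 :=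
  mk' (M := V) (N := ((diag A).forgetRight.tensor V).forgetLeft)
    (fun i j h => (show V.X i →ₗ[k] ((diag A).forgetRight.tensor V).X j from
      tm (diag A).forgetRight V 0 i j (by lia) (diagOne A)))
    (base_map_lmul (M := V) (N := ((diag A).forgetRight.tensor V).forgetLeft) _)
    (fun i j n i' n' h hi hn h' x b =>
      (rmul_tm (M := (diag A).forgetRight) (K := V) h' (by lia) h (by lia) (diagOne A) x b).symm)

lemma closed_inducedLeft (A : DGAlgebra k) (V : DGBimod (DGAlgebra.base k) B) :
    (inducedLeft A V).Closed :=
  closed_of_d_f fun i m l j hil hlj him hmj x => by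
    rw [Int.negOnePow_zero, one_smul]
    refine (d_tm (M := (diag A).forgetRight) (K := V) (by lia) (zero_add 1) him hlj (by lia)
      (by lia) (diagOne A) x).trans ?_
    have : (diag A).forgetRight.d 0 1 (zero_add 1) (diagOne A) = 0 := A.d_one _ _
    rw [this, map_zero, LinearMap.zero_apply, zero_add, Int.negOnePow_zero, one_smul]
    rfl

/-- The counit `A ⊗ₖ N → N`, `a ⊗ x ↦ a x`. -/
noncomputable def actLeft (N : DGBimod A B) : GHom ((diag A).forgetRight.tensor N.forgetLeft) N 0 :=
  tdesc (M := (diag A).forgetRight) (K := N.forgetLeft) (fun i j n h => N.lmul i j n (by lia))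
    (fun i l j il lj n hil hlj h h' m a x => N.lmul_lmul _ _ _ _ _ _ _ _ _ _ _ _ _)
    (fun c i j ci l n hci h h' h'' a m x => by
      rw [zero_mul, Int.negOnePow_zero, one_smul]
      exact N.lmul_lmul _ _ _ _ _ _ _ _ _ _ _ _ _)
    (fun i j b jb l n hjb h h' h'' m x y => (N.lmul_rmul _ _ _ _ _ _ _ _ _ _ _ _ _).symm)

lemma actLeft_tm (N : DGBimod A B) (i j n l : ℤ) (hij : i + j = n) (hl : n + 0 = l)
    (h : i + j = l) (a : A.X i) (x : N.X j) :
    (actLeft N).f n l hl (tm (diag A).forgetRight N.forgetLeft i j n hij a x) =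
      N.lmul i j l h a x :=
  tdesc_tm ..

lemma closed_actLeft (N : DGBimod A B) : (actLeft N).Closed :=
  closed_of_tm fun i j n i' j' n' l l' hij hi hj hn h₁ h₂ hl hl' hll a m => by
    refine (congrArg _ (actLeft_tm N i j n l hij hl (by lia) a m)).trans ?_
    rw [Int.negOnePow_zero, one_smul]
    refine (N.d_lmul _ _ _ i' j' _ _ hi hj _ (by lia) (by lia) _ _).trans ?_
    exact congrArg₂ _ (actLeft_tm N i' j n' l' h₁ hl' (by lia) _ m).symm
      (congrArg _ (actLeft_tm N i j' n' l' h₂ hl' (by lia) a _).symm)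

lemma hProjective_diag_tensor (A : DGAlgebra k) {V : DGBimod (DGAlgebra.base k) B}
    (hV : V.HProjective) : ((diag A).forgetRight.tensor V).HProjective :=
  hProjective_of_htpy fun N hN p f hf => by
    obtain ⟨g, hg, hgf⟩ : ∃ g : GHom ((diag A).forgetRight.tensor V).forgetLeft N.forgetLeft p,
      g.Closed ∧
        ∀ i j h x, g.f i j h x = f.f i j h x :=
      ⟨(forgetLeftF A B).map f, (forgetLeftF A B).map_closed hf, fun _ _ _ _ => rfl⟩
    have h1 := hV.htpy_zero (N := N.forgetLeft) hN
      ((inducedLeft A V).comp g (zero_add p)) ((closed_inducedLeft A V).comp hg _)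
    have h3 : Htpy (tensorLMap (diag A).forgetRight ((inducedLeft A V).comp g (zero_add p))) 0 :=
      (Htpy.map (tensorL B (diag A).forgetRight) h1).trans
        (.of_eq (tensorL B (diag A).forgetRight).map_zero)
    have h2 := Htpy.comp_right h3 (closed_actLeft N) (add_zero p)
    rw [zero_comp] at h2
    refine .trans (.of_eq ?_) h2
    refine tensor_ext fun i j n l hij hn a v => ?_
    rw [GHom.comp_f _ _ _ n l l hn hn (add_zero l)]
    rw [tensorLMap_tm _ _ i j n l (j + p) hij hn rfl (by lia), map_sign]
    refine Eq.trans ?_ (congrArg _ (actLeft_tm N i (j + p) l l (by lia) _ (by lia) a _).symm)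
    rw [GHom.comp_f _ _ _ j j (j + p) rfl (add_zero j) rfl, hgf]
    have h3 := f.map_lmul i j n (j + p) l hij rfl hn (by lia) a
      (tm (diag A).forgetRight V 0 j j (zero_add j) (diagOne A) v)
    refine Eq.trans ?_ h3
    rw [lmul_tm (M := (diag A).forgetRight) (K := V) hij (zero_add j) (add_zero i) hij a
      (diagOne A) v]
    exact congrArg (fun b' => f.f n l hn (tm (diag A).forgetRight V i j n hij b' v))
      (A.mul_one i (add_zero i) a).symm

end DGBimod

namespace DGBimod

variable {k : Type u} [Field k] {A B C E : DGAlgebra k}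

open GHom

/-! ### Complexes with finite dimensional cohomology -/

lemma castOr_of_ne (X : ℤ → Type u) [∀ i, AddCommGroup (X i)] [∀ i, Module k (X i)] {j n : ℤ}
    (h : j ≠ n) : castOr (k := k) X j n = 0 := by simp [castOr, h]

lemma GHom.sum_f {M N : DGBimod A B} {p : ℤ} {ι : Type*} (s : Finset ι) (f : ι → GHom M N p)
    (i j : ℤ) (h : i + p = j) (x : M.X i) :
    (∑ t ∈ s, f t).f i j h x = ∑ t ∈ s, (f t).f i j h x := by
  classical
  induction s using Finset.induction_on with
  | empty => simp
  | insert a s ha ih => rw [Finset.sum_insert ha, Finset.sum_insert ha, add_f, ih]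

/-- A dg bimodule has finite cohomology if its total cohomology is finite dimensional. -/
structure FinCoh (M : DGBimod A B) : Prop where
  ne_top : ∀ n, M.hdim n ≠ ⊤
  bounded : ∃ s : Finset ℤ, ∀ n ∉ s, M.hdim n = 0

section Decomp

variable (M : DGBimod (DGAlgebra.base k) (DGAlgebra.base k))

lemma finite_of_hdim_ne_top {M : DGBimod A B} {n : ℤ} (h : M.hdim n ≠ ⊤) :
    Module.Finite k (M.H n) := by
  rw [← Module.rank_lt_aleph0_iff, ← not_le]
  exact fun h' => h (Cardinal.toENat_eq_top.2 h')

lemma hdim_eq_finrank {M : DGBimod A B} {n : ℤ} (h : M.hdim n ≠ ⊤) :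
    M.hdim n = Module.finrank k (M.H n) := by
  have := finite_of_hdim_ne_top h
  rw [hdim, ← Module.finrank_eq_rank]
  simp

set_option maxHeartbeats 1000000 in
/-- A complex of vector spaces with finite dimensional total cohomology is homotopy equivalent to a
finite direct sum of shifts of the ground field, one summand for each element of a basis of the
cohomology. -/
lemma exists_sumDecomp_base (s : Finset ℤ) (hs : ∀ n ∉ s, M.hdim n = 0)
    (hf : ∀ n, M.hdim n ≠ ⊤) :
    ∃ S : SumDecomp (diag (DGAlgebra.base k)) M,
      ∃ e : S.ι ≃ Σ n : s, Fin (Module.finrank k (M.H n)), ∀ j, S.deg j = -((e j).1 : ℤ) := by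
  have (n : ℤ) : Module.Finite k (M.H n) := finite_of_hdim_ne_top (hf n)
  obtain ⟨e, he, hid, h1, h2⟩ := exists_htpy_id M
  let b (n : ℤ) := Module.finBasis k (M.H n)
  choose z hz using fun (n : ℤ) (j : Fin (Module.finrank k (M.H n))) =>
    M.Hmk_surjective n (b n j)
  -- the cohomology class of `e x`
  let γ (n : ℤ) : M.X n →ₗ[k] M.H n := M.Hmk n ∘ₗ
    (e.f n n (add_zero n)).codRestrict (LinearMap.ker (M.d n (n + 1) rfl)) (h1 n (n + 1) rfl)
  have hγd (n m : ℤ) (h : n + 1 = m) (x : M.X n) : γ m (M.d n m h x) = 0 := by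
    change M.Hmk m _ = 0
    rw [M.Hmk_eq_zero_iff h]
    exact ⟨0, by rw [map_zero]; exact (h2 n m h x).symm⟩
  have hγz (n : ℤ) (x : LinearMap.ker (M.d n (n + 1) rfl)) : γ n x.1 = M.Hmk n x := by
    obtain ⟨w, hw⟩ := hid.exists_D (by lia : (-1 : ℤ) + 1 = 0)
    rw [← sub_eq_zero]
    change M.Hmk n _ - M.Hmk n x = 0
    rw [← map_sub, M.Hmk_eq_zero_iff (sub_add_cancel n 1)]
    refine ⟨w.f n (n - 1) (by lia) x.1, ?_⟩
    have h3 := congr_f hw n n (add_zero n) x.1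
    rw [D_f w _ n (n - 1) (n + 1) n _ (by lia) (by lia) rfl (by lia), sub_f, GHom.id_f] at h3
    have h4 : M.d n (n + 1) rfl x.1 = 0 := x.2
    rw [h4, map_zero, smul_zero, sub_zero] at h3
    exact h3
  let p (n : ℤ) (j : Fin (Module.finrank k (M.H n))) : GHom M (diag (DGAlgebra.base k)) (-n) :=
    mkBase fun i l _ => castOr (k := k) (DGAlgebra.base k).X 0 l ∘ₗ
      (LinearMap.toSpanSingleton k _ (DGAlgebra.base k).one) ∘ₗ (b n).coord j ∘ₗ γ n ∘ₗ
        castOr M.X i n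
  let q (n : ℤ) (j : Fin (Module.finrank k (M.H n))) : GHom (diag (DGAlgebra.base k)) M (- -n) :=
    mkBase fun i l _ => castOr M.X n l ∘ₗ (LinearMap.toSpanSingleton k _ (z n j).1) ∘ₗ coeff k i
  have hp0 (n j) (x : M.X n) (h : n + -n = 0) :
      (p n j).f n 0 h x = (b n).coord j (γ n x) • (DGAlgebra.base k).one := by
    change castOr (k := k) (DGAlgebra.base k).X 0 0
      ((b n).coord j (γ n (castOr (k := k) M.X n n x)) •
      (DGAlgebra.base k).one) = _
    rw [castOr_self, castOr_self]
    rfl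
  have hp1 (n j) (i l : ℤ) (hi : i ≠ n) (h : i + -n = l) (x : M.X i) : (p n j).f i l h x = 0 := by
    change castOr (k := k) (DGAlgebra.base k).X 0 l
      ((b n).coord j (γ n (castOr (k := k) M.X i n x)) •
      (DGAlgebra.base k).one) = _
    rw [castOr_of_ne _ hi, LinearMap.zero_apply, map_zero, map_zero, zero_smul, map_zero]
    rfl
  have hq0 (n j) (c : (diag (DGAlgebra.base k)).X 0) (h : 0 + - -n = n) :
      (q n j).f 0 n h c = coeff k 0 c • (z n j).1 := by
    change castOr (k := k) M.X n n (coeff k 0 c • (z n j).1) = _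
    rw [castOr_self]
    rfl
  have hcoord (n) (i j : Fin (Module.finrank k (M.H n))) :
      (b n).coord j (γ n (z n i).1) = if i = j then 1 else 0 := by
    rw [hγz, hz, Module.Basis.coord_apply, Module.Basis.repr_self, Finsupp.single_apply]
  have hone (c : (diag (DGAlgebra.base k)).X 0) : c = coeff k 0 c • (DGAlgebra.base k).one :=
    base_eq_smul_one c
  have hbz {i : ℤ} (hi : i ≠ 0) (c : (diag (DGAlgebra.base k)).X i) : c = 0 := base_eq_zero hi c
  have hpc (n j) : (p n j).Closed := closed_of_d_f fun i m l t hil hlt him hmt x => by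
    have h3 : (diag (DGAlgebra.base k)).d l t hlt ((p n j).f i l hil x) = 0 := base_d l t hlt _
    rw [h3]
    by_cases hm : m = n
    · subst hm
      obtain rfl : t = 0 := by lia
      rw [hp0, hγd, map_zero, zero_smul]
      exact (smul_zero _).symm
    · rw [hp1 _ _ _ _ hm, smul_zero]
  have hqc (n j) : (q n j).Closed := closed_of_d_f fun i m l t hil hlt him hmt c => by
    have h3 : (diag (DGAlgebra.base k)).d i m him c = 0 := base_d i m him _
    rw [h3, map_zero, smul_zero]
    by_cases hi : i = 0
    · subst hi
      obtain rfl : l = n := by lia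
      obtain rfl : t = l + 1 := by lia
      have h4 : M.d l (l + 1) rfl (z l j).1 = 0 := (z l j).2
      rw [hq0, map_smul, h4, smul_zero]
    · rw [hbz hi c, map_zero, map_zero]
  have hpq (i : ℤ) (x : M.X i) (n j) (h : i + 0 = i) :
      ((p n j).comp (q n j) (add_neg_cancel _)).f i i h x =
      if n = i then
        (b n).coord j (γ n (castOr (k := k) M.X i n x)) • castOr (k := k) M.X n i (z n j).1
        else 0 := by
    rw [GHom.comp_f _ _ _ i (i + -n) i h rfl (by lia)]
    split_ifs with hn
    · subst hn
      have (l : ℤ) (h : 0 = l) (h3 : n + -n = l) (h4 : l + - -n = n) :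
          (q n j).f l n h4 ((p n j).f n l h3 x) = (b n).coord j (γ n x) • (z n j).1 := by
        subst h
        rw [hp0]
        refine (hq0 n j _ _).trans ?_
        rw [map_smul, coeff_one, smul_eq_mul, mul_one]
      rw [castOr_self]
      exact this _ (by lia) _ _
    · rw [hp1 _ _ _ _ (Ne.symm hn), map_zero]
  refine ⟨{
    ι := Σ n : s, Fin (Module.finrank k (M.H n))
    deg := fun j => -(j.1 : ℤ)
    p := fun j => p j.1 j.2
    q := fun j => q j.1 j.2
    closed_p := fun j => hpc _ _
    closed_q := fun j => hqc _ _
    q_p := ?_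
    q_p_of_ne := ?_
    total := ?_ }, Equiv.refl _, fun j => rfl⟩
  · rintro ⟨⟨n, hn⟩, j⟩
    refine .of_eq (ext_zero fun i c => ?_)
    rw [GHom.comp_f _ _ _ i (i + - -n) i (add_zero i) rfl (by lia), GHom.id_f]
    by_cases hi : i = 0
    · subst hi
      have (l : ℤ) (h : n = l) (h3 : 0 + - -n = l) (h4 : l + -n = 0) :
          (p n j).f l 0 h4 ((q n j).f 0 l h3 c) = c := by
        subst h
        rw [hp0, hq0, map_smul, map_smul, hcoord, if_pos rfl, smul_eq_mul, mul_one]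
        exact (hone c).symm
      exact this _ (by lia) _ _
    · rw [hbz hi c, map_zero, map_zero]
  · rintro ⟨⟨n, hn⟩, i⟩ ⟨⟨n', hn'⟩, j⟩ hij
    refine .of_eq (GHom.ext fun a t h c => ?_)
    rw [GHom.comp_f _ _ _ a (a + - -n) t h rfl (by dsimp only at h ⊢; lia), zero_f]
    by_cases ha : a = 0
    · subst ha
      have (l : ℤ) (h : n = l) (h3 : 0 + - -n = l) (h4 : l + -n' = t) :
          (p n' j).f l t h4 ((q n i).f 0 l h3 c) = 0 := by
        subst h
        by_cases hnn : n = n'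
        · subst hnn
          obtain rfl : t = 0 := by lia
          rw [hp0, hq0, map_smul, map_smul, hcoord, if_neg, smul_zero, zero_smul]
          · rfl
          · rintro rfl
            exact hij rfl
        · exact hp1 _ _ _ _ hnn _ _
      exact this _ (by lia) _ _
    · rw [hbz ha c, map_zero, map_zero]
  · have hsum : (∑ j : (Σ n : s, Fin (Module.finrank k (M.H n))), (p j.1 j.2).comp (q j.1 j.2)
        (add_neg_cancel _)).Closed := .sum fun j => (hpc _ _).comp (hqc _ _) _
    refine .trans ?_ hid
    have hW : (e - ∑ j : (Σ n : s, Fin (Module.finrank k (M.H n))),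
        (p j.1 j.2).comp (q j.1 j.2) (add_neg_cancel _)).comp e (add_zero 0) = 0 :=
      ext_zero fun i x => by
        rw [GHom.comp_f _ _ _ i i i (add_zero i) (add_zero i) (add_zero i), zero_f, sub_f, sum_f,
          Fintype.sum_sigma]
        refine (congrArg (fun v => e.f i i (add_zero i) (e.f i i (add_zero i) x - v))
          (Finset.sum_congr rfl fun (n : s) _ => Finset.sum_congr rfl fun j _ =>
            hpq i x n j (add_zero i))).trans ?_
        obtain ⟨w, hw, hw0⟩ : ∃ w : LinearMap.ker (M.d i (i + 1) rfl), w.1 =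
            e.f i i (add_zero i) x - ∑ n : s, ∑ j, (if (n : ℤ) = i then
              (b n).coord j (γ n (castOr (k := k) M.X i n x)) •
                castOr (k := k) M.X n i (z n j).1 else 0) ∧
              M.Hmk i w = 0 := by
          by_cases hi : i ∈ s
          · refine ⟨⟨e.f i i (add_zero i) x, h1 i (i + 1) rfl x⟩ -
              ∑ j, (b i).coord j (γ i x) • z i j, ?_, ?_⟩
            · rw [Finset.sum_eq_single (⟨i, hi⟩ : s)]
              · simp
              · intro n _ hn
                exact Finset.sum_eq_zero fun j _ => if_neg fun h => hn (Subtype.ext h)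
              · exact fun h => absurd (Finset.mem_univ _) h
            · simp only [map_sub, map_sum, map_smul, hz]
              exact sub_eq_zero.2 ((b i).sum_repr (γ i x)).symm
          · refine ⟨⟨e.f i i (add_zero i) x, h1 i (i + 1) rfl x⟩, ?_, ?_⟩
            · rw [Finset.sum_eq_zero, sub_zero]
              intro n _
              exact Finset.sum_eq_zero fun j _ => if_neg fun h : (n : ℤ) = i => hi (h ▸ n.2)
            · have := hdim_eq_zero_iff.1 (hs i hi)
              exact Subsingleton.elim _ _
        rw [← hw]
        obtain ⟨y, hy⟩ := (M.Hmk_eq_zero_iff (sub_add_cancel i 1) w).1 hw0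
        rw [← hy, h2]
    have hWc : (e - ∑ j : (Σ n : s, Fin (Module.finrank k (M.H n))),
        (p j.1 j.2).comp (q j.1 j.2) (add_neg_cancel _)).Closed := by
      rw [sub_eq_add_neg]
      exact he.add hsum.neg
    have h3 := Htpy.comp_left hWc hid (add_zero 0)
    rw [hW, comp_id] at h3
    have h4 := Htpy.add h3 (.refl (∑ j : (Σ n : s, Fin (Module.finrank k (M.H n))),
        (p j.1 j.2).comp (q j.1 j.2) (add_neg_cancel _)))
    rwa [zero_add, sub_add_cancel] at h4

lemma hdim_obj_le_of_base (s : Finset ℤ) (hs : ∀ n ∉ s, M.hdim n = 0) (hf : ∀ n, M.hdim n ≠ ⊤)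
    (Φ : DGFunctor (DGAlgebra.base k) (DGAlgebra.base k) C E) (n : ℤ) :
    (Φ.obj M).hdim n ≤ ∑ m ∈ s, M.hdim m * (Φ.obj (diag (DGAlgebra.base k))).hdim (n - m) := by
  obtain ⟨S, e, he⟩ := exists_sumDecomp_base M s hs hf
  refine ((S.map Φ).hdim_le n).trans (le_of_eq ?_)
  change ∑ j : S.ι, (Φ.obj (diag (DGAlgebra.base k))).hdim (n + S.deg j) = _
  rw [← s.sum_coe_sort, ← e.symm.sum_comp, Fintype.sum_sigma]
  refine Finset.sum_congr rfl fun m _ => ?_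
  have hj (j) : n + S.deg (e.symm ⟨m, j⟩) = n - m := by
    rw [he, Equiv.apply_symm_apply, sub_eq_add_neg]
  simp only [hj]
  rw [Finset.sum_const, Finset.card_univ, Fintype.card_fin, nsmul_eq_mul, hdim_eq_finrank (hf m)]

end Decomp

/-! ### Dg algebras with perfect diagonal bimodule -/

section Smooth

variable {P : DGBimod A A}

lemma hProjective_regular (A : DGAlgebra k) : A.regular.HProjective :=
  (leftUnit A.regular).hProjective (hProjective_tensor_regular (hProjective_base _) A)

lemma hProjective_diag_forgetRight (A : DGAlgebra k) : (diag A).forgetRight.HProjective :=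
  (rightUnit (diag A).forgetRight).hProjective (hProjective_diag_tensor A (hProjective_base _))

/-- Objects of `⟨A⟩` are h-projective. -/
lemma hProjective_of_thick_regular {X : HoBimod (DGAlgebra.base k) A}
    (h : HoBimod.thick (HoBimod.of A.regular) X) : X.as.HProjective :=
  hProjective_of_thick h (DGFunctor.id _ _) (hProjective_regular A)

/-- As a right module, the cone of `P → A` is h-projective and acyclic. -/
lemma contractible_cone_forgetLeft (hP : HoBimod.thick (HoBimod.of (free A A)) (HoBimod.of P))
    {q : P ⟶ diag A} (hq : QuasiIso q) : (cone q).forgetLeft.Contractible := by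
  refine HProjective.contractible ?_ ((quasiIso_iff_acyclic_cone q).1 hq)
  refine hProjective_cone q (forgetLeftF A A) ?_ (hProjective_regular A)
  refine hProjective_of_thick hP (forgetLeftF A A) ?_
  exact (forgetLeftTensor (diag A).forgetRight (diag A).forgetLeft).hProjective
    (hProjective_tensor_regular (hProjective_base _) A)

/-- As a left module, the cone of `P → A` is h-projective and acyclic. -/
lemma contractible_cone_forgetRight (hP : HoBimod.thick (HoBimod.of (free A A)) (HoBimod.of P))
    {q : P ⟶ diag A} (hq : QuasiIso q) : (cone q).forgetRight.Contractible := by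
  refine HProjective.contractible ?_ ((quasiIso_iff_acyclic_cone q).1 hq)
  refine hProjective_cone q (forgetRightF A A) ?_ (hProjective_diag_forgetRight A)
  refine hProjective_of_thick hP (forgetRightF A A) ?_
  exact (forgetRightTensor (diag A).forgetRight (diag A).forgetLeft).hProjective
    (hProjective_diag_tensor A (hProjective_base _))

/-- The map `M ⊗_A P → M ⊗_A A ≅ M` induced by `q : P → A`. -/
noncomputable def resRight (q : P ⟶ diag A) (M : DGBimod C A) : M.tensor P ⟶ M :=
  (tensorL A M).mapHom q ≫ (rightUnit M).toIso.hom

/-- The map `P ⊗_A K → A ⊗_A K ≅ K` induced by `q : P → A`. -/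
noncomputable def resLeft (q : P ⟶ diag A) (K : DGBimod A B) : P.tensor K ⟶ K :=
  (tensorR A K).mapHom q ≫ (leftUnit K).toIso.hom

lemma quasiIso_iso_hom {M N : DGBimod A B} (e : M ≅ N) : QuasiIso e.hom :=
  quasiIso_of_isIso e.hom

/-- No flatness of `M` is needed, because the cone of `q` is contractible as a left module. -/
lemma quasiIso_resRight (hP : HoBimod.thick (HoBimod.of (free A A)) (HoBimod.of P))
    {q : P ⟶ diag A} (hq : QuasiIso q) (M : DGBimod C A) : QuasiIso (resRight q M) :=
  (((tensorL A M).quasiIso_mapHom_iff q).2 ((forgetRightTensor M (cone q)).acyclic_iff.1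
    ((contractible_cone_forgetRight hP hq).acyclic_obj (tensorL _ M)))).comp (quasiIso_iso_hom _)

/-- No flatness of `K` is needed, because the cone of `q` is contractible as a right module. -/
lemma quasiIso_resLeft (hP : HoBimod.thick (HoBimod.of (free A A)) (HoBimod.of P))
    {q : P ⟶ diag A} (hq : QuasiIso q) (K : DGBimod A B) : QuasiIso (resLeft q K) :=
  (((tensorR A K).quasiIso_mapHom_iff q).2 ((forgetLeftTensor (cone q) K).acyclic_iff.1
    ((contractible_cone_forgetLeft hP hq).acyclic_obj (tensorR _ K)))).comp (quasiIso_iso_hom _)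

/-- `X ⊗_A ((A ⊗ₖ A) ⊗_A K) ≅ X ⊗ₖ K`. -/
noncomputable def tensorFreeTensor (X : DGBimod C A) (K : DGBimod A B) :
    GIso (X.tensor ((free A A).tensor K)) (X.forgetRight.tensor K.forgetLeft) 0 :=
  have e₁ : GIso ((X.tensor (free A A)).tensor K) ((X.forgetRight.tensor A.regular).tensor K) 0 :=
    (tensorR C K).mapGIso (tensorFree X A)
  have e₂ : GIso ((X.forgetRight.tensor A.regular).tensor K)
    (X.forgetRight.tensor K.forgetLeft) 0 :=
    (assocIso X.forgetRight A.regular K).trans ((tensorL B X.forgetRight).mapGIso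
      ((forgetLeftTensor (diag A) K).trans ((forgetLeftF A B).mapGIso (leftUnit K)) (zero_add 0)))
      (zero_add 0)
  (assocIso X (free A A) K).symm.trans (e₁.trans e₂ (zero_add 0)) (neg_add_cancel 0)

lemma acyclic_tensor_base {X : DGBimod C (DGAlgebra.base k)} (hX : X.Acyclic)
    (K : DGBimod (DGAlgebra.base k) B) : (X.tensor K).Acyclic :=
  (forgetLeftTensor X K).acyclic_iff.1
    ((contractible_of_acyclic X.forgetLeft hX).acyclic_obj (tensorR _ K))

/-- `P ⊗_A K` is flat: as `P` is built from `A ⊗ₖ A`, it suffices that `X ⊗ₖ K` is acyclic. -/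
lemma acyclic_tensor_tensor (hP : HoBimod.thick (HoBimod.of (free A A)) (HoBimod.of P))
    {X : DGBimod C A} (hX : X.Acyclic) (K : DGBimod A B) : (X.tensor (P.tensor K)).Acyclic :=
  acyclic_obj_of_thick hP ((tensorR A K).comp (tensorL B X))
    ((tensorFreeTensor X K).acyclic_iff.2 (acyclic_tensor_base (X := X.forgetRight) hX _))

/-- `M ⊗_A P` is perfect if `M` has finite cohomology: it is built from `M ⊗_A (A ⊗ₖ A) ≅ M ⊗ₖ A`,
which is a finite direct sum of shifts of `A` up to homotopy. -/
lemma thick_tensor_of_finCoh (hP : HoBimod.thick (HoBimod.of (free A A)) (HoBimod.of P))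
    {M : DGBimod (DGAlgebra.base k) A} (hM : M.FinCoh) :
    HoBimod.thick (HoBimod.of A.regular) (HoBimod.of (M.tensor P)) := by
  obtain ⟨s, hs⟩ := hM.bounded
  obtain ⟨S, -⟩ := exists_sumDecomp_base M.forgetRight s hs hM.ne_top
  have S₁ : SumDecomp A.regular (M.forgetRight.tensor A.regular) :=
    (SumDecomp.ofGIso (leftUnit A.regular)).trans (S.map (tensorR _ A.regular))
  exact thick_of_sumDecomp (S₁.trans (SumDecomp.ofGIso (tensorFree M A)))
    (thick_map hP (tensorL A M))

/-- `(P ⊗_A K) ⊗_A P` is h-projective: it is built from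
`(A ⊗ₖ A) ⊗_A K ⊗_A (A ⊗ₖ A) ≅ A ⊗ₖ K ⊗ₖ A`. -/
lemma hProjective_tensor_tensor (hP : HoBimod.thick (HoBimod.of (free A A)) (HoBimod.of P))
    (K : DGBimod A A) : ((P.tensor K).tensor P).HProjective := by
  refine hProjective_of_thick hP ((tensorR A K).comp (tensorR A P)) ?_
  refine ((tensorR A P).mapGIso (freeTensor A K)).symm.hProjective ?_
  refine hProjective_of_thick hP (tensorL A ((diag A).forgetRight.tensor K.forgetLeft)) ?_
  refine (tensorFree ((diag A).forgetRight.tensor K.forgetLeft) A).symm.hProjective ?_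
  refine hProjective_tensor_regular ?_ A
  exact (forgetRightTensor (diag A).forgetRight K.forgetLeft).hProjective
    (hProjective_diag_tensor A (hProjective_base _))

/-- The h-projective resolution `(P ⊗_A K) ⊗_A P → K`. -/
lemma exists_hProjective_resolution (hP : HoBimod.thick (HoBimod.of (free A A)) (HoBimod.of P))
    {q : P ⟶ diag A} (hq : QuasiIso q) (K : DGBimod A A) :
    ∃ Q : DGBimod A A, Q.HProjective ∧ ∃ f : Q ⟶ K, QuasiIso f :=
  ⟨_, hProjective_tensor_tensor hP K, resRight q (P.tensor K) ≫ resLeft q K,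
    (quasiIso_resRight hP hq _).comp (quasiIso_resLeft hP hq _)⟩

end Smooth

end DGBimod

/-! ### Growth of submultiplicative sequences of graded dimensions -/

namespace GrowthSeq

open Filter Topology

lemma natCast_pos {N : ℕ} (h : 1 ≤ N) : (0 : EReal) < N := by exact_mod_cast h

lemma natCast_ne_top (N : ℕ) : (N : EReal) ≠ ⊤ := EReal.natCast_ne_top N

lemma tendsto_const_div (c : ℝ) : Tendsto (fun N : ℕ => (c : EReal) / N) atTop (𝓝 0) := by
  have h : Tendsto (fun N : ℕ => c / (N : ℝ)) atTop (𝓝 0) := tendsto_const_div_atTop_nhds_zero_nat c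
  exact (EReal.tendsto_coe.2 h).congr fun N => EReal.coe_div c N

lemma tendsto_add_zero {ι : Type*} {l : Filter ι} {f g : ι → EReal} {L : EReal}
    (hf : Tendsto f l (𝓝 L)) (hg : Tendsto g l (𝓝 0)) : Tendsto (fun i => f i + g i) l (𝓝 L) := by
  have h := (EReal.continuousAt_add (p := (L, 0)) (.inr (by simp)) (.inr (by simp))).tendsto.comp
    (hf.prodMk_nhds hg)
  simpa [Function.comp_def] using h

/-- Sequences at bounded distance have the same linear growth. -/
lemma tendsto_div_of_le_add {w w' : ℕ → EReal} {R R' : ℝ} {L : EReal} (h : ∀ N, w N ≤ w' N + R)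
    (h' : ∀ N, w' N ≤ w N + R') (hw' : Tendsto (fun N => w' N / (N : EReal)) atTop (𝓝 L)) :
    Tendsto (fun N => w N / (N : EReal)) atTop (𝓝 L) := by
  have hN (N : ℕ) : (0 : EReal) ≤ N := by exact_mod_cast N.zero_le
  refine tendsto_of_tendsto_of_tendsto_of_le_of_le
    (tendsto_add_zero hw' (tendsto_const_div (-R')))
      (tendsto_add_zero hw' (tendsto_const_div R)) ?_ ?_
  · intro N
    dsimp only
    rw [← EReal.add_div_of_nonneg_right (hN N)]
    refine EReal.div_le_div_right_of_nonneg (hN N) ?_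
    rw [EReal.coe_neg, ← sub_eq_add_neg]
    exact EReal.sub_le_of_le_add (h' N)
  · intro N
    dsimp only
    rw [← EReal.add_div_of_nonneg_right (hN N)]
    exact EReal.div_le_div_right_of_nonneg (hN N) (h N)

lemma iterate_bound {w : ℕ → EReal} {c α β : ℝ} {m r : ℕ} (hsub : ∀ M N, w (M + N) ≤ w M + w N + c)
    (hm : w m + c ≤ α) (hr : w r ≤ β) (q : ℕ) : w (q * m + r) ≤ ((q * α + β : ℝ) : EReal) := by
  induction q with
  | zero => simpa using hr
  | succ q ih =>
    rw [show (q + 1) * m + r = m + (q * m + r) by ring]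
    calc w (m + (q * m + r)) ≤ w m + w (q * m + r) + c := hsub _ _
      _ = (w m + c) + w (q * m + r) := add_right_comm _ _ _
      _ ≤ (α : EReal) + ((q * α + β : ℝ) : EReal) := add_le_add hm ih
      _ = _ := by
        rw [← EReal.coe_add]
        congr 1
        push_cast
        ring

/-- Fekete's lemma for sequences with values in `[-∞, ∞)` that are subadditive up to a constant. -/
theorem fekete {w : ℕ → EReal} {c : ℝ} (hw : ∀ N, w N ≠ ⊤)
    (hsub : ∀ M N, w (M + N) ≤ w M + w N + c) :
    ∃ L : EReal, L ≠ ⊤ ∧ Tendsto (fun N => w N / (N : EReal)) atTop (𝓝 L) := by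
  let L : EReal := ⨅ (m : ℕ) (_ : 1 ≤ m), (w m + c) / (m : EReal)
  have hL (m : ℕ) (hm : 1 ≤ m) : L ≤ (w m + c) / (m : EReal) := iInf₂_le m hm
  have hwc (m : ℕ) : w m + c ≠ ⊤ := EReal.add_ne_top (hw m) (EReal.coe_ne_top c)
  refine ⟨L, ?_, ?_⟩
  · have h1 := hL 1 le_rfl
    rw [Nat.cast_one, EReal.div_eq_inv_mul, ← EReal.coe_one, ← EReal.coe_inv, inv_one,
      EReal.coe_one,
      one_mul] at h1
    exact ne_top_of_le_ne_top (hwc 1) h1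
  · rw [tendsto_order]
    constructor
    · intro a ha
      -- `w N / N ≥ L - c / N` by the definition of `L`
      have h1 : Tendsto (fun N : ℕ => L + ((-c : ℝ) : EReal) / (N : EReal)) atTop (𝓝 L) :=
        tendsto_add_zero tendsto_const_nhds (tendsto_const_div (-c))
      filter_upwards [h1.eventually (lt_mem_nhds ha), eventually_ge_atTop 1] with N hN hN1
      refine hN.trans_le ((add_le_add_left (hL N hN1) _).trans ?_)
      rw [← EReal.add_div_of_nonneg_right (natCast_pos hN1).le]
      refine EReal.div_le_div_right_of_nonneg (natCast_pos hN1).le ?_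
      rw [add_assoc, ← EReal.coe_add, add_neg_cancel, EReal.coe_zero, add_zero]
    · intro a ha
      -- for `m` with `(w m + c) / m < a' < a`, division with remainder gives `w N ≤ a' N + K`
      obtain ⟨m, hm⟩ := iInf_lt_iff.1 ha
      obtain ⟨hm1, hm⟩ := iInf_lt_iff.1 hm
      obtain ⟨a', ha', ha'a⟩ := EReal.lt_iff_exists_real_btwn.1 hm
      have hα : w m + c ≤ ((a' * m : ℝ) : EReal) := by
        rw [EReal.div_lt_iff (natCast_pos hm1) (natCast_ne_top m)] at ha'
        rw [EReal.coe_mul]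
        exact_mod_cast ha'.le
      have hβ (r : ℕ) : ∃ β : ℝ, w r ≤ β := by
        obtain ⟨β, hβ, -⟩ := EReal.lt_iff_exists_real_btwn.1 (lt_top_iff_ne_top.2 (hw r))
        exact ⟨β, hβ.le⟩
      choose β hβ using hβ
      -- a bound for the contributions of all remainders modulo `m`
      obtain ⟨K, hK⟩ : ∃ K : ℝ, ∀ r < m, β r - a' * r ≤ K := by
        obtain ⟨K, hK⟩ := ((Finset.range m).image fun r => β r - a' * r).bddAbove
        exact ⟨K, fun r hr => hK (Finset.mem_image_of_mem _ (Finset.mem_range.2 hr))⟩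
      have hbound (N : ℕ) : w N ≤ ((a' * N + K : ℝ) : EReal) := by
        have h1 := iterate_bound hsub hα (hβ (N % m)) (N / m)
        rw [mul_comm, Nat.div_add_mod] at h1
        refine h1.trans (EReal.coe_le_coe_iff.2 ?_)
        have h2 := hK (N % m) (Nat.mod_lt N hm1)
        have h3 : ((N : ℕ) : ℝ) = (m : ℝ) * ((N / m : ℕ) : ℝ) + ((N % m : ℕ) : ℝ) := by
          exact_mod_cast (Nat.div_add_mod N m).symm
        rw [h3]
        linarith
      have h1 : Tendsto (fun N : ℕ => (a' : EReal) + (K : EReal) / (N : EReal)) atTop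
          (𝓝 (a' : EReal)) :=
        tendsto_add_zero tendsto_const_nhds (tendsto_const_div K)
      filter_upwards [h1.eventually (gt_mem_nhds ha'a), eventually_ge_atTop 1] with N hN hN1
      refine lt_of_le_of_lt ?_ hN
      rw [EReal.div_le_iff_le_mul (natCast_pos hN1) (natCast_ne_top N)]
      refine (hbound N).trans (le_of_eq ?_)
      have hN0 : (N : ℝ) ≠ 0 := by positivity
      have : (N : EReal) = ((N : ℝ) : EReal) := rfl
      rw [this, ← EReal.coe_div, ← EReal.coe_add, ← EReal.coe_mul]
      congr 1
      field_simp

/-- `-inf {i | a i ≠ 0}`. -/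
noncomputable def negInf (a : ℤ → ℕ∞) : EReal := ⨆ (i : ℤ) (_ : a i ≠ 0), ((-i : ℝ) : EReal)

/-- `∑ₙ a n e^(-nt)`. -/
noncomputable def weight (a : ℤ → ℕ∞) (t : ℝ) : ENNReal :=
  ∑' n : ℤ, ((a n : ℕ∞) : ENNReal) * ENNReal.ofReal (Real.exp (-(n * t)))

lemma le_negInf {a : ℤ → ℕ∞} {i : ℤ} (h : a i ≠ 0) : ((-i : ℝ) : EReal) ≤ negInf a :=
  le_iSup₂ (f := fun (i : ℤ) (_ : a i ≠ 0) => ((-i : ℝ) : EReal)) i h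

lemma negInf_le {a : ℤ → ℕ∞} {x : EReal} (h : ∀ i, a i ≠ 0 → ((-i : ℝ) : EReal) ≤ x) :
    negInf a ≤ x := iSup₂_le h

lemma exists_bound {ι : Type*} [Fintype ι] (s : ι → ℤ) : ∃ R : ℝ, ∀ j, (s j : ℝ) ≤ R := by
  obtain ⟨R, hR⟩ := (Finset.univ.image fun j => (s j : ℝ)).bddAbove
  exact ⟨R, fun j => hR (by simp)⟩

lemma negInf_ne_top {a : ℤ → ℕ∞} (S : Finset ℤ) (hS : ∀ i ∉ S, a i = 0) : negInf a ≠ ⊤ := by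
  obtain ⟨R, hR⟩ := exists_bound fun i : S => -(i : ℤ)
  refine ne_top_of_le_ne_top (EReal.coe_ne_top R) (negInf_le fun i hi => ?_)
  have : i ∈ S := by
    by_contra h
    exact hi (hS i h)
  have := hR ⟨i, this⟩
  push_cast at this
  exact EReal.coe_le_coe_iff.2 this

lemma negInf_le_of_le_sum {ι : Type*} [Fintype ι] {a b : ℤ → ℕ∞} {s : ι → ℤ} {R : ℝ}
    (hR : ∀ j, (s j : ℝ) ≤ R) (h : ∀ n, a n ≤ ∑ j, b (n + s j)) : negInf a ≤ negInf b + R := by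
  refine negInf_le fun i hi => ?_
  obtain ⟨j, -, hj⟩ := Finset.exists_ne_zero_of_sum_ne_zero
    (show ∑ j, b (i + s j) ≠ 0 from fun h0 => hi (le_antisymm ((h i).trans h0.le) (by simp)))
  refine le_trans ?_ (add_le_add (le_negInf hj) (EReal.coe_le_coe_iff.2 (hR j)))
  rw [← EReal.coe_add, EReal.coe_le_coe_iff]
  push_cast
  linarith

lemma negInf_le_of_le_sum_mul {ι : Type*} [Fintype ι] {a b c : ℤ → ℕ∞} {s : ι → ℤ} {R : ℝ}
    (hR : ∀ j, (s j : ℝ) ≤ R) (S : Finset ℤ)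
    (h : ∀ n, c n ≤ ∑ j, ∑ i ∈ S, a i * b (n + s j - i)) : negInf c ≤ negInf a + negInf b + R := by
  refine negInf_le fun n hn => ?_
  obtain ⟨j, -, hj⟩ := Finset.exists_ne_zero_of_sum_ne_zero
    (show ∑ j, ∑ i ∈ S, a i * b (n + s j - i) ≠ 0 from
      fun h0 => hn (le_antisymm ((h n).trans h0.le) (by simp)))
  obtain ⟨i, -, hi⟩ := Finset.exists_ne_zero_of_sum_ne_zero hj
  refine le_trans ?_ (add_le_add (add_le_add (le_negInf (left_ne_zero_of_mul hi))
    (le_negInf (right_ne_zero_of_mul hi))) (EReal.coe_le_coe_iff.2 (hR j)))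
  rw [← EReal.coe_add, ← EReal.coe_add, EReal.coe_le_coe_iff]
  push_cast
  linarith

lemma ofReal_exp_add (x y : ℝ) : ENNReal.ofReal (Real.exp (x + y)) =
    ENNReal.ofReal (Real.exp x) * ENNReal.ofReal (Real.exp y) := by
  rw [Real.exp_add, ENNReal.ofReal_mul (Real.exp_nonneg x)]

lemma weight_shift (b : ℤ → ℕ∞) (s : ℤ) (t : ℝ) :
    weight (fun n => b (n + s)) t = ENNReal.ofReal (Real.exp (s * t)) * weight b t := by
  rw [weight, weight, ← ENNReal.tsum_mul_left, ← (Equiv.addRight s).tsum_eq fun n : ℤ =>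
    ENNReal.ofReal (Real.exp (s * t)) * (((b n : ℕ∞) : ENNReal) *
      ENNReal.ofReal (Real.exp (-(n * t))))]
  refine tsum_congr fun n => ?_
  rw [Equiv.coe_addRight, mul_left_comm, ← ofReal_exp_add]
  congr 3
  push_cast
  ring

lemma toENNReal_sum {ι : Type*} (s : Finset ι) (f : ι → ℕ∞) :
    ((∑ j ∈ s, f j : ℕ∞) : ENNReal) = ∑ j ∈ s, ((f j : ℕ∞) : ENNReal) :=
  map_sum ENat.toENNRealRingHom f s

lemma weight_mono {a b : ℤ → ℕ∞} (h : ∀ n, a n ≤ b n) (t : ℝ) : weight a t ≤ weight b t :=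
  ENNReal.tsum_le_tsum fun n => mul_le_mul_left (ENat.toENNReal_le.2 (h n)) _

lemma weight_sum {ι : Type*} (s : Finset ι) (f : ι → ℤ → ℕ∞) (t : ℝ) :
    weight (fun n => ∑ j ∈ s, f j n) t = ∑ j ∈ s, weight (f j) t := by
  simp only [weight, toENNReal_sum, Finset.sum_mul]
  exact Summable.tsum_finsetSum fun _ _ => ENNReal.summable

lemma weight_mul (c : ℕ∞) (a : ℤ → ℕ∞) (t : ℝ) :
    weight (fun n => c * a n) t = (c : ENNReal) * weight a t := by
  simp only [weight, ENat.toENNReal_mul, mul_assoc]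
  exact ENNReal.tsum_mul_left

/-- `∑ⱼ e^(s_j t)`. -/
noncomputable def shiftConst {ι : Type*} [Fintype ι] (s : ι → ℤ) (t : ℝ) : ENNReal :=
  ∑ j, ENNReal.ofReal (Real.exp (s j * t))

lemma exists_log_shiftConst_le {ι : Type*} [Fintype ι] (s : ι → ℤ) (t : ℝ) :
    ∃ R : ℝ, ENNReal.log (shiftConst s t) ≤ R := by
  have h : ENNReal.log (shiftConst s t) < ⊤ := by
    rw [ENNReal.log_lt_top_iff]
    exact ENNReal.sum_lt_top.2 fun _ _ => ENNReal.ofReal_lt_top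
  obtain ⟨R, hR, -⟩ := EReal.lt_iff_exists_real_btwn.1 h
  exact ⟨R, hR.le⟩

lemma weight_le_of_le_sum {ι : Type*} [Fintype ι] {a b : ℤ → ℕ∞} {s : ι → ℤ}
    (h : ∀ n, a n ≤ ∑ j, b (n + s j)) (t : ℝ) : weight a t ≤ weight b t * shiftConst s t := by
  refine (weight_mono h t).trans (le_of_eq ?_)
  rw [weight_sum, shiftConst, Finset.mul_sum]
  exact Finset.sum_congr rfl fun j _ => by rw [weight_shift, mul_comm]

lemma weight_le_of_le_sum_mul {ι : Type*} [Fintype ι] {a b c : ℤ → ℕ∞} {s : ι → ℤ} (S : Finset ℤ)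
    (h : ∀ n, c n ≤ ∑ j, ∑ i ∈ S, a i * b (n + s j - i)) (t : ℝ) :
    weight c t ≤ weight a t * weight b t * shiftConst s t := by
  refine (weight_mono h t).trans ?_
  rw [weight_sum, shiftConst, Finset.mul_sum]
  refine Finset.sum_le_sum fun j _ => ?_
  rw [weight_sum]
  have h1 (i : ℤ) : weight (fun n => a i * b (n + s j - i)) t =
      ((a i : ENNReal) * ENNReal.ofReal (Real.exp (-(i * t)))) *
        (weight b t * ENNReal.ofReal (Real.exp (s j * t))) := by
    rw [weight_mul]
    have := weight_shift b (s j - i) t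
    simp only [← add_sub_assoc] at this
    rw [this, show ((s j - i : ℤ) : ℝ) * t = -(i * t) + s j * t by push_cast; ring, ofReal_exp_add]
    ring
  rw [Finset.sum_congr rfl fun i _ => h1 i, ← Finset.sum_mul, mul_assoc]
  exact mul_le_mul_left (ENNReal.sum_le_tsum S) _

lemma weight_ne_top {a : ℤ → ℕ∞} (ha : ∀ n, a n ≠ ⊤) (S : Finset ℤ) (hS : ∀ i ∉ S, a i = 0)
    (t : ℝ) : weight a t ≠ ⊤ := by
  rw [weight, tsum_eq_sum (s := S) fun i hi => by rw [hS i hi]; simp]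
  exact ENNReal.sum_ne_top.2 fun i _ => ENNReal.mul_ne_top
    (by simpa using ha i) ENNReal.ofReal_ne_top

/-- A sequence of graded dimensions that is submultiplicative up to finitely many shifts. -/
structure Submult (b : ℕ → ℤ → ℕ∞) : Prop where
  ne_top : ∀ N n, b N n ≠ ⊤
  bounded : ∀ N, ∃ S : Finset ℤ, ∀ n ∉ S, b N n = 0
  mul_le : ∃ (ι : Type) (_ : Fintype ι) (s : ι → ℤ), ∀ (M N : ℕ) (S : Finset ℤ),
    (∀ n ∉ S, b M n = 0) → ∀ n, b (M + N) n ≤ ∑ j, ∑ i ∈ S, b M i * b N (n + s j - i)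

/-- Two sequences of graded dimensions bound each other up to finitely many shifts. -/
structure Comparable (a b : ℕ → ℤ → ℕ∞) : Prop where
  le : ∃ (ι : Type) (_ : Fintype ι) (s : ι → ℤ), ∀ N n, a N n ≤ ∑ j, b N (n + s j)
  ge : ∃ (ι : Type) (_ : Fintype ι) (s : ι → ℤ), ∀ N n, b N n ≤ ∑ j, a N (n + s j)

/-- Reflection of the grading. -/
def reflect (b : ℕ → ℤ → ℕ∞) : ℕ → ℤ → ℕ∞ := fun N n => b N (-n)

lemma Submult.reflect {b : ℕ → ℤ → ℕ∞} (hb : Submult b) : Submult (reflect b) where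
  ne_top N n := hb.ne_top N (-n)
  bounded N := by
    obtain ⟨S, hS⟩ := hb.bounded N
    exact ⟨S.map (Equiv.neg ℤ).toEmbedding, fun n hn => hS _ fun h => hn (by simpa using h)⟩
  mul_le := by
    obtain ⟨ι, _, s, hs⟩ := hb.mul_le
    refine ⟨ι, inferInstance, fun j => -s j, fun M N S hS n => ?_⟩
    refine (hs M N (S.map (Equiv.neg ℤ).toEmbedding)
      (fun i hi => by simpa [GrowthSeq.reflect] using hS (-i) fun h => hi (by simpa using h))
        (-n)).trans
        (le_of_eq ?_)
    refine Finset.sum_congr rfl fun j _ => ?_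
    rw [Finset.sum_map]
    refine Finset.sum_congr rfl fun i _ => ?_
    simp only [GrowthSeq.reflect, Equiv.coe_toEmbedding, Equiv.neg_apply]
    congr 2
    ring

lemma Comparable.reflect {a b : ℕ → ℤ → ℕ∞} (h : Comparable a b) :
    Comparable (reflect a) (reflect b) where
  le := by
    obtain ⟨ι, _, s, hs⟩ := h.le
    refine ⟨ι, inferInstance, fun j => -s j, fun N n => (hs N (-n)).trans (le_of_eq ?_)⟩
    refine Finset.sum_congr rfl fun j _ => ?_
    simp only [GrowthSeq.reflect]
    congr 1
    ring
  ge := by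
    obtain ⟨ι, _, s, hs⟩ := h.ge
    refine ⟨ι, inferInstance, fun j => -s j, fun N n => (hs N (-n)).trans (le_of_eq ?_)⟩
    refine Finset.sum_congr rfl fun j _ => ?_
    simp only [GrowthSeq.reflect]
    congr 1
    ring

lemma weight_reflect (b : ℕ → ℤ → ℕ∞) (N : ℕ) (t : ℝ) :
    weight (reflect b N) t = weight (b N) (-t) := by
  rw [weight, weight, ← (Equiv.neg ℤ).tsum_eq]
  refine tsum_congr fun n => ?_
  simp only [reflect, Equiv.neg_apply, neg_neg]
  congr 3
  push_cast
  ring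

section Limits

variable {a b : ℕ → ℤ → ℕ∞}

lemma Submult.exists_tendsto_negInf (hb : Submult b) : ∃ U : EReal, U ≠ ⊤ ∧
    Tendsto (fun N => negInf (b N) / (N : EReal)) atTop (𝓝 U) := by
  obtain ⟨ι, _, s, hs⟩ := hb.mul_le
  obtain ⟨R, hR⟩ := exists_bound s
  refine fekete (c := R) (fun N => ?_) fun M N => ?_
  · obtain ⟨S, hS⟩ := hb.bounded N
    exact negInf_ne_top S hS
  · obtain ⟨S, hS⟩ := hb.bounded M
    exact negInf_le_of_le_sum_mul hR S (hs M N S hS)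

lemma Submult.exists_tendsto_weight (hb : Submult b) (t : ℝ) : ∃ h : EReal, h ≠ ⊤ ∧
    Tendsto (fun N => ENNReal.log (weight (b N) t) / (N : EReal)) atTop (𝓝 h) := by
  obtain ⟨ι, _, s, hs⟩ := hb.mul_le
  obtain ⟨R, hR⟩ := exists_log_shiftConst_le s t
  refine fekete (c := R) (fun N => ?_) fun M N => ?_
  · obtain ⟨S, hS⟩ := hb.bounded N
    exact (ENNReal.log_lt_top_iff.2 (weight_ne_top (hb.ne_top N) S hS t).lt_top).ne
  · obtain ⟨S, hS⟩ := hb.bounded M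
    refine (ENNReal.log_le_log (weight_le_of_le_sum_mul S (hs M N S hS) t)).trans ?_
    rw [ENNReal.log_mul_add, ENNReal.log_mul_add]
    exact add_le_add le_rfl hR

lemma Comparable.tendsto_negInf (h : Comparable a b) {U : EReal}
    (hU : Tendsto (fun N => negInf (b N) / (N : EReal)) atTop (𝓝 U)) :
    Tendsto (fun N => negInf (a N) / (N : EReal)) atTop (𝓝 U) := by
  obtain ⟨ι, _, s, hs⟩ := h.le
  obtain ⟨ι', _, s', hs'⟩ := h.ge
  obtain ⟨R, hR⟩ := exists_bound s
  obtain ⟨R', hR'⟩ := exists_bound s'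
  exact tendsto_div_of_le_add (fun N => negInf_le_of_le_sum hR (hs N))
    (fun N => negInf_le_of_le_sum hR' (hs' N)) hU

lemma Comparable.tendsto_weight (h : Comparable a b) {t : ℝ} {L : EReal}
    (hL : Tendsto (fun N => ENNReal.log (weight (b N) t) / (N : EReal)) atTop (𝓝 L)) :
    Tendsto (fun N => ENNReal.log (weight (a N) t) / (N : EReal)) atTop (𝓝 L) := by
  obtain ⟨ι, _, s, hs⟩ := h.le
  obtain ⟨ι', _, s', hs'⟩ := h.ge
  obtain ⟨R, hR⟩ := exists_log_shiftConst_le s t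
  obtain ⟨R', hR'⟩ := exists_log_shiftConst_le s' t
  refine tendsto_div_of_le_add (R := R) (R' := R') (fun N => ?_) (fun N => ?_) hL
  · refine (ENNReal.log_le_log (weight_le_of_le_sum (hs N) t)).trans ?_
    rw [ENNReal.log_mul_add]
    exact add_le_add le_rfl hR
  · refine (ENNReal.log_le_log (weight_le_of_le_sum (hs' N) t)).trans ?_
    rw [ENNReal.log_mul_add]
    exact add_le_add le_rfl hR'

lemma log_ofReal_exp (x : ℝ) : ENNReal.log (ENNReal.ofReal (Real.exp x)) = (x : EReal) := by
  rw [ENNReal.log_ofReal, if_neg (not_le.2 (Real.exp_pos x)), Real.log_exp]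

/-- The term of the smallest degree bounds the weighted dimension from below. -/
lemma mul_negInf_le_log_weight (c : ℤ → ℕ∞) {t : ℝ} (ht : 0 < t) :
    (t : EReal) * negInf c ≤ ENNReal.log (weight c t) := by
  rw [mul_comm, ← EReal.le_div_iff_mul_le (EReal.coe_pos.2 ht) (EReal.coe_ne_top t)]
  refine negInf_le fun i hi => ?_
  rw [EReal.le_div_iff_mul_le (EReal.coe_pos.2 ht) (EReal.coe_ne_top t), ← EReal.coe_mul,
    neg_mul, ← log_ofReal_exp]
  refine ENNReal.log_le_log (le_trans ?_ (ENNReal.le_tsum i))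
  refine le_mul_of_one_le_left (zero_le) ?_
  rw [← ENat.toENNReal_one, ENat.toENNReal_le]
  exact Order.one_le_iff_ne_zero.2 hi

/-- All terms are at most `e^(-nt)` for the smallest degree `n`. -/
lemma log_weight_le (c : ℤ → ℕ∞) (S : Finset ℤ) (hS : ∀ i ∉ S, c i = 0) {t : ℝ} (ht : 0 < t) :
    ENNReal.log (weight c t) ≤ ENNReal.log (weight c 0) + (t : EReal) * negInf c := by
  by_cases h0 : ∀ i, c i = 0
  · have : weight c t = 0 := by simp [weight, h0]
    rw [this, ENNReal.log_zero]
    exact bot_le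
  push Not at h0
  obtain ⟨i₀, hi₀⟩ := h0
  obtain ⟨r, hr⟩ : ∃ r : ℝ, negInf c = r := by
    refine ⟨(negInf c).toReal, (EReal.coe_toReal (negInf_ne_top S hS) ?_).symm⟩
    exact ((EReal.bot_lt_coe _).trans_le (le_negInf hi₀)).ne'
  rw [hr, ← EReal.coe_mul, ← log_ofReal_exp, ← ENNReal.log_mul_add]
  refine ENNReal.log_le_log ?_
  rw [weight, weight, ← ENNReal.tsum_mul_right]
  refine ENNReal.tsum_le_tsum fun n => ?_
  by_cases hn : c n = 0
  · simp [hn]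
  · rw [mul_assoc, ← ofReal_exp_add]
    refine mul_le_mul_right (ENNReal.ofReal_le_ofReal (Real.exp_le_exp.2 ?_)) _
    have := le_negInf hn
    rw [hr, EReal.coe_le_coe_iff] at this
    nlinarith

lemma Submult.tendsto_div_atTop (hb : Submult b) {U : EReal} (hU' : U ≠ ⊤)
    (hU : Tendsto (fun N => negInf (b N) / (N : EReal)) atTop (𝓝 U)) {h : ℝ → EReal}
    (h' : ∀ t, h t ≠ ⊤)
    (hh : ∀ t, Tendsto (fun N => ENNReal.log (weight (b N) t) / (N : EReal)) atTop (𝓝 (h t))) :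
    Tendsto (fun t : ℝ => h t / (t : EReal)) atTop (𝓝 U) := by
  have hmul (t : ℝ) (ht : 0 < t) :
      Tendsto (fun N => (t : EReal) * negInf (b N) / (N : EReal)) atTop (𝓝 (t * U)) := by
    simp only [← EReal.mul_div]
    have ht' : (t : EReal) ≠ 0 := EReal.coe_ne_zero.2 ht.ne'
    exact (EReal.continuousAt_mul (p := ((t : EReal), U)) (.inl ht') (.inl ht')
      (.inl (EReal.coe_ne_bot t)) (.inl (EReal.coe_ne_top t))).tendsto.comp
        (tendsto_const_nhds.prodMk_nhds hU)
  have hlow (t : ℝ) (ht : 0 < t) : (t : EReal) * U ≤ h t :=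
    le_of_tendsto_of_tendsto' (hmul t ht) (hh t) fun N =>
      EReal.div_le_div_right_of_nonneg (by exact_mod_cast N.zero_le)
        (mul_negInf_le_log_weight (b N) ht)
  obtain ⟨H, hH, -⟩ := EReal.lt_iff_exists_real_btwn.1 (lt_top_iff_ne_top.2 (h' 0))
  have hup (t : ℝ) (ht : 0 < t) : h t ≤ H + (t : EReal) * U := by
    have htU : (t : EReal) * U ≠ ⊤ := by
      induction U with
      | bot => rw [EReal.coe_mul_bot_of_pos ht]; exact bot_ne_top
      | coe r => exact EReal.coe_ne_top (t * r)
      | top => exact absurd rfl hU'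
    refine le_trans ?_ (add_le_add_left hH.le _)
    refine le_of_tendsto_of_tendsto' (hh t)
      ((EReal.continuousAt_add (p := (h 0, (t : EReal) * U)) (.inl (h' 0)) (.inr htU)).tendsto.comp
        ((hh 0).prodMk_nhds (hmul t ht))) fun N => ?_
    have hN : (0 : EReal) ≤ N := by exact_mod_cast N.zero_le
    dsimp only [Function.comp_apply]
    rw [← EReal.add_div_of_nonneg_right hN]
    obtain ⟨S, hS⟩ := hb.bounded N
    exact EReal.div_le_div_right_of_nonneg hN (log_weight_le (b N) S hS ht)
  have hconst : Tendsto (fun t : ℝ => (H : EReal) / (t : EReal)) atTop (𝓝 0) := by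
    have h1 : Tendsto (fun t : ℝ => H / t) atTop (𝓝 0) := tendsto_const_nhds.div_atTop tendsto_id
    exact (EReal.tendsto_coe.2 h1).congr fun t => EReal.coe_div H t
  refine tendsto_of_tendsto_of_tendsto_of_le_of_le' tendsto_const_nhds
    (tendsto_add_zero (tendsto_const_nhds (x := U)) hconst) ?_ ?_
  · filter_upwards [eventually_gt_atTop 0] with t ht
    rw [EReal.le_div_iff_mul_le (EReal.coe_pos.2 ht) (EReal.coe_ne_top t), mul_comm]
    exact hlow t ht
  · filter_upwards [eventually_gt_atTop 0] with t ht
    have ht0 : (t : EReal) ≠ 0 := EReal.coe_ne_zero.2 ht.ne'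
    refine (EReal.div_le_div_right_of_nonneg (EReal.coe_nonneg.2 ht.le) (hup t ht)).trans
      (le_of_eq ?_)
    rw [EReal.add_div_of_nonneg_right (EReal.coe_nonneg.2 ht.le), ← EReal.mul_div,
      EReal.mul_div_left_comm, EReal.div_self (EReal.coe_ne_bot t) (EReal.coe_ne_top t) ht0,
        mul_one,
      add_comm]

lemma neg_div' (x : EReal) (y : EReal) : -x / y = -(x / y) := neg_mul _ _

/-- The growth rates of a submultiplicative sequence: `U` and `L` are the growth rates of the
smallest and largest degrees, with signs reversed, and `h t` is the one of the weighted dimensions.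
They are shared by all comparable sequences. For `t > 0` the logarithm of the weighted dimension
lies between `-t n` and `-t n + log d`, where `n` is the smallest degree and `d` the total
dimension. This gives `t U ≤ h t ≤ h 0 + t U`, hence the limit of `h t / t`; negative `t` are
reduced to positive ones by reflecting the grading. -/
theorem Submult.exists_growthRates (hb : Submult b) : ∃ (U L : EReal) (h : ℝ → EReal),
    (∀ a, Comparable a b →
      Tendsto (fun N => negInf (a N) / (N : EReal)) atTop (𝓝 U) ∧
      Tendsto (fun N => -negInf (GrowthSeq.reflect a N) / (N : EReal)) atTop (𝓝 L) ∧
      ∀ t, Tendsto (fun N => ENNReal.log (weight (a N) t) / (N : EReal)) atTop (𝓝 (h t))) ∧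
    (∀ t, h t ≠ ⊤) ∧
    Tendsto (fun t : ℝ => h t / (t : EReal)) atTop (𝓝 U) ∧
    Tendsto (fun t : ℝ => h t / (t : EReal)) atBot (𝓝 L) ∧
    ((∀ N, ∃ n, b N n ≠ 0) → (∃ r : ℝ, U = r) ∧ ∃ r : ℝ, L = r) := by
  obtain ⟨U, hU', hU⟩ := hb.exists_tendsto_negInf
  obtain ⟨V, hV', hV⟩ := hb.reflect.exists_tendsto_negInf
  choose h h' hh using hb.exists_tendsto_weight
  refine ⟨U, -V, h, fun a ha => ⟨ha.tendsto_negInf hU, ?_, fun t => ha.tendsto_weight (hh t)⟩, h',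
    hb.tendsto_div_atTop hU' hU h' hh, ?_, ?_⟩
  · simp only [neg_div']
    exact (ha.reflect.tendsto_negInf hV).neg
  · have h1 := hb.reflect.tendsto_div_atTop hV' hV (h := fun t => h (-t)) (fun t => h' (-t))
      fun t => by simpa only [weight_reflect] using hh (-t)
    have h2 := (h1.comp tendsto_neg_atBot_atTop).neg
    refine h2.congr fun t => ?_
    simp only [Function.comp_apply, neg_neg]
    rw [EReal.coe_neg, EReal.div_eq_inv_mul, EReal.inv_neg, neg_mul, neg_neg,
      ← EReal.div_eq_inv_mul]
  · intro hne
    have hle : -V ≤ U := by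
      refine le_of_tendsto_of_tendsto' hV.neg hU fun N => ?_
      rw [← neg_div']
      refine EReal.div_le_div_right_of_nonneg (by exact_mod_cast N.zero_le) ?_
      obtain ⟨n, hn⟩ := hne N
      refine le_trans ?_ (le_negInf hn)
      rw [EReal.neg_le]
      have h2 := le_negInf (a := GrowthSeq.reflect b N) (i := -n)
        (by simpa [GrowthSeq.reflect] using hn)
      simpa using h2
    have hV0 : -V ≠ ⊥ := by simpa using hV'
    exact ⟨⟨U.toReal, (EReal.coe_toReal hU' (ne_bot_of_le_ne_bot hV0 hle)).symm⟩,
      ⟨(-V).toReal, (EReal.coe_toReal (ne_top_of_le_ne_top hU' hle) hV0).symm⟩⟩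

end Limits

end GrowthSeq

namespace DGBimod

variable {k : Type u} [Field k] {A B C E : DGAlgebra k}

open GHom

/-! ### Morphism spaces of the homotopy category -/

lemma cls_smul {M N : DGBimod A B} (c : k) (f : GHom M N 0) (hf : f.Closed) :
    c • cls f hf = cls (c • f) (hf.smul c) := rfl

/-- The class of a closed map of degree `n` as a morphism to the shift. -/
noncomputable def shiftCls (X Y : DGBimod A B) (n : ℤ) :
    LinearMap.ker ((homCx X Y).d n (n + 1) rfl) →ₗ[k]
      (HoBimod.of X ⟶ HoBimod.of (Y.shift n)) where
  toFun f := cls ((show GHom X Y n from f.1).comp (GIso.toShift Y n).hom (add_neg_cancel n))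
    (((closed_iff _).2 fun q hq => by
      subst hq
      exact f.2).comp (GIso.toShift Y n).closed_hom _)
  map_add' f g := by
    rw [cls_add, cls_eq_iff]
    exact .of_eq (add_comp (L := Y.shift n) (show GHom X Y n from f.1) (show GHom X Y n from g.1)
      (GIso.toShift Y n).hom (add_neg_cancel n))
  map_smul' c f := by
    rw [RingHom.id_apply, cls_smul, cls_eq_iff]
    exact .of_eq (smul_comp (L := Y.shift n) c (show GHom X Y n from f.1)
      (GIso.toShift Y n).hom (add_neg_cancel n))

lemma shiftCls_surjective (X Y : DGBimod A B) (n : ℤ) : Function.Surjective (shiftCls X Y n) := by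
  intro φ
  obtain ⟨g, hg, rfl⟩ := exists_cls φ
  let t := GIso.toShift Y n
  have hc : (g.comp t.inv (by lia : 0 + - -n = n)).Closed := Closed.comp hg t.closed_inv _
  refine ⟨⟨g.comp t.inv (by lia : 0 + - -n = n), hc.D rfl⟩, cls_eq_iff.2 (.of_eq ?_)⟩
  refine (comp_assoc g t.inv t.hom (by lia : 0 + - -n = n) (add_neg_cancel n)
    (neg_add_cancel (-n)) (add_zero 0)).trans ?_
  rw [t.inv_hom]
  exact comp_id _ _

lemma ker_shiftCls (X Y : DGBimod A B) (n : ℤ) : LinearMap.ker (shiftCls X Y n) =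
    (LinearMap.range ((homCx X Y).d (n - 1) n (sub_add_cancel n 1))).submoduleOf
      (LinearMap.ker ((homCx X Y).d n (n + 1) rfl)) := by
  ext f
  rw [LinearMap.mem_ker, ← Submodule.Quotient.mk_eq_zero]
  refine Iff.trans ?_ ((homCx X Y).Hmk_eq_zero_iff (sub_add_cancel n 1) f).symm
  let t := GIso.toShift Y n
  refine cls_eq_zero_iff.trans (Iff.trans ?_ (htpy_zero_iff (sub_add_cancel n 1)
    (show GHom X Y n from f.1)))
  constructor
  · intro h
    have h1 := Htpy.comp_right h t.closed_inv (r := n) (by lia)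
    rw [zero_comp] at h1
    refine .trans (.of_eq ?_) h1
    refine Eq.symm ((comp_assoc (show GHom X Y n from f.1) t.hom t.inv _ _ (add_neg_cancel (-n))
      (add_zero n)).trans ?_)
    rw [t.hom_inv, comp_id]
  · intro h
    have h1 := Htpy.comp_right h t.closed_hom (add_neg_cancel n)
    rwa [zero_comp] at h1

/-- `Hom(X, Y[n]) ≅ Hⁿ(Hom(X, Y))`. -/
noncomputable def homEquiv (X Y : DGBimod A B) (n : ℤ) :
    (homCx X Y).H n ≃ₗ[k] (HoBimod.of X ⟶ HoBimod.of (Y.shift n)) :=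
  (Submodule.quotEquivOfEq _ _ (ker_shiftCls X Y n).symm).trans
    ((shiftCls X Y n).quotKerEquivOfSurjective (shiftCls_surjective X Y n))

lemma toENat_rank_hom (X Y : HoBimod A B) (n : ℤ) :
    Cardinal.toENat (Module.rank k (X ⟶ HoBimod.shift Y n)) = (homCx X.as Y.as).hdim n := by
  rw [hdim, (homEquiv X.as Y.as n).rank_eq]
  rfl

lemma nontrivial_hom_iff (X Y : HoBimod A B) (n : ℤ) :
    Nontrivial (X ⟶ HoBimod.shift Y n) ↔ (homCx X.as Y.as).hdim n ≠ 0 := by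
  rw [hdim_ne_zero_iff]
  exact (homEquiv X.as Y.as n).toEquiv.nontrivial_congr.symm

lemma neg_iInf_eq_negInf {p : ℤ → Prop} {a : ℤ → ℕ∞} (h : ∀ i, p i ↔ a i ≠ 0) :
    -(⨅ (i : ℤ) (_ : p i), ((i : ℝ) : EReal)) = GrowthSeq.negInf a := by
  apply le_antisymm
  · rw [EReal.neg_le]
    refine le_iInf₂ fun i hi => ?_
    rw [EReal.neg_le]
    exact_mod_cast GrowthSeq.le_negInf ((h i).1 hi)
  · refine GrowthSeq.negInf_le fun i hi => ?_
    rw [EReal.le_neg]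
    have := iInf₂_le (f := fun (i : ℤ) (_ : p i) => ((i : ℝ) : EReal)) i ((h i).2 hi)
    simpa using this

lemma iSup_eq_negInf {p : ℤ → Prop} {a : ℤ → ℕ∞} (h : ∀ i, p i ↔ a i ≠ 0) :
    (⨆ (i : ℤ) (_ : p i), ((i : ℝ) : EReal)) = GrowthSeq.negInf fun n => a (-n) := by
  apply le_antisymm
  · refine iSup₂_le fun i hi => ?_
    have := GrowthSeq.le_negInf (a := fun n => a (-n)) (i := -i) (by simpa using (h i).1 hi)
    simpa using this
  · refine GrowthSeq.negInf_le fun i hi => ?_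
    have := le_iSup₂ (f := fun (i : ℤ) (_ : p i) => ((i : ℝ) : EReal)) (-i) ((h _).2 hi)
    simpa using this

/-- Evaluation at `1`, the map `Hom(A, Y) → Y`, `g ↦ g 1`. -/
noncomputable def evalOne (Y : DGBimod (DGAlgebra.base k) A) :
    GHom (homCx A.regular Y) Y.forgetRight 0 :=
  mkBase (M := homCx A.regular Y) (N := Y.forgetRight) fun i j h =>
    { toFun := fun f : GHom A.regular Y i => f.f 0 j (by lia) (diagOne A)
      map_add' := fun f g => rfl
      map_smul' := fun c f => rfl }

lemma d_map_cocycle {X Y : DGBimod A B} {p q i l m j : ℤ} (f : GHom X Y p) (h : p + 1 = q)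
    (hl : i + p = l) (hlj : l + 1 = j) (hj : i + q = j) (hm : i + 1 = m) {x : X.X i}
    (hx : X.d i m hm x = 0) : Y.d l j hlj (f.f i l hl x) = (f.D h).f i j hj x := by
  rw [D_f f h i l m j hj hl hlj hm (by lia), hx, map_zero, smul_zero, sub_zero]

lemma closed_evalOne (Y : DGBimod (DGAlgebra.base k) A) : (evalOne Y).Closed :=
  closed_of_d_f fun i m l j hil hlj him hmj f => by
    rw [Int.negOnePow_zero, one_smul]
    exact d_map_cocycle (show GHom A.regular Y i from f) him (by lia) hlj (by lia)
      (zero_add 1) (x := diagOne A) (A.d_one _ _)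

lemma map_eq_rmul {Y : DGBimod (DGAlgebra.base k) A} {p : ℤ} (f : GHom A.regular Y p) (i j l : ℤ)
    (h : i + p = j) (hl : 0 + p = l) (h' : l + i = j) (a : A.X i) :
    f.f i j h a = Y.rmul l i j h' (f.f 0 l hl (diagOne A)) a := by
  have := f.map_rmul 0 i i l j (zero_add i) hl h h' (diagOne A) a
  refine Eq.trans ?_ this
  exact congrArg (f.f i j h) (A.one_mul i _ a).symm

lemma ext_one {Y : DGBimod (DGAlgebra.base k) A} {p l : ℤ} {f g : GHom A.regular Y p}
    (hl : 0 + p = l) (h : f.f 0 l hl (diagOne A) = g.f 0 l hl (diagOne A)) : f = g :=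
  GHom.ext fun i j hij x => by
    refine (map_eq_rmul f i j l hij hl (by lia) x).trans (Eq.trans ?_
      (map_eq_rmul g i j l hij hl (by lia) x).symm)
    rw [h]

/-- `Hom(A, Y) ≅ Y`. -/
noncomputable def homRegular (Y : DGBimod (DGAlgebra.base k) A) :
    GIso (homCx A.regular Y) Y.forgetRight 0 :=
  GIso.ofBijective (evalOne Y) (closed_evalOne Y) fun i j h => by
    obtain rfl : i = j := by lia
    constructor
    · intro f g hfg
      exact ext_one (zero_add i) hfg
    · intro y
      refine ⟨(mk' (M := A.regular) (N := Y) (fun a b hab => Y.rmul i a b (by lia) y)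
        (base_map_lmul (M := A.regular) (N := Y) _)
        (fun a j n i' n' h hi hn h' x b =>
          (Y.rmul_rmul i a j i' n n' (by lia) h h' (by lia) y x b).symm) : GHom A.regular Y i), ?_⟩
      exact Y.rmul_one i _ y

lemma hdim_homCx_regular (Y : DGBimod (DGAlgebra.base k) A) (n : ℤ) :
    (homCx A.regular Y).hdim n = Y.hdim n :=
  (homRegular Y).hdim_eq n n (add_zero n)

/-! ### Zigzags of quasi-isomorphisms -/

/-- Dg bimodules connected by a zigzag of quasi-isomorphisms. -/
def QuasiEq (M N : DGBimod A B) : Prop :=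
  Relation.EqvGen (fun M N : DGBimod A B => ∃ f : M ⟶ N, QuasiIso f) M N

namespace QuasiEq

variable {M N L : DGBimod A B}

lemma of_quasiIso {f : M ⟶ N} (hf : QuasiIso f) : QuasiEq M N := Relation.EqvGen.rel _ _ ⟨f, hf⟩

lemma refl (M : DGBimod A B) : QuasiEq M M := Relation.EqvGen.refl _

lemma symm (h : QuasiEq M N) : QuasiEq N M := Relation.EqvGen.symm _ _ h

lemma trans (h : QuasiEq M N) (h' : QuasiEq N L) : QuasiEq M L := Relation.EqvGen.trans _ _ _ h h'

lemma of_gIso (e : GIso M N 0) : QuasiEq M N := of_quasiIso (quasiIso_iso_hom e.toIso)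

lemma hdim_eq (h : QuasiEq M N) (n : ℤ) : M.hdim n = N.hdim n := by
  induction h with
  | rel _ _ h => exact h.choose_spec.hdim_eq n
  | refl _ => rfl
  | symm _ _ _ ih => exact ih.symm
  | trans _ _ _ _ _ ih ih' => exact ih.trans ih'

lemma map (h : QuasiEq M N) (Φ : DGFunctor A B C E)
    (hΦ : ∀ M : DGBimod A B, M.Acyclic → (Φ.obj M).Acyclic) : QuasiEq (Φ.obj M) (Φ.obj N) := by
  induction h with
  | rel _ _ h => exact of_quasiIso (Φ.quasiIso_mapHom hΦ h.choose_spec)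
  | refl _ => exact refl _
  | symm _ _ _ ih => exact ih.symm
  | trans _ _ _ _ _ ih ih' => exact ih.trans ih'

lemma finCoh (h : QuasiEq M N) (hM : M.FinCoh) : N.FinCoh where
  ne_top n := by
    rw [← h.hdim_eq]
    exact hM.ne_top n
  bounded := by
    obtain ⟨s, hs⟩ := hM.bounded
    exact ⟨s, fun n hn => by rw [← h.hdim_eq, hs n hn]⟩

end QuasiEq

lemma FinCoh.of_le_sum {M : DGBimod A B} {N : DGBimod C E} (hN : N.FinCoh) {ι : Type} [Fintype ι]
    (s : ι → ℤ) (h : ∀ n, M.hdim n ≤ ∑ j, N.hdim (n + s j)) : M.FinCoh where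
  ne_top n := by
    refine ne_top_of_le_ne_top ?_ (h n)
    exact (WithTop.sum_lt_top.2 fun j _ => (hN.ne_top _).lt_top).ne
  bounded := by
    obtain ⟨S, hS⟩ := hN.bounded
    classical
    refine ⟨Finset.univ.biUnion fun j => S.image fun i => i - s j, fun n hn => ?_⟩
    refine le_antisymm ((h n).trans (le_of_eq ?_)) (by simp)
    refine Finset.sum_eq_zero fun j _ => hS _ fun hj => hn ?_
    exact Finset.mem_biUnion.2 ⟨j, Finset.mem_univ j, Finset.mem_image.2 ⟨_, hj, by lia⟩⟩

lemma finCoh_of_compact (hc : A.Compact) : A.regular.FinCoh := by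
  have : Module.Finite k (DirectSum ℤ fun i => (diag A).H i) := hc
  constructor
  · intro n
    have : Module.Finite k ((diag A).H n) :=
      Module.Finite.of_surjective (DirectSum.component k ℤ (fun i => (diag A).H i) n) fun x =>
        ⟨DirectSum.lof k ℤ _ n x, DirectSum.component.lof_self k _ x⟩
    exact Cardinal.toENat_eq_top.not.2 (not_le.2 (Module.rank_lt_aleph0 k ((diag A).H n)))
  · classical
    obtain ⟨S, hS⟩ := Module.finite_def.1 hc
    refine ⟨S.biUnion fun x => x.support, fun n hn => ?_⟩
    refine hdim_eq_zero_iff.2 ⟨fun x y => ?_⟩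
    have h0 : ∀ z, DirectSum.component k ℤ (fun i => (diag A).H i) n z = 0 := by
      intro z
      have hz : z ∈ Submodule.span k (S : Set (DirectSum ℤ fun i => (diag A).H i)) := by
        rw [hS]
        trivial
      induction hz using Submodule.span_induction with
      | mem w hw =>
        by_contra hne
        exact hn (Finset.mem_biUnion.2 ⟨w, hw, DFinsupp.mem_support_iff.2 hne⟩)
      | zero => exact map_zero _
      | add _ _ _ _ h h' => rw [map_add, h, h', add_zero]
      | smul c _ _ h => rw [map_smul, h, smul_zero]
    have hz (z : (diag A).H n) : z = 0 :=
      (DirectSum.component.lof_self k n z).symm.trans (h0 (DirectSum.lof k ℤ _ n z))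
    exact (hz x).trans (hz y).symm

lemma finCoh_of_thick (hc : A.Compact) {X : HoBimod (DGAlgebra.base k) A}
    (hX : HoBimod.thick (HoBimod.of A.regular) X) : X.as.FinCoh := by
  obtain ⟨ι, _, s, hs⟩ := thick_bound hX
  exact (finCoh_of_compact hc).of_le_sum s fun n => hs (DGFunctor.id _ _) n

/-- Objects of `⟨A⟩` are flat. -/
lemma acyclic_tensor_of_thick {X : HoBimod (DGAlgebra.base k) A}
    (hX : HoBimod.thick (HoBimod.of A.regular) X) {K : DGBimod A B} (hK : K.Acyclic) :
    (X.as.tensor K).Acyclic :=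
  acyclic_obj_of_thick hX (tensorR _ K)
    (((forgetLeftTensor (diag A) K).trans ((forgetLeftF A B).mapGIso (leftUnit K))
      (zero_add 0)).acyclic_iff.2 hK)

end DGBimod

namespace DGBimod

variable {k : Type u} [Field k] {A B C E : DGAlgebra k}

open GHom

/-! ### The growth sequence of a tensor endofunctor -/

section Growth

lemma acyclic_iter {T : DGFunctor A B A B} (hT : ∀ M : DGBimod A B, M.Acyclic → (T.obj M).Acyclic)
    (N : ℕ) : ∀ M : DGBimod A B, M.Acyclic → ((T.iter N).obj M).Acyclic := by
  induction N with
  | zero => exact fun M hM => hM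
  | succ N ih => exact fun M hM => hT _ (ih M hM)

/-- The dimensions of the cohomology of `A ⊗_A L ⊗_A ⋯ ⊗_A L` with `N` factors `L`. -/
noncomputable def growth (L : DGBimod A A) (N : ℕ) (n : ℤ) : ℕ∞ :=
  (((tensorR (DGAlgebra.base k) L).iter N).obj A.regular).hdim n

variable {P : DGBimod A A}

/-- Submultiplicativity of the growth sequence: with `X = A ⊗ L ⊗ ⋯ ⊗ L` (`M` factors), the complex
`X ⊗ L ⊗ ⋯ ⊗ L` is quasi-isomorphic to `X ⊗_A P ⊗ L ⊗ ⋯ ⊗ L`, and `P` is built from finitely many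
shifts of `A ⊗ₖ A`; for the latter one gets `X ⊗ₖ (A ⊗ L ⊗ ⋯ ⊗ L)`. -/
lemma growth_mul_le (hP : HoBimod.thick (HoBimod.of (free A A)) (HoBimod.of P))
    {q : P ⟶ diag A} (hq : QuasiIso q) {L : DGBimod A A}
    (hL : ∀ M : DGBimod (DGAlgebra.base k) A, M.Acyclic → (M.tensor L).Acyclic)
    (hfin : ∀ N n, growth L N n ≠ ⊤) :
    ∃ (ι : Type) (_ : Fintype ι) (s : ι → ℤ), ∀ (M N : ℕ) (S : Finset ℤ),
      (∀ n ∉ S, growth L M n = 0) → ∀ n, growth L (M + N) n ≤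
        ∑ j, ∑ i ∈ S, growth L M i * growth L N (n + s j - i) := by
  obtain ⟨ι, _, s, hs⟩ := thick_bound hP
  refine ⟨ι, inferInstance, s, fun M N S hS n => ?_⟩
  set T := tensorR (DGAlgebra.base k) L
  set X := (T.iter M).obj A.regular
  have e₁ : growth L (M + N) n = ((T.iter N).obj X).hdim n :=
    congrArg (fun Z : DGBimod (DGAlgebra.base k) A => Z.hdim n) (T.iter_add_obj M N A.regular)
  have e₂ : ((T.iter N).obj X).hdim n = ((T.iter N).obj (X.tensor P)).hdim n :=
    ((QuasiEq.of_quasiIso (quasiIso_resRight hP hq X)).map (T.iter N)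
      (acyclic_iter hL N)).symm.hdim_eq n
  rw [e₁, e₂]
  refine (hs ((tensorL A X).comp (T.iter N)) n).trans (Finset.sum_le_sum fun j _ => ?_)
  have e₃ : (((tensorL A X).comp (T.iter N)).obj (free A A)).hdim (n + s j) =
      ((T.iter N).obj (X.forgetRight.tensor A.regular)).hdim (n + s j) :=
    (QuasiEq.of_gIso ((T.iter N).mapGIso (tensorFree X A))).hdim_eq _
  refine e₃.le.trans ((hdim_obj_le_of_base X.forgetRight S hS (hfin M)
    ((tensorR _ A.regular).comp (T.iter N)) (n + s j)).trans (le_of_eq ?_))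
  refine Finset.sum_congr rfl fun i _ => ?_
  have e₄ : ((T.iter N).obj ((diag (DGAlgebra.base k)).tensor A.regular)).hdim (n + s j - i) =
      growth L N (n + s j - i) :=
    (QuasiEq.of_gIso ((T.iter N).mapGIso (leftUnit A.regular))).hdim_eq _
  exact congrArg (growth L M i * ·) e₄

/-- If `X` and `X'` are built from `Y` and `Y'`, then `Hom(X, Φ X')` is bounded by finitely many
shifts of `Hom(Y, Φ Y')`, uniformly in `Φ`. -/
lemma exists_homCx_bound {X Y : HoBimod A B} {X' Y' : HoBimod C E} (h : HoBimod.thick Y X)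
    (h' : HoBimod.thick Y' X') : ∃ (ι : Type) (_ : Fintype ι) (s : ι → ℤ),
      ∀ (Φ : DGFunctor C E A B) (n : ℤ), (homCx X.as (Φ.obj X'.as)).hdim n ≤
        ∑ j, (homCx Y.as (Φ.obj Y'.as)).hdim (n + s j) := by
  obtain ⟨ι, _, s, hs⟩ := thick_bound h
  obtain ⟨ι', _, s', hs'⟩ := thick_bound h'
  refine ⟨ι × ι', inferInstance, fun j => -s j.1 + s' j.2, fun Φ n => ?_⟩
  have h₁ : (homCx X.as (Φ.obj X'.as)).hdim n ≤
      ∑ j, (homCx Y.as (Φ.obj X'.as)).hdim (n + -s j) := by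
    have := hs (dhomF (Φ.obj X'.as)) (-n)
    have e (M : DGBimod A B) (m : ℤ) :
        ((dhomF (Φ.obj X'.as)).obj M).hdim m = (homCx M (Φ.obj X'.as)).hdim (-m) := hdim_dual _ _
    simp only [e] at this
    rw [neg_neg] at this
    refine this.trans (Finset.sum_le_sum fun j _ => ?_)
    rw [show -(-n + s j) = n + -s j by ring]
  refine h₁.trans ?_
  rw [Fintype.sum_prod_type]
  refine Finset.sum_le_sum fun j _ => ?_
  refine (hs' (Φ.comp (homF Y.as)) (n + -s j)).trans (Finset.sum_le_sum fun i _ => ?_)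
  rw [add_assoc]
  rfl

/-- For generators `G`, `G'` the sequence `Hom(G, G' ⊗ L ⊗ ⋯ ⊗ L)` is comparable with the growth
sequence, which is the case `G = G' = A`. -/
lemma comparable_homCx (L : DGBimod A A) {G G' : HoBimod (DGAlgebra.base k) A}
    (h₁ : HoBimod.thick (HoBimod.of A.regular) G) (h₂ : HoBimod.thick G (HoBimod.of A.regular))
    (h₁' : HoBimod.thick (HoBimod.of A.regular) G') (h₂' : HoBimod.thick G' (HoBimod.of A.regular))
    {Y : ℕ → DGBimod (DGAlgebra.base k) A}
    (hY : ∀ N, QuasiEq (Y N) (((tensorR (DGAlgebra.base k) L).iter N).obj G'.as)) :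
    GrowthSeq.Comparable (fun N n => (homCx G.as (Y N)).hdim n) (growth L) := by
  have e (N : ℕ) (n : ℤ) : (homCx G.as (Y N)).hdim n =
      (homCx G.as (((tensorR (DGAlgebra.base k) L).iter N).obj G'.as)).hdim n :=
    ((hY N).map (homF G.as) ((hProjective_iff _).1 (hProjective_of_thick_regular h₁))).hdim_eq n
  simp only [e]
  constructor
  · obtain ⟨ι, i, s, hs⟩ := exists_homCx_bound h₁ h₁'
    refine ⟨ι, i, s, fun N n => (hs _ n).trans (Finset.sum_le_sum fun j _ => ?_)⟩
    exact (hdim_homCx_regular _ _).le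
  · obtain ⟨ι, i, s, hs⟩ := exists_homCx_bound h₂ h₂'
    exact ⟨ι, i, s, fun N n => (hdim_homCx_regular _ _).symm.le.trans (hs _ n)⟩

end Growth

end DGBimod

/-! ### Dimensions and entropy of functors computed by a bimodule -/

namespace Perf

open DGBimod GHom

variable {k : Type u} [Field k] {A : DGAlgebra k}

/-- `F` is computed by `L`: `- ⊗_A L` preserves acyclicity, and `F(X)` is connected with `X ⊗_A L`
by quasi-isomorphisms. These need not be natural in `X`; flatness of `L` allows one to iterate. -/
structure ComputedBy (F : Perf A ⥤ Perf A) (L : DGBimod A A) : Prop where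
  flat : ∀ M : DGBimod (DGAlgebra.base k) A, M.Acyclic → (M.tensor L).Acyclic
  quasiEq : ∀ X : Perf A, QuasiEq (F.obj X).obj.as (X.obj.as.tensor L)

lemma ComputedBy.iterate {F : Perf A ⥤ Perf A} {L : DGBimod A A} (h : ComputedBy F L) (X : Perf A)
    (N : ℕ) : QuasiEq (F.obj^[N] X).obj.as
      (((tensorR (DGAlgebra.base k) L).iter N).obj X.obj.as) := by
  induction N with
  | zero => exact QuasiEq.refl _
  | succ N ih =>
    rw [Function.iterate_succ_apply']
    exact (h.quasiEq _).trans (ih.map (tensorR (DGAlgebra.base k) L) h.flat)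

lemma quasiEq_tensor_of_quasiIso {K L : DGBimod A A} (X : Perf A) {f : L ⟶ K} (hf : QuasiIso f) :
    QuasiEq (X.obj.as.tensor L) (X.obj.as.tensor K) :=
  QuasiEq.of_quasiIso (((tensorL A X.obj.as).quasiIso_mapHom_iff f).2
    (acyclic_tensor_of_thick X.property ((quasiIso_iff_acyclic_cone f).1 hf)))

/-- A tensor endofunctor is computed by the flat bimodule `P ⊗_A K`. -/
lemma computedBy_of_quasiEq {F : Perf A ⥤ Perf A} {K P : DGBimod A A}
    (hP : HoBimod.thick (HoBimod.of (DGBimod.free A A)) (HoBimod.of P)) {q : P ⟶ diag A}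
    (hq : QuasiIso q) (hF : ∀ X : Perf A, QuasiEq (F.obj X).obj.as (X.obj.as.tensor K)) :
    ComputedBy F (P.tensor K) where
  flat _ hM := acyclic_tensor_tensor hP hM K
  quasiEq X := (hF X).trans (quasiEq_tensor_of_quasiIso X (quasiIso_resLeft hP hq K)).symm

lemma IsTensorEndofunctor.exists_quasiEq {F : Perf A ⥤ Perf A} (hF : IsTensorEndofunctor F) :
    ∃ K : DGBimod A A, ∀ X : Perf A, QuasiEq (F.obj X).obj.as (X.obj.as.tensor K) := by
  obtain ⟨K, η, hη⟩ := hF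
  refine ⟨K, fun X => ?_⟩
  obtain ⟨f, -, hf⟩ := hη X
  exact QuasiEq.of_quasiIso hf

/-- Objects of `Perf(A)` are h-projective, so acyclic ones are contractible. -/
lemma isZero_of_acyclic {X : Perf A} (h : X.obj.as.Acyclic) : Limits.IsZero X := by
  have h₁ : Htpy (GHom.id X.obj.as) 0 :=
    ((hProjective_of_thick_regular X.property).contractible h).htpy_zero _ (closed_id _)
  have h₂ : 𝟙 (HoBimod.of X.obj.as) = 0 :=
    (cls_id X.obj.as).symm.trans (cls_eq_zero_iff.2 h₁)
  exact (Limits.IsZero.iff_id_eq_zero X).2 (ObjectProperty.hom_ext _ h₂)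

lemma isGenerator_free (A : DGAlgebra k) : IsGenerator (free A) := fun X => X.property

lemma submult_growth (hc : A.Compact) {F : Perf A ⥤ Perf A} {L P : DGBimod A A}
    (hP : HoBimod.thick (HoBimod.of (DGBimod.free A A)) (HoBimod.of P)) {q : P ⟶ diag A}
    (hq : QuasiIso q) (h : ComputedBy F L) : GrowthSeq.Submult (growth L) := by
  have hfin (N : ℕ) : (((tensorR (DGAlgebra.base k) L).iter N).obj A.regular).FinCoh :=
    (h.iterate (free A) N).finCoh (finCoh_of_thick hc (F.obj^[N] (free A)).property)
  exact ⟨fun N => (hfin N).ne_top, fun N => (hfin N).bounded,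
    growth_mul_le hP hq h.flat fun N => (hfin N).ne_top⟩

/-- If all powers of `F` are nonzero, the growth sequence does not vanish: otherwise
`Fᴺ(A)` is acyclic for some `N`, hence so is `Fᴺ(X)` for all `X` built from `A`. -/
lemma exists_growth_ne_zero {F : Perf A ⥤ Perf A} {L : DGBimod A A} (h : ComputedBy F L)
    (hF : ¬ IsNilpotentFunctor F) (N : ℕ) : ∃ n, growth L N n ≠ 0 := by
  by_contra! h0
  refine hF ⟨N, fun X => isZero_of_acyclic (acyclic_iff_hdim.2 fun n => ?_)⟩
  rw [(h.iterate X N).hdim_eq]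
  exact acyclic_iff_hdim.1 (acyclic_obj_of_thick X.property
    ((tensorR (DGAlgebra.base k) L).iter N) (acyclic_iff_hdim.2 h0)) n

variable (F : Perf A ⥤ Perf A) (G G' : Perf A)

/-- The dimensions of `Homⁿ(G, Fᴺ(G'))`. -/
noncomputable def homSeq (N : ℕ) (n : ℤ) : ℕ∞ := (homCx G.obj.as (F.obj^[N] G').obj.as).hdim n

lemma upperSeq_eq : upperSeq F G G' = fun N => GrowthSeq.negInf (homSeq F G G' N) / (N : EReal) :=
  funext fun _ => congrArg (· / _) (neg_iInf_eq_negInf fun i => nontrivial_hom_iff _ _ i)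

lemma lowerSeq_eq : lowerSeq F G G' =
    fun N => -GrowthSeq.negInf (GrowthSeq.reflect (homSeq F G G') N) / (N : EReal) :=
  funext fun _ => congrArg (fun x => -x / _) (iSup_eq_negInf fun i => nontrivial_hom_iff _ _ i)

lemma entropySeq_eq (t : ℝ) : entropySeq F G G' t =
    fun N => ENNReal.log (GrowthSeq.weight (homSeq F G G' N) t) / (N : EReal) := by
  funext N
  refine congrArg (fun x => ENNReal.log x / (N : EReal)) (tsum_congr fun n => ?_)
  rw [toENat_rank_hom]
  rfl

variable {F G G'}

lemma ComputedBy.comparable {L : DGBimod A A} (h : ComputedBy F L) (hG : IsGenerator G)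
    (hG' : IsGenerator G') : GrowthSeq.Comparable (homSeq F G G') (growth L) :=
  comparable_homCx L G.property (hG (free A)) G'.property (hG' (free A)) fun N => h.iterate G' N

/-- The dimensions and the entropy of a functor computed by a bimodule `L` are the growth rates of
the growth sequence of `L`. -/
theorem ComputedBy.dim_and_entropy (hc : A.Compact) {L P : DGBimod A A}
    (hP : HoBimod.thick (HoBimod.of (DGBimod.free A A)) (HoBimod.of P)) {q : P ⟶ diag A}
    (hq : QuasiIso q) (h : ComputedBy F L) :
    (∀ G G' : Perf A, IsGenerator G → IsGenerator G' →
      upperDimWrt F G G' = upperDim F ∧ lowerDimWrt F G G' = lowerDim F ∧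
      Filter.Tendsto (upperSeq F G G') Filter.atTop (nhds (upperDim F)) ∧
      Filter.Tendsto (lowerSeq F G G') Filter.atTop (nhds (lowerDim F)) ∧
      ∀ t : ℝ, Filter.Tendsto (entropySeq F G G' t) Filter.atTop (nhds (entropy F t))) ∧
    (∀ t : ℝ, entropy F t ≠ ⊤) ∧
    Filter.Tendsto (fun t : ℝ => entropy F t / (t : EReal)) Filter.atTop (nhds (upperDim F)) ∧
    Filter.Tendsto (fun t : ℝ => entropy F t / (t : EReal)) Filter.atBot (nhds (lowerDim F)) ∧
    (¬ IsNilpotentFunctor F →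
      (∃ r : ℝ, upperDim F = (r : EReal)) ∧ ∃ r : ℝ, lowerDim F = (r : EReal)) ∧
    Filter.Tendsto (fun N => GrowthSeq.negInf (growth L N) / (N : EReal)) Filter.atTop
      (nhds (upperDim F)) ∧
    Filter.Tendsto (fun N => -GrowthSeq.negInf (GrowthSeq.reflect (growth L) N) / (N : EReal))
      Filter.atTop (nhds (lowerDim F)) := by
  obtain ⟨U, V, e, H, he, hU, hV, hfin⟩ := (submult_growth hc hP hq h).exists_growthRates
  have key (G G' : Perf A) (hG : IsGenerator G) (hG' : IsGenerator G') :
      Filter.Tendsto (upperSeq F G G') Filter.atTop (nhds U) ∧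
      Filter.Tendsto (lowerSeq F G G') Filter.atTop (nhds V) ∧
      ∀ t, Filter.Tendsto (entropySeq F G G' t) Filter.atTop (nhds (e t)) := by
    simp only [upperSeq_eq, lowerSeq_eq, entropySeq_eq]
    exact H _ (h.comparable hG hG')
  have hA := key _ _ (isGenerator_free A) (isGenerator_free A)
  have hU' : upperDim F = U := hA.1.limsup_eq
  have hV' : lowerDim F = V := hA.2.1.liminf_eq
  have he' (t) : entropy F t = e t := (hA.2.2 t).limsup_eq
  have hL := H (growth L) ⟨⟨Unit, inferInstance, fun _ => 0, by simp⟩,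
    ⟨Unit, inferInstance, fun _ => 0, by simp⟩⟩
  simp only [hU', hV', he']
  refine ⟨fun G G' hG hG' => ?_, he, hU, hV, fun hF => hfin (exists_growth_ne_zero h hF),
    hL.1, hL.2.1⟩
  obtain ⟨h₁, h₂, h₃⟩ := key G G' hG hG'
  exact ⟨h₁.limsup_eq, h₂.liminf_eq, h₁, h₂, h₃⟩

end Perf

namespace DGBimod

variable {k : Type u} [Field k] {A B C E : DGAlgebra k}

open GHom

/-! ### Evaluation and contraction maps -/

section Contract

/-- Elements of degree `i` of the dual are functionals on the part of degree `j = -i`. -/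
def dualEquiv (M : DGBimod A B) {i j : ℤ} (h : i + j = 0) :
    M.dual.X i ≃ₗ[k] Module.Dual k (M.X j) :=
  (LinearEquiv.ofLinearMap (M.castX j (-i) (by lia)) (M.castX (-i) j (by lia))
    (by ext x; simp) (by ext x; simp)).dualMap

lemma dualEquiv_add (M : DGBimod A B) {i j : ℤ} (h : i + j = 0) (φ ψ : M.dual.X i) (x : M.X j) :
    dualEquiv M h (φ + ψ) x = dualEquiv M h φ x + dualEquiv M h ψ x := rfl

lemma dualEquiv_sign (M : DGBimod A B) {i j : ℤ} (h : i + j = 0) (s : ℤˣ) (φ : M.dual.X i)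
    (x : M.X j) : dualEquiv M h (s • φ) x = s • dualEquiv M h φ x := rfl

lemma dualEquiv_d (M : DGBimod A B) {i i' j j' : ℤ} (hi : i + 1 = i') (h' : i' + j' = 0)
    (h : i + j = 0) (hj : j' + 1 = j) (φ : M.dual.X i) (x : M.X j') :
    dualEquiv M h' (M.dual.d i i' hi φ) x = -(i.negOnePow • dualEquiv M h φ (M.d j' j hj x)) := by
  obtain rfl : j = -i := by lia
  obtain rfl : j' = -i' := by lia
  rfl

lemma dualEquiv_lmul (M : DGBimod A B) {i j n l m : ℤ} (h : i + j = n) (hn : n + l = 0)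
    (hl : l + i = m) (hm : j + m = 0) (b : B.X i) (φ : M.dual.X j) (x : M.X l) :
    dualEquiv M hn (M.dual.lmul i j n h b φ) x =
      i.negOnePow • dualEquiv M hm φ (M.rmul l i m hl x b) := by
  obtain rfl : l = -n := by lia
  obtain rfl : m = -j := by lia
  rfl

lemma dualEquiv_rmul (M : DGBimod A B) {i j n l m : ℤ} (h : i + j = n) (hn : n + l = 0)
    (hl : j + l = m) (hm : i + m = 0) (φ : M.dual.X i) (a : A.X j) (x : M.X l) :
    dualEquiv M hn (M.dual.rmul i j n h φ a) x = dualEquiv M hm φ (M.lmul j l m hl a x) := by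
  obtain rfl : l = -n := by lia
  obtain rfl : m = -i := by lia
  rfl

lemma dualEquiv_ext (M : DGBimod A B) {i j : ℤ} (h : i + j = 0) {φ ψ : M.dual.X i}
    (e : ∀ x, dualEquiv M h φ x = dualEquiv M h ψ x) : φ = ψ :=
  (dualEquiv M h).injective (LinearMap.ext e)

variable (T : DGBimod (DGAlgebra.base k) A)

/-- The contraction `T^* ⊗ₖ T → A^*`, `w ⊗ t ↦ (a ↦ w (t a))`. -/
def contract (i j n : ℤ) (h : i + j = n) :
    T.dual.X i →ₗ[k] T.X j →ₗ[k] (diag A).dual.X n :=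
  LinearMap.mk₂ k (fun w t => (show Module.Dual k (A.X (-n)) from
      (dualEquiv T (by lia : i + (j + -n) = 0) w) ∘ₗ T.rmul j (-n) (j + -n) rfl t))
    (fun w w' t => by rw [map_add, LinearMap.add_comp]; rfl)
    (fun c w t => by rw [map_smul, LinearMap.smul_comp]; rfl)
    (fun w t t' => by rw [map_add, LinearMap.comp_add]; rfl)
    (fun c w t => by rw [map_smul, LinearMap.comp_smul]; rfl)

lemma contract_apply {i j n l m : ℤ} (h : i + j = n) (hl : n + l = 0) (hm : j + l = m)
    (hi : i + m = 0) (w : T.dual.X i) (t : T.X j) (a : (diag A).X l) :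
    dualEquiv (diag A) hl (contract T i j n h w t) a =
      dualEquiv T hi w (T.rmul j l m hm t a) := by
  obtain rfl : l = -n := by lia
  subst hm
  rfl

lemma contract_lmul {i j n l il ln : ℤ} (h : i + j = n) (hl : l + i = il) (h' : il + j = ln)
    (h'' : l + n = ln) (a : A.X l) (w : T.dual.X i) (t : T.X j) :
    contract T il j ln h' (T.dual.lmul l i il hl a w) t =
      (diag A).dual.lmul l n ln h'' a (contract T i j n h w t) := by
  refine dualEquiv_ext _ (add_neg_cancel ln) fun b => ?_
  rw [contract_apply T h' (add_neg_cancel ln) rfl (by lia),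
    dualEquiv_lmul (diag A) h'' (add_neg_cancel ln) rfl (by lia),
    contract_apply T h (by lia) (by lia : j + (-ln + l) = j + -ln + l) (by lia),
    dualEquiv_lmul T hl (by lia) rfl (by lia)]
  congr 2
  exact T.rmul_rmul _ _ _ _ _ _ _ _ _ _ _ _ _

lemma contract_rmul {i j n l jl nl : ℤ} (h : i + j = n) (hl : j + l = jl) (h' : i + jl = nl)
    (h'' : n + l = nl) (w : T.dual.X i) (t : T.X j) (a : A.X l) :
    contract T i jl nl h' w (T.rmul j l jl hl t a) =
      (diag A).dual.rmul n l nl h'' (contract T i j n h w t) a := by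
  refine dualEquiv_ext _ (add_neg_cancel nl) fun b => ?_
  rw [contract_apply T h' (add_neg_cancel nl) rfl (by lia),
    dualEquiv_rmul (diag A) h'' (add_neg_cancel nl) rfl (by lia),
    contract_apply T h (by lia) (by lia : j + (l + -nl) = jl + -nl) (by lia)]
  congr 1
  exact T.rmul_rmul _ _ _ _ _ _ _ _ _ _ _ _ _

lemma contract_d {i j n i' j' n' : ℤ} (h : i + j = n) (hi : i + 1 = i') (hj : j + 1 = j')
    (hn : n + 1 = n') (h₁ : i' + j = n') (h₂ : i + j' = n') (w : T.dual.X i) (t : T.X j) :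
    (diag A).dual.d n n' hn (contract T i j n h w t) =
      contract T i' j n' h₁ (T.dual.d i i' hi w) t +
        i.negOnePow • contract T i j' n' h₂ w (T.d j j' hj t) := by
  refine dualEquiv_ext _ (add_neg_cancel n') fun b => ?_
  obtain rfl : j' = j + 1 := hj.symm
  have hr := T.d_rmul j (-n') (j + -n') (j + 1) (-n) (-i) rfl rfl (by lia) (by lia) (by lia)
    (by lia) t b
  have e₁ : dualEquiv (diag A) (add_neg_cancel n') ((diag A).dual.d n n' hn
      (contract T i j n h w t)) b = -(n.negOnePow • dualEquiv T (add_neg_cancel i) w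
        (T.rmul j (-n) (-i) (by lia) t (A.d (-n') (-n) (by lia) b))) := by
    rw [dualEquiv_d (diag A) hn (add_neg_cancel n') (add_neg_cancel n) (by lia),
      contract_apply T h (add_neg_cancel n) (by lia : j + -n = -i) (add_neg_cancel i)]
    rfl
  have e₂ : dualEquiv (diag A) (add_neg_cancel n')
    (contract T i' j n' h₁ (T.dual.d i i' hi w) t) b =
      -(i.negOnePow • dualEquiv T (add_neg_cancel i) w
        (T.d (j + -n') (-i) (by lia) (T.rmul j (-n') (j + -n') rfl t b))) := by
    rw [contract_apply T h₁ (add_neg_cancel n') rfl (by lia),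
      dualEquiv_d T hi (by lia) (add_neg_cancel i) (by lia)]
  have e₃ : dualEquiv (diag A) (add_neg_cancel n')
      (contract T i (j + 1) n' h₂ w (T.d j (j + 1) rfl t)) b = dualEquiv T (add_neg_cancel i) w
        (T.rmul (j + 1) (-n') (-i) (by lia) (T.d j (j + 1) rfl t) b) := by
    rw [contract_apply T h₂ (add_neg_cancel n') (by lia : j + 1 + -n' = -i) (add_neg_cancel i)]
  rw [dualEquiv_add, dualEquiv_sign, e₁, e₂, e₃, hr, map_add, map_sign, smul_add, smul_smul,
    ← Int.negOnePow_add, show i + j = n from h]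
  abel

end Contract

end DGBimod

namespace DGBimod

variable {k : Type u} [Field k] {A B C E : DGAlgebra k}

open GHom

section EvalContract

/-- A graded map `M ⊗_A K → N` of degree zero between complexes of vector spaces, given by a
balanced family of bilinear maps. -/
noncomputable def tbase {M : DGBimod (DGAlgebra.base k) A} {K : DGBimod A (DGAlgebra.base k)}
    {N : DGBimod (DGAlgebra.base k) (DGAlgebra.base k)}
    (φ : ∀ i j n : ℤ, i + j = n → M.X i →ₗ[k] K.X j →ₗ[k] N.X n)
    (hφ : ∀ (i l j il lj n : ℤ) (hil : i + l = il) (hlj : l + j = lj) (h : il + j = n)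
      (h' : i + lj = n) (m : M.X i) (a : A.X l) (x : K.X j),
      φ il j n h (M.rmul i l il hil m a) x = φ i lj n h' m (K.lmul l j lj hlj a x)) :
    GHom (M.tensor K) N 0 :=
  mkBase fun n l h => tlift (fun i j hij => φ i j l (by lia))
    fun i l' j il lj hil hlj h₁ h₂ m a x => hφ i l' j il lj l hil hlj (by lia) (by lia) m a x

lemma tbase_tm {M : DGBimod (DGAlgebra.base k) A} {K : DGBimod A (DGAlgebra.base k)}
    {N : DGBimod (DGAlgebra.base k) (DGAlgebra.base k)}
    (φ : ∀ i j n : ℤ, i + j = n → M.X i →ₗ[k] K.X j →ₗ[k] N.X n) (hφ) {i j n l : ℤ}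
    (hij : i + j = n) (h : n + 0 = l) (h' : i + j = l) (m : M.X i) (x : K.X j) :
    (tbase φ hφ).f n l h (tm M K i j n hij m x) = φ i j l h' m x :=
  tlift_tm (fun i j hij => φ i j l (by lia))
    (fun i l' j il lj hil hlj h₁ h₂ m a x => hφ i l' j il lj l hil hlj (by lia) (by lia) m a x)
    i j hij m x

variable (X T : DGBimod (DGAlgebra.base k) A)

/-- The functional `g ↦ (-1)^|x| w (g x)` on `Hom(X, T)`. -/
def evalFun (i j n : ℤ) (h : i + j = n) :
    X.X i →ₗ[k] T.dual.X j →ₗ[k] (homCx X T).dual.X n :=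
  i.negOnePow • (LinearMap.llcomp k (GHom X T (-n)) (T.X (-j)) k).flip.compl₁₂
    ({ toFun := fun g => g.f i (-j) (by lia)
       map_add' := fun g g' => rfl
       map_smul' := fun c g => rfl } : GHom X T (-n) →ₗ[k] X.X i →ₗ[k] T.X (-j)).flip
    (dualEquiv T (add_neg_cancel j)).toLinearMap

lemma homEval_evalFun {i j n m s : ℤ} (h : i + j = n) (hm : n + m = 0) (hs : i + m = s)
    (hj : j + s = 0) (x : X.X i) (w : T.dual.X j) (g : GHom X T m) :
    homEval (evalFun X T i j n h x w) hm g = i.negOnePow • dualEquiv T hj w (g.f i s hs x) := by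
  obtain rfl : m = -n := by lia
  obtain rfl : s = -j := by lia
  rw [homEval_self]
  rfl

/-- The map `X ⊗_A T^* → Hom(X, T)^*`, `x ⊗ w ↦ (g ↦ (-1)^|x| w (g x))`. -/
noncomputable def evalHom : GHom (X.tensor T.dual) (homCx X T).dual 0 :=
  tbase (evalFun X T) (by
    intro i l' j il lj l hil hlj h₁ h₂ x a w
    refine homEval_ext (add_neg_cancel l) fun g => ?_
    rw [homEval_evalFun X T _ (add_neg_cancel l) (by lia : il + -l = -j) (add_neg_cancel j),
      homEval_evalFun X T _ (add_neg_cancel l) (by lia : i + -l = -lj) (add_neg_cancel lj),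
      dualEquiv_lmul T hlj (add_neg_cancel lj) (by lia : -lj + l' = -j) (add_neg_cancel j),
      g.map_rmul i l' il (-lj) (-j) hil (by lia) (by lia) (by lia), smul_smul, ← Int.negOnePow_add,
      show i + l' = il from hil])

lemma evalHom_tm {i j n l : ℤ} (hij : i + j = n) (h : n + 0 = l) (x : X.X i) (w : T.dual.X j) :
    (evalHom X T).f n l h (tm X T.dual i j n hij x w) = evalFun X T i j l (by lia) x w :=
  tbase_tm (evalFun X T) _ hij h _ x w

lemma closed_evalHom : (evalHom X T).Closed := by
  refine closed_of_tm fun i j n i' j' n' l l' hij hi hj hn h₁ h₂ hl hl' hll x w => ?_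
  rw [evalHom_tm, evalHom_tm, evalHom_tm, Int.negOnePow_zero, one_smul]
  refine homEval_ext (add_neg_cancel l') fun g => ?_
  obtain rfl : i' = i + 1 := hi.symm
  rw [homEval_d _ hll (add_neg_cancel l') (add_neg_cancel l) (by lia), homEval_add, homEval_sign,
    homEval_evalFun X T _ (add_neg_cancel l) (by lia : i + -l = -j) (add_neg_cancel j),
    homEval_evalFun X T _ (add_neg_cancel l') (by lia : i + 1 + -l' = -j) (add_neg_cancel j),
    homEval_evalFun X T _ (add_neg_cancel l') (by lia : i + -l' = -j') (add_neg_cancel j'),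
    dualEquiv_d T hj (add_neg_cancel j') (add_neg_cancel j) (by lia),
    D_f g (by lia : -l' + 1 = -l) i (-j') (i + 1) (-j) (by lia) (by lia) (by lia) rfl (by lia) x,
    map_sub, map_sign, Int.negOnePow_succ, Int.negOnePow_neg]
  have e : l'.negOnePow = -(i.negOnePow * j.negOnePow) := by
    rw [← Int.negOnePow_add, ← Int.negOnePow_succ]
    congr 1
    lia
  have e' : l.negOnePow = i.negOnePow * j.negOnePow := by
    rw [← Int.negOnePow_add]
    congr 1
    lia
  rw [e, e']
  generalize dualEquiv T _ w (T.d _ _ _ _) = y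
  generalize dualEquiv T _ w (g.f _ _ _ _) = z
  rcases Int.units_eq_one_or i.negOnePow with h | h <;>
    rcases Int.units_eq_one_or j.negOnePow with h' | h' <;> simp [h, h'] <;> ring

/-- The right linear map `t ↦ x ⊗ (w ⌟ t)`. -/
noncomputable def contractFun (i j n : ℤ) (h : i + j = n) :
    X.X i →ₗ[k] T.dual.X j →ₗ[k] (homCx T (X.tensor (diag A).dual)).X n :=
  LinearMap.mk₂ k (fun x w => (mk' (M := T) (N := X.tensor (diag A).dual)
      (fun a b hab => tm X (diag A).dual i (j + a) b (by lia) x ∘ₗ contract T j a (j + a) rfl w)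
      (base_map_lmul (M := T) (N := X.tensor (diag A).dual) _)
      (fun a c n' a' n'' h₁ h₂ h₃ h₄ t b => by
        simp only [LinearMap.comp_apply]
        rw [rmul_tm (by lia) (by lia) (by lia : j + a + c = j + n') (by lia),
          contract_rmul T rfl h₁ rfl (by lia)]) : GHom T (X.tensor (diag A).dual) n))
    (fun x x' w => GHom.ext fun a b hab t => by
      simp only [mk'_f, LinearMap.comp_apply, map_add, LinearMap.add_apply]
      rfl)
    (fun c x w => GHom.ext fun a b hab t => by
      simp only [mk'_f, LinearMap.comp_apply, map_smul, LinearMap.smul_apply]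
      rfl)
    (fun x w w' => GHom.ext fun a b hab t => by
      simp only [mk'_f, LinearMap.comp_apply, map_add, LinearMap.add_apply]
      rfl)
    (fun c x w => GHom.ext fun a b hab t => by
      simp only [mk'_f, LinearMap.comp_apply, map_smul, LinearMap.smul_apply]
      rfl)

lemma contractFun_f {i j n a b s : ℤ} (h : i + j = n) (hab : a + n = b) (hs : j + a = s)
    (hb : i + s = b) (x : X.X i) (w : T.dual.X j) (t : T.X a) :
    (show GHom T (X.tensor (diag A).dual) n from contractFun X T i j n h x w).f a b hab t =
      tm X (diag A).dual i s b hb x (contract T j a s hs w t) := by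
  subst hs
  rfl

/-- The map `X ⊗_A T^* → Hom(T, X ⊗_A A^*)`, `x ⊗ w ↦ (t ↦ x ⊗ (a ↦ w (t a)))`. -/
noncomputable def contractHom :
    GHom (X.tensor T.dual) (homCx T (X.tensor (diag A).dual)) 0 :=
  tbase (contractFun X T) (by
    intro i l' j il lj n hil hlj h₁ h₂ x a w
    refine GHom.ext (M := T) (N := X.tensor (diag A).dual) fun p q hpq t => ?_
    refine (contractFun_f X T _ hpq rfl (by lia) _ w t).trans (Eq.trans ?_
      (contractFun_f X T _ hpq rfl (by lia) x _ t).symm)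
    rw [contract_lmul T rfl hlj rfl (by lia), tm_balanced])

lemma contractHom_tm {i j n l : ℤ} (hij : i + j = n) (h : n + 0 = l) (x : X.X i)
    (w : T.dual.X j) :
    (contractHom X T).f n l h (tm X T.dual i j n hij x w) = contractFun X T i j l (by lia) x w :=
  tbase_tm (contractFun X T) _ hij h _ x w

lemma closed_contractHom : (contractHom X T).Closed := by
  refine closed_of_tm fun i j n i' j' n' l l' hij hi hj hn h₁ h₂ hl hl' hll x w => ?_
  rw [contractHom_tm, contractHom_tm, contractHom_tm, Int.negOnePow_zero, one_smul]
  refine GHom.ext (M := T) (N := X.tensor (diag A).dual) fun a b hab t => ?_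
  have e₁ := contractFun_f X T (by lia : i + j = l) (by lia : a + l = a + l) rfl (by lia) x w t
  have e₂ := contractFun_f X T (by lia : i + j = l) (by lia : a + 1 + l = b) rfl (by lia) x w
    (T.d a (a + 1) rfl t)
  have e₃ := contractFun_f X T (by lia : i' + j = l') hab rfl (by lia) (X.d i i' hi x) w t
  have e₄ := contractFun_f X T (by lia : i + j' = l') hab rfl (by lia) x (T.dual.d j j' hj w) t
  refine (D_f (show GHom T (X.tensor (diag A).dual) l from contractFun X T i j l (by lia) x w) hll
    a (a + l) (a + 1) b hab rfl (by lia) rfl (by lia) t).trans ?_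
  refine Eq.trans ?_ (congrArg₂ (fun y z => y + i.negOnePow • z) e₃ e₄).symm
  rw [e₁, e₂, d_tm (by lia) hi (by lia : j + a + 1 = j' + a) (by lia) (by lia) (by lia),
    contract_d T rfl hj rfl (by lia) rfl (by lia : j + (a + 1) = j' + a)]
  obtain rfl : j' = j + 1 := hj.symm
  have e (s s' : ℤ) (hs : s = s') (h₁ : i + s = b) (h₂ : i + s' = b) (h₃ : j + (a + 1) = s)
      (h₄ : j + (a + 1) = s') : tm X (diag A).dual i s b h₁ x
        (contract T j (a + 1) s h₃ w (T.d a (a + 1) rfl t)) =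
      tm X (diag A).dual i s' b h₂ x (contract T j (a + 1) s' h₄ w (T.d a (a + 1) rfl t)) := by
    subst hs
    rfl
  rw [e _ (j + 1 + a) (by lia) _ (by lia) _ (by lia), map_add, map_sign, smul_add, smul_smul,
    ← Int.negOnePow_add,
    show i + j = l by lia]
  abel

end EvalContract

end DGBimod

namespace DGBimod

variable {k : Type u} [Field k] {A B C E : DGAlgebra k}

open GHom

/-! ### Naturality of the evaluation and contraction maps -/

section Naturality

/-- Naturality of `evalHom` for graded maps of the first argument, of any degree. -/
lemma evalHom_natural {X X' : DGBimod (DGAlgebra.base k) A} (T : DGBimod (DGAlgebra.base k) A)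
    {p : ℤ} (f : GHom X X' p) : (tensorRMap T.dual f).comp (evalHom X' T) (add_zero p) =
      (evalHom X T).comp (dhomMap T f) (zero_add p) := by
  refine tensor_ext fun i j n l hij hn x w => ?_
  rw [GHom.comp_f _ _ _ n l l hn hn (by lia), GHom.comp_f _ _ _ n n l hn (by lia) hn,
    tensorRMap_tm T.dual f i j n l (i + p) hij hn rfl (by lia), evalHom_tm, evalHom_tm]
  refine homEval_ext (add_neg_cancel l) fun g => ?_
  rw [homEval_evalFun X' T _ (add_neg_cancel l) (by lia : i + p + -l = -j) (add_neg_cancel j),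
    homEval_dhomMap f _ hn (add_neg_cancel l) (add_neg_cancel n) (by lia),
    homEval_evalFun X T _ (add_neg_cancel n) (by lia : i + -n = -j) (add_neg_cancel j),
    GHom.comp_f f g _ i (i + p) (-j) (by lia) rfl (by lia), smul_smul, ← Int.negOnePow_add,
    add_comm p i]

/-- The map `g ↦ f ∘ g` between morphism complexes. -/
def postMap (T : DGBimod A B) {M N : DGBimod A B} {p : ℤ} (f : GHom M N p) :
    GHom (homCx T M) (homCx T N) p := (homF T).map f

/-- Naturality of `contractHom` for graded maps of the first argument, of any degree. -/
lemma contractHom_natural {X X' : DGBimod (DGAlgebra.base k) A}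
    (T : DGBimod (DGAlgebra.base k) A) {p : ℤ} (f : GHom X X' p) :
    (tensorRMap T.dual f).comp (contractHom X' T) (add_zero p) =
      (contractHom X T).comp (postMap T (tensorRMap (diag A).dual f)) (zero_add p) := by
  refine tensor_ext fun i j n l hij hn x w => ?_
  rw [GHom.comp_f _ _ _ n l l hn hn (by lia), GHom.comp_f _ _ _ n n l hn (by lia) hn,
    tensorRMap_tm T.dual f i j n l (i + p) hij hn rfl (by lia), contractHom_tm, contractHom_tm]
  refine GHom.ext (M := T) (N := X'.tensor (diag A).dual) fun a b hab t => ?_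
  refine (contractFun_f X' T _ hab rfl (by lia) _ w t).trans (Eq.trans ?_
    (GHom.comp_f (M := T) (show GHom T (X.tensor (diag A).dual) n from
      contractFun X T i j n (by lia) x w) (tensorRMap (diag A).dual f) hn a (a + n) b hab rfl
      (by lia) t).symm)
  rw [contractFun_f X T _ rfl rfl (by lia),
    tensorRMap_tm (diag A).dual f i (j + a) _ b (i + p) (by lia) (by lia) rfl (by lia)]

/-- The dual of a map of degree zero. -/
def dualMap {T T' : DGBimod A B} (g : GHom T T' 0) : GHom T'.dual T.dual 0 :=
  mk' (fun i j h => Module.Dual.transpose (R := k) (M := T.X (-j)) (M' := T'.X (-i))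
      (g.f (-j) (-i) (by lia)))
    (fun i j n j' n' h hj hn h' b φ => by
      obtain rfl : j' = j := by lia
      obtain rfl : n' = n := by lia
      refine dualEquiv_ext _ (add_neg_cancel n') fun x => ?_
      rw [zero_mul, Int.negOnePow_zero, one_smul]
      rw [dualEquiv_lmul T h' (add_neg_cancel _) (by lia : -n' + i = -j') (add_neg_cancel _)]
      refine (dualEquiv_lmul T' h (add_neg_cancel _) (by lia : -n' + i = -j') (add_neg_cancel _)
        b φ (g.f (-n') (-n') (by lia) x)).trans ?_
      rw [← g.map_rmul (-n') i (-j') (-n') (-j') (by lia) (by lia) (by lia) (by lia)]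
      rfl)
    (fun i j n i' n' h hi hn h' φ a => by
      obtain rfl : i' = i := by lia
      obtain rfl : n' = n := by lia
      refine dualEquiv_ext _ (add_neg_cancel n') fun x => ?_
      rw [dualEquiv_rmul T h' (add_neg_cancel _) (by lia : j + -n' = -i') (add_neg_cancel _)]
      refine (dualEquiv_rmul T' h (add_neg_cancel _) (by lia : j + -n' = -i') (add_neg_cancel _)
        φ a (g.f (-n') (-n') (by lia) x)).trans ?_
      have := g.map_lmul j (-n') (-i') (-n') (-i') (by lia) (by lia) (by lia) (by lia) a x
      rw [zero_mul, Int.negOnePow_zero, one_smul] at this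
      rw [← this]
      rfl)

lemma dualEquiv_dualMap {T T' : DGBimod A B} (g : GHom T T' 0) {i j : ℤ} (h : i + j = 0)
    (φ : T'.dual.X i) (x : T.X j) : dualEquiv T h ((dualMap g).f i i (add_zero i) φ) x =
      dualEquiv T' h φ (g.f j j (add_zero j) x) := by
  obtain rfl : j = -i := by lia
  rfl

lemma closed_dualMap {T T' : DGBimod A B} {g : GHom T T' 0} (hg : g.Closed) :
    (dualMap g).Closed := by
  refine closed_of_d_f fun i m l j hil hlj him hmj φ => ?_
  obtain rfl : l = i := by lia
  obtain rfl : j = m := by lia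
  rw [Int.negOnePow_zero, one_smul]
  refine dualEquiv_ext _ (add_neg_cancel j) fun x => ?_
  rw [dualEquiv_d T hlj (add_neg_cancel j) (add_neg_cancel l) (by lia), dualEquiv_dualMap,
    dualEquiv_dualMap, dualEquiv_d T' him (add_neg_cancel j) (add_neg_cancel l) (by lia),
    hg.d_f (-j) (-l) (-j) (-l) (by lia) (by lia) (by lia) (by lia), Int.negOnePow_zero, one_smul]

variable (X : DGBimod (DGAlgebra.base k) A) {T T' : DGBimod (DGAlgebra.base k) A} (g : GHom T T' 0)

lemma homEval_evalHom_dualMap {n m : ℤ} (h : n + m = 0) (z : (X.tensor T'.dual).X n)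
    (φ : GHom X T m) : homEval ((evalHom X T).f n n (add_zero n)
        ((tensorLMap X (dualMap g)).f n n (add_zero n) z)) h φ =
      homEval ((evalHom X T').f n n (add_zero n) z) h (φ.comp g (add_zero m)) := by
  induction z using tm_induction with
  | h0 => simp only [map_zero]; rfl
  | hadd z w hz hw => simp only [map_add, homEval_add, hz, hw]
  | h i j hij x w =>
    rw [tensorLMap_tm X (dualMap g) i j n n j hij (add_zero n) (add_zero j) hij, evalHom_tm,
      zero_mul, Int.negOnePow_zero, one_smul, evalHom_tm,
      homEval_evalFun X T _ h (by lia : i + m = -j) (add_neg_cancel j),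
      homEval_evalFun X T' _ h (by lia : i + m = -j) (add_neg_cancel j), dualEquiv_dualMap,
      GHom.comp_f φ g _ i (-j) (-j) (by lia) (by lia) (by lia)]

lemma contractHom_dualMap {n : ℤ} (z : (X.tensor T'.dual).X n) :
    (show GHom T (X.tensor (diag A).dual) n from (contractHom X T).f n n (add_zero n)
        ((tensorLMap X (dualMap g)).f n n (add_zero n) z)) =
      g.comp (show GHom T' (X.tensor (diag A).dual) n from
        (contractHom X T').f n n (add_zero n) z) (zero_add n) := by
  induction z using tm_induction with
  | h0 =>
    simp only [map_zero]
    exact (comp_zero (N := T') g _).symm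
  | hadd z w hz hw =>
    simp only [map_add]
    exact (congrArg₂ (· + ·) hz hw).trans (comp_add (N := T') g _ _ _).symm
  | h i j hij x w =>
    rw [tensorLMap_tm X (dualMap g) i j n n j hij (add_zero n) (add_zero j) hij,
      zero_mul, Int.negOnePow_zero, one_smul, contractHom_tm, contractHom_tm]
    refine GHom.ext (M := T) (N := X.tensor (diag A).dual) fun a b hab t => ?_
    refine (contractFun_f X T _ hab rfl (by lia) _ _ t).trans (Eq.trans ?_
      (GHom.comp_f g (show GHom T' (X.tensor (diag A).dual) n from
        contractFun X T' i j n (by lia) x w) (zero_add n) a a b hab (add_zero a) hab t).symm)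
    rw [contractFun_f X T' _ hab rfl (by lia)]
    congr 1
    refine dualEquiv_ext _ (add_neg_cancel (j + a)) fun c => ?_
    rw [contract_apply T rfl (add_neg_cancel _) (by lia : a + -(j + a) = -j) (add_neg_cancel j),
      contract_apply T' rfl (add_neg_cancel _) (by lia : a + -(j + a) = -j) (add_neg_cancel j),
      dualEquiv_dualMap]
    exact congrArg (dualEquiv T' (add_neg_cancel j) w)
      (g.map_rmul a (-(j + a)) (-j) a (-j) (by lia) (by lia) (by lia) (by lia) t c)

end Naturality

/-! ### Evaluation and contraction for the regular module -/

section Regular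

variable (T : DGBimod (DGAlgebra.base k) A)

/-- `A ⊗_A K ≅ K`. -/
noncomputable def regularTensor (K : DGBimod A B) : GIso (A.regular.tensor K) K.forgetLeft 0 :=
  (forgetLeftTensor (diag A) K).trans ((forgetLeftF A B).mapGIso (leftUnit K)) (zero_add 0)

lemma regularTensor_tm (K : DGBimod A B) {i j n l : ℤ} (hij : i + j = n) (hl : n + 0 = l)
    (h : i + j = l) (a : A.X i) (x : K.X j) :
    (regularTensor K).hom.f n l hl (tm A.regular K i j n hij a x) = K.lmul i j l h a x := by
  obtain rfl : l = n := by lia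
  exact (GHom.comp_f (forgetLeftTensor (diag A) K).hom ((forgetLeftF A B).map (leftUnit K).hom)
    (zero_add 0) l l l hl hl hl _).trans (leftUnitHom_tm K i j l l hij hl h a x)

/-- The unit of `A` as an element of the regular module. -/
def regularOne (A : DGAlgebra k) : A.regular.X 0 := A.one

lemma bijective_one_tm (K : DGBimod A B) (n : ℤ) :
    Function.Bijective fun x : K.X n => tm A.regular K 0 n n (zero_add n) (regularOne A) x := by
  have h := (regularTensor K).bijective n n (add_zero n)
  have e (x : K.X n) : (regularTensor K).hom.f n n (add_zero n)
      (tm A.regular K 0 n n (zero_add n) (regularOne A) x) = x := by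
    exact (regularTensor_tm K _ _ (zero_add n) _ x).trans (K.one_lmul n _ x)
  refine ⟨fun x y hxy => ?_, fun z => ⟨(regularTensor K).hom.f n n (add_zero n) z, h.1 (e _)⟩⟩
  rw [← e x, ← e y]
  exact congrArg _ hxy

/-- For `X = A` both sides of `evalHom` are `T^*`. -/
lemma bijective_evalHom (n : ℤ) :
    Function.Bijective ((evalHom A.regular T).f n n (add_zero n)) := by
  have key (w : T.dual.X n) (g : GHom A.regular T (-n)) :
      homEval ((evalHom A.regular T).f n n (add_zero n)
        (tm A.regular T.dual 0 n n (zero_add n) (regularOne A) w)) (add_neg_cancel n) g =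
        dualEquiv T (add_neg_cancel n) w (g.f 0 (-n) (zero_add _) (diagOne A)) := by
    rw [evalHom_tm, homEval_evalFun A.regular T _ _ (zero_add (-n)) (add_neg_cancel n),
      Int.negOnePow_zero, one_smul]
    rfl
  have hb := (homRegular T).bijective (-n) (-n) (add_zero _)
  refine (Function.Bijective.of_comp_iff _ (bijective_one_tm T.dual n)).1 ⟨fun w w' h => ?_,
    fun φ => ?_⟩
  · refine dualEquiv_ext _ (add_neg_cancel n) fun x => ?_
    obtain ⟨g, rfl⟩ := hb.2 x
    have e := congrArg (fun φ => homEval φ (add_neg_cancel n) g) h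
    exact (key w g).symm.trans (e.trans (key w' g))
  · let e := LinearEquiv.ofBijective _ hb
    refine ⟨(show Module.Dual k (T.X (-n)) from
      (show Module.Dual k (GHom A.regular T (-n)) from φ) ∘ₗ e.symm.toLinearMap), ?_⟩
    refine homEval_ext (add_neg_cancel n) fun g => (key _ g).trans ?_
    rw [homEval_self]
    exact congrArg (show Module.Dual k (GHom A.regular T (-n)) from φ) (e.symm_apply_apply g)

/-- For `X = A` both sides of `contractHom` are `T^*`: a right linear `φ : T → A^*` corresponds to
the functional `t ↦ φ(t)(1)`. -/
lemma bijective_contractHom (n : ℤ) :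
    Function.Bijective ((contractHom A.regular T).f n n (add_zero n)) := by
  have key (w : T.dual.X n) (a b : ℤ) (hab : a + n = b) (h' : n + a = b) (t : T.X a) :
      (regularTensor (diag A).dual).hom.f b b (add_zero b)
        ((show GHom T (A.regular.tensor (diag A).dual) n from
          (contractHom A.regular T).f n n (add_zero n)
            (tm A.regular T.dual 0 n n (zero_add n) (regularOne A) w)).f a b hab t) =
        contract T n a b h' w t := by
    rw [contractHom_tm, contractFun_f A.regular T _ hab h' (zero_add b)]
    exact (regularTensor_tm (diag A).dual _ _ (zero_add b) _ _).trans
      ((diag A).dual.one_lmul b _ _)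
  refine (Function.Bijective.of_comp_iff _ (bijective_one_tm T.dual n)).1 ⟨fun w w' h => ?_,
    fun φ => ?_⟩
  · refine dualEquiv_ext _ (add_neg_cancel n) fun x => ?_
    have e : contract T n (-n) 0 (add_neg_cancel n) w x =
        contract T n (-n) 0 (add_neg_cancel n) w' x :=
      (key w (-n) 0 (by lia) (by lia) x).symm.trans
        ((congrArg _ (GHom.congr_f h (-n) 0 (by lia) x)).trans (key w' (-n) 0 (by lia) (by lia) x))
    have e' := congrArg (fun ψ => dualEquiv (diag A) (add_zero 0) ψ (diagOne A)) e
    rw [contract_apply T _ _ (add_zero (-n)) (add_neg_cancel n),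
      contract_apply T _ _ (add_zero (-n)) (add_neg_cancel n)] at e'
    have e₁ : T.rmul (-n) 0 (-n) (add_zero (-n)) x (diagOne A) = x := T.rmul_one _ _ x
    rwa [e₁] at e'
  · let g : GHom T (diag A).dual.forgetLeft n :=
      GHom.comp (show GHom T (A.regular.tensor (diag A).dual) n from φ)
        (regularTensor (diag A).dual).hom (add_zero n)
    refine ⟨(show Module.Dual k (T.X (-n)) from
      { toFun := fun t => dualEquiv (diag A) (add_zero 0) (g.f (-n) 0 (by lia) t) (diagOne A)
        map_add' := fun t t' => by rw [map_add]; rfl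
        map_smul' := fun c t => by rw [map_smul]; rfl }), ?_⟩
    refine GHom.ext (M := T) (N := A.regular.tensor (diag A).dual) fun a b hab t => ?_
    refine ((regularTensor (diag A).dual).bijective b b (add_zero b)).1 ?_
    refine (key _ a b hab (by lia) t).trans ?_
    refine Eq.trans ?_ (GHom.comp_f (show GHom T (A.regular.tensor (diag A).dual) n from φ)
        (regularTensor (diag A).dual).hom (add_zero n) a b b hab hab (add_zero b) t)
    refine dualEquiv_ext _ (add_neg_cancel b) fun c => ?_
    refine (contract_apply T _ _ (by lia : a + -b = -n) (add_neg_cancel n) _ t c).trans ?_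
    change dualEquiv (diag A) (add_zero 0) (g.f (-n) 0 (by lia)
      (T.rmul a (-b) (-n) (by lia) t c)) (diagOne A) = dualEquiv (diag A) _ (g.f a b hab t) c
    refine (congrArg (fun ψ => dualEquiv (diag A) (add_zero 0) ψ (diagOne A))
      (g.map_rmul a (-b) (-n) b 0 (by lia) hab (by lia) (by lia) t c)).trans ?_
    refine (dualEquiv_rmul (diag A) (by lia : b + -b = 0) (add_zero 0) (by lia : -b + 0 = -b)
      (add_neg_cancel b) (g.f a b hab t) c (diagOne A)).trans ?_
    rw [lmul_diagOne]
    rfl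

end Regular

end DGBimod

namespace DGBimod

variable {k : Type u} [Field k] {A B C E : DGAlgebra k}

open GHom

/-! ### Duality for perfect modules -/

section Duality

lemma quasiIso_toHom_of_bijective {M N : DGBimod A B} (f : GHom M N 0) (hf : f.Closed)
    (h : ∀ n, Function.Bijective (f.f n n (add_zero n))) : QuasiIso (f.toHom hf) :=
  quasiIso_iso_hom (GIso.ofBijective f hf fun i j hij => by
    obtain rfl : j = i := by lia
    exact h j).toIso

lemma quasiIso_evalHom {X : DGBimod (DGAlgebra.base k) A}
    (hX : HoBimod.thick (HoBimod.of A.regular) (HoBimod.of X))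
    (T : DGBimod (DGAlgebra.base k) A) :
    QuasiIso ((evalHom X T).toHom (closed_evalHom X T)) :=
  quasiIso_of_thick hX (tensorR _ T.dual) (dhomF T) (fun X => evalHom X T)
    (fun X => closed_evalHom X T) (evalHom_natural T)
    (quasiIso_toHom_of_bijective _ _ (bijective_evalHom T))

lemma quasiIso_contractHom {X : DGBimod (DGAlgebra.base k) A}
    (hX : HoBimod.thick (HoBimod.of A.regular) (HoBimod.of X))
    (T : DGBimod (DGAlgebra.base k) A) :
    QuasiIso ((contractHom X T).toHom (closed_contractHom X T)) :=
  quasiIso_of_thick hX (tensorR _ T.dual) ((tensorR _ (diag A).dual).comp (homF T))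
    (fun X => contractHom X T) (fun X => closed_contractHom X T) (contractHom_natural T)
    (quasiIso_toHom_of_bijective _ _ (bijective_contractHom T))

/-- The space of cocycles of degree zero. -/
abbrev cocycles (M : DGBimod A B) : Submodule k (M.X 0) := LinearMap.ker (M.d 0 (0 + 1) rfl)

/-- The map on cocycles induced by a closed map. -/
def cocyclesMap {M N : DGBimod A B} (f : GHom M N 0) (hf : f.Closed) :
    cocycles M →ₗ[k] cocycles N :=
  (f.f 0 0 (add_zero 0)).restrict fun z hz => by
    rw [LinearMap.mem_ker, hf.d_f 0 (0 + 1) 0 (0 + 1) (add_zero 0) rfl rfl (add_zero _),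
      LinearMap.mem_ker.1 hz, map_zero, smul_zero]

lemma cocyclesMap_val {M N : DGBimod A B} (f : GHom M N 0) (hf : f.Closed) (z : cocycles M) :
    (cocyclesMap f hf z).1 = f.f 0 0 (add_zero 0) z.1 := rfl

lemma Hmap_Hmk {M N : DGBimod A B} (f : GHom M N 0) (hf : f.Closed) (z : cocycles M) :
    Hmap f hf 0 0 (add_zero 0) (M.Hmk 0 z) = N.Hmk 0 (cocyclesMap f hf z) := by
  obtain ⟨h, e⟩ := Hmap_mk f hf 0 0 (add_zero 0) z
  exact e

lemma QuasiIso.exists_cocycle {M N : DGBimod A B} {f : GHom M N 0} {hf : f.Closed}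
    (h : QuasiIso (f.toHom hf)) (y : cocycles N) :
    ∃ (z : cocycles M) (w : N.X (-1)), N.d (-1) 0 (neg_add_cancel 1) w =
      f.f 0 0 (add_zero 0) z.1 - y.1 := by
  obtain ⟨x, hx⟩ := ((quasiIso_iff_bijective _).1 h 0).2 (N.Hmk 0 y)
  obtain ⟨z, rfl⟩ := M.Hmk_surjective 0 x
  have h0 : N.Hmk 0 (cocyclesMap f hf z - y) = 0 := by
    rw [map_sub, sub_eq_zero, ← Hmap_Hmk]
    refine Eq.trans ?_ hx
    congr 1
  obtain ⟨w, hw⟩ := (N.Hmk_eq_zero_iff (neg_add_cancel 1) _).1 h0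
  exact ⟨z, w, hw⟩

lemma QuasiIso.exists_boundary {M N : DGBimod A B} {f : GHom M N 0} {hf : f.Closed}
    (h : QuasiIso (f.toHom hf)) (z : cocycles M) (w : N.X (-1))
    (hw : N.d (-1) 0 (neg_add_cancel 1) w = f.f 0 0 (add_zero 0) z.1) :
    ∃ v, M.d (-1) 0 (neg_add_cancel 1) v = z.1 := by
  refine (M.Hmk_eq_zero_iff (neg_add_cancel 1) z).1 ?_
  refine ((quasiIso_iff_bijective _).1 h 0).1 ?_
  rw [map_zero]
  refine Eq.trans ?_ ((N.Hmk_eq_zero_iff (neg_add_cancel 1) (cocyclesMap f hf z)).2 ⟨w, hw⟩)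
  exact Hmap_Hmk f hf z

lemma closed_of_cocycle {X Y : DGBimod A B} (f : cocycles (homCx X Y)) :
    (show GHom X Y 0 from f.1).Closed :=
  (closed_iff _).2 fun q hq => by
    subst hq
    exact f.2

/-- The homotopy class of a cocycle of the morphism complex. -/
noncomputable def clsMap (X Y : DGBimod A B) :
    cocycles (homCx X Y) →ₗ[k] (HoBimod.of X ⟶ HoBimod.of Y) where
  toFun f := cls (show GHom X Y 0 from f.1) (closed_of_cocycle f)
  map_add' _ _ := (cls_add _ _ _ _).symm
  map_smul' _ _ := (cls_smul _ _ _).symm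

lemma clsMap_surjective (X Y : DGBimod A B) : Function.Surjective (clsMap X Y) := by
  intro φ
  obtain ⟨g, hg, rfl⟩ := exists_cls φ
  exact ⟨⟨g, hg.D rfl⟩, rfl⟩

lemma clsMap_eq_zero_iff {X Y : DGBimod A B} (f : cocycles (homCx X Y)) :
    clsMap X Y f = 0 ↔ ∃ e, (homCx X Y).d (-1) 0 (neg_add_cancel 1) e = f.1 :=
  cls_eq_zero_iff.trans (htpy_zero_iff (neg_add_cancel 1) (show GHom X Y 0 from f.1))

/-- A closed functional on a complex that vanishes on all cocycles is a boundary. -/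
lemma exists_dual_boundary {M : DGBimod A B} (φ : cocycles M.dual)
    (h : ∀ z : cocycles M, dualEquiv M (add_zero 0) φ.1 z.1 = 0) :
    ∃ w, M.dual.d (-1) 0 (neg_add_cancel 1) w = φ.1 := by
  have h0 : dualPairing M 0 φ = 0 := by
    refine LinearMap.ext fun x => ?_
    obtain ⟨z, rfl⟩ := M.Hmk_surjective (-0) x
    exact (dualPairing_mk M 0 φ z).trans (h z)
  have h1 : φ ∈ LinearMap.ker (dualPairing M 0) := h0
  rw [ker_dualPairing] at h1
  exact h1

lemma homEval_eq {X Y : DGBimod A B} {i j : ℤ} (φ : (homCx X Y).dual.X i) (h : i + j = 0)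
    (g : GHom X Y j) : homEval φ h g = dualEquiv (homCx X Y) h φ g := by
  obtain rfl : j = -i := by lia
  rw [homEval_self]
  rfl

lemma homEval_boundary {X Y : DGBimod A B} (φ : cocycles (homCx X Y).dual) (e : GHom X Y (-1)) :
    homEval φ.1 (add_zero 0) (e.D (neg_add_cancel 1)) = 0 := by
  have h := homEval_d φ.1 (zero_add 1 : (0 : ℤ) + 1 = 1) (by lia : (1 : ℤ) + -1 = 0) (add_zero 0)
    (neg_add_cancel 1) e
  have h0 : (homCx X Y).dual.d 0 1 (zero_add 1) φ.1 = 0 := φ.2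
  rw [h0, Int.negOnePow_zero, one_smul] at h
  exact neg_eq_zero.1 (h.symm.trans rfl)

lemma homEval_of_boundary {X Y : DGBimod A B} (w : (homCx X Y).dual.X (-1))
    (g : cocycles (homCx X Y)) :
    homEval ((homCx X Y).dual.d (-1) 0 (neg_add_cancel 1) w) (add_zero 0)
      (show GHom X Y 0 from g.1) = 0 := by
  rw [homEval_d w (neg_add_cancel 1) (add_zero 0) (neg_add_cancel 1) (zero_add 1),
    (closed_of_cocycle g).D, map_zero, smul_zero, neg_zero]

/-- Evaluation of a closed functional on homotopy classes, by means of a linear choice of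
representatives. -/
noncomputable def dualCls (X Y : DGBimod A B) :
    cocycles (homCx X Y).dual →ₗ[k] Module.Dual k (HoBimod.of X ⟶ HoBimod.of Y) where
  toFun φ := homEval φ.1 (add_zero 0) ∘ₗ (cocycles (homCx X Y)).subtype ∘ₗ
    ((clsMap X Y).exists_rightInverse_of_surjective
      (LinearMap.range_eq_top.2 (clsMap_surjective X Y))).choose
  map_add' _ _ := rfl
  map_smul' _ _ := rfl

lemma dualCls_clsMap {X Y : DGBimod A B} (φ : cocycles (homCx X Y).dual)
    (g : cocycles (homCx X Y)) : dualCls X Y φ (clsMap X Y g) =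
      homEval φ.1 (add_zero 0) (show GHom X Y 0 from g.1) := by
  let σ := ((clsMap X Y).exists_rightInverse_of_surjective
    (LinearMap.range_eq_top.2 (clsMap_surjective X Y))).choose
  have hσ : clsMap X Y ∘ₗ σ = LinearMap.id := ((clsMap X Y).exists_rightInverse_of_surjective
    (LinearMap.range_eq_top.2 (clsMap_surjective X Y))).choose_spec
  have h0 : clsMap X Y (σ (clsMap X Y g) - g) = 0 := by
    rw [map_sub, sub_eq_zero]
    exact LinearMap.congr_fun hσ _
  obtain ⟨e, he⟩ := (clsMap_eq_zero_iff _).1 h0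
  have h1 := homEval_boundary φ e
  have h2 : e.D (neg_add_cancel 1) = (show GHom X Y 0 from (σ (clsMap X Y g)).1) -
    (show GHom X Y 0 from g.1) := he
  rw [h2, map_sub, sub_eq_zero] at h1
  exact h1

lemma dualCls_surjective (X Y : DGBimod A B) : Function.Surjective (dualCls X Y) := by
  intro F
  obtain ⟨G, hG⟩ := LinearMap.exists_extend (F ∘ₗ clsMap X Y)
  let φ : (homCx X Y).dual.X 0 := (dualEquiv (homCx X Y) (add_zero 0)).symm G
  have hφ (g : GHom X Y 0) : homEval φ (add_zero 0) g = G g := by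
    rw [homEval_eq]
    exact LinearMap.congr_fun ((dualEquiv (homCx X Y) (add_zero 0)).apply_symm_apply G) g
  have hφ' (g : cocycles (homCx X Y)) :
      homEval φ (add_zero 0) (show GHom X Y 0 from g.1) = F (clsMap X Y g) :=
    (hφ _).trans (LinearMap.congr_fun hG g)
  have hc : φ ∈ cocycles (homCx X Y).dual := by
    refine homEval_ext (by lia : (0 + 1 : ℤ) + -1 = 0) fun e => ?_
    rw [homEval_d φ rfl (by lia : (0 + 1 : ℤ) + -1 = 0) (add_zero 0) (neg_add_cancel 1)]
    have h1 := hφ' ⟨e.D (neg_add_cancel 1), D_D e _ rfl⟩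
    rw [(clsMap_eq_zero_iff _).2 ⟨e, rfl⟩, map_zero] at h1
    refine (congrArg (fun x => -((0 : ℤ).negOnePow • x)) h1).trans ?_
    rw [smul_zero, neg_zero]
    rfl
  refine ⟨⟨φ, hc⟩, LinearMap.ext fun ψ => ?_⟩
  obtain ⟨g, rfl⟩ := clsMap_surjective X Y ψ
  rw [dualCls_clsMap]
  exact hφ' g

lemma dualCls_eq_zero_iff {X Y : DGBimod A B} (φ : cocycles (homCx X Y).dual) :
    dualCls X Y φ = 0 ↔ ∃ w, (homCx X Y).dual.d (-1) 0 (neg_add_cancel 1) w = φ.1 := by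
  constructor
  · intro h
    refine exists_dual_boundary φ fun z => ?_
    have h1 := dualCls_clsMap φ z
    rw [h, homEval_eq] at h1
    exact h1.symm
  · rintro ⟨w, hw⟩
    refine LinearMap.ext fun ψ => ?_
    obtain ⟨g, rfl⟩ := clsMap_surjective X Y ψ
    rw [dualCls_clsMap, ← hw, homEval_of_boundary]
    rfl

variable (X Y : DGBimod (DGAlgebra.base k) A)

/-- The map sending a cocycle of `X ⊗_A Y^*` to a morphism `Y → X ⊗_A A^*`. -/
noncomputable def toHomCls : cocycles (X.tensor Y.dual) →ₗ[k]
    (HoBimod.of Y ⟶ HoBimod.of (X.tensor (diag A).dual)) :=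
  clsMap _ _ ∘ₗ cocyclesMap (contractHom X Y) (closed_contractHom X Y)

/-- The map sending a cocycle of `X ⊗_A Y^*` to a functional on `Hom(X, Y)`. -/
noncomputable def toDualCls : cocycles (X.tensor Y.dual) →ₗ[k]
    Module.Dual k (HoBimod.of X ⟶ HoBimod.of Y) :=
  dualCls _ _ ∘ₗ cocyclesMap (evalHom X Y) (closed_evalHom X Y)

variable {X Y}

lemma toHomCls_surjective (hX : HoBimod.thick (HoBimod.of A.regular) (HoBimod.of X)) :
    Function.Surjective (toHomCls X Y) := by
  intro φ
  obtain ⟨y, rfl⟩ := clsMap_surjective _ _ φ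
  obtain ⟨z, w, h⟩ := (quasiIso_contractHom hX Y).exists_cocycle y
  refine ⟨z, sub_eq_zero.1 ?_⟩
  rw [toHomCls, LinearMap.comp_apply, ← map_sub]
  exact (clsMap_eq_zero_iff _).2 ⟨w, h⟩

lemma toDualCls_surjective (hX : HoBimod.thick (HoBimod.of A.regular) (HoBimod.of X)) :
    Function.Surjective (toDualCls X Y) := by
  intro φ
  obtain ⟨y, rfl⟩ := dualCls_surjective _ _ φ
  obtain ⟨z, w, h⟩ := (quasiIso_evalHom hX Y).exists_cocycle y
  refine ⟨z, sub_eq_zero.1 ?_⟩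
  rw [toDualCls, LinearMap.comp_apply, ← map_sub]
  exact (dualCls_eq_zero_iff _).2 ⟨w, h⟩

lemma toHomCls_eq_zero_iff (hX : HoBimod.thick (HoBimod.of A.regular) (HoBimod.of X))
    (z : cocycles (X.tensor Y.dual)) : toHomCls X Y z = 0 ↔
    ∃ v, (X.tensor Y.dual).d (-1) 0 (neg_add_cancel 1) v = z.1 := by
  refine (clsMap_eq_zero_iff _).trans ⟨fun ⟨w, hw⟩ =>
    (quasiIso_contractHom hX Y).exists_boundary z w hw, fun ⟨v, hv⟩ => ?_⟩
  refine ⟨(contractHom X Y).f (-1) (-1) (add_zero _) v, ?_⟩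
  rw [cocyclesMap_val, ← hv, (closed_contractHom X Y).d_f (-1) 0 (-1) 0 _ _ (neg_add_cancel 1)
    (add_zero 0), Int.negOnePow_zero, one_smul]

lemma toDualCls_eq_zero_iff (hX : HoBimod.thick (HoBimod.of A.regular) (HoBimod.of X))
    (z : cocycles (X.tensor Y.dual)) : toDualCls X Y z = 0 ↔
    ∃ v, (X.tensor Y.dual).d (-1) 0 (neg_add_cancel 1) v = z.1 := by
  refine (dualCls_eq_zero_iff _).trans ⟨fun ⟨w, hw⟩ =>
    (quasiIso_evalHom hX Y).exists_boundary z w hw, fun ⟨v, hv⟩ => ?_⟩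
  refine ⟨(evalHom X Y).f (-1) (-1) (add_zero _) v, ?_⟩
  rw [cocyclesMap_val, ← hv, (closed_evalHom X Y).d_f (-1) 0 (-1) 0 _ _ (neg_add_cancel 1)
    (add_zero 0), Int.negOnePow_zero, one_smul]

/-- For perfect `X`, morphisms `Y → X ⊗_A A^*` are functionals on `Hom(X, Y)`: both are the cocycles
of `X ⊗_A Y^*` modulo boundaries, through `contractHom` and `evalHom`. -/
noncomputable def dualityEquiv (hX : HoBimod.thick (HoBimod.of A.regular) (HoBimod.of X)) :
    (HoBimod.of Y ⟶ HoBimod.of (X.tensor (diag A).dual)) ≃ₗ[k]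
      Module.Dual k (HoBimod.of X ⟶ HoBimod.of Y) :=
  ((toHomCls X Y).quotKerEquivOfSurjective (toHomCls_surjective hX)).symm.trans
    ((Submodule.quotEquivOfEq _ _ (by
      ext z
      exact (toHomCls_eq_zero_iff hX z).trans (toDualCls_eq_zero_iff hX z).symm)).trans
      ((toDualCls X Y).quotKerEquivOfSurjective (toDualCls_surjective hX)))

lemma dualityEquiv_toHomCls (hX : HoBimod.thick (HoBimod.of A.regular) (HoBimod.of X))
    (z : cocycles (X.tensor Y.dual)) :
    dualityEquiv hX (toHomCls X Y z) = toDualCls X Y z := by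
  have h : ((toHomCls X Y).quotKerEquivOfSurjective (toHomCls_surjective hX)).symm
      (toHomCls X Y z) = Submodule.Quotient.mk z :=
    (LinearEquiv.symm_apply_eq _).2 rfl
  rw [dualityEquiv, LinearEquiv.trans_apply, h]
  rfl

end Duality

end DGBimod

namespace DGBimod

variable {k : Type u} [Field k] {A B C E : DGAlgebra k}

open GHom

/-! ### Naturality of the duality -/

section SerrePairing

variable {X X' Y Y' : DGBimod (DGAlgebra.base k) A}

/-- The right linear map given by an element of degree zero of `X ⊗_A Y^*`. -/
noncomputable def contractEl (z : (X.tensor Y.dual).X 0) : GHom Y (X.tensor (diag A).dual) 0 :=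
  (contractHom X Y).f 0 0 (add_zero 0) z

lemma closed_contractEl (z : cocycles (X.tensor Y.dual)) : (contractEl z.1).Closed :=
  closed_of_cocycle (cocyclesMap (contractHom X Y) (closed_contractHom X Y) z)

lemma toHomCls_eq_cls (z : cocycles (X.tensor Y.dual)) :
    toHomCls X Y z = cls (contractEl z.1) (closed_contractEl z) := rfl

lemma toDualCls_cls (z : cocycles (X.tensor Y.dual)) (g : GHom X Y 0) (hg : g.Closed) :
    toDualCls X Y z (cls g hg) =
      homEval ((evalHom X Y).f 0 0 (add_zero 0) z.1) (add_zero 0) g :=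
  dualCls_clsMap (cocyclesMap (evalHom X Y) (closed_evalHom X Y) z) ⟨g, hg.D rfl⟩

lemma dualityEquiv_natural_left (hX : HoBimod.thick (HoBimod.of A.regular) (HoBimod.of X))
    (hX' : HoBimod.thick (HoBimod.of A.regular) (HoBimod.of X')) (f : GHom X' X 0) (hf : f.Closed)
    (hf' : (tensorRMap (diag A).dual f).Closed)
    (χ : HoBimod.of Y ⟶ HoBimod.of (X'.tensor (diag A).dual)) (φ : HoBimod.of X ⟶ HoBimod.of Y) :
    dualityEquiv hX (χ ≫ cls (tensorRMap (diag A).dual f) hf') φ =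
      dualityEquiv hX' χ (cls f hf ≫ φ) := by
  obtain ⟨z, rfl⟩ := toHomCls_surjective hX' χ
  obtain ⟨g, hg, rfl⟩ : ∃ (g : GHom X Y 0) (hg : g.Closed), cls g hg = φ := exists_cls φ
  let z' := cocyclesMap (tensorRMap Y.dual f) ((tensorR _ Y.dual).map_closed hf) z
  have e : toHomCls X' Y z ≫ cls (tensorRMap (diag A).dual f) hf' = toHomCls X Y z' := by
    rw [toHomCls_eq_cls, toHomCls_eq_cls, cls_comp, cls_eq_iff]
    have h := congr_f (contractHom_natural Y f) 0 0 (add_zero 0) z.1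
    rw [GHom.comp_f _ _ _ 0 0 0 _ (add_zero 0) (add_zero 0),
      GHom.comp_f _ _ _ 0 0 0 _ (add_zero 0) (add_zero 0)] at h
    exact .of_eq h.symm
  rw [e, dualityEquiv_toHomCls, dualityEquiv_toHomCls, cls_comp, toDualCls_cls, toDualCls_cls]
  have h := congr_f (evalHom_natural Y f) 0 0 (add_zero 0) z.1
  rw [GHom.comp_f _ _ _ 0 0 0 _ (add_zero 0) (add_zero 0),
    GHom.comp_f _ _ _ 0 0 0 _ (add_zero 0) (add_zero 0)] at h
  refine (congrArg (fun φ => homEval φ (add_zero 0) g) h).trans ?_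
  rw [homEval_dhomMap f _ (add_zero 0) (add_zero 0) (add_zero 0) (add_zero 0),
    Int.negOnePow_zero, one_smul]

lemma dualityEquiv_natural_right (hX : HoBimod.thick (HoBimod.of A.regular) (HoBimod.of X))
    (g : HoBimod.of Y ⟶ HoBimod.of Y') (χ : HoBimod.of Y' ⟶ HoBimod.of (X.tensor (diag A).dual))
    (φ : HoBimod.of X ⟶ HoBimod.of Y) :
    dualityEquiv hX χ (φ ≫ g) = dualityEquiv hX (g ≫ χ) φ := by
  obtain ⟨z, rfl⟩ := toHomCls_surjective hX χ
  obtain ⟨φ, hφ, rfl⟩ : ∃ (φ' : GHom X Y 0) (h : φ'.Closed), cls φ' h = φ := exists_cls φ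
  obtain ⟨g, hg, rfl⟩ : ∃ (g' : GHom Y Y' 0) (h : g'.Closed), cls g' h = g := exists_cls g
  let z' := cocyclesMap (tensorLMap X (dualMap g))
    ((tensorL _ X).map_closed (closed_dualMap hg)) z
  have e : cls g hg ≫ toHomCls X Y' z = toHomCls X Y z' := by
    rw [toHomCls_eq_cls, toHomCls_eq_cls, cls_comp, cls_eq_iff]
    exact .of_eq (contractHom_dualMap X g z.1).symm
  rw [e, dualityEquiv_toHomCls, dualityEquiv_toHomCls, cls_comp, toDualCls_cls, toDualCls_cls]
  exact (homEval_evalHom_dualMap X g (add_zero 0) z.1 φ).symm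

variable {P : DGBimod A A} (q : P ⟶ diag A)

lemma ofHom_resRight (M : DGBimod C A) : ofHom (resRight q M) =
    (tensorLMap M (ofHom q)).comp (rightUnit M).hom (add_zero 0) := by
  refine (ofHom_comp (M := M.tensor P) _ _).trans ?_
  exact congrArg₂ (fun f g => GHom.comp f g (add_zero 0)) ((tensorL A M).ofHom_mapHom q)
    (ofHom_toHom (rightUnit M).hom (rightUnit M).closed_hom)

lemma resRight_natural {M N : DGBimod C A} (f : GHom M N 0) :
    (tensorRMap P f).comp (ofHom (resRight q N)) (add_zero 0) =
      (ofHom (resRight q M)).comp f (add_zero 0) := by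
  have hr (L : DGBimod C A) (i j n : ℤ) (hij : i + j = n) (m : L.X i) (x : P.X j) :
      (ofHom (resRight q L)).f n n (add_zero n) (tm L P i j n hij m x) =
        L.rmul i j n hij m (Hom.f q j x) := by
    rw [ofHom_resRight, GHom.comp_f _ _ _ n n n (add_zero n) (add_zero n) (add_zero n),
      tensorLMap_tm L (ofHom q) i j n n j hij (add_zero n) (add_zero j) hij, zero_mul,
      Int.negOnePow_zero, one_smul, ofHom_f]
    exact rightUnitHom_tm L i j n n hij (add_zero n) hij m _
  refine tensor_ext fun i j n l hij hn m x => ?_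
  obtain rfl : l = n := by lia
  rw [GHom.comp_f _ _ _ l l l hn hn hn, GHom.comp_f _ _ _ l l l hn hn hn,
    tensorRMap_tm P f i j l l i hij hn (add_zero i) hij, hr, hr]
  exact (f.map_rmul i j l i l hij (add_zero i) hn hij m (Hom.f q j x)).symm

lemma DGFunctor.mapHom_toHom (Φ : DGFunctor A B C E) {M N : DGBimod A B} (f : GHom M N 0)
    (hf : f.Closed) : Φ.mapHom (f.toHom hf) = (Φ.map f).toHom (Φ.map_closed hf) := by
  apply DGFunctor.ofHom_injective
  rw [DGFunctor.ofHom_mapHom, ofHom_toHom, ofHom_toHom]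

/-- Composition with a quasi-isomorphism is bijective on morphisms from h-projective objects. -/
lemma bijective_comp_cls {M N : DGBimod A B} {f : GHom M N 0} {hf : f.Closed}
    (h : QuasiIso (f.toHom hf)) {T : DGBimod A B} (hT : T.HProjective) :
    Function.Bijective fun φ : HoBimod.of T ⟶ HoBimod.of M => φ ≫ cls f hf := by
  have hq : QuasiIso ((postMap T f).toHom ((homF T).map_closed hf)) := by
    have := (homF T).quasiIso_mapHom ((hProjective_iff T).1 hT) h
    rw [DGFunctor.mapHom_toHom] at this
    exact this
  constructor
  · intro φ ψ e
    obtain ⟨y, hy⟩ := clsMap_surjective T M (φ - ψ)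
    have e₁ : clsMap T M y ≫ cls f hf = 0 := by
      rw [hy, Preadditive.sub_comp]
      exact sub_eq_zero.2 e
    obtain ⟨w, hw⟩ := (clsMap_eq_zero_iff (cocyclesMap (postMap T f) ((homF T).map_closed hf) y)).1
      ((cls_comp _ f (closed_of_cocycle y) hf).symm.trans e₁)
    obtain ⟨v, hv⟩ := hq.exists_boundary y w hw
    exact sub_eq_zero.1 (hy.symm.trans ((clsMap_eq_zero_iff y).2 ⟨v, hv⟩))
  · intro ψ
    obtain ⟨y, rfl⟩ := clsMap_surjective T N ψ
    obtain ⟨z, w, hw⟩ := hq.exists_cocycle y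
    refine ⟨clsMap T M z, ?_⟩
    have e : clsMap T N (cocyclesMap (postMap T f) ((homF T).map_closed hf) z - y) = 0 :=
      (clsMap_eq_zero_iff _).2 ⟨w, hw⟩
    rw [map_sub, sub_eq_zero] at e
    exact (cls_comp _ f (closed_of_cocycle z) hf).trans e

end SerrePairing

end DGBimod

namespace DGBimod

variable {k : Type u} [Field k] {A B C E : DGAlgebra k}

open GHom

/-! ### Flatness and finiteness -/

/-- H-projective bimodules are flat: such an `R` is a homotopy retract of `P ⊗_A R`, where `P → A`
is a perfect resolution of the diagonal bimodule. -/
lemma acyclic_tensor_of_hProjective {P : DGBimod A A}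
    (hP : HoBimod.thick (HoBimod.of (free A A)) (HoBimod.of P)) {q : P ⟶ diag A}
    (hq : QuasiIso q) {R : DGBimod A B} (hR : R.HProjective) {M : DGBimod C A} (hM : M.Acyclic) :
    (M.tensor R).Acyclic := by
  have h : QuasiIso ((ofHom (resLeft q R)).toHom (closed_ofHom _)) := by
    rw [toHom_ofHom]
    exact quasiIso_resLeft hP hq R
  obtain ⟨s, hs⟩ := (bijective_comp_cls h hR).2 (𝟙 (HoBimod.of R))
  have hr : Retract (HoBimod.of R) (HoBimod.of (P.tensor R)) := ⟨s, _, hs⟩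
  refine acyclic_iff_hdim.2 fun n => le_antisymm
    ((hdim_le_of_retract' hr (tensorL B M) n).trans (le_of_eq ?_)) (by simp)
  exact acyclic_iff_hdim.1 (acyclic_tensor_tensor hP hM R) n

/-- `A ⊗_A A^* ≅ A^*`, whose cohomology is dual to that of `A`. -/
lemma finCoh_regular_dual (hc : A.Compact) : (A.regular.tensor (diag A).dual).FinCoh := by
  have e (n : ℤ) : (A.regular.tensor (diag A).dual).hdim n = A.regular.hdim (-n) :=
    ((regularTensor (diag A).dual).hdim_eq n n (add_zero n)).trans (hdim_dual (diag A) n)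
  obtain ⟨S, hS⟩ := (finCoh_of_compact hc).bounded
  refine ⟨fun n => (e n).trans_ne ((finCoh_of_compact hc).ne_top _), S.image fun n => -n,
    fun n hn => (e n).trans (hS _ fun h => hn ?_)⟩
  exact Finset.mem_image.2 ⟨-n, h, neg_neg n⟩

lemma finCoh_tensor_dual (hc : A.Compact) {X : HoBimod (DGAlgebra.base k) A}
    (hX : HoBimod.thick (HoBimod.of A.regular) X) : (X.as.tensor (diag A).dual).FinCoh := by
  obtain ⟨ι, _, s, hs⟩ := thick_bound hX
  exact (finCoh_regular_dual hc).of_le_sum s fun n => hs (tensorR _ (diag A).dual) n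

/-- `Hom(X, Y)` is bounded by finitely many shifts of `Hom(A, A) ≅ A`. -/
lemma finCoh_homCx (hc : A.Compact) {X Y : HoBimod (DGAlgebra.base k) A}
    (hX : HoBimod.thick (HoBimod.of A.regular) X) (hY : HoBimod.thick (HoBimod.of A.regular) Y) :
    (homCx X.as Y.as).FinCoh := by
  obtain ⟨ι, _, s, hs⟩ := exists_homCx_bound hX hY
  refine (finCoh_of_compact hc).of_le_sum s fun n => (hs (DGFunctor.id _ _) n).trans (le_of_eq ?_)
  exact Finset.sum_congr rfl fun j _ => hdim_homCx_regular _ _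

lemma finite_hom {X Y : HoBimod A B} (h : (homCx X.as Y.as).FinCoh) : Module.Finite k (X ⟶ Y) := by
  have := finite_of_hdim_ne_top (h.ne_top 0)
  have : Module.Finite k (X ⟶ HoBimod.shift Y 0) :=
    Module.Finite.equiv (homEquiv X.as Y.as 0)
  exact Module.Finite.equiv (Linear.homCongr k (Iso.refl X)
    ((Quotient.functor homotopic).mapIso Y.as.isoShiftZero)).symm

lemma quasiEq_of_iso {X Y : HoBimod A B} (e : X ≅ Y) : QuasiEq X.as Y.as := by
  obtain ⟨f, hf⟩ := (Quotient.functor (homotopic (A := A) (B := B))).map_surjective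
    (X := X.as) (Y := Y.as) e.hom
  have : IsIso ((Quotient.functor (homotopic (A := A) (B := B))).map f) := by
    rw [hf]
    exact inferInstanceAs (IsIso e.hom)
  exact QuasiEq.of_quasiIso (quasiIso_of_isIso f)

/-- Restricting the left action of a tensor power of `R`, one gets `A ⊗_A R ⊗_A ⋯ ⊗_A R`. -/
lemma hdim_tensorPow {R : DGBimod A A}
    (hR : ∀ M : DGBimod (DGAlgebra.base k) A, M.Acyclic → (M.tensor R).Acyclic) (m : ℕ) (n : ℤ) :
    (R.tensorPow m).hdim n = growth R m n := by
  have h : QuasiEq (R.tensorPow m).forgetLeft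
      (((tensorR (DGAlgebra.base k) R).iter m).obj A.regular) := by
    induction m with
    | zero => exact QuasiEq.refl _
    | succ m ih =>
      exact (QuasiEq.of_gIso (forgetLeftTensor (R.tensorPow m) R)).symm.trans
        (ih.map (tensorR (DGAlgebra.base k) R) hR)
  exact h.hdim_eq n

end DGBimod

/-! ### Serre functors -/

namespace Perf

open DGBimod GHom

variable {k : Type u} [Field k] {A : DGAlgebra k}

/-- Morphisms of `Perf(A)` are morphisms of the homotopy category. -/
def homLinearEquiv (X Y : Perf A) : (X ⟶ Y) ≃ₗ[k] (X.obj ⟶ Y.obj) where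
  toFun f := f.hom
  invFun f := ObjectProperty.homMk f
  map_add' _ _ := rfl
  map_smul' _ _ := rfl
  left_inv _ := rfl
  right_inv _ := rfl

lemma finite_hom (hc : A.Compact) (X Y : Perf A) : Module.Finite k (X ⟶ Y) :=
  have := DGBimod.finite_hom (finCoh_homCx hc X.property Y.property)
  Module.Finite.equiv (homLinearEquiv X Y).symm

section Serre

variable {P : DGBimod A A}

/-- The functor `X ↦ (X ⊗_A A^*) ⊗_A P`, where `P → A` is a perfect resolution of the diagonal
bimodule. -/
noncomputable def serre (hc : A.Compact)
    (hP : HoBimod.thick (HoBimod.of (DGBimod.free A A)) (HoBimod.of P)) : Perf A ⥤ Perf A :=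
  ObjectProperty.lift _ (ObjectProperty.ι _ ⋙
    ((tensorR (DGAlgebra.base k) (diag A).dual).comp (tensorR _ P)).ho)
    fun X => thick_tensor_of_finCoh hP (finCoh_tensor_dual hc X.property)

/-- The morphism `(X ⊗_A A^*) ⊗_A P → X ⊗_A A^*` of the homotopy category induced by `q : P → A`. -/
noncomputable def resCls (q : P ⟶ diag A) (X : DGBimod (DGAlgebra.base k) A) :
    HoBimod.of ((X.tensor (diag A).dual).tensor P) ⟶ HoBimod.of (X.tensor (diag A).dual) :=
  cls (ofHom (resRight q (X.tensor (diag A).dual))) (closed_ofHom _)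

lemma bijective_comp_resCls
    (hP : HoBimod.thick (HoBimod.of (DGBimod.free A A)) (HoBimod.of P))
    {q : P ⟶ diag A} (hq : QuasiIso q)
    (X : DGBimod (DGAlgebra.base k) A) {Y : DGBimod (DGAlgebra.base k) A} (hY : Y.HProjective) :
    Function.Bijective fun φ : HoBimod.of Y ⟶ _ => φ ≫ resCls q X := by
  refine bijective_comp_cls ?_ hY
  rw [toHom_ofHom]
  exact quasiIso_resRight hP hq _

lemma ho_map_resCls (q : P ⟶ diag A) {X X' : DGBimod (DGAlgebra.base k) A} (f : GHom X' X 0)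
    (hf : f.Closed) :
    ((tensorR (DGAlgebra.base k) (diag A).dual).comp (tensorR _ P)).ho.map (cls f hf) ≫
      resCls q X = resCls q X' ≫ cls (tensorRMap (diag A).dual f)
        ((tensorR (DGAlgebra.base k) (diag A).dual).map_closed hf) := by
  rw [DGFunctor.ho_cls]
  refine (cls_comp _ _ _ _).trans (Eq.trans ?_ (cls_comp _ _ _ _).symm)
  exact cls_eq_iff.2 (.of_eq (resRight_natural q (tensorRMap (diag A).dual f)))

/-- The Serre duality `Hom(Y, S X) ≅ Hom(X, Y)^*`: the duality for the perfect module `X`, after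
composition with the quasi-isomorphism `S X → X ⊗_A A^*`. -/
noncomputable def serreEquiv (hc : A.Compact)
    (hP : HoBimod.thick (HoBimod.of (DGBimod.free A A)) (HoBimod.of P))
    {q : P ⟶ diag A} (hq : QuasiIso q) (X Y : Perf A) :
    (Y ⟶ (serre hc hP).obj X) ≃ₗ[k] Module.Dual k (X ⟶ Y) :=
  have e₁ : (Y.obj ⟶ ((serre hc hP).obj X).obj) ≃ₗ[k]
      (Y.obj ⟶ HoBimod.of (X.obj.as.tensor (diag A).dual)) :=
    LinearEquiv.ofBijective (Linear.rightComp k Y.obj (resCls q X.obj.as))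
      (bijective_comp_resCls hP hq X.obj.as (hProjective_of_thick_regular Y.property))
  (homLinearEquiv _ _).trans (e₁.trans ((dualityEquiv X.property).trans
    (homLinearEquiv X Y).dualMap))

lemma serreEquiv_apply (hc : A.Compact)
    (hP : HoBimod.thick (HoBimod.of (DGBimod.free A A)) (HoBimod.of P))
    {q : P ⟶ diag A} (hq : QuasiIso q) (X Y : Perf A)
    (ψ : Y ⟶ (serre hc hP).obj X) (φ : X ⟶ Y) :
    serreEquiv hc hP hq X Y ψ φ = dualityEquiv (X := X.obj.as) (Y := Y.obj.as) X.property
      (ψ.hom ≫ resCls q X.obj.as) φ.hom := rfl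

lemma isSerreFunctor_serre (hc : A.Compact)
    (hP : HoBimod.thick (HoBimod.of (DGBimod.free A A)) (HoBimod.of P))
    {q : P ⟶ diag A} (hq : QuasiIso q) : IsSerreFunctor (serre hc hP) := by
  have := finite_hom hc
  refine ⟨fun X Y => (Module.evalEquiv k (X ⟶ Y)).trans (serreEquiv hc hP hq X Y).dualMap,
    fun X' X Y f φ ψ => ?_, fun X Y Y' g φ ψ => ?_⟩
  · change serreEquiv hc hP hq X' Y ψ (f ≫ φ) =
      serreEquiv hc hP hq X Y (ψ ≫ (serre hc hP).map f) φ
    rw [serreEquiv_apply, serreEquiv_apply]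
    obtain ⟨f₀, hf₀, h⟩ : ∃ (f₀ : GHom X'.obj.as X.obj.as 0) (hf₀ : f₀.Closed),
      cls f₀ hf₀ = f.hom := exists_cls f.hom
    refine ((congrArg _ (congrArg (· ≫ φ.hom) h)).symm.trans
      (dualityEquiv_natural_left X.property X'.property f₀ hf₀
        ((tensorR (DGAlgebra.base k) (diag A).dual).map_closed hf₀) (ψ.hom ≫ resCls q X'.obj.as)
        φ.hom).symm).trans ?_
    refine congrArg (fun χ => dualityEquiv (X := X.obj.as) (Y := Y.obj.as) X.property χ φ.hom) ?_
    refine (Category.assoc _ _ _).trans ?_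
    refine (congrArg (ψ.hom ≫ ·) (ho_map_resCls q f₀ hf₀).symm).trans ?_
    refine (Category.assoc _ _ _).symm.trans (congrArg (· ≫ resCls q X.obj.as) ?_)
    exact congrArg (fun g => ψ.hom ≫
      ((tensorR (DGAlgebra.base k) (diag A).dual).comp (tensorR _ P)).ho.map g) h
  · change serreEquiv hc hP hq X Y' ψ (φ ≫ g) = serreEquiv hc hP hq X Y (g ≫ ψ) φ
    rw [serreEquiv_apply, serreEquiv_apply]
    refine (dualityEquiv_natural_right (X := X.obj.as) X.property g.hom
      (ψ.hom ≫ resCls q X.obj.as) φ.hom).trans ?_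
    refine congrArg (fun χ => dualityEquiv (X := X.obj.as) (Y := Y.obj.as) X.property χ φ.hom) ?_
    exact (Category.assoc _ _ _).symm

/-- A Serre functor represents `Y ↦ Hom(X, Y)^*`. -/
lemma IsSerreFunctor.exists_equiv {S : Perf A ⥤ Perf A} (hS : IsSerreFunctor S)
    (hc : A.Compact) :
    ∃ E : ∀ X Y : Perf A, (Y ⟶ S.obj X) ≃ₗ[k] Module.Dual k (X ⟶ Y),
      ∀ (X Y Y' : Perf A) (g : Y ⟶ Y') (ψ : Y' ⟶ S.obj X) (φ : X ⟶ Y),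
        E X Y (g ≫ ψ) φ = E X Y' ψ (φ ≫ g) := by
  obtain ⟨e, -, he⟩ := hS
  have := finite_hom hc
  exact ⟨fun X Y => (Module.evalEquiv k (Y ⟶ S.obj X)).trans (e X Y).dualMap,
    fun X Y Y' g ψ φ => (he X Y Y' g φ ψ).symm⟩

/-- The value of a Serre functor at an object is unique up to isomorphism, by the Yoneda lemma. -/
lemma IsSerreFunctor.nonempty_iso {S S' : Perf A ⥤ Perf A} (hS : IsSerreFunctor S)
    (hc : A.Compact) (hS' : IsSerreFunctor S') (X : Perf A) : Nonempty (S.obj X ≅ S'.obj X) := by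
  obtain ⟨E, hE⟩ := hS.exists_equiv hc
  obtain ⟨E', hE'⟩ := hS'.exists_equiv hc
  let T (Y : Perf A) : (Y ⟶ S.obj X) ≃ₗ[k] (Y ⟶ S'.obj X) := (E X Y).trans (E' X Y).symm
  have hT (Y : Perf A) (ψ : Y ⟶ S.obj X) : E' X Y (T Y ψ) = E X Y ψ :=
    (E' X Y).apply_symm_apply _
  have hcomp {Y Y' : Perf A} (g : Y ⟶ Y') (ψ : Y' ⟶ S.obj X) : T Y (g ≫ ψ) = g ≫ T Y' ψ := by
    refine (E' X Y).injective (LinearMap.ext fun φ => ?_)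
    rw [hT, hE, hE', hT]
  let v : S'.obj X ⟶ S.obj X := (T (S'.obj X)).symm (𝟙 _)
  have hv : T (S'.obj X) v = 𝟙 _ := (T (S'.obj X)).apply_symm_apply _
  refine ⟨⟨T (S.obj X) (𝟙 _), v, (T (S.obj X)).injective ?_, ?_⟩⟩
  · rw [hcomp, hv, Category.comp_id]
  · rw [← hcomp, Category.comp_id, hv]

lemma IsSerreFunctor.quasiEq {S : Perf A ⥤ Perf A} (hS : IsSerreFunctor S) (hc : A.Compact)
    (hP : HoBimod.thick (HoBimod.of (DGBimod.free A A)) (HoBimod.of P))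
    {q : P ⟶ diag A} (hq : QuasiIso q) (X : Perf A) :
    QuasiEq (S.obj X).obj.as (X.obj.as.tensor (diag A).dual) := by
  obtain ⟨e⟩ := hS.nonempty_iso hc (isSerreFunctor_serre hc hP hq) X
  exact (quasiEq_of_iso ((ObjectProperty.ι _).mapIso e)).trans
    (QuasiEq.of_quasiIso (quasiIso_resRight hP hq _))

/-- Any Serre functor is computed by any h-projective resolution of `A^*`. -/
lemma IsSerreFunctor.computedBy {S : Perf A ⥤ Perf A} (hS : IsSerreFunctor S) (hc : A.Compact)
    (hP : HoBimod.thick (HoBimod.of (DGBimod.free A A)) (HoBimod.of P))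
    {q : P ⟶ diag A} (hq : QuasiIso q)
    {R : DGBimod A A} (hR : R.IsDualResolution) : ComputedBy S R := by
  obtain ⟨hR, f, hf⟩ := hR
  exact ⟨fun M hM => acyclic_tensor_of_hProjective hP hq hR hM,
    fun X => (hS.quasiEq hc hP hq X).trans (quasiEq_tensor_of_quasiIso X hf).symm⟩

/-- `Hom(X, X) ≅ Hom(X, S X)^*` vanishes if `S X = 0`. -/
lemma IsSerreFunctor.not_isZero {S : Perf A ⥤ Perf A} (hS : IsSerreFunctor S) {X : Perf A}
    (hX : ¬ Limits.IsZero X) : ¬ Limits.IsZero (S.obj X) := by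
  obtain ⟨e, -⟩ := hS
  refine fun h => hX ((Limits.IsZero.iff_id_eq_zero X).2 ((e X X).injective ?_))
  refine LinearMap.ext fun ψ => ?_
  rw [h.eq_of_tgt ψ 0, map_zero, map_zero]

lemma IsSerreFunctor.not_isNilpotent {S : Perf A ⥤ Perf A} (hS : IsSerreFunctor S) {X : Perf A}
    (hX : ¬ Limits.IsZero X) : ¬ IsNilpotentFunctor S := by
  rintro ⟨N, hN⟩
  refine absurd (hN X) ?_
  clear hN
  induction N with
  | zero => exact hX
  | succ N ih =>
    rw [Function.iterate_succ_apply']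
    exact hS.not_isZero ih

end Serre

end Perf

theorem mainTheorem8 {k : Type u} [Field k] (A : DGAlgebra k) (hs : A.Smooth) (hc : A.Compact) :
    -- tensor endofunctors: `F`-dimensions are limits and are computed by the entropy
    (∀ F : Perf A ⥤ Perf A, Perf.IsTensorEndofunctor F →
      (∀ G G' : Perf A, Perf.IsGenerator G → Perf.IsGenerator G' →
        Perf.upperDimWrt F G G' = Perf.upperDim F ∧
        Perf.lowerDimWrt F G G' = Perf.lowerDim F ∧
        Filter.Tendsto (Perf.upperSeq F G G') Filter.atTop (nhds (Perf.upperDim F)) ∧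
        Filter.Tendsto (Perf.lowerSeq F G G') Filter.atTop (nhds (Perf.lowerDim F)) ∧
        ∀ t : ℝ, Filter.Tendsto (Perf.entropySeq F G G' t) Filter.atTop
          (nhds (Perf.entropy F t))) ∧
      (∀ t : ℝ, Perf.entropy F t ≠ ⊤) ∧
      Filter.Tendsto (fun t : ℝ => Perf.entropy F t / (t : EReal)) Filter.atTop
        (nhds (Perf.upperDim F)) ∧
      Filter.Tendsto (fun t : ℝ => Perf.entropy F t / (t : EReal)) Filter.atBot
        (nhds (Perf.lowerDim F)) ∧
      (¬ Perf.IsNilpotentFunctor F →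
        (∃ r : ℝ, Perf.upperDim F = (r : EReal)) ∧ ∃ r : ℝ, Perf.lowerDim F = (r : EReal))) ∧
    -- Serre functors and h-projective resolutions of `A^*` exist
    (∃ S : Perf A ⥤ Perf A, Perf.IsSerreFunctor S) ∧
    (∃ P : DGBimod A A, P.IsDualResolution) ∧
    -- the Serre dimensions are limits, computed by the derived tensor powers of `A^*`, and finite
    ∀ S : Perf A ⥤ Perf A, Perf.IsSerreFunctor S →
      (∀ G G' : Perf A, Perf.IsGenerator G → Perf.IsGenerator G' →
        Perf.upperDimWrt S G G' = Perf.upperDim S ∧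
        Perf.lowerDimWrt S G G' = Perf.lowerDim S ∧
        Filter.Tendsto (Perf.upperSeq S G G') Filter.atTop (nhds (Perf.upperDim S)) ∧
        Filter.Tendsto (Perf.lowerSeq S G G') Filter.atTop (nhds (Perf.lowerDim S))) ∧
      (∀ P : DGBimod A A, P.IsDualResolution →
        Filter.Tendsto (fun m : ℕ => -(P.tensorPow m).infH / (m : EReal)) Filter.atTop
          (nhds (Perf.upperDim S)) ∧
        Filter.Tendsto (fun m : ℕ => -(P.tensorPow m).supH / (m : EReal)) Filter.atTop
          (nhds (Perf.lowerDim S))) ∧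
      ((∃ X : Perf A, ¬ Limits.IsZero X) →
        (∃ r : ℝ, Perf.upperDim S = (r : EReal)) ∧ ∃ r : ℝ, Perf.lowerDim S = (r : EReal)) := by
  obtain ⟨P, hP, q, hq⟩ := hs
  obtain ⟨R, hR⟩ : ∃ R : DGBimod A A, R.IsDualResolution :=
    DGBimod.exists_hProjective_resolution hP hq (DGBimod.diag A).dual
  refine ⟨fun F hF => ?_, ⟨_, Perf.isSerreFunctor_serre hc hP hq⟩, ⟨R, hR⟩, fun S hS => ?_⟩
  · obtain ⟨K, hK⟩ := hF.exists_quasiEq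
    obtain ⟨h₁, h₂, h₃, h₄, h₅, -⟩ :=
      (Perf.computedBy_of_quasiEq hP hq hK).dim_and_entropy hc hP hq
    exact ⟨h₁, h₂, h₃, h₄, h₅⟩
  · obtain ⟨h₁, -, -, -, h₅, -⟩ := (hS.computedBy hc hP hq hR).dim_and_entropy hc hP hq
    refine ⟨fun G G' hG hG' => ?_, fun Q hQ => ?_, fun ⟨X, hX⟩ => h₅ (hS.not_isNilpotent hX)⟩
    · obtain ⟨e₁, e₂, e₃, e₄, -⟩ := h₁ G G' hG hG'
      exact ⟨e₁, e₂, e₃, e₄⟩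
    · obtain ⟨-, -, -, -, -, h₆, h₇⟩ := (hS.computedBy hc hP hq hQ).dim_and_entropy hc hP hq
      have e (m : ℕ) (i : ℤ) : Nontrivial ((Q.tensorPow m).H i) ↔ DGBimod.growth Q m i ≠ 0 := by
        rw [← DGBimod.hdim_tensorPow (hS.computedBy hc hP hq hQ).flat, DGBimod.hdim_ne_zero_iff]
      constructor
      · refine h₆.congr fun m => ?_
        rw [DGBimod.infH, DGBimod.neg_iInf_eq_negInf (e m)]
      · refine h₇.congr fun m => ?_
        rw [DGBimod.supH, DGBimod.iSup_eq_negInf (e m)]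
        rfl
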